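/- **Setting.** Let $d\in\{2,3\}$ and let $\Omega\subset\mathbb R^d$ be polygonal/polyhedral: the interior of the union of a finite edge-to-edge triangulation by $d$-simplices. Write $\|\cdot\|$, $(\cdot,\cdot)$ for the norm and inner product of $L^2(\Omega)$, $\|\cdot\|_\ell$, $|\cdot|_\ell$ for the norm and seminorm of $H^\ell(\Omega)$ (componentwise for vector fields), $X=H^1_0(\Omega)^d$, $Q=\{q\in L^2(\Omega):\int_\Omega q=0\}$, and $$b(u,v,w)=\tfrac12((u\cdot\nabla)v,w)-\tfrac12((u\cdot\nabla)w,v).$$ For $j=1,\dots,J$ let $(u^j,p^j)$ solve the Navier–Stokes equations $$u^j_t+(u^j\cdot\nabla)u^j-\nu\Delta u^j+\nabla p^j=f^j,\qquad \nabla\cdot u^j=0\quad\text{in }\Omega\times(0,T),$$ with $u^j(t)\in X\cap H^2(\Omega)^d$ and $p^j(t)\in Q\cap H^1(\Omega)$ for $0<t<T$, and $u^j(t)\in X$, $\nabla\cdot u^j(t)=0$, $p^j(t)\in Q$ for $t=0,T$; here $\nu,T>0$. **Time grid and DLN coefficients.** Let $0=t_0<t_1<\dots<t_N=T$, $k_n=t_{n+1}-t_n$,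 $k_{\max}=\max_{0\le n\le N-1}k_n$, $\varepsilon_n=(k_n-k_{n-1})/(k_n+k_{n-1})$. For $\theta\in(0,1)$ let $(\alpha_2,\alpha_1,\alpha_0)=(\frac{\theta+1}2,-\theta,\frac{\theta-1}2)$, $$\beta_2^{(n)}=\tfrac14\Big(1+\tfrac{1-\theta^2}{(1+\varepsilon_n\theta)^2}+\varepsilon_n^2\tfrac{\theta(1-\theta^2)}{(1+\varepsilon_n\theta)^2}+\theta\Big),\quad \beta_1^{(n)}=\tfrac12\Big(1-\tfrac{1-\theta^2}{(1+\varepsilon_n\theta)^2}\Big),$$ $$\beta_0^{(n)}=\tfrac14\Big(1+\tfrac{1-\theta^2}{(1+\varepsilon_n\theta)^2}-\varepsilon_n^2\tfrac{\theta(1-\theta^2)}{(1+\varepsilon_n\theta)^2}-\theta\Big),$$ and $\widehat k_n=\alpha_2k_n-\alpha_0k_{n-1}$. For a sequence $(z_n)$ and $1\le n\le N-1$ put $z_{n,\alpha}=\sum_{\ell=0}^2\alpha_\ell z_{n-1+\ell}$, $z_{n,\beta}=\sum_{\ell=0}^2\beta^{(n)}_\ell z_{n-1+\ell}$ and $$z_{n,*}=\Big(\beta_2^{(n)}\big(1+\tfrac{k_n}{k_{n-1}}\big)+\beta_1^{(n)}\Big)z_n+\Big(\beta_0^{(n)}-\beta_2^{(n)}\tfrac{k_n}{k_{n-1}}\Big)z_{n-1};$$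 in particular $t_{n,\beta}=\sum_{\ell}\beta^{(n)}_\ell t_{n-1+\ell}$. Write $u^j_n=u^j(t_n)$ and $\langle z\rangle_n=\frac1J\sum_{j=1}^Jz^j_n$. **Finite element spaces.** For $0<h\le1$ let $X^h\subset X$, $Q^h\subset Q$ be finite-dimensional spaces of $C^m$ ($m\ge 0$) piecewise polynomial functions on a triangulation of $\Omega$ of diameter $h$ such that, for constants $C_{app},C_{inv},C_{is}>0$ and orders $r,s\ge1$: * $\inf_{v^h\in X^h}\|u-v^h\|_\ell\le C_{app}h^{r+1-\ell}|u|_{r+1}$ for $u\in X\cap H^{r+1}$, $0\le\ell\le\min\{m+1,r+1\}$, and $\inf_{q^h\in Q^h}\|p-q^h\|_\ell\le C_{app}h^{s+1-\ell}|p|_{s+1}$ for $p\in Q\cap H^{s+1}$, $0\le\ell\le\min\{m+1,s+1\}$; * $|v^h|_1\le C_{inv}h^{-1}\|v^h\|$ for $v^h\in X^h$; * $\inf_{0\ne q^h\in Q^h}\sup_{0\ne v^h\in X^h}\frac{(\nabla\cdot v^h,q^h)}{\|\nabla v^h\|\|q^h\|}\ge C_{is}$. Let $V^h=\{v^h\in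 X^h:(q^h,\nabla\cdot v^h)=0\ \forall q^h\in Q^h\}$. **DLN-Ensemble algorithm.** From starting values at $n=0,1$, the numerical solutions $u^{j,h}_n\in X^h$, $p^{j,h}_n\in Q^h$ satisfy, for $1\le n\le N-1$, all $j$ and all $v^h\in X^h$, $q^h\in Q^h$, $$\Big(\frac{u^{j,h}_{n,\alpha}}{\widehat k_n},v^h\Big)+b\big(\langle u^h\rangle_{n,*},u^{j,h}_{n,\beta},v^h\big)-(p^{j,h}_{n,\beta},\nabla\cdot v^h)+\nu(\nabla u^{j,h}_{n,\beta},\nabla v^h)=(f^j(t_{n,\beta}),v^h)-b\big(u^{j,h}_{n,*}-\langle u^h\rangle_{n,*},u^{j,h}_{n,*},v^h\big),$$ $$(\nabla\cdot u^{j,h}_{n,\beta},q^h)=0.$$ **Assumptions.** For all $j$: 1. (Regularity in time) $u^j_t,u^j_{tt}\in L^2(0,T;H^{r+1}(\Omega))$, $u^j_{ttt}\in L^2(0,T;X^{-1}\cap L^2(\Omega))$, where $X^{-1}$ is the dual of $X$, and $p^j_t,p^j_{tt}\in L^2(0,T;H^{s+1}(\Omega))$. 2. (Discrete regularity) $\max_{0\le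 n\le N}\|u^j(t_n)\|_r$, $\max_{0\le n\le N}\|u^j(t_n)\|_2$, $\max_{1\le n\le N-1}\|u^j(t_{n,\beta})\|_2$, $\big(\sum_{n=1}^{N-1}(k_n+k_{n-1})\|u^j(t_{n,\beta})\|_{r+1}^2\big)^{1/2}$, $\max_{0\le n\le N}\|p^j(t_n)\|_{s+1}$ and $\big(\sum_{n=1}^{N-1}(k_n+k_{n-1})\|p^j(t_{n,\beta})\|_{s+1}^2\big)^{1/2}$ are all at most $M$ (all these values of $u^j$, $p^j$ lying in the Sobolev spaces concerned). 3. (Time ratio bounds) $C_L<k_n/k_{n-1}<C_U$ for $1\le n\le N-1$, with $C_L,C_U>0$. 4. (Time–diameter condition) $k_{\max}\le h^{1/4}$. 5. (Starting values) $u^{j,h}_0,u^{j,h}_1\in V^h$ and $\|u^j_n-u^{j,h}_n\|_1\le C_0\big(h^r+h^{s+1}+k_{\max}^2+h^{1/2}k_{\max}^{3/2}\big)$ for $n=0,1$. **Theorem.** For given $d$, $\Omega$, $\theta\in(0,1)$ and $C_{inv}$ there is a constant $C_{cfl}>0$, depending only on these, such that the following holds. For all $r,s\ge1$, $m\ge0$,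 $C_{app},C_{is},\nu,T>0$, all exact solutions $(u^j,p^j)_{1\le j\le J}$ satisfying assumption 1, and all $C_L,C_U>0$, $M$, $C_0$, there is a constant $C$ such that for every $h\in(0,1]$, all finite element spaces as above, all time grids and all numerical solutions of the DLN-Ensemble algorithm, if assumptions 2–5 hold together with the CFL-like conditions $$1-C_{cfl}\Big(\frac{1+\varepsilon_n\theta}{1-\varepsilon_n}\Big)^2\frac{\widehat k_n}{h\nu}\big\|\nabla\big(u^{j,h}_{n,*}-\langle u^h\rangle_{n,*}\big)\big\|^2\ge0\qquad(1\le j\le J,\ 1\le n\le N-1),$$ then for every $j$ $$\max_{0\le n\le N}\|u^j_n-u^{j,h}_n\|_1+\sum_{n=1}^{N-1}\frac{\widehat k_n}\nu\Big\|\frac{u^j_{n,\alpha}-u^{j,h}_{n,\alpha}}{\widehat k_n}\Big\|^2\le C\big(h^r+h^{s+1}+k_{\max}^2+h^{1/2}k_{\max}^{3/2}\big).$$ In particular $C$ does not depend on $h$, on the time grid, on the finite element spaces or on the numerical solution. -/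

import Mathlib

open MeasureTheory Set
open scoped ContDiff

namespace DLN

noncomputable section

/-! ### Lebesgue and Sobolev spaces on an open set -/

/-- Points of `ℝ^d`. -/
abbrev Pt (d : ℕ) := EuclideanSpace ℝ (Fin d)

/-- `L²(Ω)`. -/
abbrev L2 {d : ℕ} (Ω : Set (Pt d)) := Lp ℝ 2 (volume.restrict Ω)

/-- `(L²(Ω))^d` with its Hilbert space structure. -/
abbrev L2V {d : ℕ} (Ω : Set (Pt d)) := PiLp 2 (fun _ : Fin d => L2 Ω)

/-- `φ` is a smooth function with compact support contained in `Ω`. -/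
def IsTest {d : ℕ} (Ω : Set (Pt d)) (φ : Pt d → ℝ) : Prop :=
  ContDiff ℝ ∞ φ ∧ HasCompactSupport φ ∧ tsupport φ ⊆ Ω

/-- `g` is the weak derivative `∂_{a 0} ⋯ ∂_{a (k-1)} v` on `Ω`. -/
def IsWeakDeriv {d : ℕ} {Ω : Set (Pt d)} {k : ℕ} (a : Fin k → Fin d) (v g : L2 Ω) : Prop :=
  ∀ φ : Pt d → ℝ, IsTest Ω φ →
    ∫ x in Ω, v x * iteratedFDeriv ℝ k φ x (fun i => EuclideanSpace.single (a i) 1) =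
      (-1) ^ k * ∫ x in Ω, g x * φ x

open Classical in
/-- The weak derivative in `L²(Ω)` (the value `0` is used if there is none). -/
def weakDeriv {d : ℕ} {Ω : Set (Pt d)} {k : ℕ} (a : Fin k → Fin d) (v : L2 Ω) : L2 Ω :=
  if h : ∃ g : L2 Ω, IsWeakDeriv a v g then h.choose else 0

/-- `v ∈ H^ℓ(Ω)`. -/
def MemH {d : ℕ} {Ω : Set (Pt d)} (ℓ : ℕ) (v : L2 Ω) : Prop :=
  ∀ k ≤ ℓ, ∀ a : Fin k → Fin d, ∃ g : L2 Ω, IsWeakDeriv a v g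

/-- The square of the seminorm `|v|_ℓ`, i.e. `∫_Ω |D^ℓ v|²`, where `D^ℓ v` is the full tensor of
weak derivatives of order `ℓ`. -/
def semiSqH {d : ℕ} {Ω : Set (Pt d)} (ℓ : ℕ) (v : L2 Ω) : ℝ :=
  ∑ a : Fin ℓ → Fin d, ‖weakDeriv a v‖ ^ 2

/-- The seminorm `|v|_ℓ` of `H^ℓ(Ω)`. -/
def semiH {d : ℕ} {Ω : Set (Pt d)} (ℓ : ℕ) (v : L2 Ω) : ℝ := Real.sqrt (semiSqH ℓ v)

/-- The norm `‖v‖_ℓ` of `H^ℓ(Ω)`. -/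
def normH {d : ℕ} {Ω : Set (Pt d)} (ℓ : ℕ) (v : L2 Ω) : ℝ :=
  Real.sqrt (∑ k ∈ Finset.range (ℓ + 1), semiSqH k v)

/-- `v ∈ H^ℓ(Ω)^d`. -/
def MemHV {d : ℕ} {Ω : Set (Pt d)} (ℓ : ℕ) (v : L2V Ω) : Prop := ∀ i, MemH ℓ (v i)

/-- The seminorm `|v|_ℓ` of `H^ℓ(Ω)^d`. -/
def semiHV {d : ℕ} {Ω : Set (Pt d)} (ℓ : ℕ) (v : L2V Ω) : ℝ :=
  Real.sqrt (∑ i, semiSqH ℓ (v i))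

/-- The norm `‖v‖_ℓ` of `H^ℓ(Ω)^d`. -/
def normHV {d : ℕ} {Ω : Set (Pt d)} (ℓ : ℕ) (v : L2V Ω) : ℝ :=
  Real.sqrt (∑ i, normH ℓ (v i) ^ 2)

/-- `v ∈ H^1(Ω)` with `v = 0` on `∂Ω`: `v` is an `H^1`-limit of test functions. -/
def MemH10 {d : ℕ} {Ω : Set (Pt d)} (v : L2 Ω) : Prop :=
  MemH 1 v ∧ ∀ δ > 0, ∃ (φ : Pt d → ℝ) (w : L2 Ω),
    IsTest Ω φ ∧ w =ᵐ[volume.restrict Ω] φ ∧ normH 1 (v - w) < δ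

/-- The velocity space `X`. -/
def MemX {d : ℕ} {Ω : Set (Pt d)} (v : L2V Ω) : Prop := ∀ i, MemH10 (v i)

/-- The pressure space `Q`. -/
def MemQ {d : ℕ} {Ω : Set (Pt d)} (q : L2 Ω) : Prop := ∫ x in Ω, q x = 0

/-- The first order weak derivative `∂_i v`. -/
def pd {d : ℕ} {Ω : Set (Pt d)} (i : Fin d) (v : L2 Ω) : L2 Ω := weakDeriv ![i] v

/-- The divergence. -/
def divg {d : ℕ} {Ω : Set (Pt d)} (v : L2V Ω) : L2 Ω := ∑ i, pd i (v i)

/-- `(∇v, ∇w)`. -/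
def gradInner {d : ℕ} {Ω : Set (Pt d)} (v w : L2V Ω) : ℝ :=
  ∑ k, ∑ i, inner ℝ (pd i (v k)) (pd i (w k))

/-- `‖∇v‖`. -/
def gradNorm {d : ℕ} {Ω : Set (Pt d)} (v : L2V Ω) : ℝ := Real.sqrt (gradInner v v)

/-- `((u · ∇) v, w)`. -/
def convec {d : ℕ} {Ω : Set (Pt d)} (u v w : L2V Ω) : ℝ :=
  ∫ x in Ω, ∑ k, ∑ i, u i x * pd i (v k) x * w k x

/-- The skew-symmetric trilinear form `b(u, v, w)`. -/
def trib {d : ℕ} {Ω : Set (Pt d)} (u v w : L2V Ω) : ℝ :=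
  1 / 2 * convec u v w - 1 / 2 * convec u w v

/-! ### Time-dependent functions -/

/-- `w' ` is the time derivative of `w` on `[0,T]`, and `w` is the absolutely continuous
representative: `w(t) = w(0) + ∫_0^t w'(s) ds` in `L²(Ω)` for all `t ∈ [0,T]`. -/
def HasTimeDeriv {d : ℕ} {Ω : Set (Pt d)} (T : ℝ) (w w' : ℝ → L2 Ω) : Prop :=
  IntervalIntegrable w' volume 0 T ∧ ∀ t ∈ Icc 0 T, w t = w 0 + ∫ s in (0 : ℝ)..t, w' s

/-- `w ∈ L²(0,T; H^ℓ(Ω))`. -/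
def MemL2H {d : ℕ} {Ω : Set (Pt d)} (T : ℝ) (ℓ : ℕ) (w : ℝ → L2 Ω) : Prop :=
  AEStronglyMeasurable w (volume.restrict (Ioo 0 T)) ∧
  (∀ᵐ t ∂(volume.restrict (Ioo 0 T)), MemH ℓ (w t)) ∧
  Integrable (fun t => normH ℓ (w t) ^ 2) (volume.restrict (Ioo 0 T))

/-- `(u, p)` solves the incompressible Navier–Stokes equations on `Ω × (0,T)` with viscosity `ν`,
body force `f` and homogeneous Dirichlet boundary condition; `ut` is the time derivative of `u`. -/
structure IsNSESolution {d : ℕ} {Ω : Set (Pt d)} (ν T : ℝ) (u ut : ℝ → L2V Ω) (p : ℝ → L2 Ω)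
    (f : ℝ → L2V Ω) : Prop where
  timeDeriv : ∀ k, HasTimeDeriv T (fun t => u t k) (fun t => ut t k)
  memX : ∀ t ∈ Icc 0 T, MemX (u t)
  divFree : ∀ t ∈ Icc 0 T, divg (u t) = 0
  memQ : ∀ t ∈ Icc 0 T, MemQ (p t)
  memH2 : ∀ t ∈ Ioo 0 T, MemHV 2 (u t)
  memH1 : ∀ t ∈ Ioo 0 T, MemH 1 (p t)
  momentum : ∀ t ∈ Ioo 0 T, ∀ᵐ x ∂(volume.restrict Ω), ∀ k,
    ut t k x + ∑ i, u t i x * pd i (u t k) x - ν * ∑ i, weakDeriv ![i, i] (u t k) x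
      + pd k (p t) x = f t k x

/-- The continuous-in-time regularity of velocity and pressure. (An `L²(Ω)` function is an element
of the dual of `X` by the Poincaré inequality.) -/
structure IsRegular {d : ℕ} {Ω : Set (Pt d)} (T : ℝ) (r s : ℕ) (u ut utt uttt : ℝ → L2V Ω)
    (p pt ptt : ℝ → L2 Ω) : Prop where
  hasDeriv_u : ∀ k, HasTimeDeriv T (fun t => u t k) (fun t => ut t k)
  hasDeriv_ut : ∀ k, HasTimeDeriv T (fun t => ut t k) (fun t => utt t k)
  hasDeriv_utt : ∀ k, HasTimeDeriv T (fun t => utt t k) (fun t => uttt t k)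
  hasDeriv_p : HasTimeDeriv T p pt
  hasDeriv_pt : HasTimeDeriv T pt ptt
  mem_ut : ∀ k, MemL2H T (r + 1) (fun t => ut t k)
  mem_utt : ∀ k, MemL2H T (r + 1) (fun t => utt t k)
  mem_uttt : ∀ k, MemL2H T 0 (fun t => uttt t k)
  mem_pt : MemL2H T (s + 1) pt
  mem_ptt : MemL2H T (s + 1) ptt

/-! ### The DLN coefficients on a variable time grid -/

/-- `0 = t_0 < t_1 < ⋯ < t_N = T`. -/
structure IsGrid (T : ℝ) (N : ℕ) (t : ℕ → ℝ) : Prop where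
  first : t 0 = 0
  last : t N = T
  lt : ∀ n < N, t n < t (n + 1)

/-- `k_n = t_{n+1} - t_n`. -/
def stp (t : ℕ → ℝ) (n : ℕ) : ℝ := t (n + 1) - t n

/-- `k_max = max_{0 ≤ n ≤ N-1} k_n`. -/
def kmax (N : ℕ) (t : ℕ → ℝ) : ℝ := ⨆ n : Fin N, stp t n

/-- The step variability `ε_n`. -/
def vari (t : ℕ → ℝ) (n : ℕ) : ℝ := (stp t n - stp t (n - 1)) / (stp t n + stp t (n - 1))

/-- `(α_0, α_1, α_2)`. -/
def alpha (θ : ℝ) : Fin 3 → ℝ := ![(θ - 1) / 2, -θ, (θ + 1) / 2]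

/-- `(β_0, β_1, β_2)` for the step variability `ε`. -/
def beta (θ ε : ℝ) : Fin 3 → ℝ :=
  ![1 / 4 * (1 + (1 - θ ^ 2) / (1 + ε * θ) ^ 2
      - ε ^ 2 * (θ * (1 - θ ^ 2) / (1 + ε * θ) ^ 2) - θ),
    1 / 2 * (1 - (1 - θ ^ 2) / (1 + ε * θ) ^ 2),
    1 / 4 * (1 + (1 - θ ^ 2) / (1 + ε * θ) ^ 2
      + ε ^ 2 * (θ * (1 - θ ^ 2) / (1 + ε * θ) ^ 2) + θ)]

/-- The average time step `k̂_n = α_2 k_n - α_0 k_{n-1}`. -/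
def khat (θ : ℝ) (t : ℕ → ℝ) (n : ℕ) : ℝ := alpha θ 2 * stp t n - alpha θ 0 * stp t (n - 1)

/-- `z_{n,α}` (for `n ≥ 1`). -/
def zAlpha {V : Type*} [AddCommGroup V] [Module ℝ V] (θ : ℝ) (z : ℕ → V) (n : ℕ) : V :=
  alpha θ 2 • z (n + 1) + alpha θ 1 • z n + alpha θ 0 • z (n - 1)

/-- `z_{n,β}` (for `n ≥ 1`). -/
def zBeta {V : Type*} [AddCommGroup V] [Module ℝ V] (θ : ℝ) (t : ℕ → ℝ) (z : ℕ → V) (n : ℕ) : V :=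
  beta θ (vari t n) 2 • z (n + 1) + beta θ (vari t n) 1 • z n + beta θ (vari t n) 0 • z (n - 1)

/-- `z_{n,*}` (for `n ≥ 1`). -/
def zStar {V : Type*} [AddCommGroup V] [Module ℝ V] (θ : ℝ) (t : ℕ → ℝ) (z : ℕ → V) (n : ℕ) : V :=
  (beta θ (vari t n) 2 * (1 + stp t n / stp t (n - 1)) + beta θ (vari t n) 1) • z n
    + (beta θ (vari t n) 0 - beta θ (vari t n) 2 * (stp t n / stp t (n - 1))) • z (n - 1)

/-- `t_{n,β}`. -/
def tBeta (θ : ℝ) (t : ℕ → ℝ) (n : ℕ) : ℝ := zBeta θ t t n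

/-- The discrete-in-time regularity
`u ∈ ℓ^∞(H^r ∩ H^2) ∩ ℓ^{∞,β}(H^2) ∩ ℓ^{2,β}(H^{r+1})`, `p ∈ ℓ^∞(H^{s+1}) ∩ ℓ^{2,β}(H^{s+1})`
on the grid `t`, with all the discrete norms bounded by `M`. -/
structure DiscreteRegular {d : ℕ} {Ω : Set (Pt d)} (θ : ℝ) (r s N : ℕ) (t : ℕ → ℝ) (M : ℝ)
    (u : ℝ → L2V Ω) (p : ℝ → L2 Ω) : Prop where
  u_inf_r : ∀ n ≤ N, MemHV r (u (t n)) ∧ normHV r (u (t n)) ≤ M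
  u_inf_two : ∀ n ≤ N, MemHV 2 (u (t n)) ∧ normHV 2 (u (t n)) ≤ M
  u_inf_beta : ∀ n ∈ Finset.Ico 1 N,
    MemHV 2 (u (tBeta θ t n)) ∧ normHV 2 (u (tBeta θ t n)) ≤ M
  u_two_beta : (∀ n ∈ Finset.Ico 1 N, MemHV (r + 1) (u (tBeta θ t n))) ∧
    Real.sqrt (∑ n ∈ Finset.Ico 1 N,
      (stp t n + stp t (n - 1)) * normHV (r + 1) (u (tBeta θ t n)) ^ 2) ≤ M
  p_inf : ∀ n ≤ N, MemH (s + 1) (p (t n)) ∧ normH (s + 1) (p (t n)) ≤ M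
  p_two_beta : (∀ n ∈ Finset.Ico 1 N, MemH (s + 1) (p (tBeta θ t n))) ∧
    Real.sqrt (∑ n ∈ Finset.Ico 1 N,
      (stp t n + stp t (n - 1)) * normH (s + 1) (p (tBeta θ t n)) ^ 2) ≤ M

/-! ### Finite element spaces -/

/-- `K` is a (finite, edge-to-edge) triangulation of `Ω` by `d`-simplices. -/
structure IsTriangulation {d : ℕ} (K : Geometry.SimplicialComplex ℝ (Pt d)) (Ω : Set (Pt d)) :
    Prop where
  finite : K.faces.Finite
  pure : ∀ s ∈ K.faces, ∃ c ∈ K.faces, s ⊆ c ∧ c.card = d + 1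
  domain : Ω = interior K.space

/-- `Ω` is the interior of a triangulated polygon (`d = 2`) or polyhedron (`d = 3`). -/
def IsPolyhedral {d : ℕ} (Ω : Set (Pt d)) : Prop := ∃ K, IsTriangulation K Ω

/-- The diameter of the triangulation: the largest diameter of its simplices. -/
def meshDiam {d : ℕ} (K : Geometry.SimplicialComplex ℝ (Pt d)) : ℝ :=
  sSup ((fun c : Finset (Pt d) => Metric.diam (convexHull ℝ (c : Set (Pt d)))) '' K.faces)

/-- `v` is a function of class `C^m` on `Ω` which is a polynomial on every cell of `K`. -/
def IsFEFunction {d : ℕ} {Ω : Set (Pt d)} (K : Geometry.SimplicialComplex ℝ (Pt d)) (m : ℕ)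
    (v : L2 Ω) : Prop :=
  (∃ w : Pt d → ℝ, ContDiffOn ℝ m w Ω ∧ v =ᵐ[volume.restrict Ω] w) ∧
  ∀ c ∈ K.faces, c.card = d + 1 → ∃ P : MvPolynomial (Fin d) ℝ,
    ∀ᵐ x ∂(volume.restrict Ω), x ∈ convexHull ℝ (c : Set (Pt d)) →
      v x = MvPolynomial.eval (fun i => x i) P

/-- `X^h ⊂ X` and `Q^h ⊂ Q` are `C^m` finite element spaces on the triangulation `K` of diameter
`h` which satisfy the approximation properties of orders `r` and `s` (constant `Capp`), the inverse
inequality (constant `Cinv`) and the discrete inf-sup condition (constant `Cis`). Infima and suprema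
over the finite-dimensional spaces `X^h`, `Q^h` are attained. -/
structure IsFEPair {d : ℕ} {Ω : Set (Pt d)} (r s m : ℕ) (Capp Cinv Cis h : ℝ)
    (K : Geometry.SimplicialComplex ℝ (Pt d)) (Xh : Submodule ℝ (L2V Ω))
    (Qh : Submodule ℝ (L2 Ω)) : Prop where
  triangulation : IsTriangulation K Ω
  diam : meshDiam K = h
  finX : FiniteDimensional ℝ Xh
  finQ : FiniteDimensional ℝ Qh
  memX : ∀ v ∈ Xh, MemX v
  memQ : ∀ q ∈ Qh, MemQ q
  feX : ∀ v ∈ Xh, ∀ i, IsFEFunction K m (v i)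
  feQ : ∀ q ∈ Qh, IsFEFunction K m q
  approxX : ∀ u : L2V Ω, MemX u → MemHV (r + 1) u → ∀ ℓ ≤ min (m + 1) (r + 1),
    ∃ v ∈ Xh, MemHV ℓ (u - v) ∧ normHV ℓ (u - v) ≤ Capp * h ^ (r + 1 - ℓ) * semiHV (r + 1) u
  approxQ : ∀ p : L2 Ω, MemQ p → MemH (s + 1) p → ∀ ℓ ≤ min (m + 1) (s + 1),
    ∃ q ∈ Qh, MemH ℓ (p - q) ∧ normH ℓ (p - q) ≤ Capp * h ^ (s + 1 - ℓ) * semiH (s + 1) p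
  inverse : ∀ v ∈ Xh, semiHV 1 v ≤ Cinv * h⁻¹ * ‖v‖
  infSup : ∀ q ∈ Qh, q ≠ 0 →
    ∃ v ∈ Xh, v ≠ 0 ∧ Cis * (gradNorm v * ‖q‖) ≤ inner ℝ (divg v) q

/-- The discretely divergence-free space `V^h`. -/
def MemVh {d : ℕ} {Ω : Set (Pt d)} (Xh : Submodule ℝ (L2V Ω)) (Qh : Submodule ℝ (L2 Ω))
    (v : L2V Ω) : Prop :=
  v ∈ Xh ∧ ∀ q ∈ Qh, inner ℝ q (divg v) = 0

/-! ### The DLN-Ensemble algorithm -/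

/-- The ensemble average `⟨z⟩_n`. -/
def ensMean {V : Type*} [AddCommGroup V] [Module ℝ V] {J : ℕ} (z : Fin J → ℕ → V) (n : ℕ) : V :=
  (1 / J : ℝ) • ∑ j, z j n

/-- `(U j n, P j n)`, `0 ≤ n ≤ N`, `j = 1, …, J`, is produced by the variable time-stepping
DLN-Ensemble algorithm with parameter `θ` from its starting values at `n = 0, 1`. -/
structure IsDLNEnsemble {d : ℕ} {Ω : Set (Pt d)} {J : ℕ} (θ ν : ℝ) (N : ℕ) (t : ℕ → ℝ)
    (Xh : Submodule ℝ (L2V Ω)) (Qh : Submodule ℝ (L2 Ω)) (f : Fin J → ℝ → L2V Ω)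
    (U : Fin J → ℕ → L2V Ω) (P : Fin J → ℕ → L2 Ω) : Prop where
  memX : ∀ j, ∀ n ≤ N, U j n ∈ Xh
  memQ : ∀ j, ∀ n ≤ N, P j n ∈ Qh
  momentum : ∀ j, ∀ n ∈ Finset.Ico 1 N, ∀ v ∈ Xh,
    inner ℝ ((khat θ t n)⁻¹ • zAlpha θ (U j) n) v
      + trib (zStar θ t (ensMean U) n) (zBeta θ t (U j) n) v
      - inner ℝ (zBeta θ t (P j) n) (divg v)
      + ν * gradInner (zBeta θ t (U j) n) v
    = inner ℝ (f j (tBeta θ t n)) v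
      - trib (zStar θ t (U j) n - zStar θ t (ensMean U) n) (zStar θ t (U j) n) v
  divFree : ∀ j, ∀ n ∈ Finset.Ico 1 N, ∀ q ∈ Qh, inner ℝ (divg (zBeta θ t (U j) n)) q = 0

/-- The CFL-like conditions with constant `Ccfl`. -/
def CFL {d : ℕ} {Ω : Set (Pt d)} {J : ℕ} (Ccfl θ ν h : ℝ) (N : ℕ) (t : ℕ → ℝ)
    (U : Fin J → ℕ → L2V Ω) : Prop :=
  ∀ j, ∀ n ∈ Finset.Ico 1 N,
    0 ≤ 1 - Ccfl * ((1 + vari t n * θ) / (1 - vari t n)) ^ 2 * (khat θ t n / (h * ν))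
      * gradNorm (zStar θ t (U j) n - zStar θ t (ensMean U) n) ^ 2

/-- The rate `h^r + h^{s+1} + k_max^2 + h^{1/2} k_max^{3/2}`. -/
def rate (r s : ℕ) (h k : ℝ) : ℝ :=
  h ^ r + h ^ (s + 1) + k ^ 2 + h ^ (1 / 2 : ℝ) * k ^ (3 / 2 : ℝ)

end

end DLN

/-!
The errors of the ensemble members decouple: the `j`-th error only sees the other members through
the fluctuation `U' = U_{n,*} - ⟨U⟩_{n,*}`, and that quantity is controlled by the CFL-like
condition. So one exact solution `u` and one numerical solution `U` are compared, with an arbitrary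
advecting velocity in place of the ensemble mean (`exists_error_bound`).

**Splitting of the error.** With the discrete Stokes projection `s` of `(u, p)` into the discretely
divergence-free functions, `u - U = (u - s) + φ`, where `φ = s - U` is discrete. The inf-sup
condition makes `‖∇(u - s)‖` of order `h ^ r + h ^ (s + 1)` (`IsStokes.norm_sub_le`), and it gives
the same order for the DLN combinations of `u - s`, as the projection is linear. In the equation
for `φ` (`error_equation`) the pressures only enter through their error in time.

**Consistency.** Every combination of point values in time that annihilates polynomials of degree
less than `m` is dominated, after any continuous functional, by an integral of the `m`-th time
derivative (`WeakDom`). Such a bound is inherited by all Sobolev norms. The resulting squares of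
the consistency errors sum up to `ρ ^ 2 + k ^ 4 + h * k ^ 3` with `ρ = h ^ r + h ^ (s + 1)` and `k`
the largest time increment.

**Energy estimates.** Testing with `φ_{n,β}` and using the `G`-stability of the method
(`inner_zAlpha_zBeta`) produces numerical dissipation. The difference `φ_{n,β} - φ_{n,*}` is a
multiple of the second difference in this dissipation, and its squared norm is at most a constant
times `((1 + ε_n θ) / (1 - ε_n)) ^ 2` times the dissipation (`norm_zBeta_sub_zStar_sq_le`). Under
the CFL-like condition the dissipation therefore absorbs the fluctuation term `b(U', φ_{n,β} -
φ_{n,*}, φ_{n,β})` (`cfl_absorb`). Its constant comes from the bound of `b`, the inverse inequality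
and `θ` only. All other terms are treated by Young's inequality, the extrapolation `φ_{n,*}`
contains no value at `t_{n+1}`, and an explicit discrete Gronwall inequality gives the estimate in
`L²`, including the sum of `k̂_n ‖∇φ_{n,β}‖ ^ 2`.

Testing with `φ_{n,α} / k̂_n` gives the estimate in `H¹`. Here the term `b(φ_{n,*}, φ_{n,β}, ·)`,
which is quadratic in the error, can only be estimated by means of the inverse inequality, with a
factor `h ^ (-1/2)`. It enters the Gronwall inequality with the weight `h⁻¹ k̂_n ‖∇φ_{n,β}‖ ^ 2`.
The sum of these weights is bounded: by the `L²` estimate it is at most a constant times `h⁻¹ *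
rate ^ 2`, and `rate ^ 2 ≤ 16 * h` because of `k ≤ h ^ (1/4)`. This is `energy_estimate`, stated
for an abstract trilinear form.

**Trilinear form.** On a polyhedral domain, possibly not Lipschitz, the required bounds of `b` are
proved from two sources: the Gagliardo–Nirenberg–Sobolev inequality on `H^1_0`, and the embeddings
`H¹ ⊂ L⁴` and `H² ⊂ L^∞` for functions without boundary values. The latter hold on each cell of the
triangulation, because a cell is convex: a value at `x` is compared with the mean value over a
fixed subset of positive measure, along the segments from `x`.

**Degenerate data.** If no value of `u` or `p` belongs to `H^{r+1}` or `H^{s+1}`, respectively, the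
discrete regularity cannot hold on a grid with an interior node. Then `N = 1` and only the starting
values are left. Otherwise the regularity of `u_t` and `p_t` bounds `u` and `p` in these spaces
uniformly in time, independently of the grid.
-/

namespace DLN

/-! ### Functionals bounded by a linear map into a Hilbert space -/

/-- Riesz representation for a functional that is bounded through a linear map `ι` into a Hilbert
space. -/
theorem exists_inner_eq_of_bound {V H : Type*} [AddCommGroup V] [Module ℝ V]
    [NormedAddCommGroup H] [InnerProductSpace ℝ H] [CompleteSpace H] (ι : V →ₗ[ℝ] H)
    (l : V →ₗ[ℝ] ℝ) (B : ℝ) (hB : 0 ≤ B) (hl : ∀ v, |l v| ≤ B * ‖ι v‖) :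
    ∃ g : H, ‖g‖ ≤ B ∧ ∀ v, l v = inner ℝ g (ι v) := by
  have hker : LinearMap.ker ι ≤ LinearMap.ker l := by
    intro v hv
    have h := hl v
    rw [LinearMap.mem_ker.1 hv, norm_zero, mul_zero] at h
    exact LinearMap.mem_ker.2 (abs_nonpos_iff.1 h)
  let l' : LinearMap.range ι →ₗ[ℝ] ℝ :=
    ((LinearMap.ker ι).liftQ l hker).comp ι.quotKerEquivRange.symm.toLinearMap
  have hl' : ∀ v, l' ⟨ι v, v, rfl⟩ = l v := by
    intro v
    have : ι.quotKerEquivRange.symm ⟨ι v, v, rfl⟩ = (LinearMap.ker ι).mkQ v :=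
      ι.quotKerEquivRange_symm_apply_image v _
    simp only [l', LinearMap.comp_apply, LinearEquiv.coe_coe, this, Submodule.mkQ_apply,
      Submodule.liftQ_apply]
  let c : StrongDual ℝ (LinearMap.range ι) := l'.mkContinuous B (by
    rintro ⟨_, v, rfl⟩
    rw [hl' v]
    exact hl v)
  obtain ⟨G, hG, hGn⟩ := exists_extension_norm_eq (LinearMap.range ι) c
  refine ⟨(InnerProductSpace.toDual ℝ H).symm G, ?_, fun v => ?_⟩
  · rw [LinearIsometryEquiv.norm_map, hGn]
    exact LinearMap.mkContinuous_norm_le _ hB _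
  · rw [InnerProductSpace.toDual_symm_apply, ← hl' v]
    exact (hG ⟨ι v, v, rfl⟩).symm

/-! ### Test functions and weak derivatives -/

section WeakDeriv

variable {d : ℕ} {Ω : Set (Pt d)}

/-- The partial derivative `∂_{a 0} ⋯ ∂_{a (k-1)} φ` of a smooth function. -/
noncomputable def testDeriv {k : ℕ} (a : Fin k → Fin d) (φ : Pt d → ℝ) (x : Pt d) : ℝ :=
  iteratedFDeriv ℝ k φ x (fun i => EuclideanSpace.single (a i) 1)

theorem IsTest.add {φ ψ : Pt d → ℝ} (hφ : IsTest Ω φ) (hψ : IsTest Ω ψ) : IsTest Ω (φ + ψ) :=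
  ⟨hφ.1.add hψ.1, hφ.2.1.add hψ.2.1,
    (tsupport_add φ ψ).trans (union_subset hφ.2.2 hψ.2.2)⟩

theorem IsTest.smul {φ : Pt d → ℝ} (c : ℝ) (hφ : IsTest Ω φ) : IsTest Ω (c • φ) :=
  ⟨hφ.1.const_smul c, hφ.2.1.smul_left (f := fun _ => c),
    (closure_mono (Function.support_const_smul_subset c φ)).trans hφ.2.2⟩

theorem IsTest.mul {φ ψ : Pt d → ℝ} (hφ : IsTest Ω φ) (hψ : IsTest Ω ψ) : IsTest Ω (φ * ψ) :=
  ⟨hφ.1.mul hψ.1, hφ.2.1.mul_right, (tsupport_mul_subset_left).trans hφ.2.2⟩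

theorem isTest_zero : IsTest Ω (0 : Pt d → ℝ) :=
  ⟨contDiff_const, HasCompactSupport.zero, by
    simp [tsupport, Function.support_zero]⟩

variable (Ω) in
/-- The space of test functions on `Ω`. -/
def TestSpace : Submodule ℝ (Pt d → ℝ) where
  carrier := {φ | IsTest Ω φ}
  add_mem' := IsTest.add
  zero_mem' := isTest_zero
  smul_mem' c _ h := h.smul c

theorem IsTest.memLp_testDeriv {k : ℕ} {φ : Pt d → ℝ} (hφ : IsTest Ω φ) (a : Fin k → Fin d)
    (p : ENNReal) : MemLp (testDeriv a φ) p (volume.restrict Ω) := by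
  have hc : Continuous (testDeriv a φ) := by
    have h1 : Continuous (iteratedFDeriv ℝ k φ) :=
      hφ.1.continuous_iteratedFDeriv (by exact_mod_cast le_top)
    exact (ContinuousMultilinearMap.apply ℝ (fun _ : Fin k => Pt d) ℝ
      (fun i => EuclideanSpace.single (a i) 1)).continuous.comp h1
  have hs : HasCompactSupport (testDeriv a φ) :=
    (hφ.2.1.iteratedFDeriv k).comp_left
      (g := fun L : ContinuousMultilinearMap ℝ (fun _ : Fin k => Pt d) ℝ =>
        L (fun i => EuclideanSpace.single (a i) 1)) rfl
  exact (hc.memLp_of_hasCompactSupport hs).restrict _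

theorem IsTest.memLp {φ : Pt d → ℝ} (hφ : IsTest Ω φ) (p : ENNReal) :
    MemLp φ p (volume.restrict Ω) :=
  (hφ.1.continuous.memLp_of_hasCompactSupport hφ.2.1).restrict _

variable (Ω) in
/-- The embedding of test functions into `L²(Ω)`. -/
noncomputable def testLp : TestSpace Ω →ₗ[ℝ] L2 Ω where
  toFun φ := (IsTest.memLp φ.2 2).toLp φ
  map_add' _ _ := rfl
  map_smul' _ _ := rfl

theorem testLp_coe (φ : TestSpace Ω) : testLp Ω φ =ᵐ[volume.restrict Ω] (φ : Pt d → ℝ) :=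
  MemLp.coeFn_toLp (IsTest.memLp φ.2 2)

theorem testDeriv_add {k : ℕ} (a : Fin k → Fin d) {φ ψ : Pt d → ℝ} (hφ : ContDiff ℝ ∞ φ)
    (hψ : ContDiff ℝ ∞ ψ) : testDeriv a (φ + ψ) = testDeriv a φ + testDeriv a ψ := by
  funext x
  simp only [testDeriv, Pi.add_apply]
  rw [iteratedFDeriv_add_apply (hφ.contDiffAt.of_le (by exact_mod_cast le_top))
    (hψ.contDiffAt.of_le (by exact_mod_cast le_top))]
  rfl

theorem testDeriv_smul {k : ℕ} (a : Fin k → Fin d) {φ : Pt d → ℝ} (c : ℝ)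
    (hφ : ContDiff ℝ ∞ φ) : testDeriv a (c • φ) = c • testDeriv a φ := by
  funext x
  simp only [testDeriv, Pi.smul_apply]
  rw [iteratedFDeriv_const_smul_apply (hφ.contDiffAt.of_le (by exact_mod_cast le_top))]
  rfl

/-- The derivative `∂_a φ` of a test function as an element of `L²(Ω)`. -/
noncomputable def derivLp {k : ℕ} (a : Fin k → Fin d) : TestSpace Ω →ₗ[ℝ] L2 Ω where
  toFun φ := (IsTest.memLp_testDeriv φ.2 a 2).toLp (testDeriv a φ)
  map_add' φ ψ := by
    rw [← MemLp.toLp_add]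
    congr 1
    exact testDeriv_add a φ.2.1 ψ.2.1
  map_smul' c φ := by
    rw [RingHom.id_apply, ← MemLp.toLp_const_smul]
    congr 1
    exact testDeriv_smul a c φ.2.1

theorem derivLp_coe {k : ℕ} (a : Fin k → Fin d) (φ : TestSpace Ω) :
    derivLp a φ =ᵐ[volume.restrict Ω] testDeriv a (φ : Pt d → ℝ) :=
  MemLp.coeFn_toLp (IsTest.memLp_testDeriv φ.2 a 2)

theorem inner_eq_integral (f g : L2 Ω) : inner ℝ f g = ∫ x in Ω, f x * g x := by
  rw [L2.inner_def]
  exact integral_congr_ae (Filter.Eventually.of_forall fun x => mul_comm _ _)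

theorem inner_eq_integral_of_ae {f g : L2 Ω} {ψ : Pt d → ℝ}
    (h : g =ᵐ[volume.restrict Ω] ψ) : inner ℝ f g = ∫ x in Ω, f x * ψ x := by
  rw [inner_eq_integral]
  exact integral_congr_ae (h.mono fun x hx => by simp only [hx])

/-- Weak derivatives in terms of inner products with test functions. -/
theorem isWeakDeriv_iff {k : ℕ} {a : Fin k → Fin d} {v g : L2 Ω} :
    IsWeakDeriv a v g ↔
      ∀ φ : TestSpace Ω, inner ℝ v (derivLp a φ) = (-1) ^ k * inner ℝ g (testLp Ω φ) := by
  constructor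
  · intro h φ
    rw [inner_eq_integral_of_ae (derivLp_coe a φ), inner_eq_integral_of_ae (testLp_coe φ)]
    exact h φ φ.2
  · intro h φ hφ
    have := h ⟨φ, hφ⟩
    rwa [inner_eq_integral_of_ae (derivLp_coe a _), inner_eq_integral_of_ae (testLp_coe _)] at this

/-- Test functions are dense in `L²(Ω)`. -/
theorem eq_zero_of_inner_testLp (hΩ : IsOpen Ω) {g : L2 Ω}
    (h : ∀ φ : TestSpace Ω, inner ℝ g (testLp Ω φ) = 0) : g = 0 := by
  have hloc : LocallyIntegrableOn g Ω volume := by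
    have h1 : LocallyIntegrable g (volume.restrict Ω) := (Lp.memLp g).locallyIntegrable one_le_two
    rw [locallyIntegrableOn_iff hΩ.isLocallyClosed]
    intro k hk hkc
    have := h1.integrableOn_isCompact hkc
    rwa [IntegrableOn, Measure.restrict_restrict hkc.measurableSet,
      inter_eq_left.2 hk] at this
  have key := hΩ.ae_eq_zero_of_integral_contDiff_smul_eq_zero (μ := volume) hloc (by
    intro φ h1 h2 h3
    have := h ⟨φ, h1, h2, h3⟩
    rw [inner_eq_integral_of_ae (testLp_coe _)] at this
    rw [← this, setIntegral_eq_integral_of_forall_compl_eq_zero]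
    · exact integral_congr_ae (Filter.Eventually.of_forall fun x => by simp [mul_comm])
    · intro x hx
      have : φ x = 0 := by
        by_contra hne
        exact hx (h3 (subset_tsupport _ hne))
      simp [this])
  rw [← ae_restrict_iff' hΩ.measurableSet] at key
  exact (Lp.eq_zero_iff_ae_eq_zero).2 key

theorem IsWeakDeriv.unique (hΩ : IsOpen Ω) {k : ℕ} {a : Fin k → Fin d} {v g g' : L2 Ω}
    (h : IsWeakDeriv a v g) (h' : IsWeakDeriv a v g') : g = g' := by
  rw [← sub_eq_zero]
  refine eq_zero_of_inner_testLp hΩ fun φ => ?_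
  have h1 := isWeakDeriv_iff.1 h φ
  have h2 := isWeakDeriv_iff.1 h' φ
  rw [inner_sub_left, sub_eq_zero]
  exact mul_left_cancel₀ (pow_ne_zero k (by norm_num)) (h1.symm.trans h2)

theorem IsWeakDeriv.add {k : ℕ} {a : Fin k → Fin d} {v w g g' : L2 Ω}
    (h : IsWeakDeriv a v g) (h' : IsWeakDeriv a w g') : IsWeakDeriv a (v + w) (g + g') := by
  rw [isWeakDeriv_iff] at *
  intro φ
  rw [inner_add_left, inner_add_left, h, h', mul_add]

theorem IsWeakDeriv.smul {k : ℕ} {a : Fin k → Fin d} {v g : L2 Ω} (c : ℝ)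
    (h : IsWeakDeriv a v g) : IsWeakDeriv a (c • v) (c • g) := by
  rw [isWeakDeriv_iff] at *
  intro φ
  rw [inner_smul_left, inner_smul_left, h]
  simp only [conj_trivial]
  ring

theorem weakDeriv_eq (hΩ : IsOpen Ω) {k : ℕ} {a : Fin k → Fin d} {v g : L2 Ω}
    (h : IsWeakDeriv a v g) : weakDeriv a v = g := by
  have hex : ∃ g : L2 Ω, IsWeakDeriv a v g := ⟨g, h⟩
  rw [weakDeriv, dif_pos hex]
  exact hex.choose_spec.unique hΩ h

theorem isWeakDeriv_weakDeriv {k : ℕ} {a : Fin k → Fin d} {v : L2 Ω}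
    (h : ∃ g : L2 Ω, IsWeakDeriv a v g) : IsWeakDeriv a v (weakDeriv a v) := by
  rw [weakDeriv, dif_pos h]
  exact h.choose_spec

theorem MemH.isWeakDeriv {ℓ k : ℕ} {v : L2 Ω} (h : MemH ℓ v) (hk : k ≤ ℓ) (a : Fin k → Fin d) :
    IsWeakDeriv a v (weakDeriv a v) :=
  isWeakDeriv_weakDeriv (h k hk a)

theorem MemH.mono {ℓ m : ℕ} {v : L2 Ω} (h : MemH ℓ v) (hm : m ≤ ℓ) : MemH m v :=
  fun k hk a => h k (hk.trans hm) a

theorem MemH.add {ℓ : ℕ} {v w : L2 Ω} (hv : MemH ℓ v) (hw : MemH ℓ w) : MemH ℓ (v + w) :=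
  fun _ hk a => ⟨_, (hv.isWeakDeriv hk a).add (hw.isWeakDeriv hk a)⟩

theorem MemH.smul {ℓ : ℕ} {v : L2 Ω} (c : ℝ) (hv : MemH ℓ v) : MemH ℓ (c • v) :=
  fun _ hk a => ⟨_, (hv.isWeakDeriv hk a).smul c⟩

theorem weakDeriv_add (hΩ : IsOpen Ω) {ℓ k : ℕ} {v w : L2 Ω} (hv : MemH ℓ v) (hw : MemH ℓ w)
    (hk : k ≤ ℓ) (a : Fin k → Fin d) : weakDeriv a (v + w) = weakDeriv a v + weakDeriv a w :=
  weakDeriv_eq hΩ ((hv.isWeakDeriv hk a).add (hw.isWeakDeriv hk a))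

theorem weakDeriv_smul (hΩ : IsOpen Ω) {ℓ k : ℕ} {v : L2 Ω} (c : ℝ) (hv : MemH ℓ v)
    (hk : k ≤ ℓ) (a : Fin k → Fin d) : weakDeriv a (c • v) = c • weakDeriv a v :=
  weakDeriv_eq hΩ ((hv.isWeakDeriv hk a).smul c)

theorem isWeakDeriv_nil (a : Fin 0 → Fin d) (v : L2 Ω) : IsWeakDeriv a v v := by
  intro φ _
  simp

theorem weakDeriv_nil (hΩ : IsOpen Ω) (a : Fin 0 → Fin d) (v : L2 Ω) : weakDeriv a v = v :=
  weakDeriv_eq hΩ (isWeakDeriv_nil a v)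

/-- A function whose pairing with `∂_a φ` is bounded by `‖φ‖` has a weak derivative. -/
theorem exists_isWeakDeriv_of_bound {k : ℕ} {a : Fin k → Fin d} {v : L2 Ω} {B : ℝ} (hB : 0 ≤ B)
    (h : ∀ φ : TestSpace Ω, |inner ℝ v (derivLp a φ)| ≤ B * ‖testLp Ω φ‖) :
    ∃ g : L2 Ω, IsWeakDeriv a v g ∧ ‖g‖ ≤ B := by
  obtain ⟨g, hg, hgv⟩ := exists_inner_eq_of_bound (testLp Ω)
    ((-1 : ℝ) ^ k • ((innerSL ℝ v).toLinearMap.comp (derivLp a))) B hB (by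
      intro φ
      simpa [abs_mul, abs_pow] using h φ)
  refine ⟨g, isWeakDeriv_iff.2 fun φ => ?_, hg⟩
  rw [← hgv φ]
  simp only [LinearMap.smul_apply, LinearMap.comp_apply, smul_eq_mul,
    ContinuousLinearMap.coe_coe, innerSL_apply_apply]
  rw [← mul_assoc, ← mul_pow]
  norm_num

/-! ### Sobolev norms -/

theorem semiSqH_nonneg (ℓ : ℕ) (v : L2 Ω) : 0 ≤ semiSqH ℓ v :=
  Finset.sum_nonneg fun _ _ => by positivity

theorem normH_nonneg (ℓ : ℕ) (v : L2 Ω) : 0 ≤ normH ℓ v := Real.sqrt_nonneg _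

theorem normH_sq (ℓ : ℕ) (v : L2 Ω) :
    normH ℓ v ^ 2 = ∑ k ∈ Finset.range (ℓ + 1), semiSqH k v :=
  Real.sq_sqrt (Finset.sum_nonneg fun _ _ => semiSqH_nonneg _ _)

theorem semiSqH_le_normH_sq {ℓ k : ℕ} (hk : k ≤ ℓ) (v : L2 Ω) : semiSqH k v ≤ normH ℓ v ^ 2 := by
  rw [normH_sq]
  exact Finset.single_le_sum (f := fun k => semiSqH k v) (fun _ _ => semiSqH_nonneg _ _)
    (Finset.mem_range.2 (by omega))

theorem norm_weakDeriv_le_normH {ℓ k : ℕ} (hk : k ≤ ℓ) (a : Fin k → Fin d) (v : L2 Ω) :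
    ‖weakDeriv a v‖ ≤ normH ℓ v := by
  refine le_of_sq_le_sq ?_ (normH_nonneg _ _)
  refine le_trans ?_ (semiSqH_le_normH_sq hk v)
  exact Finset.single_le_sum (f := fun a : Fin k → Fin d => ‖weakDeriv a v‖ ^ 2)
    (fun _ _ => by positivity) (Finset.mem_univ a)

theorem norm_le_normH (hΩ : IsOpen Ω) (ℓ : ℕ) (v : L2 Ω) : ‖v‖ ≤ normH ℓ v := by
  simpa [weakDeriv_nil hΩ] using norm_weakDeriv_le_normH (Nat.zero_le ℓ) ![] v

theorem normH_mono {ℓ m : ℕ} (h : m ≤ ℓ) (v : L2 Ω) : normH m v ≤ normH ℓ v :=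
  Real.sqrt_le_sqrt (Finset.sum_le_sum_of_subset_of_nonneg
    (Finset.range_mono (by omega)) fun _ _ _ => semiSqH_nonneg _ _)

theorem norm_pd_le_normH (i : Fin d) {ℓ : ℕ} (hℓ : 1 ≤ ℓ) (v : L2 Ω) : ‖pd i v‖ ≤ normH ℓ v :=
  norm_weakDeriv_le_normH hℓ ![i] v

/-- The number of multi-indices of length at most `ℓ`. -/
def multiCard (d ℓ : ℕ) : ℕ := ∑ k ∈ Finset.range (ℓ + 1), Fintype.card (Fin k → Fin d)

theorem normH_le_of_forall {ℓ : ℕ} {v : L2 Ω} {B : ℝ} (hB : 0 ≤ B)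
    (h : ∀ k ≤ ℓ, ∀ a : Fin k → Fin d, ‖weakDeriv a v‖ ≤ B) :
    normH ℓ v ≤ (multiCard d ℓ : ℝ) * B := by
  have h1 : normH ℓ v ^ 2 ≤ multiCard d ℓ * B ^ 2 := by
    rw [normH_sq, multiCard, Nat.cast_sum, Finset.sum_mul]
    refine Finset.sum_le_sum fun k hk => ?_
    have : semiSqH k v ≤ ∑ _a : Fin k → Fin d, B ^ 2 :=
      Finset.sum_le_sum fun a _ =>
        pow_le_pow_left₀ (norm_nonneg _) (h k (by simpa [Nat.lt_succ_iff] using hk) a) 2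
    simpa using this
  have h0 : (multiCard d ℓ : ℝ) ≤ (multiCard d ℓ : ℝ) ^ 2 := by
    exact_mod_cast Nat.le_self_pow two_ne_zero _
  refine abs_le_of_sq_le_sq' ?_ (by positivity) |>.2
  calc normH ℓ v ^ 2 ≤ multiCard d ℓ * B ^ 2 := h1
    _ ≤ (multiCard d ℓ : ℝ) ^ 2 * B ^ 2 := by gcongr
    _ = _ := by ring

theorem semiH_le_normH (ℓ : ℕ) (v : L2 Ω) : semiH ℓ v ≤ normH ℓ v :=
  Real.sqrt_le_iff.2 ⟨normH_nonneg _ _, semiSqH_le_normH_sq le_rfl v⟩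

end WeakDeriv

/-! ### Functions vanishing on the boundary -/

section Boundary

variable {d : ℕ} {Ω : Set (Pt d)}

open Filter Topology

theorem testDeriv_one (i : Fin d) (φ : Pt d → ℝ) (x : Pt d) :
    testDeriv ![i] φ x = fderiv ℝ φ x (EuclideanSpace.single i 1) := by
  simp [testDeriv, iteratedFDeriv_one_apply]

theorem IsTest.testDeriv_one {φ : Pt d → ℝ} (hφ : IsTest Ω φ) (i : Fin d) :
    IsTest Ω (testDeriv ![i] φ) := by
  have h : testDeriv ![i] φ = fun x => fderiv ℝ φ x (EuclideanSpace.single i 1) :=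
    funext (DLN.testDeriv_one i φ)
  rw [h]
  refine ⟨?_, hφ.2.1.fderiv_apply ℝ _, (tsupport_fderiv_apply_subset ℝ _).trans hφ.2.2⟩
  exact (hφ.1.fderiv_right (m := ∞) (by exact_mod_cast le_top)).clm_apply contDiff_const

theorem IsTest.eq_zero_of_notMem {φ : Pt d → ℝ} (hφ : IsTest Ω φ) {x : Pt d} (hx : x ∉ Ω) :
    φ x = 0 := by
  by_contra hne
  exact hx (hφ.2.2 (subset_tsupport _ hne))

theorem isWeakDeriv_testLp (i : Fin d) (φ : TestSpace Ω) :
    IsWeakDeriv ![i] (testLp Ω φ) (derivLp ![i] φ) := by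
  intro ψ hψ
  have hφ : IsTest Ω (φ : Pt d → ℝ) := φ.2
  have e1 : ∫ x in Ω, testLp Ω φ x *
      iteratedFDeriv ℝ 1 ψ x (fun j => EuclideanSpace.single ((![i] : Fin 1 → Fin d) j) 1) =
      ∫ x, (φ : Pt d → ℝ) x * fderiv ℝ ψ x (EuclideanSpace.single i 1) := by
    refine Eq.trans ?_ (setIntegral_eq_integral_of_forall_compl_eq_zero (s := Ω) ?_)
    · refine integral_congr_ae ((testLp_coe φ).mono fun x hx => ?_)
      simp only [hx, iteratedFDeriv_one_apply]
      rfl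
    · intro x hx
      simp [hφ.eq_zero_of_notMem hx]
  have e2 : ∫ x in Ω, derivLp ![i] φ x * ψ x =
      ∫ x, fderiv ℝ (φ : Pt d → ℝ) x (EuclideanSpace.single i 1) * ψ x := by
    refine Eq.trans ?_ (setIntegral_eq_integral_of_forall_compl_eq_zero (s := Ω) ?_)
    · refine integral_congr_ae ((derivLp_coe ![i] φ).mono fun x hx => ?_)
      simp only [hx, DLN.testDeriv_one]
    · intro x hx
      simp [hψ.eq_zero_of_notMem hx]
  rw [e1, e2, pow_one, neg_one_mul]
  have hc : ∀ {f g : Pt d → ℝ}, IsTest Ω f → IsTest Ω g →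
      Integrable (fun x => f x * g x) volume := fun hf hg =>
    ((hf.mul hg).1.continuous).integrable_of_hasCompactSupport (hf.mul hg).2.1
  have h1 := hφ.testDeriv_one i
  have h2 := hψ.testDeriv_one i
  rw [show testDeriv ![i] (φ : Pt d → ℝ) = _ from funext (DLN.testDeriv_one i _)] at h1
  rw [show testDeriv ![i] ψ = _ from funext (DLN.testDeriv_one i _)] at h2
  exact integral_mul_fderiv_eq_neg_fderiv_mul_of_integrable (hc h1 hψ) (hc hφ h2) (hc hφ hψ)
    (fun x _ => (hφ.1.differentiable (by simp)).differentiableAt)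
    (fun x _ => (hψ.1.differentiable (by simp)).differentiableAt)

theorem memH_one_of_forall {v : L2 Ω} (h : ∀ i : Fin d, ∃ g : L2 Ω, IsWeakDeriv ![i] v g) :
    MemH 1 v := by
  intro k hk a
  interval_cases k
  · exact ⟨v, isWeakDeriv_nil a v⟩
  · have : a = ![a 0] := by
      funext j
      fin_cases j
      rfl
    rw [this]
    exact h _

theorem memH_testLp (φ : TestSpace Ω) : MemH 1 (testLp Ω φ) :=
  memH_one_of_forall fun i => ⟨_, isWeakDeriv_testLp i φ⟩

theorem pd_testLp (hΩ : IsOpen Ω) (i : Fin d) (φ : TestSpace Ω) :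
    pd i (testLp Ω φ) = derivLp ![i] φ :=
  weakDeriv_eq hΩ (isWeakDeriv_testLp i φ)

theorem pd_add (hΩ : IsOpen Ω) (i : Fin d) {v w : L2 Ω} (hv : MemH 1 v) (hw : MemH 1 w) :
    pd i (v + w) = pd i v + pd i w :=
  weakDeriv_add hΩ hv hw le_rfl _

theorem pd_smul (hΩ : IsOpen Ω) (i : Fin d) (c : ℝ) {v : L2 Ω} (hv : MemH 1 v) :
    pd i (c • v) = c • pd i v :=
  weakDeriv_smul hΩ c hv le_rfl _

theorem pd_sub (hΩ : IsOpen Ω) (i : Fin d) {v w : L2 Ω} (hv : MemH 1 v) (hw : MemH 1 w) :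
    pd i (v - w) = pd i v - pd i w := by
  rw [sub_eq_add_neg, ← neg_one_smul ℝ w, pd_add hΩ i hv (hw.smul _), pd_smul hΩ i _ hw,
    neg_one_smul, ← sub_eq_add_neg]

/-- The sum of the norms of the first order derivatives. -/
noncomputable def gradSum (v : L2 Ω) : ℝ := ∑ i, ‖pd i v‖

theorem gradSum_nonneg (v : L2 Ω) : 0 ≤ gradSum v := Finset.sum_nonneg fun _ _ => norm_nonneg _

theorem norm_pd_le_gradSum (i : Fin d) (v : L2 Ω) : ‖pd i v‖ ≤ gradSum v :=
  Finset.single_le_sum (f := fun i => ‖pd i v‖) (fun _ _ => norm_nonneg _) (Finset.mem_univ i)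

theorem normH_one_le (hΩ : IsOpen Ω) (v : L2 Ω) :
    normH 1 v ≤ (multiCard d 1 : ℝ) * (‖v‖ + gradSum v) := by
  refine normH_le_of_forall (add_nonneg (norm_nonneg _) (gradSum_nonneg _)) fun k hk a => ?_
  interval_cases k
  · rw [weakDeriv_nil hΩ]
    linarith [gradSum_nonneg v]
  · have : a = ![a 0] := by
      funext j
      fin_cases j
      rfl
    rw [this]
    exact (norm_pd_le_gradSum (a 0) v).trans (by linarith [norm_nonneg v])

/-- `H^1_0` functions are limits of sequences of test functions. -/
theorem MemH10.exists_seq (hΩ : IsOpen Ω) {v : L2 Ω} (h : MemH10 v) :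
    ∃ φ : ℕ → TestSpace Ω, Tendsto (fun n => testLp Ω (φ n)) atTop (𝓝 v) ∧
      ∀ i, Tendsto (fun n => derivLp ![i] (φ n)) atTop (𝓝 (pd i v)) := by
  have key : ∀ n : ℕ, ∃ φ : TestSpace Ω, normH 1 (v - testLp Ω φ) < 1 / ((n : ℝ) + 1) := by
    intro n
    obtain ⟨φ, w, hφ, hw, hn⟩ := h.2 (1 / ((n : ℝ) + 1)) (by positivity)
    refine ⟨⟨φ, hφ⟩, ?_⟩
    have : w = testLp Ω ⟨φ, hφ⟩ := Lp.ext (hw.trans (testLp_coe ⟨φ, hφ⟩).symm)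
    rwa [← this]
  choose φ hφ using key
  have hlim := tendsto_one_div_add_atTop_nhds_zero_nat (𝕜 := ℝ)
  refine ⟨φ, ?_, fun i => ?_⟩
  · rw [tendsto_iff_norm_sub_tendsto_zero]
    refine squeeze_zero (fun _ => norm_nonneg _) (fun n => ?_) hlim
    rw [norm_sub_rev]
    exact (norm_le_normH hΩ 1 _).trans (hφ n).le
  · rw [tendsto_iff_norm_sub_tendsto_zero]
    refine squeeze_zero (fun _ => norm_nonneg _) (fun n => ?_) hlim
    rw [norm_sub_rev, ← pd_testLp hΩ, ← pd_sub hΩ i h.1 (memH_testLp _)]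
    exact (norm_pd_le_normH i le_rfl _).trans (hφ n).le

theorem memH10_of_seq (hΩ : IsOpen Ω) {v : L2 Ω} (hv : MemH 1 v) (φ : ℕ → TestSpace Ω)
    (h0 : Tendsto (fun n => testLp Ω (φ n)) atTop (𝓝 v))
    (h1 : ∀ i, Tendsto (fun n => derivLp ![i] (φ n)) atTop (𝓝 (pd i v))) : MemH10 v := by
  refine ⟨hv, fun δ hδ => ?_⟩
  have hlim : Tendsto (fun n => (multiCard d 1 : ℝ) *
      (‖v - testLp Ω (φ n)‖ + ∑ i, ‖pd i v - derivLp ![i] (φ n)‖)) atTop (𝓝 0) := by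
    have a0 : Tendsto (fun n => ‖v - testLp Ω (φ n)‖) atTop (𝓝 0) := by
      simpa using ((tendsto_const_nhds (x := v)).sub h0).norm
    have a1 : Tendsto (fun n => ∑ i, ‖pd i v - derivLp ![i] (φ n)‖) atTop (𝓝 0) := by
      have : ∀ i ∈ (Finset.univ : Finset (Fin d)),
          Tendsto (fun n => ‖pd i v - derivLp ![i] (φ n)‖) atTop (𝓝 0) := fun i _ => by
        simpa using ((tendsto_const_nhds (x := pd i v)).sub (h1 i)).norm
      simpa using tendsto_finsetSum _ this
    simpa using (a0.add a1).const_mul (multiCard d 1 : ℝ)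
  obtain ⟨n, hn⟩ := (hlim.eventually_lt_const hδ).exists
  refine ⟨φ n, testLp Ω (φ n), (φ n).2, testLp_coe _, lt_of_le_of_lt ?_ hn⟩
  refine (normH_one_le hΩ _).trans_eq ?_
  simp only [gradSum, pd_sub hΩ _ hv (memH_testLp _), pd_testLp hΩ]

theorem memH10_testLp (φ : TestSpace Ω) (hΩ : IsOpen Ω) : MemH10 (testLp Ω φ) :=
  memH10_of_seq hΩ (memH_testLp φ) (fun _ => φ) tendsto_const_nhds fun i => by
    rw [pd_testLp hΩ]
    exact tendsto_const_nhds

theorem MemH10.add (hΩ : IsOpen Ω) {v w : L2 Ω} (hv : MemH10 v) (hw : MemH10 w) :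
    MemH10 (v + w) := by
  obtain ⟨φ, h0, h1⟩ := hv.exists_seq hΩ
  obtain ⟨ψ, g0, g1⟩ := hw.exists_seq hΩ
  refine memH10_of_seq hΩ (hv.1.add hw.1) (fun n => φ n + ψ n) ?_ fun i => ?_
  · simpa only [map_add] using h0.add g0
  · rw [pd_add hΩ i hv.1 hw.1]
    simpa only [map_add] using (h1 i).add (g1 i)

theorem MemH10.smul (hΩ : IsOpen Ω) {v : L2 Ω} (c : ℝ) (hv : MemH10 v) : MemH10 (c • v) := by
  obtain ⟨φ, h0, h1⟩ := hv.exists_seq hΩ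
  refine memH10_of_seq hΩ (hv.1.smul c) (fun n => c • φ n) ?_ fun i => ?_
  · simpa only [map_smul] using h0.const_smul c
  · rw [pd_smul hΩ i c hv.1]
    simpa only [map_smul] using (h1 i).const_smul c

theorem memH10_zero (hΩ : IsOpen Ω) : MemH10 (0 : L2 Ω) := by
  simpa using memH10_testLp (0 : TestSpace Ω) hΩ

theorem MemH10.sub (hΩ : IsOpen Ω) {v w : L2 Ω} (hv : MemH10 v) (hw : MemH10 w) :
    MemH10 (v - w) := by
  have := hv.add hΩ (hw.smul hΩ (-1))
  rwa [neg_one_smul, ← sub_eq_add_neg] at this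

/-- Integration by parts of one derivative. -/
theorem IsWeakDeriv.inner_eq_neg (hΩ : IsOpen Ω) {i : Fin d} {q g v : L2 Ω}
    (hq : IsWeakDeriv ![i] q g) (hv : MemH10 v) : inner ℝ q (pd i v) = - inner ℝ g v := by
  obtain ⟨φ, h0, h1⟩ := hv.exists_seq hΩ
  have e : ∀ n, inner ℝ q (derivLp ![i] (φ n)) = - inner ℝ g (testLp Ω (φ n)) := fun n => by
    simpa using isWeakDeriv_iff.1 hq (φ n)
  refine tendsto_nhds_unique (tendsto_const_nhds.inner (h1 i)) ?_
  simp only [e]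
  exact (tendsto_const_nhds.inner h0).neg

theorem MemH.isWeakDeriv_pd {w : L2 Ω} (hw : MemH 2 w) (i j : Fin d) :
    IsWeakDeriv ![j] (pd i w) (weakDeriv ![i, j] w) := by
  rw [isWeakDeriv_iff]
  intro φ
  let ψ : TestSpace Ω := ⟨testDeriv ![j] (φ : Pt d → ℝ), IsTest.testDeriv_one φ.2 j⟩
  have h1 := isWeakDeriv_iff.1 (hw.isWeakDeriv (by norm_num : 1 ≤ 2) ![i]) ψ
  have h2 := isWeakDeriv_iff.1 (hw.isWeakDeriv le_rfl ![i, j]) φ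
  have e1 : derivLp ![i] ψ = derivLp ![i, j] φ := by
    refine Lp.ext ((derivLp_coe _ _).trans (EventuallyEq.trans ?_ (derivLp_coe _ _).symm))
    refine Eventually.of_forall fun x => ?_
    have hφ : ContDiff ℝ ∞ (φ : Pt d → ℝ) := φ.2.1
    rw [DLN.testDeriv_one]
    change fderiv ℝ (testDeriv ![j] (φ : Pt d → ℝ)) x _ = _
    rw [show testDeriv ![j] (φ : Pt d → ℝ) = _ from funext (DLN.testDeriv_one j _), testDeriv,
      iteratedFDeriv_two_apply, fderiv_clm_apply]
    · simp
    · exact ((hφ.fderiv_right (m := ∞) (by exact_mod_cast le_top)).differentiable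
        (by simp)).differentiableAt
    · exact differentiableAt_const _
  have e2 : testLp Ω ψ = derivLp ![j] φ :=
    Lp.ext ((testLp_coe ψ).trans (derivLp_coe _ _).symm)
  rw [e1, h2, e2] at h1
  rw [pow_one] at *
  have h3 : (pd i w : L2 Ω) = weakDeriv ![i] w := rfl
  rw [h3]
  linarith

theorem MemH.pd {w : L2 Ω} (hw : MemH 2 w) (i : Fin d) : MemH 1 (pd i w) :=
  memH_one_of_forall fun j => ⟨_, hw.isWeakDeriv_pd i j⟩

theorem pd_pd (hΩ : IsOpen Ω) {w : L2 Ω} (hw : MemH 2 w) (i j : Fin d) :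
    pd j (pd i w) = weakDeriv ![i, j] w :=
  weakDeriv_eq hΩ (hw.isWeakDeriv_pd i j)

/-! ### Lebesgue norms of products -/

/-- The `L^p(Ω)` norm of a square integrable function, meaningful if it is finite. -/
noncomputable def lpn (p : ENNReal) (v : L2 Ω) : ℝ := (eLpNorm v p (volume.restrict Ω)).toReal

theorem lpn_nonneg (p : ENNReal) (v : L2 Ω) : 0 ≤ lpn p v := ENNReal.toReal_nonneg

theorem lpn_two (v : L2 Ω) : lpn 2 v = ‖v‖ := rfl

/-- The integral of a product of three functions. -/
noncomputable def tri (a b c : L2 Ω) : ℝ := ∫ x in Ω, a x * (b x * c x)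

theorem memLp_mul_of_holder {p q : ENNReal} [hpq : p.HolderTriple q 2] {b c : L2 Ω}
    (hb : MemLp b p (volume.restrict Ω)) (hc : MemLp c q (volume.restrict Ω)) :
    MemLp (fun x => b x * c x) 2 (volume.restrict Ω) := by
  exact MemLp.mul (p := p) (q := q) hc hb

theorem tri_integrable {p q : ENNReal} [hpq : p.HolderTriple q 2] (a : L2 Ω) {b c : L2 Ω}
    (hb : MemLp b p (volume.restrict Ω)) (hc : MemLp c q (volume.restrict Ω)) :
    Integrable (fun x => a x * (b x * c x)) (volume.restrict Ω) :=
  MemLp.integrable_mul (p := 2) (q := 2) (Lp.memLp a) (memLp_mul_of_holder hb hc)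

/-- Hölder's inequality for three functions. -/
theorem abs_tri_le {p q : ENNReal} [hpq : p.HolderTriple q 2] (a : L2 Ω) {b c : L2 Ω}
    (hb : MemLp b p (volume.restrict Ω)) (hc : MemLp c q (volume.restrict Ω)) :
    |tri a b c| ≤ ‖a‖ * (lpn p b * lpn q c) := by
  have hm := memLp_mul_of_holder hb hc
  have e : tri a b c = inner ℝ a (hm.toLp _) :=
    (inner_eq_integral_of_ae hm.coeFn_toLp).symm
  rw [e]
  refine (abs_real_inner_le_norm _ _).trans ?_
  gcongr
  rw [Lp.norm_toLp, lpn, lpn, ← ENNReal.toReal_mul]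
  refine ENNReal.toReal_mono (ENNReal.mul_ne_top hb.2.ne hc.2.ne) ?_
  have := eLpNorm_le_eLpNorm_mul_eLpNorm'_of_norm (p := p) (q := q) (r := 2)
    (Lp.aestronglyMeasurable b) (Lp.aestronglyMeasurable c) (fun x y => x * y) 1
    (Eventually.of_forall fun x => by simp)
  simpa using this

theorem tri_comm (a b c : L2 Ω) : tri a b c = tri a c b :=
  integral_congr_ae (Eventually.of_forall fun x => by simp only [mul_comm])

theorem tri_left_comm (a b c : L2 Ω) : tri a b c = tri b a c :=
  integral_congr_ae (Eventually.of_forall fun x => by simp only [mul_left_comm])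

instance holderTriple_six_three_two : ENNReal.HolderTriple 6 3 2 where
  inv_add_inv_eq_inv := by
    rw [← ENNReal.toReal_eq_toReal_iff' (by simp) (by simp), ENNReal.toReal_add (by simp) (by simp)]
    norm_num

instance holderTriple_four_four_two : ENNReal.HolderTriple 4 4 2 where
  inv_add_inv_eq_inv := by
    rw [← ENNReal.toReal_eq_toReal_iff' (by simp) (by simp), ENNReal.toReal_add (by simp) (by simp)]
    norm_num

instance holderTriple_four_twelve_three : ENNReal.HolderTriple 4 12 3 where
  inv_add_inv_eq_inv := by
    rw [← ENNReal.toReal_eq_toReal_iff' (by simp) (by simp), ENNReal.toReal_add (by simp) (by simp)]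
    norm_num

/-- Interpolation of `L³` between `L²` and `L⁶`. -/
theorem lpn_three_sq_le {c : L2 Ω} (hc : MemLp c 6 (volume.restrict Ω)) :
    MemLp c 3 (volume.restrict Ω) ∧ lpn 3 c ^ 2 ≤ ‖c‖ * lpn 6 c := by
  set μ := volume.restrict Ω
  have h2 : MemLp c 2 μ := Lp.memLp c
  have hle : eLpNorm c 3 μ ≤ eLpNorm c 2 μ ^ (1 / 2 : ℝ) * eLpNorm c 6 μ ^ (1 / 2 : ℝ) := by
    have hs : AEStronglyMeasurable (fun x => ‖c x‖ ^ (1 / 2 : ℝ)) μ :=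
      (h2.1.norm.aemeasurable.pow_const _).aestronglyMeasurable
    have := eLpNorm_le_eLpNorm_mul_eLpNorm'_of_norm (p := 4) (q := 12) (r := 3)
      hs hs (fun x y => x * y) 1 (Eventually.of_forall fun x => by simp)
    rw [eLpNorm_norm_rpow _ (by norm_num), eLpNorm_norm_rpow _ (by norm_num)] at this
    have e4 : (4 : ENNReal) * ENNReal.ofReal (1 / 2) = 2 := by
      rw [← ENNReal.toReal_eq_toReal_iff' (by finiteness) (by simp), ENNReal.toReal_mul,
        ENNReal.toReal_ofReal (by norm_num)]
      norm_num
    have e12 : (12 : ENNReal) * ENNReal.ofReal (1 / 2) = 6 := by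
      rw [← ENNReal.toReal_eq_toReal_iff' (by finiteness) (by simp), ENNReal.toReal_mul,
        ENNReal.toReal_ofReal (by norm_num)]
      norm_num
    rw [e4, e12, ENNReal.coe_one, one_mul] at this
    refine le_trans (le_of_eq ?_) this
    rw [← eLpNorm_norm]
    refine eLpNorm_congr_ae (Eventually.of_forall fun x => ?_)
    simp only
    rw [← Real.rpow_add_of_nonneg (norm_nonneg _) (by norm_num) (by norm_num)]
    norm_num
  have h3 : MemLp c 3 μ := ⟨h2.1, hle.trans_lt (ENNReal.mul_lt_top
    (ENNReal.rpow_lt_top_of_nonneg (by norm_num) h2.2.ne)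
    (ENNReal.rpow_lt_top_of_nonneg (by norm_num) hc.2.ne))⟩
  refine ⟨h3, ?_⟩
  have := ENNReal.toReal_mono (ENNReal.mul_ne_top
    (ENNReal.rpow_ne_top_of_nonneg (by norm_num) h2.2.ne)
    (ENNReal.rpow_ne_top_of_nonneg (by norm_num) hc.2.ne)) hle
  rw [ENNReal.toReal_mul, ← ENNReal.toReal_rpow, ← ENNReal.toReal_rpow] at this
  change lpn 3 c ≤ lpn 2 c ^ (1 / 2 : ℝ) * lpn 6 c ^ (1 / 2 : ℝ) at this
  rw [lpn_two, ← Real.sqrt_eq_rpow, ← Real.sqrt_eq_rpow] at this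
  calc lpn 3 c ^ 2 ≤ (√‖c‖ * √(lpn 6 c)) ^ 2 := by
        gcongr
        exact lpn_nonneg _ _
    _ = ‖c‖ * lpn 6 c := by
        rw [mul_pow, Real.sq_sqrt (norm_nonneg _), Real.sq_sqrt (lpn_nonneg _ _)]

end Boundary

/-! ### The Sobolev and Poincaré inequalities -/

section Sobolev

variable {d : ℕ} {Ω : Set (Pt d)}

open Filter Topology

theorem volume_ne_top_of_isBounded (hb : Bornology.IsBounded Ω) : volume Ω ≠ ⊤ :=
  hb.measure_lt_top.ne

theorem norm_le_sum_single (L : Pt d →L[ℝ] ℝ) :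
    ‖L‖ ≤ ∑ i, ‖L (EuclideanSpace.single i 1)‖ := by
  refine L.opNorm_le_bound (Finset.sum_nonneg fun _ _ => norm_nonneg _) fun x => ?_
  have hx : x = ∑ i, x i • EuclideanSpace.single i (1 : ℝ) := by
    have := (EuclideanSpace.basisFun (Fin d) ℝ).sum_repr x
    simpa using this.symm
  conv_lhs => rw [hx]
  rw [map_sum, Finset.sum_mul]
  refine (norm_sum_le _ _).trans (Finset.sum_le_sum fun i _ => ?_)
  rw [map_smul, norm_smul, mul_comm]
  gcongr
  exact PiLp.norm_apply_le x i

theorem eLpNorm_fderiv_restrict (φ : TestSpace Ω) (p : ENNReal) :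
    eLpNorm (fderiv ℝ (φ : Pt d → ℝ)) p (volume.restrict Ω) =
      eLpNorm (fderiv ℝ (φ : Pt d → ℝ)) p volume := by
  rw [← eLpNorm_norm, ← eLpNorm_norm (μ := volume)]
  refine eLpNorm_restrict_eq_of_support_subset (f := fun x => ‖fderiv ℝ (φ : Pt d → ℝ) x‖)
    fun x hx => φ.2.2.2 (support_fderiv_subset ℝ ?_)
  intro h
  simp [h] at hx

/-- The Gagliardo–Nirenberg–Sobolev inequality for test functions on a bounded set. -/
theorem exists_eLpNorm_six_le (hd : d = 2 ∨ d = 3) (hb : Bornology.IsBounded Ω) :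
    ∃ C : NNReal, ∀ φ : TestSpace Ω, eLpNorm (φ : Pt d → ℝ) 6 volume ≤
      C * eLpNorm (fderiv ℝ (φ : Pt d → ℝ)) 2 volume := by
  have hsup : ∀ φ : TestSpace Ω, Function.support (φ : Pt d → ℝ) ⊆ Ω := fun φ =>
    (subset_tsupport _).trans φ.2.2.2
  have hC1 : ∀ φ : TestSpace Ω, ContDiff ℝ 1 (φ : Pt d → ℝ) := fun φ =>
    φ.2.1.of_le (by exact_mod_cast le_top)
  have hfin : Module.finrank ℝ (Pt d) = d := by simp
  rcases hd with rfl | rfl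
  · -- in two dimensions the exponent `3/2 < 2` on the right-hand side gives the exponent `6`
    set K : NNReal := eLpNormLESNormFDerivOfLeConst ℝ volume Ω (3 / 2) 6
    have hvol := volume_ne_top_of_isBounded hb
    refine ⟨K * ((volume Ω) ^ (1 / 6 : ℝ)).toNNReal, fun φ => ?_⟩
    have h1 := eLpNorm_le_eLpNorm_fderiv_of_le volume (hC1 φ) (hsup φ) (p := 3 / 2) (q := 6)
      (by rw [← NNReal.coe_le_coe]; norm_num)
      (by rw [hfin, ← NNReal.coe_lt_coe]; norm_num) (by rw [hfin]; norm_num) hb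
    have h2 : eLpNorm (fderiv ℝ (φ : Pt 2 → ℝ)) ((3 / 2 : NNReal) : ENNReal) volume ≤
        eLpNorm (fderiv ℝ (φ : Pt 2 → ℝ)) 2 volume * volume Ω ^ (1 / 6 : ℝ) := by
      rw [← eLpNorm_fderiv_restrict]
      refine (eLpNorm_le_eLpNorm_mul_rpow_measure_univ (q := 2) ?_ ?_).trans ?_
      · rw [show (2 : ENNReal) = ((2 : NNReal) : ENNReal) by norm_num, ENNReal.coe_le_coe,
          ← NNReal.coe_le_coe]
        norm_num
      · exact ((hC1 φ).continuous_fderiv one_ne_zero).aestronglyMeasurable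
      · rw [Measure.restrict_apply_univ]
        have e : (1 / ((3 / 2 : NNReal) : ENNReal).toReal - 1 / (2 : ENNReal).toReal) =
            (1 / 6 : ℝ) := by
          rw [ENNReal.coe_toReal]
          norm_num
        rw [e, eLpNorm_fderiv_restrict]
    calc eLpNorm (φ : Pt 2 → ℝ) 6 volume ≤ K * eLpNorm (fderiv ℝ (φ : Pt 2 → ℝ))
          ((3 / 2 : NNReal) : ENNReal) volume := by simpa using h1
      _ ≤ K * (eLpNorm (fderiv ℝ (φ : Pt 2 → ℝ)) 2 volume * volume Ω ^ (1 / 6 : ℝ)) := by gcongr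
      _ = _ := by
        rw [ENNReal.coe_mul, ENNReal.coe_toNNReal
          (ENNReal.rpow_ne_top_of_nonneg (by norm_num) hvol)]
        ring
  · refine ⟨eLpNormLESNormFDerivOfLeConst ℝ volume Ω 2 6, fun φ => ?_⟩
    have h1 := eLpNorm_le_eLpNorm_fderiv_of_le volume (hC1 φ) (hsup φ) (p := 2) (q := 6)
      (by norm_num) (by rw [hfin, ← NNReal.coe_lt_coe]; norm_num) (by rw [hfin]; norm_num) hb
    simpa using h1

theorem eLpNorm_fderiv_le (φ : TestSpace Ω) :
    eLpNorm (fderiv ℝ (φ : Pt d → ℝ)) 2 volume ≤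
      ENNReal.ofReal (∑ i, ‖derivLp (Ω := Ω) ![i] φ‖) := by
  rw [← eLpNorm_fderiv_restrict]
  calc eLpNorm (fderiv ℝ (φ : Pt d → ℝ)) 2 (volume.restrict Ω)
      ≤ eLpNorm (∑ i, fun x => ‖testDeriv ![i] (φ : Pt d → ℝ) x‖) 2 (volume.restrict Ω) := by
        refine eLpNorm_mono_real fun x => ?_
        rw [Finset.sum_apply]
        simpa only [testDeriv_one] using norm_le_sum_single (fderiv ℝ (φ : Pt d → ℝ) x)
    _ ≤ ∑ i, eLpNorm (fun x => ‖testDeriv ![i] (φ : Pt d → ℝ) x‖) 2 (volume.restrict Ω) :=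
        eLpNorm_sum_le (fun i _ => (IsTest.memLp_testDeriv φ.2 ![i] 2).1.norm) one_le_two
    _ = ∑ i, ENNReal.ofReal ‖derivLp (Ω := Ω) ![i] φ‖ := by
        refine Finset.sum_congr rfl fun i _ => ?_
        rw [eLpNorm_norm, Lp.norm_def, ENNReal.ofReal_toReal (Lp.eLpNorm_ne_top _)]
        exact eLpNorm_congr_ae (derivLp_coe _ _).symm
    _ = _ := (ENNReal.ofReal_sum_of_nonneg fun _ _ => norm_nonneg _).symm

/-- The Sobolev inequality `‖v‖_{L⁶} ≤ C ‖∇v‖` on `H^1_0(Ω)`. -/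
theorem exists_lpn_six_le (hd : d = 2 ∨ d = 3) (hΩ : IsOpen Ω) (hb : Bornology.IsBounded Ω) :
    ∃ C : ℝ, 0 ≤ C ∧ ∀ v : L2 Ω, MemH10 v →
      MemLp v 6 (volume.restrict Ω) ∧ lpn 6 v ≤ C * gradSum v := by
  obtain ⟨C, hC⟩ := exists_eLpNorm_six_le hd hb
  refine ⟨C, C.2, fun v hv => ?_⟩
  obtain ⟨φ, h0, h1⟩ := hv.exists_seq hΩ
  obtain ⟨ns, hns, hae⟩ := (tendstoInMeasure_of_tendsto_Lp h0).exists_seq_tendsto_ae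
  have hsum : Tendsto (fun n => ∑ i, ‖derivLp (Ω := Ω) ![i] (φ (ns n))‖) atTop (𝓝 (gradSum v)) :=
    tendsto_finsetSum _ fun i _ => ((h1 i).comp hns.tendsto_atTop).norm
  have hle : eLpNorm v 6 (volume.restrict Ω) ≤ C * ENNReal.ofReal (gradSum v) := by
    refine (Lp.eLpNorm_lim_le_liminf_eLpNorm (fun n => Lp.aestronglyMeasurable _) v hae).trans ?_
    have hlim : Tendsto (fun n => (C : ENNReal) *
        ENNReal.ofReal (∑ i, ‖derivLp (Ω := Ω) ![i] (φ (ns n))‖)) atTop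
        (𝓝 (C * ENNReal.ofReal (gradSum v))) :=
      ENNReal.Tendsto.const_mul ((ENNReal.continuous_ofReal.tendsto _).comp hsum)
        (Or.inr ENNReal.coe_ne_top)
    refine le_trans (liminf_le_liminf (Eventually.of_forall fun n => ?_)) hlim.liminf_eq.le
    refine le_trans ?_ (mul_le_mul_right (eLpNorm_fderiv_le (φ (ns n))) _)
    rw [eLpNorm_congr_ae (testLp_coe _)]
    exact (eLpNorm_restrict_le _ _ _ _).trans (hC _)
  refine ⟨⟨Lp.aestronglyMeasurable v, hle.trans_lt (by finiteness)⟩, ?_⟩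
  refine (ENNReal.toReal_mono (by finiteness) hle).trans_eq ?_
  rw [ENNReal.toReal_mul, ENNReal.toReal_ofReal (gradSum_nonneg v), ENNReal.coe_toReal]

/-- The Poincaré inequality. -/
theorem exists_poincare (hd : d = 2 ∨ d = 3) (hΩ : IsOpen Ω) (hb : Bornology.IsBounded Ω) :
    ∃ C : ℝ, 0 ≤ C ∧ ∀ v : L2 Ω, MemH10 v → ‖v‖ ≤ C * gradSum v := by
  obtain ⟨C, hC0, hC⟩ := exists_lpn_six_le hd hΩ hb
  have hvol := volume_ne_top_of_isBounded hb
  set V : ℝ := ((volume Ω) ^ (1 / 2 - 1 / 6 : ℝ)).toReal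
  refine ⟨V * C, by positivity, fun v hv => ?_⟩
  obtain ⟨h6, hle⟩ := hC v hv
  have h := eLpNorm_le_eLpNorm_mul_rpow_measure_univ (μ := volume.restrict Ω) (p := 2) (q := 6)
    (by norm_num) (Lp.aestronglyMeasurable v)
  rw [Measure.restrict_apply_univ] at h
  have hne : volume Ω ^ (1 / 2 - 1 / 6 : ℝ) ≠ ⊤ := ENNReal.rpow_ne_top_of_nonneg (by norm_num) hvol
  have h' := ENNReal.toReal_mono (ENNReal.mul_ne_top h6.2.ne (by simpa using hne)) h
  rw [ENNReal.toReal_mul] at h'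
  have h'' : ‖v‖ ≤ lpn 6 v * V := by simpa [V, lpn, Lp.norm_def] using h'
  calc ‖v‖ ≤ lpn 6 v * V := h''
    _ ≤ C * gradSum v * V := by gcongr
    _ = _ := by ring

theorem tri_add_left {p q : ENNReal} [p.HolderTriple q 2] (a a' : L2 Ω) {b c : L2 Ω}
    (hb : MemLp b p (volume.restrict Ω)) (hc : MemLp c q (volume.restrict Ω)) :
    tri (a + a') b c = tri a b c + tri a' b c := by
  rw [tri, tri, tri, ← integral_add (tri_integrable a hb hc) (tri_integrable a' hb hc)]
  refine integral_congr_ae ((Lp.coeFn_add a a').mono fun x hx => ?_)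
  simp only [hx, Pi.add_apply, add_mul]

theorem tri_add_right {p q : ENNReal} [p.HolderTriple q 2] (a : L2 Ω) {b c c' : L2 Ω}
    (hb : MemLp b p (volume.restrict Ω)) (hc : MemLp c q (volume.restrict Ω))
    (hc' : MemLp c' q (volume.restrict Ω)) :
    tri a b (c + c') = tri a b c + tri a b c' := by
  rw [tri, tri, tri, ← integral_add (tri_integrable a hb hc) (tri_integrable a hb hc')]
  refine integral_congr_ae ((Lp.coeFn_add c c').mono fun x hx => ?_)
  simp only [hx, Pi.add_apply, mul_add]

theorem tri_add_middle {p q : ENNReal} [p.HolderTriple q 2] (a : L2 Ω) {b b' c : L2 Ω}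
    (hb : MemLp b p (volume.restrict Ω)) (hb' : MemLp b' p (volume.restrict Ω))
    (hc : MemLp c q (volume.restrict Ω)) :
    tri a (b + b') c = tri a b c + tri a b' c := by
  rw [tri, tri, tri, ← integral_add (tri_integrable a hb hc) (tri_integrable a hb' hc)]
  refine integral_congr_ae ((Lp.coeFn_add b b').mono fun x hx => ?_)
  simp only [hx, Pi.add_apply, mul_add, add_mul]

theorem tri_smul_left (r : ℝ) (a b c : L2 Ω) : tri (r • a) b c = r * tri a b c := by
  rw [tri, tri, ← integral_const_mul]
  refine integral_congr_ae ((Lp.coeFn_smul r a).mono fun x hx => ?_)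
  simp only [hx, Pi.smul_apply, smul_eq_mul, mul_assoc]

theorem tri_smul_middle (r : ℝ) (a b c : L2 Ω) : tri a (r • b) c = r * tri a b c := by
  rw [tri_left_comm, tri_smul_left, tri_left_comm]

theorem tri_smul_right (r : ℝ) (a b c : L2 Ω) : tri a b (r • c) = r * tri a b c := by
  rw [tri_comm, tri_smul_middle, tri_comm]

/-- The integral of a product of three functions is continuous in its factors. -/
theorem tendsto_tri {p q : ENNReal} [p.HolderTriple q 2] {a b c : ℕ → L2 Ω} {a' b' c' : L2 Ω}
    (hb : ∀ n, MemLp (b n) p (volume.restrict Ω)) (hc : ∀ n, MemLp (c n) q (volume.restrict Ω))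
    (hb' : MemLp b' p (volume.restrict Ω)) (hc' : MemLp c' q (volume.restrict Ω))
    (ha : Tendsto a atTop (𝓝 a')) (hbt : Tendsto (fun n => lpn p (b n - b')) atTop (𝓝 0))
    (hct : Tendsto (fun n => lpn q (c n - c')) atTop (𝓝 0)) :
    Tendsto (fun n => tri (a n) (b n) (c n)) atTop (𝓝 (tri a' b' c')) := by
  have mb : ∀ n, MemLp (b n - b' : L2 Ω) p (volume.restrict Ω) := fun n =>
    ((hb n).sub hb').ae_eq (Lp.coeFn_sub _ _).symm
  have mc : ∀ n, MemLp (c n - c' : L2 Ω) q (volume.restrict Ω) := fun n =>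
    ((hc n).sub hc').ae_eq (Lp.coeFn_sub _ _).symm
  have z : ∀ {f : ℕ → ℝ} {g : ℕ → ℝ}, (∀ n, |f n| ≤ g n) → Tendsto g atTop (𝓝 0) →
      Tendsto f atTop (𝓝 0) := fun h hg => squeeze_zero_norm h hg
  have hal : Tendsto (fun n => ‖a n - a'‖) atTop (𝓝 0) := by
    simpa using (ha.sub (tendsto_const_nhds (x := a'))).norm
  have t1 : Tendsto (fun n => tri (a n - a') b' c') atTop (𝓝 0) :=
    z (fun n => abs_tri_le _ hb' hc') (by simpa using hal.mul_const (lpn p b' * lpn q c'))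
  have t2 : Tendsto (fun n => tri (a n) (b n - b') c') atTop (𝓝 0) :=
    z (fun n => abs_tri_le _ (mb n) hc')
      (by simpa using ha.norm.mul (hbt.mul_const (lpn q c')))
  have t3 : Tendsto (fun n => tri (a n) b' (c n - c')) atTop (𝓝 0) :=
    z (fun n => abs_tri_le _ hb' (mc n))
      (by simpa using ha.norm.mul (hct.const_mul (lpn p b')))
  have t4 : Tendsto (fun n => tri (a n) (b n - b') (c n - c')) atTop (𝓝 0) :=
    z (fun n => abs_tri_le _ (mb n) (mc n)) (by simpa using ha.norm.mul (hbt.mul hct))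
  have key : ∀ n, tri (a n) (b n) (c n) = tri a' b' c' + (tri (a n - a') b' c'
      + tri (a n) (b n - b') c' + tri (a n) b' (c n - c')
      + tri (a n) (b n - b') (c n - c')) := by
    intro n
    have e1 := tri_add_left (a n - a') a' hb' hc'
    have e2 := tri_add_middle (a n) (mb n) hb' (hc n)
    have e3 := tri_add_right (a n) hb' (mc n) hc'
    have e4 := tri_add_right (a n) (mb n) (mc n) hc'
    rw [sub_add_cancel] at e1 e2 e3 e4
    rw [e2, e3, e4, e1]
    ring
  simp only [key]
  simpa using tendsto_const_nhds.add (((t1.add t2).add t3).add t4)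

theorem testLp_mul_coe (φ ψ : TestSpace Ω) :
    ∀ᵐ x ∂(volume.restrict Ω), testLp Ω ⟨_, IsTest.mul φ.2 ψ.2⟩ x = testLp Ω φ x * testLp Ω ψ x := by
  filter_upwards [testLp_coe (Ω := Ω) ⟨_, IsTest.mul φ.2 ψ.2⟩, testLp_coe φ, testLp_coe ψ]
    with x h1 h2 h3
  rw [h1, h2, h3]
  rfl

/-- The integral of a derivative of a product of three functions of `H^1_0(Ω)` vanishes. -/
theorem tri_pd_add (hd : d = 2 ∨ d = 3) (hΩ : IsOpen Ω) (hb : Bornology.IsBounded Ω) (i : Fin d)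
    {u v w : L2 Ω} (hu : MemH10 u) (hv : MemH10 v) (hw : MemH10 w) :
    tri (pd i u) v w + tri (pd i v) u w + tri (pd i w) u v = 0 := by
  obtain ⟨C, hC0, hC⟩ := exists_lpn_six_le hd hΩ hb
  have three : ∀ z : L2 Ω, MemH10 z → MemLp z 3 (volume.restrict Ω) := fun z hz =>
    (lpn_three_sq_le (hC z hz).1).1
  obtain ⟨P, hP0, hP⟩ := exists_poincare hd hΩ hb
  -- products of test functions
  have base : ∀ φ ψ : TestSpace Ω, tri (pd i u) (testLp Ω φ) (testLp Ω ψ)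
      + tri (derivLp ![i] φ) u (testLp Ω ψ) + tri (derivLp ![i] ψ) u (testLp Ω φ) = 0 := by
    intro φ ψ
    set χ : TestSpace Ω := ⟨_, IsTest.mul φ.2 ψ.2⟩
    have h := isWeakDeriv_iff.1 (hu.1.isWeakDeriv le_rfl ![i]) χ
    have eχ := testLp_mul_coe φ ψ
    have e1 : inner ℝ (weakDeriv ![i] u) (testLp Ω χ) =
        tri (pd i u) (testLp Ω φ) (testLp Ω ψ) := by
      rw [inner_eq_integral]
      exact integral_congr_ae (eχ.mono fun x hx => by simp only [χ, hx, pd])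
    have m6 : ∀ φ : TestSpace Ω, MemLp (derivLp (Ω := Ω) ![i] φ) 6 (volume.restrict Ω) := fun φ =>
      (IsTest.memLp_testDeriv φ.2 ![i] 6).ae_eq (derivLp_coe _ _).symm
    have m3 : ∀ φ : TestSpace Ω, MemLp (testLp Ω φ) 3 (volume.restrict Ω) := fun φ =>
      (IsTest.memLp φ.2 3).ae_eq (testLp_coe _).symm
    have e2 : inner ℝ u (derivLp ![i] χ) =
        tri (derivLp ![i] φ) u (testLp Ω ψ) + tri (derivLp ![i] ψ) u (testLp Ω φ) := by
      rw [tri_left_comm, tri_left_comm (derivLp ![i] ψ), tri, tri,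
        ← integral_add (tri_integrable u (m6 φ) (m3 ψ)) (tri_integrable u (m6 ψ) (m3 φ)),
        inner_eq_integral]
      refine integral_congr_ae ?_
      filter_upwards [derivLp_coe ![i] χ, derivLp_coe ![i] φ, derivLp_coe ![i] ψ, testLp_coe φ,
        testLp_coe ψ] with x h1 h2 h3 h4 h5
      rw [h1, h2, h3, h4, h5, testDeriv_one, testDeriv_one, testDeriv_one]
      change u x * fderiv ℝ ((φ : Pt d → ℝ) * (ψ : Pt d → ℝ)) x _ = _
      rw [fderiv_mul (φ.2.1.differentiable (by simp)).differentiableAt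
        (ψ.2.1.differentiable (by simp)).differentiableAt]
      simp only [_root_.add_apply, _root_.smul_apply, smul_eq_mul]
      ring
    rw [e1, e2] at h
    rw [add_assoc, h]
    ring
  obtain ⟨φ, f0, f1⟩ := hv.exists_seq hΩ
  obtain ⟨ψ, g0, g1⟩ := hw.exists_seq hΩ
  -- `H^1` convergence implies convergence in `L⁶` and in `L³`
  have conv : ∀ {z : L2 Ω} {χ : ℕ → TestSpace Ω}, MemH10 z →
      (∀ i, Tendsto (fun n => derivLp ![i] (χ n)) atTop (𝓝 (pd i z))) →
      Tendsto (fun n => lpn 6 (testLp Ω (χ n) - z)) atTop (𝓝 0) ∧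
      Tendsto (fun n => lpn 3 (testLp Ω (χ n) - z)) atTop (𝓝 0) := by
    intro z χ hz ht
    have hm : ∀ n, MemH10 (testLp Ω (χ n) - z) := fun n => (memH10_testLp _ hΩ).sub hΩ hz
    have hg : Tendsto (fun n => gradSum (testLp Ω (χ n) - z)) atTop (𝓝 0) := by
      simp only [gradSum, pd_sub hΩ _ (memH_testLp _) hz.1, pd_testLp hΩ]
      have : ∀ j ∈ (Finset.univ : Finset (Fin d)),
          Tendsto (fun n => ‖derivLp ![j] (χ n) - pd j z‖) atTop (𝓝 0) := fun j _ => by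
        simpa using ((ht j).sub (tendsto_const_nhds (x := pd j z))).norm
      simpa using tendsto_finsetSum _ this
    constructor
    · exact squeeze_zero (fun _ => lpn_nonneg _ _) (fun n => (hC _ (hm n)).2)
        (by simpa using hg.const_mul C)
    · have hsq : Tendsto (fun n => lpn 3 (testLp Ω (χ n) - z) ^ 2) atTop (𝓝 0) := by
        refine squeeze_zero (fun _ => by positivity) (fun n =>
          ((lpn_three_sq_le (hC _ (hm n)).1).2).trans (mul_le_mul (hP _ (hm n)) (hC _ (hm n)).2
            (lpn_nonneg _ _) (mul_nonneg hP0 (gradSum_nonneg _)))) ?_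
        simpa using (hg.const_mul P).mul (hg.const_mul C)
      have := hsq.sqrt
      simpa [Real.sqrt_sq (lpn_nonneg _ _)] using this
  obtain ⟨cv6, cv3⟩ := conv hv f1
  obtain ⟨cw6, cw3⟩ := conv hw g1
  have z3 : Tendsto (fun _ : ℕ => lpn 6 (u - u)) atTop (𝓝 0) := by
    have : lpn 6 (u - u : L2 Ω) = 0 := by
      rw [sub_self, lpn, eLpNorm_congr_ae (Lp.coeFn_zero _ _ _)]
      simp
    rw [this]
    exact tendsto_const_nhds
  have t1 := tendsto_tri (p := 6) (q := 3) (fun n => (hC _ (memH10_testLp (φ n) hΩ)).1)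
    (fun n => three _ (memH10_testLp (ψ n) hΩ)) (hC v hv).1 (three w hw)
    (tendsto_const_nhds (x := pd i u)) cv6 cw3
  have t2 := tendsto_tri (p := 6) (q := 3) (fun n => (hC u hu).1)
    (fun n => three _ (memH10_testLp (ψ n) hΩ)) (hC u hu).1 (three w hw) (f1 i) z3 cw3
  have t3 := tendsto_tri (p := 6) (q := 3) (fun n => (hC u hu).1)
    (fun n => three _ (memH10_testLp (φ n) hΩ)) (hC u hu).1 (three v hv) (g1 i) z3 cv3
  have := (t1.add t2).add t3
  simp only [base] at this
  exact tendsto_nhds_unique this tendsto_const_nhds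

end Sobolev

/-! ### Embeddings on convex sets -/

section Convex

open Filter Topology

/-- Jensen's inequality for powers. -/
theorem lintegral_pow_le {α : Type*} [MeasurableSpace α] (μ : Measure α) {g : α → ENNReal}
    (hg : AEMeasurable g μ) {n : ℕ} (hn : n ≠ 0) :
    (∫⁻ x, g x ∂μ) ^ n ≤ μ univ ^ (n - 1) * ∫⁻ x, g x ^ n ∂μ := by
  have hn0 : (n : ℝ) ≠ 0 := by exact_mod_cast hn
  have hn1 : (1 : ℝ) ≤ n := by exact_mod_cast Nat.one_le_iff_ne_zero.2 hn
  have h := ENNReal.lintegral_mul_norm_pow_le (μ := μ) (f := fun x => g x ^ n) (g := fun _ => 1)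
    (hg.pow_const n) aemeasurable_const (p := 1 / n) (q := 1 - 1 / n) (by positivity)
    (sub_nonneg.2 ((div_le_one (by positivity)).2 hn1)) (by ring)
  have e : ∀ x, (g x ^ n) ^ (1 / (n : ℝ)) * 1 ^ (1 - 1 / (n : ℝ)) = g x := fun x => by
    rw [ENNReal.one_rpow, mul_one, ← ENNReal.rpow_natCast, ← ENNReal.rpow_mul,
      mul_one_div_cancel hn0, ENNReal.rpow_one]
  simp only [e, lintegral_one] at h
  calc (∫⁻ x, g x ∂μ) ^ n
      ≤ ((∫⁻ x, g x ^ n ∂μ) ^ (1 / (n : ℝ)) * μ univ ^ (1 - 1 / (n : ℝ))) ^ n := by gcongr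
    _ = (∫⁻ x, g x ^ n ∂μ) * μ univ ^ (n - 1) := by
        rw [mul_pow, ← ENNReal.rpow_natCast, ← ENNReal.rpow_mul, one_div_mul_cancel hn0,
          ENNReal.rpow_one, ← ENNReal.rpow_natCast, ← ENNReal.rpow_mul, ← ENNReal.rpow_natCast]
        congr 2
        rw [Nat.cast_sub (Nat.one_le_iff_ne_zero.2 hn)]
        field_simp
        simp
    _ = _ := mul_comm _ _

theorem add_pow_four_le (a b : ENNReal) : (a + b) ^ 4 ≤ 8 * (a ^ 4 + b ^ 4) := by
  have := ENNReal.rpow_add_le_mul_rpow_add_rpow a b (p := 4) (by norm_num)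
  norm_num at this
  exact_mod_cast this

variable {d : ℕ}

theorem lintegral_comp_add_smul (G : Pt d → ENNReal) (hG : Measurable G) (z : Pt d) {r : ℝ}
    (hr : 0 < r) : ∫⁻ y, G (z + r • y) = ENNReal.ofReal ((r ^ d)⁻¹) * ∫⁻ y, G y := by
  have h1 : ∫⁻ y, G (z + r • y) = ∫⁻ y, G (z + y) ∂(Measure.map (fun y => r • y) volume) := by
    rw [lintegral_map (by fun_prop) (by fun_prop)]
  rw [h1, Measure.map_addHaar_smul volume hr.ne', lintegral_smul_measure, smul_eq_mul,
    lintegral_add_left_eq_self G z, finrank_euclideanSpace, Fintype.card_fin,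
    abs_of_pos (by positivity)]

/-- The integral of `G` over the contraction of `B` towards `x` by the factor `t`, before
normalisation. -/
noncomputable def coneInt (B : Set (Pt d)) (G : Pt d → ENNReal) (x : Pt d) (t : ℝ) : ENNReal :=
  ∫⁻ y in B, G (x + t • (y - x))

theorem measurable_coneInt {B : Set (Pt d)} {G : Pt d → ENNReal} (hG : Measurable G) :
    Measurable (Function.uncurry (coneInt B G)) := by
  unfold coneInt
  refine Measurable.lintegral_prod_right' (f := fun p : (Pt d × ℝ) × Pt d =>
    G (p.1.1 + p.1.2 • (p.2 - p.1.1))) ?_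
  fun_prop

/-- The fundamental theorem of calculus along a segment of a convex set. -/
theorem enorm_le_add_segment {C : Set (Pt d)} (hC : Convex ℝ C) {R : ℝ}
    (hR : ∀ x ∈ C, ∀ y ∈ C, ‖y - x‖ ≤ R) {f : Pt d → ℝ} (hf : ContDiff ℝ 1 f) {G : Pt d → ENNReal}
    (hfG : ∀ x ∈ C, ‖fderiv ℝ f x‖ₑ ≤ G x) {x y : Pt d} (hx : x ∈ C) (hy : y ∈ C) :
    ‖f x‖ₑ ≤ ‖f y‖ₑ + ENNReal.ofReal R * ∫⁻ t in Ioc (0 : ℝ) 1, G (x + t • (y - x)) := by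
  have hcont : Continuous fun t : ℝ => fderiv ℝ f (x + t • (y - x)) (y - x) :=
    ((hf.continuous_fderiv one_ne_zero).comp (by fun_prop)).clm_apply continuous_const
  have hd : ∀ t ∈ uIcc (0 : ℝ) 1, HasDerivAt (fun t : ℝ => f (x + t • (y - x)))
      (fderiv ℝ f (x + t • (y - x)) (y - x)) t := by
    intro t _
    have h1 : HasFDerivAt f (fderiv ℝ f (x + t • (y - x))) (x + t • (y - x)) :=
      (hf.differentiable one_ne_zero).differentiableAt.hasFDerivAt
    have h2 : HasDerivAt (fun t : ℝ => x + t • (y - x)) (y - x) t := by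
      simpa using ((hasDerivAt_id t).smul_const (y - x)).const_add x
    exact h1.comp_hasDerivAt t h2
  have h := intervalIntegral.integral_eq_sub_of_hasDerivAt hd
    (hcont.intervalIntegrable 0 1)
  simp only [one_smul, zero_smul, add_zero, add_sub_cancel] at h
  have hfx : f x = f y - ∫ t in (0 : ℝ)..1, fderiv ℝ f (x + t • (y - x)) (y - x) := by
    rw [h]; ring
  rw [hfx, intervalIntegral.integral_of_le zero_le_one]
  refine enorm_sub_le.trans ?_
  gcongr
  refine (enorm_integral_le_lintegral_enorm _).trans ?_
  rw [← lintegral_const_mul' _ _ ENNReal.ofReal_ne_top]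
  refine setLIntegral_mono' measurableSet_Ioc fun t ht => ?_
  have hm : x + t • (y - x) ∈ C := hC.add_smul_sub_mem hx hy ⟨ht.1.le, ht.2⟩
  calc ‖fderiv ℝ f (x + t • (y - x)) (y - x)‖ₑ
      ≤ ‖fderiv ℝ f (x + t • (y - x))‖ₑ * ‖y - x‖ₑ := ContinuousLinearMap.le_opENorm _ _
    _ ≤ G (x + t • (y - x)) * ENNReal.ofReal R := by
        gcongr
        · exact hfG _ hm
        · rw [← ofReal_norm]
          exact ENNReal.ofReal_le_ofReal (hR x hx y hy)
    _ = _ := mul_comm _ _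

/-- The segment estimate averaged over the endpoint `y ∈ B`. -/
theorem volume_mul_enorm_le {C B : Set (Pt d)} (hC : Convex ℝ C) (hBC : B ⊆ C)
    (hB : MeasurableSet B) {R : ℝ}
    (hR : ∀ x ∈ C, ∀ y ∈ C, ‖y - x‖ ≤ R) {f : Pt d → ℝ} (hf : ContDiff ℝ 1 f) {G : Pt d → ENNReal}
    (hG : Measurable G) (hfG : ∀ x ∈ C, ‖fderiv ℝ f x‖ₑ ≤ G x) {x : Pt d} (hx : x ∈ C) :
    volume B * ‖f x‖ₑ ≤ (∫⁻ y in B, ‖f y‖ₑ) +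
      ENNReal.ofReal R * ∫⁻ t in Ioc (0 : ℝ) 1, coneInt B G x t := by
  have hmeas : Measurable fun p : Pt d × ℝ => G (x + p.2 • (p.1 - x)) := by fun_prop
  calc volume B * ‖f x‖ₑ = ∫⁻ _ in B, ‖f x‖ₑ := by
        rw [setLIntegral_const, mul_comm]
    _ ≤ ∫⁻ y in B, (‖f y‖ₑ + ENNReal.ofReal R * ∫⁻ t in Ioc (0 : ℝ) 1, G (x + t • (y - x))) :=
        setLIntegral_mono' hB fun y hy => enorm_le_add_segment hC hR hf hfG hx (hBC hy)
    _ = _ := by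
        rw [lintegral_add_left (hf.continuous.enorm.measurable),
          lintegral_const_mul' _ _ ENNReal.ofReal_ne_top]
        congr 2
        exact lintegral_lintegral_swap hmeas.aemeasurable

/-- The finite measure `t^{-3/4} dt` on `(0,1]`. -/
noncomputable def tMeas : Measure ℝ :=
  (volume.restrict (Ioc (0 : ℝ) 1)).withDensity fun t => ENNReal.ofReal (t ^ (-(3 / 4) : ℝ))

theorem tMeas_univ : tMeas univ = 4 := by
  rw [tMeas, withDensity_apply _ MeasurableSet.univ, Measure.restrict_univ,
    ← ofReal_integral_eq_lintegral_ofReal]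
  · rw [← intervalIntegral.integral_of_le zero_le_one, integral_rpow (Or.inl (by norm_num))]
    norm_num
  · have := intervalIntegral.intervalIntegrable_rpow' (a := 0) (b := 1) (r := -(3 / 4))
      (by norm_num)
    rwa [intervalIntegrable_iff_integrableOn_Ioc_of_le zero_le_one] at this
  · exact (ae_restrict_mem measurableSet_Ioc).mono fun t ht => Real.rpow_nonneg ht.1.le _

theorem lintegral_tMeas_pow_le {Φ : ℝ → ENNReal} (hΦ : Measurable Φ) :
    (∫⁻ t in Ioc (0 : ℝ) 1, Φ t) ^ 4 ≤
      64 * ∫⁻ t in Ioc (0 : ℝ) 1, ENNReal.ofReal (t ^ (-(3 / 4) : ℝ)) *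
        (ENNReal.ofReal (t ^ 3) * Φ t ^ 4) := by
  have hm : Measurable fun t : ℝ => ENNReal.ofReal (t ^ (-(3 / 4) : ℝ)) := by fun_prop
  have hm2 : Measurable fun t : ℝ => ENNReal.ofReal (t ^ (3 / 4 : ℝ)) * Φ t := by fun_prop
  have e1 : ∫⁻ t in Ioc (0 : ℝ) 1, Φ t =
      ∫⁻ t, ENNReal.ofReal (t ^ (3 / 4 : ℝ)) * Φ t ∂tMeas := by
    rw [tMeas, lintegral_withDensity_eq_lintegral_mul _ hm hm2]
    refine setLIntegral_congr_fun measurableSet_Ioc fun t ht => ?_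
    rw [Pi.mul_apply, ← mul_assoc, ← ENNReal.ofReal_mul (Real.rpow_nonneg ht.1.le _),
      ← Real.rpow_add ht.1]
    norm_num
  rw [e1]
  refine (lintegral_pow_le tMeas hm2.aemeasurable (by norm_num : 4 ≠ 0)).trans ?_
  rw [tMeas_univ, tMeas, lintegral_withDensity_eq_lintegral_mul _ hm (hm2.pow_const 4)]
  refine mul_le_mul' (by norm_num) (le_of_eq ?_)
  refine setLIntegral_congr_fun measurableSet_Ioc fun t ht => ?_
  rw [Pi.mul_apply, mul_pow, ← ENNReal.ofReal_pow (Real.rpow_nonneg ht.1.le _),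
    ← Real.rpow_natCast, ← Real.rpow_mul ht.1.le]
  norm_num

theorem lintegral_tMeas_const (K : ENNReal) :
    ∫⁻ t in Ioc (0 : ℝ) 1, ENNReal.ofReal (t ^ (-(3 / 4) : ℝ)) * K = 4 * K := by
  rw [lintegral_mul_const _ (by fun_prop)]
  congr 1
  rw [← tMeas_univ, tMeas, withDensity_apply _ MeasurableSet.univ, Measure.restrict_univ]

theorem ofReal_inv_pow_le (hd : d ≤ 3) {t : ℝ} (ht : 0 < t) (ht1 : t ≤ 1) :
    ENNReal.ofReal ((t ^ d)⁻¹) ≤ ENNReal.ofReal ((t ^ 3)⁻¹) := by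
  refine ENNReal.ofReal_le_ofReal ?_
  gcongr ?_⁻¹
  exact pow_le_pow_of_le_one ht.le ht1 hd

/-- The contraction by `t` has Jacobian `t ^ d`, and `d ≤ 3`. -/
theorem lintegral_cone_le (hd : d ≤ 3) (B : Set (Pt d)) {F : Pt d → ENNReal} (hF : Measurable F)
    (x : Pt d) {t : ℝ} (ht : 0 < t) (ht1 : t ≤ 1) :
    coneInt B F x t ≤ ENNReal.ofReal ((t ^ 3)⁻¹) * ∫⁻ y, F y := by
  calc coneInt B F x t ≤ ∫⁻ y, F (x + t • (y - x)) := setLIntegral_le_lintegral _ _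
    _ = ∫⁻ y, F ((1 - t) • x + t • y) := by
        refine lintegral_congr fun y => ?_
        congr 1
        module
    _ = ENNReal.ofReal ((t ^ d)⁻¹) * ∫⁻ y, F y := lintegral_comp_add_smul F hF _ ht
    _ ≤ _ := by
        gcongr ?_ * _
        exact ofReal_inv_pow_le hd ht ht1

/-- Jensen's inequality for `coneInt`. -/
theorem coneInt_pow_le (B : Set (Pt d)) {G : Pt d → ENNReal} (hG : Measurable G) (x : Pt d)
    (t : ℝ) {n : ℕ} (hn : n ≠ 0) :
    coneInt B G x t ^ n ≤ volume B ^ (n - 1) * coneInt B (fun z => G z ^ n) x t := by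
  have := lintegral_pow_le (volume.restrict B) (g := fun y => G (x + t • (y - x)))
    (by fun_prop) hn
  rwa [Measure.restrict_apply_univ] at this

/-- A convex set on which `C¹` functions satisfy `W^{1,4} ⊂ L^∞`. -/
theorem enorm_pow_le_of_convex (hd : d ≤ 3) {C B : Set (Pt d)} (hC : Convex ℝ C) (hBC : B ⊆ C)
    (hB : MeasurableSet B) {R : ℝ}
    (hR : ∀ x ∈ C, ∀ y ∈ C, ‖y - x‖ ≤ R) {f : Pt d → ℝ} (hf : ContDiff ℝ 1 f) {G : Pt d → ENNReal}
    (hG : Measurable G) (hfG : ∀ x ∈ C, ‖fderiv ℝ f x‖ₑ ≤ G x) {x : Pt d} (hx : x ∈ C) :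
    volume B ^ 4 * ‖f x‖ₑ ^ 4 ≤ 8 * (volume B ^ 3 * ∫⁻ y in B, ‖f y‖ₑ ^ 4) +
      8 * (ENNReal.ofReal R ^ 4 * (64 * (4 * (volume B ^ 3 * ∫⁻ y, G y ^ 4)))) := by
  have h1 := volume_mul_enorm_le hC hBC hB hR hf hG hfG hx
  have hmΦ : Measurable (coneInt B G x) :=
    (measurable_coneInt (B := B) hG).comp (measurable_prodMk_left (x := x))
  have h2 : (∫⁻ t in Ioc (0 : ℝ) 1, coneInt B G x t) ^ 4 ≤
      64 * (4 * (volume B ^ 3 * ∫⁻ y, G y ^ 4)) := by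
    refine (lintegral_tMeas_pow_le hmΦ).trans ?_
    rw [← lintegral_tMeas_const]
    gcongr 64 * ?_
    refine setLIntegral_mono' measurableSet_Ioc fun t ht => ?_
    refine mul_le_mul_right ?_ _
    calc ENNReal.ofReal (t ^ 3) * coneInt B G x t ^ 4
        ≤ ENNReal.ofReal (t ^ 3) * (volume B ^ 3 *
            (ENNReal.ofReal ((t ^ 3)⁻¹) * ∫⁻ y, G y ^ 4)) := by
          gcongr
          refine (coneInt_pow_le B hG x t (by norm_num : 4 ≠ 0)).trans ?_
          gcongr
          exact lintegral_cone_le hd B (hG.pow_const 4) x ht.1 ht.2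
      _ = (ENNReal.ofReal (t ^ 3) * ENNReal.ofReal ((t ^ 3)⁻¹)) *
            (volume B ^ 3 * ∫⁻ y, G y ^ 4) := by ring
      _ = _ := by
          have : (0 : ℝ) < t ^ 3 := pow_pos ht.1 3
          rw [← ENNReal.ofReal_mul this.le, mul_inv_cancel₀ this.ne', ENNReal.ofReal_one, one_mul]
  have h3 : (∫⁻ y in B, ‖f y‖ₑ) ^ 4 ≤ volume B ^ 3 * ∫⁻ y in B, ‖f y‖ₑ ^ 4 := by
    simpa using lintegral_pow_le (volume.restrict B) (hf.continuous.enorm.measurable.aemeasurable)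
      (by norm_num : 4 ≠ 0)
  rw [← mul_pow]
  calc (volume B * ‖f x‖ₑ) ^ 4 ≤ _ := pow_le_pow_left' h1 4
    _ ≤ 8 * ((∫⁻ y in B, ‖f y‖ₑ) ^ 4 +
        (ENNReal.ofReal R * ∫⁻ t in Ioc (0 : ℝ) 1, coneInt B G x t) ^ 4) := by
        exact add_pow_four_le _ _
    _ ≤ _ := by
        rw [mul_add, mul_pow]
        gcongr

/-- The integral of `coneInt` over `x` is bounded uniformly in `t`: for `t ≥ 1/2` the variable `y`
is substituted, for `t ≤ 1/2` the variable `x`. -/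
theorem lintegral_coneInt_le (hd : d ≤ 3) {C B : Set (Pt d)} (hBC : B ⊆ C)
    {F : Pt d → ENNReal} (hF : Measurable F) {t : ℝ} (ht : 0 < t) (ht1 : t ≤ 1) :
    ∫⁻ x in C, coneInt B F x t ≤ 8 * (volume C * ∫⁻ y, F y) := by
  have two : ∀ {r : ℝ}, 1 / 2 ≤ r → r ≤ 1 → ENNReal.ofReal ((r ^ d)⁻¹) ≤ 8 := by
    intro r hr hr1
    have h0 : (0 : ℝ) < r := by linarith
    refine (ofReal_inv_pow_le hd h0 hr1).trans ?_
    rw [show (8 : ENNReal) = ENNReal.ofReal 8 by norm_num]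
    refine ENNReal.ofReal_le_ofReal ?_
    rw [inv_le_comm₀ (by positivity) (by norm_num)]
    calc (8 : ℝ)⁻¹ = (1 / 2) ^ 3 := by norm_num
      _ ≤ r ^ 3 := by gcongr
  have e : ∀ x y : Pt d, x + t • (y - x) = t • y + (1 - t) • x := fun x y => by module
  rcases le_total (1 / 2) t with h | h
  · -- the contraction factor is bounded below: a pointwise bound suffices
    calc ∫⁻ x in C, coneInt B F x t ≤ ∫⁻ _ in C, 8 * ∫⁻ y, F y := by
          refine lintegral_mono fun x => ?_
          calc coneInt B F x t ≤ ∫⁻ y, F (x + t • (y - x)) := setLIntegral_le_lintegral _ _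
            _ = ∫⁻ y, F ((1 - t) • x + t • y) := by simp only [e, add_comm]
            _ = ENNReal.ofReal ((t ^ d)⁻¹) * ∫⁻ y, F y := lintegral_comp_add_smul F hF _ ht
            _ ≤ _ := by
                gcongr
                exact two h ht1
      _ = _ := by rw [setLIntegral_const]; ring
  · -- integrating in `x` first, the contraction factor is `1 - t`
    calc ∫⁻ x in C, coneInt B F x t
        = ∫⁻ y in B, ∫⁻ x in C, F (x + t • (y - x)) := by
          refine lintegral_lintegral_swap (Measurable.aemeasurable ?_)
          change Measurable fun p : Pt d × Pt d => F (p.1 + t • (p.2 - p.1))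
          fun_prop
      _ ≤ ∫⁻ _ in B, 8 * ∫⁻ y, F y := by
          refine lintegral_mono fun y => ?_
          calc ∫⁻ x in C, F (x + t • (y - x)) ≤ ∫⁻ x, F (x + t • (y - x)) :=
                setLIntegral_le_lintegral _ _
            _ = ∫⁻ x, F (t • y + (1 - t) • x) := by simp only [e]
            _ = ENNReal.ofReal (((1 - t) ^ d)⁻¹) * ∫⁻ y, F y :=
                lintegral_comp_add_smul F hF _ (by linarith)
            _ ≤ _ := by
                gcongr
                exact two (by linarith) (by linarith)
      _ = volume B * (8 * ∫⁻ y, F y) := by rw [setLIntegral_const]; ring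
      _ ≤ volume C * (8 * ∫⁻ y, F y) := by gcongr
      _ = _ := by ring

/-- On a convex set, `C¹` functions satisfy `H¹ ⊂ L⁴`. -/
theorem lintegral_pow_four_le_of_convex (hd : d ≤ 3) {C B : Set (Pt d)} (hC : Convex ℝ C)
    (hCm : MeasurableSet C) (hBC : B ⊆ C) (hB : MeasurableSet B) {R : ℝ}
    (hR : ∀ x ∈ C, ∀ y ∈ C, ‖y - x‖ ≤ R) {f : Pt d → ℝ} (hf : ContDiff ℝ 1 f) {G : Pt d → ENNReal}
    (hG : Measurable G) (hfG : ∀ x ∈ C, ‖fderiv ℝ f x‖ₑ ≤ G x) :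
    volume B ^ 4 * ∫⁻ x in C, ‖f x‖ₑ ^ 4 ≤
      volume C * (8 * (volume B ^ 2 * (∫⁻ y in B, ‖f y‖ₑ ^ 2) ^ 2)) +
      8 * (ENNReal.ofReal R ^ 4 *
        (64 * (4 * (volume B ^ 2 * (8 * (volume C * (∫⁻ y, G y ^ 2) ^ 2)))))) := by
  set I := ∫⁻ y, G y ^ 2
  have hmΦ := measurable_coneInt (B := B) hG
  have hmH := measurable_coneInt (B := B) (hG.pow_const 2)
  -- the estimate of the remainder for a fixed contraction factor
  have hfix : ∀ t ∈ Ioc (0 : ℝ) 1, ∫⁻ x in C, ENNReal.ofReal (t ^ 3) * coneInt B G x t ^ 4 ≤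
      volume B ^ 2 * (8 * (volume C * I ^ 2)) := by
    intro t ht
    have ht3 : (0 : ℝ) < t ^ 3 := pow_pos ht.1 3
    calc ∫⁻ x in C, ENNReal.ofReal (t ^ 3) * coneInt B G x t ^ 4
        ≤ ∫⁻ x in C, volume B ^ 2 * I * coneInt B (fun z => G z ^ 2) x t := by
          refine lintegral_mono fun x => ?_
          have h2 := coneInt_pow_le B hG x t (by norm_num : 2 ≠ 0)
          have h3 := lintegral_cone_le hd B (hG.pow_const 2) x ht.1 ht.2
          calc ENNReal.ofReal (t ^ 3) * coneInt B G x t ^ 4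
              = ENNReal.ofReal (t ^ 3) * (coneInt B G x t ^ 2 * coneInt B G x t ^ 2) := by ring
            _ ≤ ENNReal.ofReal (t ^ 3) * ((volume B * (ENNReal.ofReal ((t ^ 3)⁻¹) * I)) *
                (volume B * coneInt B (fun z => G z ^ 2) x t)) := by
                refine mul_le_mul_right (mul_le_mul' (h2.trans ?_) (h2.trans ?_)) _
                · simp only [Nat.add_one_sub_one, pow_one]
                  exact mul_le_mul_right h3 _
                · simp
            _ = (ENNReal.ofReal (t ^ 3) * ENNReal.ofReal ((t ^ 3)⁻¹)) *
                (volume B ^ 2 * I * coneInt B (fun z => G z ^ 2) x t) := by ring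
            _ = _ := by
                rw [← ENNReal.ofReal_mul ht3.le, mul_inv_cancel₀ ht3.ne', ENNReal.ofReal_one,
                  one_mul]
      _ = volume B ^ 2 * I * ∫⁻ x in C, coneInt B (fun z => G z ^ 2) x t :=
          lintegral_const_mul _ (hmH.comp measurable_prodMk_right)
      _ ≤ volume B ^ 2 * I * (8 * (volume C * I)) := by
          gcongr
          exact lintegral_coneInt_le hd hBC (hG.pow_const 2) ht.1 ht.2
      _ = _ := by ring
  have hS : ∫⁻ x in C, (∫⁻ t in Ioc (0 : ℝ) 1, coneInt B G x t) ^ 4 ≤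
      64 * (4 * (volume B ^ 2 * (8 * (volume C * I ^ 2)))) := by
    calc ∫⁻ x in C, (∫⁻ t in Ioc (0 : ℝ) 1, coneInt B G x t) ^ 4
        ≤ ∫⁻ x in C, 64 * ∫⁻ t in Ioc (0 : ℝ) 1, ENNReal.ofReal (t ^ (-(3 / 4) : ℝ)) *
            (ENNReal.ofReal (t ^ 3) * coneInt B G x t ^ 4) :=
          lintegral_mono fun x =>
            lintegral_tMeas_pow_le (hmΦ.comp (measurable_prodMk_left (x := x)))
      _ = 64 * ∫⁻ t in Ioc (0 : ℝ) 1, ∫⁻ x in C, ENNReal.ofReal (t ^ (-(3 / 4) : ℝ)) *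
            (ENNReal.ofReal (t ^ 3) * coneInt B G x t ^ 4) := by
          rw [lintegral_const_mul' _ _ (by norm_num)]
          congr 1
          refine lintegral_lintegral_swap (Measurable.aemeasurable ?_)
          have h1 : Measurable fun p : Pt d × ℝ => coneInt B G p.1 p.2 := hmΦ
          change Measurable fun p : Pt d × ℝ => ENNReal.ofReal (p.2 ^ (-(3 / 4) : ℝ)) *
            (ENNReal.ofReal (p.2 ^ 3) * coneInt B G p.1 p.2 ^ 4)
          fun_prop
      _ ≤ 64 * ∫⁻ t in Ioc (0 : ℝ) 1, ENNReal.ofReal (t ^ (-(3 / 4) : ℝ)) *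
            (volume B ^ 2 * (8 * (volume C * I ^ 2))) := by
          refine mul_le_mul_right (setLIntegral_mono' measurableSet_Ioc fun t ht => ?_) _
          rw [lintegral_const_mul' _ _ ENNReal.ofReal_ne_top]
          exact mul_le_mul_right (hfix t ht) _
      _ = _ := by rw [lintegral_tMeas_const]
  have hBf : (∫⁻ y in B, ‖f y‖ₑ) ^ 4 ≤ volume B ^ 2 * (∫⁻ y in B, ‖f y‖ₑ ^ 2) ^ 2 := by
    have h2 : (∫⁻ y in B, ‖f y‖ₑ) ^ 2 ≤ volume B * ∫⁻ y in B, ‖f y‖ₑ ^ 2 := by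
      simpa using lintegral_pow_le (volume.restrict B)
        (hf.continuous.enorm.measurable.aemeasurable) (by norm_num : 2 ≠ 0)
    calc (∫⁻ y in B, ‖f y‖ₑ) ^ 4 = ((∫⁻ y in B, ‖f y‖ₑ) ^ 2) ^ 2 := by ring
      _ ≤ (volume B * ∫⁻ y in B, ‖f y‖ₑ ^ 2) ^ 2 := by gcongr
      _ = _ := by ring
  have hmf : Measurable fun x => ‖f x‖ₑ ^ 4 := (hf.continuous.enorm.measurable).pow_const 4
  rw [← lintegral_const_mul _ hmf]
  calc ∫⁻ x in C, volume B ^ 4 * ‖f x‖ₑ ^ 4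
      ≤ ∫⁻ x in C, (8 * (volume B ^ 2 * (∫⁻ y in B, ‖f y‖ₑ ^ 2) ^ 2) +
          8 * (ENNReal.ofReal R ^ 4 * (∫⁻ t in Ioc (0 : ℝ) 1, coneInt B G x t) ^ 4)) := by
        refine setLIntegral_mono' hCm fun x hx => ?_
        rw [← mul_pow, ← mul_add]
        refine (pow_le_pow_left' (volume_mul_enorm_le hC hBC hB hR hf hG hfG hx) 4).trans ?_
        refine (add_pow_four_le _ _).trans ?_
        exact mul_le_mul_right (add_le_add hBf (mul_pow _ _ _).le) _
    _ = volume C * (8 * (volume B ^ 2 * (∫⁻ y in B, ‖f y‖ₑ ^ 2) ^ 2)) +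
          8 * (ENNReal.ofReal R ^ 4 *
            ∫⁻ x in C, (∫⁻ t in Ioc (0 : ℝ) 1, coneInt B G x t) ^ 4) := by
        rw [lintegral_add_left measurable_const, setLIntegral_const,
          lintegral_const_mul' _ _ (by norm_num), lintegral_const_mul' _ _ (by finiteness)]
        ring
    _ ≤ _ := by gcongr

end Convex

/-! ### Embeddings on polyhedral domains -/

section Embedding

open Filter Topology
open scoped Convolution

variable {d : ℕ} {Ω : Set (Pt d)}

/-- The mollification of a function on `Ω`, extended by zero. -/
noncomputable def moll (ρ : ContDiffBump (0 : Pt d)) (v : L2 Ω) : Pt d → ℝ :=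
  convolution (ρ.normed volume) (Ω.indicator v) (ContinuousLinearMap.lsmul ℝ ℝ) volume

theorem locallyIntegrable_indicator (hΩ : IsOpen Ω) (v : L2 Ω) :
    LocallyIntegrable (Ω.indicator v) volume :=
  ((memLp_indicator_iff_restrict hΩ.measurableSet).2 (Lp.memLp v)).locallyIntegrable one_le_two

theorem measurable_indicator_Lp (hΩ : IsOpen Ω) (v : L2 Ω) : Measurable (Ω.indicator v) :=
  (Lp.stronglyMeasurable v).measurable.indicator hΩ.measurableSet

theorem contDiff_moll (hΩ : IsOpen Ω) (ρ : ContDiffBump (0 : Pt d)) (v : L2 Ω) :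
    ContDiff ℝ 1 (moll ρ v) :=
  ρ.hasCompactSupport_normed.contDiff_convolution_left _ (ρ.contDiff_normed (n := 1))
    (locallyIntegrable_indicator hΩ v)

theorem moll_eq (hΩ : IsOpen Ω) (ρ : ContDiffBump (0 : Pt d)) (v : L2 Ω) (x : Pt d) :
    moll ρ v x = ∫ y in Ω, v y * ρ.normed volume (x - y) := by
  rw [moll, convolution_eq_swap, ← integral_indicator hΩ.measurableSet]
  refine integral_congr_ae (Eventually.of_forall fun y => ?_)
  by_cases hy : y ∈ Ω
  · simp [hy, mul_comm]
  · simp [hy]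

/-- In the interior of `Ω` the derivative of a mollification is the mollification of the weak
derivative. -/
theorem fderiv_moll (hΩ : IsOpen Ω) (ρ : ContDiffBump (0 : Pt d)) {v g : L2 Ω} {i : Fin d}
    (h : IsWeakDeriv ![i] v g) {x : Pt d} (hx : Metric.closedBall x ρ.rOut ⊆ Ω) :
    fderiv ℝ (moll ρ v) x (EuclideanSpace.single i 1) = moll ρ g x := by
  set φ : Pt d → ℝ := fun y => ρ.normed volume (x - y)
  have hφ : IsTest Ω φ := by
    have hc : ContDiff ℝ ∞ φ :=
      (ρ.contDiff_normed (n := (⊤ : ℕ∞))).comp (contDiff_const.sub contDiff_id)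
    have hs : tsupport φ ⊆ Metric.closedBall x ρ.rOut := by
      refine closure_minimal (fun y hy => ?_) Metric.isClosed_closedBall
      have : x - y ∈ Function.support (ρ.normed volume) := hy
      rw [ρ.support_normed_eq, mem_ball_zero_iff] at this
      rw [Metric.mem_closedBall, dist_comm, dist_eq_norm]
      exact this.le
    exact ⟨hc, HasCompactSupport.of_support_subset_isCompact
      (isCompact_closedBall x ρ.rOut) (subset_closure.trans hs), hs.trans hx⟩
  have hder := (ρ.hasCompactSupport_normed (μ := volume)).hasFDerivAt_convolution_left
    (ContinuousLinearMap.lsmul ℝ ℝ) (ρ.contDiff_normed (n := 1))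
    (locallyIntegrable_indicator hΩ v) x
  have hφd : ∀ y, fderiv ℝ φ y (EuclideanSpace.single i 1) =
      - fderiv ℝ (ρ.normed volume) (x - y) (EuclideanSpace.single i 1) := by
    intro y
    have h1 : HasFDerivAt (ρ.normed volume) (fderiv ℝ (ρ.normed volume) (x - y)) (x - y) :=
      ((ρ.contDiff_normed (n := 1)).differentiable (by simp)).differentiableAt.hasFDerivAt
    have h2 := (h1.comp y ((hasFDerivAt_id y).const_sub x)).fderiv
    change fderiv ℝ φ y = _ at h2
    rw [h2]
    simp
  have hint : ConvolutionExistsAt (fderiv ℝ (ρ.normed volume)) (Ω.indicator v) x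
      (ContinuousLinearMap.precompL (Pt d) (ContinuousLinearMap.lsmul ℝ ℝ)) volume :=
    ((ρ.hasCompactSupport_normed (μ := volume)).fderiv ℝ).convolutionExists_left _
      ((ρ.contDiff_normed (n := 1)).continuous_fderiv (by simp))
      (locallyIntegrable_indicator hΩ v) x
  have e1 : fderiv ℝ (moll ρ v) x (EuclideanSpace.single i 1) =
      ∫ y in Ω, v y * fderiv ℝ (ρ.normed volume) (x - y) (EuclideanSpace.single i 1) := by
    rw [moll, hder.fderiv, convolution_eq_swap, ContinuousLinearMap.integral_apply,
      ← integral_indicator hΩ.measurableSet]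
    · refine integral_congr_ae (Eventually.of_forall fun y => ?_)
      by_cases hy : y ∈ Ω
      · simp [hy, mul_comm, ContinuousLinearMap.precompL_apply]
      · simp [hy]
    · exact hint.integrable_swap
  have h3 := h φ hφ
  simp only [iteratedFDeriv_one_apply] at h3
  rw [e1, moll_eq hΩ]
  have h4 : ∫ y in Ω, v y * fderiv ℝ φ y (EuclideanSpace.single i 1) =
      - ∫ y in Ω, v y * fderiv ℝ (ρ.normed volume) (x - y) (EuclideanSpace.single i 1) := by
    rw [← integral_neg]
    refine integral_congr_ae (Eventually.of_forall fun y => ?_)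
    simp only [hφd, mul_neg]
  have h5 : ∫ y in Ω, v y * fderiv ℝ φ y (EuclideanSpace.single i 1) =
      (-1) ^ 1 * ∫ y in Ω, g y * φ y := h3
  rw [h4, pow_one, neg_one_mul, neg_inj] at h5
  exact h5

/-- Mollification does not increase Lebesgue norms. -/
theorem lintegral_moll_pow_le (hΩ : IsOpen Ω) (ρ : ContDiffBump (0 : Pt d)) (v : L2 Ω) {n : ℕ}
    (hn : n ≠ 0) : ∫⁻ x, ‖moll ρ v x‖ₑ ^ n ≤ ∫⁻ x in Ω, ‖v x‖ₑ ^ n := by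
  set V := Ω.indicator v
  have hV : Measurable V := measurable_indicator_Lp hΩ v
  have hρm : Measurable fun t => ENNReal.ofReal (ρ.normed volume t) :=
    ρ.continuous_normed.measurable.ennreal_ofReal
  set π : Measure (Pt d) := volume.withDensity fun t => ENNReal.ofReal (ρ.normed volume t)
  have hπ : π univ = 1 := by
    rw [withDensity_apply _ MeasurableSet.univ, Measure.restrict_univ,
      ← ofReal_integral_eq_lintegral_ofReal ρ.integrable_normed
        (Eventually.of_forall ρ.nonneg_normed), ρ.integral_normed, ENNReal.ofReal_one]
  have hpt : ∀ x, ‖moll ρ v x‖ₑ ^ n ≤ ∫⁻ t, ‖V (x - t)‖ₑ ^ n ∂π := by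
    intro x
    have h1 : ‖moll ρ v x‖ₑ ≤ ∫⁻ t, ‖V (x - t)‖ₑ ∂π := by
      rw [lintegral_withDensity_eq_lintegral_mul _ hρm (by fun_prop)]
      refine (enorm_integral_le_lintegral_enorm _).trans (lintegral_mono fun t => ?_)
      rw [ContinuousLinearMap.lsmul_apply, enorm_smul, Pi.mul_apply,
        Real.enorm_eq_ofReal (ρ.nonneg_normed t)]
    refine (pow_le_pow_left' h1 n).trans ((lintegral_pow_le π (by fun_prop) hn).trans_eq ?_)
    rw [hπ, one_pow, one_mul]
  have hV2 : ∫⁻ x, ‖V x‖ₑ ^ n = ∫⁻ x in Ω, ‖v x‖ₑ ^ n := by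
    rw [← lintegral_indicator hΩ.measurableSet]
    refine lintegral_congr fun x => ?_
    by_cases hx : x ∈ Ω
    · simp [V, hx]
    · simp [V, hx, hn]
  have : SFinite π := inferInstanceAs (SFinite (volume.withDensity _))
  calc ∫⁻ x, ‖moll ρ v x‖ₑ ^ n ≤ ∫⁻ x, (∫⁻ t, ‖V (x - t)‖ₑ ^ n ∂π) := lintegral_mono hpt
    _ = ∫⁻ t, (∫⁻ x, ‖V (x - t)‖ₑ ^ n) ∂π := by
        refine lintegral_lintegral_swap (Measurable.aemeasurable ?_)
        change Measurable fun p : Pt d × Pt d => ‖V (p.1 - p.2)‖ₑ ^ n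
        fun_prop
    _ = ∫⁻ _, (∫⁻ x, ‖V x‖ₑ ^ n) ∂π := by
        exact lintegral_congr fun t => lintegral_sub_right_eq_self (fun x => ‖V x‖ₑ ^ n) t
    _ = _ := by rw [lintegral_const, hπ, mul_one, hV2]

theorem sum_pow_le (a : Fin d → ENNReal) {n : ℕ} (hn : n ≠ 0) :
    (∑ i, a i) ^ n ≤ (d : ENNReal) ^ (n - 1) * ∑ i, a i ^ n := by
  have := lintegral_pow_le (Measure.count : Measure (Fin d)) (g := a)
    (measurable_of_finite a).aemeasurable hn
  simpa [lintegral_fintype] using this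

theorem lintegral_sum_moll_pow_le (hΩ : IsOpen Ω) (ρ : ContDiffBump (0 : Pt d)) (g : Fin d → L2 Ω)
    {n : ℕ} (hn : n ≠ 0) : ∫⁻ x, (∑ i, ‖moll ρ (g i) x‖ₑ) ^ n ≤
      (d : ENNReal) ^ (n - 1) * ∑ i, ∫⁻ x in Ω, ‖g i x‖ₑ ^ n := by
  have hm : ∀ i, Measurable fun x => ‖moll ρ (g i) x‖ₑ ^ n := fun i =>
    ((contDiff_moll hΩ ρ (g i)).continuous.enorm.measurable).pow_const n
  calc ∫⁻ x, (∑ i, ‖moll ρ (g i) x‖ₑ) ^ n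
      ≤ ∫⁻ x, (d : ENNReal) ^ (n - 1) * ∑ i, ‖moll ρ (g i) x‖ₑ ^ n :=
        lintegral_mono fun x => sum_pow_le _ hn
    _ = (d : ENNReal) ^ (n - 1) * ∑ i, ∫⁻ x, ‖moll ρ (g i) x‖ₑ ^ n := by
        rw [lintegral_const_mul' _ _ (by finiteness), lintegral_finsetSum _ fun i _ => hm i]
    _ ≤ _ := by
        refine mul_le_mul_right (Finset.sum_le_sum fun i _ => ?_) _
        exact lintegral_moll_pow_le hΩ ρ _ hn

variable (d) in
/-- A sequence of bump functions concentrating at the origin. -/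
noncomputable def bumps (k : ℕ) : ContDiffBump (0 : Pt d) where
  rIn := 1 / (2 * ((k : ℝ) + 1))
  rOut := 1 / ((k : ℝ) + 1)
  rIn_pos := by positivity
  rIn_lt_rOut := by
    rw [div_lt_div_iff₀ (by positivity) (by positivity)]
    nlinarith [(Nat.cast_nonneg k : (0 : ℝ) ≤ k)]

theorem tendsto_bumps_rOut : Tendsto (fun k => (bumps d k).rOut) atTop (𝓝 0) :=
  tendsto_one_div_add_atTop_nhds_zero_nat

/-- Mollifications converge almost everywhere, by the Lebesgue differentiation theorem. -/
theorem ae_tendsto_moll (hΩ : IsOpen Ω) (v : L2 Ω) :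
    ∀ᵐ x, Tendsto (fun k => moll (bumps d k) v x) atTop (𝓝 (Ω.indicator v x)) := by
  refine ContDiffBump.ae_convolution_tendsto_right_of_locallyIntegrable (K := 2)
    tendsto_bumps_rOut (Eventually.of_forall fun k => ?_) (locallyIntegrable_indicator hΩ v)
  change 1 / ((k : ℝ) + 1) ≤ 2 * (1 / (2 * ((k : ℝ) + 1)))
  apply le_of_eq
  field_simp

theorem eventually_closedBall_subset (hΩ : IsOpen Ω) {C : Set (Pt d)} (hC : IsCompact C)
    (hCΩ : C ⊆ Ω) : ∀ᶠ k in atTop, ∀ x ∈ C, Metric.closedBall x (bumps d k).rOut ⊆ Ω := by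
  obtain ⟨δ, hδ, hsub⟩ := hC.exists_cthickening_subset_open hΩ hCΩ
  filter_upwards [(tendsto_bumps_rOut (d := d)).eventually_lt_const hδ] with k hk x hx
  exact (Metric.closedBall_subset_cthickening hx _).trans
    ((Metric.cthickening_mono hk.le C).trans hsub)

theorem enorm_fderiv_moll_le (hΩ : IsOpen Ω) (ρ : ContDiffBump (0 : Pt d)) {v : L2 Ω}
    (hv : MemH 1 v) {x : Pt d} (hx : Metric.closedBall x ρ.rOut ⊆ Ω) :
    ‖fderiv ℝ (moll ρ v) x‖ₑ ≤ ∑ i, ‖moll ρ (pd i v) x‖ₑ := by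
  have h := norm_le_sum_single (fderiv ℝ (moll ρ v) x)
  simp only [fun i => fderiv_moll hΩ ρ (hv.isWeakDeriv le_rfl ![i]) hx] at h
  rw [← ofReal_norm]
  refine (ENNReal.ofReal_le_ofReal h).trans_eq ?_
  rw [ENNReal.ofReal_sum_of_nonneg fun _ _ => norm_nonneg _]
  simp only [ofReal_norm]
  rfl

/-- The bound of `|B|⁴ ∫_C |v|⁴` by the `H¹(Ω)` norm. -/
noncomputable def fourBound (B : Set (Pt d)) (R : ℝ) (v : L2 Ω) : ENNReal :=
  volume Ω * (8 * (volume B ^ 2 * (∫⁻ y in Ω, ‖v y‖ₑ ^ 2) ^ 2)) +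
      8 * (ENNReal.ofReal R ^ 4 * (64 * (4 * (volume B ^ 2 * (8 * (volume Ω *
        (d * ∑ i, ∫⁻ y in Ω, ‖pd i v y‖ₑ ^ 2) ^ 2))))))

/-- The bound of `|B|⁴ sup_C |v|⁴` by the `W^{1,4}(Ω)` norm. -/
noncomputable def supBound (B : Set (Pt d)) (R : ℝ) (v : L2 Ω) : ENNReal :=
  8 * (volume B ^ 3 * ∫⁻ y in Ω, ‖v y‖ₑ ^ 4) +
      8 * (ENNReal.ofReal R ^ 4 * (64 * (4 * (volume B ^ 3 *
        ((d : ENNReal) ^ 3 * ∑ i, ∫⁻ y in Ω, ‖pd i v y‖ₑ ^ 4)))))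

/-- `H¹ ⊂ L⁴` on a compact convex subset of `Ω`, by mollification and Fatou's lemma. -/
theorem lintegral_le_fourBound (hd : d ≤ 3) (hΩ : IsOpen Ω) {C B : Set (Pt d)} (hC : Convex ℝ C)
    (hCc : IsCompact C) (hCΩ : C ⊆ Ω) (hBC : B ⊆ C) (hB : MeasurableSet B) {R : ℝ}
    (hR : ∀ x ∈ C, ∀ y ∈ C, ‖y - x‖ ≤ R) {v : L2 Ω} (hv : MemH 1 v) :
    volume B ^ 4 * ∫⁻ x in C, ‖v x‖ₑ ^ 4 ≤ fourBound B R v := by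
  have hm : ∀ k, Measurable fun x => ‖moll (bumps d k) v x‖ₑ ^ 4 := fun k =>
    ((contDiff_moll hΩ _ v).continuous.enorm.measurable).pow_const 4
  have hBtop : volume B ≠ ⊤ := (measure_mono hBC).trans_lt hCc.measure_lt_top |>.ne
  have hlim : ∫⁻ x in C, ‖v x‖ₑ ^ 4 ≤
      liminf (fun k => ∫⁻ x in C, ‖moll (bumps d k) v x‖ₑ ^ 4) atTop := by
    refine le_trans (lintegral_mono_ae ?_) (lintegral_liminf_le hm)
    filter_upwards [ae_restrict_mem hCc.measurableSet,
      ae_restrict_of_ae (ae_tendsto_moll hΩ v)] with x hx hxt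
    rw [indicator_of_mem (hCΩ hx)] at hxt
    exact (((ENNReal.continuous_pow 4).tendsto _).comp hxt.enorm).liminf_eq.ge
  have hev : ∀ᶠ k in atTop, ∫⁻ x in C, ‖moll (bumps d k) v x‖ₑ ^ 4 ≤
      fourBound B R v / volume B ^ 4 ∨ volume B = 0 := by
    filter_upwards [eventually_closedBall_subset hΩ hCc hCΩ] with k hk
    by_cases hB0 : volume B = 0
    · exact Or.inr hB0
    left
    have hG : Measurable fun x => ∑ i, ‖moll (bumps d k) (pd i v) x‖ₑ :=
      Finset.measurable_fun_sum _ fun i _ => (contDiff_moll hΩ _ _).continuous.enorm.measurable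
    have h := lintegral_pow_four_le_of_convex hd hC hCc.measurableSet hBC hB hR
      (contDiff_moll hΩ (bumps d k) v) hG
      (fun x hx => enorm_fderiv_moll_le hΩ _ hv (hk x hx))
    rw [ENNReal.le_div_iff_mul_le (Or.inl (pow_ne_zero 4 hB0)) (Or.inl (by finiteness)), mul_comm]
    refine h.trans ?_
    have h1 : ∫⁻ y in B, ‖moll (bumps d k) v y‖ₑ ^ 2 ≤ ∫⁻ y in Ω, ‖v y‖ₑ ^ 2 :=
      (setLIntegral_le_lintegral _ _).trans (lintegral_moll_pow_le hΩ _ v two_ne_zero)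
    have h2 := lintegral_sum_moll_pow_le hΩ (bumps d k) (fun i => pd i v) two_ne_zero
    simp only [Nat.add_one_sub_one, pow_one] at h2
    unfold fourBound
    gcongr
  by_cases hB0 : volume B = 0
  · simp [hB0]
  rw [mul_comm, ← ENNReal.le_div_iff_mul_le (Or.inl (pow_ne_zero 4 hB0)) (Or.inl (by finiteness))]
  refine hlim.trans (liminf_le_of_frequently_le' ?_)
  exact (hev.mono fun k hk => hk.resolve_right hB0).frequently

/-- `W^{1,4} ⊂ L^∞` on a compact convex subset of `Ω`, by mollification. -/
theorem ae_le_supBound (hd : d ≤ 3) (hΩ : IsOpen Ω) {C B : Set (Pt d)} (hC : Convex ℝ C)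
    (hCc : IsCompact C) (hCΩ : C ⊆ Ω) (hBC : B ⊆ C) (hB : MeasurableSet B) {R : ℝ}
    (hR : ∀ x ∈ C, ∀ y ∈ C, ‖y - x‖ ≤ R) {v : L2 Ω} (hv : MemH 1 v) :
    ∀ᵐ x ∂(volume.restrict C), volume B ^ 4 * ‖v x‖ₑ ^ 4 ≤ supBound B R v := by
  have hBtop : volume B ≠ ⊤ := (measure_mono hBC).trans_lt hCc.measure_lt_top |>.ne
  filter_upwards [ae_restrict_mem hCc.measurableSet,
      ae_restrict_of_ae (ae_tendsto_moll hΩ v)] with x hx hxt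
  rw [indicator_of_mem (hCΩ hx)] at hxt
  refine le_of_tendsto (ENNReal.Tendsto.const_mul (((ENNReal.continuous_pow 4).tendsto _).comp hxt.enorm)
    (Or.inr (by finiteness))) ?_
  filter_upwards [eventually_closedBall_subset hΩ hCc hCΩ] with k hk
  have hG : Measurable fun x => ∑ i, ‖moll (bumps d k) (pd i v) x‖ₑ :=
    Finset.measurable_fun_sum _ fun i _ => (contDiff_moll hΩ _ _).continuous.enorm.measurable
  have h := enorm_pow_le_of_convex hd hC hBC hB hR
    (contDiff_moll hΩ (bumps d k) v) hG
    (fun x hx => enorm_fderiv_moll_le hΩ _ hv (hk x hx)) hx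
  refine h.trans ?_
  have h1 : ∫⁻ y in B, ‖moll (bumps d k) v y‖ₑ ^ 4 ≤ ∫⁻ y in Ω, ‖v y‖ₑ ^ 4 :=
    (setLIntegral_le_lintegral _ _).trans (lintegral_moll_pow_le hΩ _ v four_ne_zero)
  have h2 := lintegral_sum_moll_pow_le hΩ (bumps d k) (fun i => pd i v) four_ne_zero
  unfold supBound
  gcongr

end Embedding

section Polyhedral

open Filter Topology

variable {d : ℕ} {Ω : Set (Pt d)}

theorem IsPolyhedral.isOpen (h : IsPolyhedral Ω) : IsOpen Ω := by
  obtain ⟨K, hK⟩ := h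
  rw [hK.domain]
  exact isOpen_interior

theorem isCompact_face (c : Finset (Pt d)) : IsCompact (convexHull ℝ (c : Set (Pt d))) :=
  c.finite_toSet.isCompact_convexHull ℝ

theorem IsPolyhedral.isBounded (h : IsPolyhedral Ω) : Bornology.IsBounded Ω := by
  obtain ⟨K, hK⟩ := h
  have : Bornology.IsBounded K.space := by
    rw [Geometry.SimplicialComplex.space, Bornology.isBounded_biUnion hK.finite]
    exact fun c _ => (isCompact_face c).isBounded
  rw [hK.domain]
  exact this.subset interior_subset

/-- A polyhedral domain is covered, up to a null set, by the interiors of finitely many compact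
convex sets. -/
theorem IsPolyhedral.exists_cells (h : IsPolyhedral Ω) :
    ∃ 𝒮 : Set (Set (Pt d)), 𝒮.Finite ∧ (∀ S ∈ 𝒮, Convex ℝ S ∧ IsCompact S ∧ interior S ⊆ Ω ∧
      (interior S).Nonempty) ∧ ∀ᵐ x ∂(volume.restrict Ω), x ∈ ⋃ S ∈ 𝒮, interior S := by
  obtain ⟨K, hK⟩ := h
  set face : Finset (Pt d) → Set (Pt d) := fun c => convexHull ℝ (c : Set (Pt d))
  refine ⟨(face '' K.faces) ∩ {S | (interior S).Nonempty}, (hK.finite.image _).inter_of_left _,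
    ?_, ?_⟩
  · rintro _ ⟨⟨c, hc, rfl⟩, hne⟩
    refine ⟨convex_convexHull ℝ _, isCompact_face c, ?_, hne⟩
    rw [hK.domain]
    refine interior_mono fun x hx => ?_
    exact mem_biUnion hc hx
  · have hnull : volume (⋃ c ∈ K.faces, frontier (face c)) = 0 :=
      (measure_biUnion_null_iff hK.finite.countable).2 fun c _ =>
        (convex_convexHull ℝ (c : Set (Pt d))).addHaar_frontier volume
    have hΩ : IsOpen Ω := by
      rw [hK.domain]
      exact isOpen_interior
    filter_upwards [ae_restrict_mem hΩ.measurableSet,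
      ae_restrict_of_ae (measure_eq_zero_iff_ae_notMem.1 hnull)] with x hx hxf
    rw [hK.domain] at hx
    have hxs : x ∈ ⋃ c ∈ K.faces, face c := interior_subset hx
    simp only [mem_iUnion, exists_prop] at hxs hxf ⊢
    obtain ⟨c, hc, hxc⟩ := hxs
    have hint : x ∈ interior (face c) := by
      by_contra hn
      exact hxf ⟨c, hc, subset_closure hxc, hn⟩
    exact ⟨face c, ⟨⟨c, hc, rfl⟩, ⟨x, hint⟩⟩, hint⟩

theorem lintegral_enorm_pow_eq (v : L2 Ω) {n : ℕ} (hn : n ≠ 0) :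
    ∫⁻ x in Ω, ‖v x‖ₑ ^ n = eLpNorm v n (volume.restrict Ω) ^ n := by
  have := eLpNorm_nnreal_pow_eq_lintegral (f := v) (μ := volume.restrict Ω) (p := (n : NNReal))
    (by exact_mod_cast hn)
  simp only [NNReal.coe_natCast, ENNReal.rpow_natCast, ENNReal.coe_natCast] at this
  exact this.symm

theorem lintegral_enorm_sq_eq (v : L2 Ω) :
    ∫⁻ x in Ω, ‖v x‖ₑ ^ 2 = ENNReal.ofReal ‖v‖ ^ 2 := by
  rw [lintegral_enorm_pow_eq v two_ne_zero, Lp.norm_def, ENNReal.ofReal_toReal (Lp.eLpNorm_ne_top v)]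
  rfl

/-- Compact convex subsets exhausting the interior of a compact convex set. -/
theorem exists_exhaustion {S : Set (Pt d)} (hS : Convex ℝ S) (hSc : IsCompact S) {c : Pt d}
    (hc : c ∈ interior S) :
    ∃ (B : Set (Pt d)) (C : ℕ → Set (Pt d)), MeasurableSet B ∧ volume B ≠ 0 ∧
      (∀ n, Convex ℝ (C n) ∧ IsCompact (C n) ∧ B ⊆ C n ∧ C n ⊆ interior S) ∧
      ∀ x ∈ interior S, ∀ᶠ n in atTop, x ∈ C n := by
  have hcS : c ∈ S := interior_subset hc
  obtain ⟨ρ, hρ, hball⟩ := Metric.isOpen_iff.1 isOpen_interior c hc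
  set a : ℕ → ℝ := fun n => 1 / ((n : ℝ) + 1)
  have ha : ∀ n, 0 < a n := fun n => by positivity
  have ha1 : ∀ n, a n ≤ 1 := fun n => by
    rw [div_le_one (by positivity)]
    linarith [(Nat.cast_nonneg n : (0 : ℝ) ≤ n)]
  set T : ℕ → Pt d → Pt d := fun n x => c + (1 + a n) • (x - c)
  have hTc : ∀ n, Continuous (T n) := fun n => by fun_prop
  have hsub : ∀ n, T n ⁻¹' S ⊆ interior S := by
    intro n x hx
    have h := hS.add_smul_sub_mem_interior hx hc (t := a n / (1 + a n))
      ⟨by have := ha n; positivity, by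
        rw [div_le_one (by linarith [ha n])]
        linarith⟩
    convert h using 1
    have : (1 + a n) ≠ 0 := by linarith [ha n]
    have e : x = c + (1 - a n / (1 + a n)) • ((1 + a n) • (x - c)) := by
      rw [smul_smul, sub_mul, div_mul_cancel₀ _ this]
      simp
    simp only [T]
    nth_rewrite 1 [e]
    module
  refine ⟨Metric.ball c (ρ / 2), fun n => T n ⁻¹' S, measurableSet_ball,
    (Metric.measure_ball_pos volume c (by positivity)).ne', fun n => ⟨?_, ?_, ?_, hsub n⟩, ?_⟩
  · intro x hx y hy s t hs ht hst
    have h := hS hx hy hs ht hst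
    have e : T n (s • x + t • y) = s • T n x + t • T n y := by
      have : t = 1 - s := by linarith
      subst this
      simp only [T]
      module
    change T n (s • x + t • y) ∈ S
    rwa [e]
  · exact hSc.of_isClosed_subset (hSc.isClosed.preimage (hTc n))
      ((hsub n).trans interior_subset)
  · intro x hx
    have : T n x ∈ interior S := by
      refine hball ?_
      rw [Metric.mem_ball, dist_eq_norm] at hx ⊢
      simp only [T, add_sub_cancel_left, norm_smul, Real.norm_eq_abs,
        abs_of_pos (show 0 < 1 + a n by linarith [ha n])]
      have := ha1 n
      nlinarith [norm_nonneg (x - c)]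
    exact interior_subset (s := S) this
  · intro x hx
    have hlim : Tendsto (fun n => T n x) atTop (𝓝 x) := by
      have h1 : Tendsto a atTop (𝓝 0) := tendsto_one_div_add_atTop_nhds_zero_nat
      have h2 : Tendsto (fun n => c + (1 + a n) • (x - c)) atTop (𝓝 (c + (1 + 0 : ℝ) • (x - c))) :=
        ((h1.const_add 1).smul_const (x - c)).const_add c
      simpa using h2
    filter_upwards [hlim.eventually (isOpen_interior.mem_nhds hx)] with n hn
    exact interior_subset (s := S) hn

/-- The embedding estimates on the interior of a cell. -/
theorem exists_cell_bound (hd : d ≤ 3) (hΩ : IsOpen Ω) (hb : Bornology.IsBounded Ω)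
    {S : Set (Pt d)} (hS : Convex ℝ S) (hSc : IsCompact S) (hSΩ : interior S ⊆ Ω)
    (hne : (interior S).Nonempty) :
    ∃ K : ENNReal, K ≠ ⊤ ∧ ∀ v : L2 Ω, MemH 1 v →
      ∫⁻ x in interior S, ‖v x‖ₑ ^ 4 ≤ K * ENNReal.ofReal (‖v‖ + gradSum v) ^ 4 ∧
      ∀ᵐ x ∂(volume.restrict (interior S)), ‖v x‖ₑ ^ 4 ≤
        K * ((∫⁻ y in Ω, ‖v y‖ₑ ^ 4) + ∑ i, ∫⁻ y in Ω, ‖pd i v y‖ₑ ^ 4) := by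
  obtain ⟨c, hc⟩ := hne
  obtain ⟨B, C, hBm, hB0, hC, hex⟩ := exists_exhaustion hS hSc hc
  set R := Metric.diam S
  have hR : ∀ n, ∀ x ∈ C n, ∀ y ∈ C n, ‖y - x‖ ≤ R := fun n x hx y hy => by
    rw [← dist_eq_norm]
    exact Metric.dist_le_diam_of_mem hSc.isBounded (interior_subset ((hC n).2.2.2 hy))
      (interior_subset ((hC n).2.2.2 hx))
  have hvol := volume_ne_top_of_isBounded hb
  have hBtop : volume B ≠ ⊤ :=
    ((measure_mono (hC 0).2.2.1).trans_lt (hC 0).2.1.measure_lt_top).ne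
  have hB4 : volume B ^ 4 ≠ 0 := pow_ne_zero 4 hB0
  set K1 : ENNReal := volume Ω * (8 * volume B ^ 2) + 8 * (ENNReal.ofReal R ^ 4 * (64 * (4 *
    (volume B ^ 2 * (8 * (volume Ω * (d * d) ^ 2))))))
  set K2 : ENNReal := 8 * volume B ^ 3 + 8 * (ENNReal.ofReal R ^ 4 * (64 * (4 * (volume B ^ 3 *
    (d : ENNReal) ^ 3))))
  have hK1 : K1 ≠ ⊤ := by finiteness
  have hK2 : K2 ≠ ⊤ := by finiteness
  refine ⟨(K1 + K2) / volume B ^ 4, ENNReal.div_ne_top (by finiteness) hB4, fun v hv => ⟨?_, ?_⟩⟩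
  · have hfour : fourBound B R v ≤ K1 * ENNReal.ofReal (‖v‖ + gradSum v) ^ 4 := by
      set N := ENNReal.ofReal (‖v‖ + gradSum v)
      have h1 : ∫⁻ x in Ω, ‖v x‖ₑ ^ 2 ≤ N ^ 2 := by
        rw [lintegral_enorm_sq_eq]
        gcongr
        exact ENNReal.ofReal_le_ofReal (by linarith [gradSum_nonneg v])
      have h2 : ∑ i, ∫⁻ x in Ω, ‖pd i v x‖ₑ ^ 2 ≤ d * N ^ 2 := by
        refine (Finset.sum_le_sum (g := fun _ => N ^ 2) fun i _ => ?_).trans (by simp)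
        rw [lintegral_enorm_sq_eq]
        gcongr
        exact ENNReal.ofReal_le_ofReal (by
          linarith [norm_pd_le_gradSum i v, norm_nonneg v])
      calc fourBound B R v ≤ volume Ω * (8 * (volume B ^ 2 * (N ^ 2) ^ 2)) +
            8 * (ENNReal.ofReal R ^ 4 * (64 * (4 * (volume B ^ 2 * (8 * (volume Ω *
            (d * (d * N ^ 2)) ^ 2)))))) := by
            unfold fourBound
            gcongr
        _ = K1 * N ^ 4 := by
            simp only [K1]
            ring
    have hn : ∀ n, ∫⁻ x in C n, ‖v x‖ₑ ^ 4 ≤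
        (K1 + K2) / volume B ^ 4 * ENNReal.ofReal (‖v‖ + gradSum v) ^ 4 := by
      intro n
      have h := lintegral_le_fourBound hd hΩ (hC n).1 (hC n).2.1
        ((hC n).2.2.2.trans hSΩ) (hC n).2.2.1 hBm (hR n) hv
      rw [mul_comm, ← ENNReal.le_div_iff_mul_le (Or.inl hB4) (Or.inl (by finiteness))] at h
      refine h.trans ?_
      rw [ENNReal.mul_div_right_comm.symm]
      gcongr
      exact hfour.trans (by gcongr; exact le_self_add)
    -- Fatou's lemma along the exhaustion
    have hm : Measurable fun x => ‖v x‖ₑ ^ 4 :=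
      (Lp.stronglyMeasurable v).measurable.enorm.pow_const 4
    rw [← lintegral_indicator isOpen_interior.measurableSet]
    refine le_trans (lintegral_mono (g := fun x => liminf (fun n =>
      (C n).indicator (fun x => ‖v x‖ₑ ^ 4) x) atTop) fun x => ?_)
      ((lintegral_liminf_le fun n => hm.indicator (hC n).2.1.measurableSet).trans
        (liminf_le_of_frequently_le' (Eventually.of_forall fun n => ?_).frequently))
    · by_cases hx : x ∈ interior S
      · rw [indicator_of_mem hx]
        refine le_liminf_of_le (by isBoundedDefault) ?_
        filter_upwards [hex x hx] with n hn
        rw [indicator_of_mem hn]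
      · simp [hx]
    · rw [lintegral_indicator (hC n).2.1.measurableSet]
      exact hn n
  · have hsup : supBound B R v ≤
        K2 * ((∫⁻ y in Ω, ‖v y‖ₑ ^ 4) + ∑ i, ∫⁻ y in Ω, ‖pd i v y‖ₑ ^ 4) := by
      unfold supBound
      simp only [K2]
      rw [add_mul]
      gcongr ?_ + ?_
      · rw [mul_assoc]
        gcongr
        exact le_self_add
      · simp only [mul_assoc]
        gcongr
        exact le_add_self
    have hall : ∀ᵐ x ∂volume, ∀ n, x ∈ C n → volume B ^ 4 * ‖v x‖ₑ ^ 4 ≤ supBound B R v := by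
      rw [ae_all_iff]
      intro n
      rw [← ae_restrict_iff' (hC n).2.1.measurableSet]
      exact ae_le_supBound hd hΩ (hC n).1 (hC n).2.1 ((hC n).2.2.2.trans hSΩ) (hC n).2.2.1 hBm
        (hR n) hv
    filter_upwards [ae_restrict_mem isOpen_interior.measurableSet, ae_restrict_of_ae hall]
      with x hx hxa
    obtain ⟨n, hn⟩ := (hex x hx).exists
    have h := hxa n hn
    rw [mul_comm, ← ENNReal.le_div_iff_mul_le (Or.inl hB4) (Or.inl (by finiteness))] at h
    refine h.trans ?_
    rw [ENNReal.mul_div_right_comm.symm]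
    gcongr
    exact hsup.trans (by gcongr; exact le_add_self)

/-- The embedding `H¹(Ω) ⊂ L⁴(Ω)`. -/
theorem IsPolyhedral.exists_lpn_four_le (hd : d ≤ 3) (h : IsPolyhedral Ω) :
    ∃ C : ℝ, 0 ≤ C ∧ ∀ v : L2 Ω, MemH 1 v →
      MemLp v 4 (volume.restrict Ω) ∧ lpn 4 v ≤ C * (‖v‖ + gradSum v) := by
  obtain ⟨𝒮, hfin, hcell, hcov⟩ := h.exists_cells
  have hK : ∀ S ∈ 𝒮, ∃ K : ENNReal, K ≠ ⊤ ∧ ∀ v : L2 Ω, MemH 1 v →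
      ∫⁻ x in interior S, ‖v x‖ₑ ^ 4 ≤ K * ENNReal.ofReal (‖v‖ + gradSum v) ^ 4 := fun S hS => by
    obtain ⟨K, h1, h2⟩ := exists_cell_bound hd h.isOpen h.isBounded (hcell S hS).1
      (hcell S hS).2.1 (hcell S hS).2.2.1 (hcell S hS).2.2.2
    exact ⟨K, h1, fun v hv => (h2 v hv).1⟩
  choose! K hKtop hKv using hK
  set L : ENNReal := ∑ S ∈ hfin.toFinset, K S
  have hL : L ≠ ⊤ := ENNReal.sum_ne_top.2 fun S hS => hKtop S (hfin.mem_toFinset.1 hS)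
  have hL4 : L ^ (1 / 4 : ℝ) ≠ ⊤ := ENNReal.rpow_ne_top_of_nonneg (by norm_num) hL
  refine ⟨(L ^ (1 / 4 : ℝ)).toReal, ENNReal.toReal_nonneg, fun v hv => ?_⟩
  set N := ENNReal.ofReal (‖v‖ + gradSum v)
  have hm : Measurable fun x => ‖v x‖ₑ ^ 4 :=
    (Lp.stronglyMeasurable v).measurable.enorm.pow_const 4
  have hint : ∫⁻ x in Ω, ‖v x‖ₑ ^ 4 ≤ L * N ^ 4 := by
    calc ∫⁻ x in Ω, ‖v x‖ₑ ^ 4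
        ≤ ∫⁻ x in Ω, ∑ S ∈ hfin.toFinset, (interior S).indicator (fun x => ‖v x‖ₑ ^ 4) x := by
          refine lintegral_mono_ae ?_
          filter_upwards [hcov] with x hx
          simp only [mem_iUnion, exists_prop] at hx
          obtain ⟨S, hS, hxS⟩ := hx
          refine le_trans ?_ (Finset.single_le_sum (f := fun S : Set (Pt d) =>
            (interior S).indicator (fun x => ‖v x‖ₑ ^ 4) x) (fun _ _ => zero_le)
            (hfin.mem_toFinset.2 hS))
          simp only [indicator_of_mem hxS, le_refl]
      _ ≤ ∑ S ∈ hfin.toFinset, ∫⁻ x in interior S, ‖v x‖ₑ ^ 4 := by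
          rw [lintegral_finsetSum _ fun S _ => hm.indicator isOpen_interior.measurableSet]
          refine Finset.sum_le_sum fun S _ => ?_
          rw [← lintegral_indicator isOpen_interior.measurableSet]
          exact setLIntegral_le_lintegral _ _
      _ ≤ ∑ S ∈ hfin.toFinset, K S * N ^ 4 :=
          Finset.sum_le_sum fun S hS => hKv S (hfin.mem_toFinset.1 hS) v hv
      _ = _ := (Finset.sum_mul _ _ _).symm
  have hle : eLpNorm v 4 (volume.restrict Ω) ≤ L ^ (1 / 4 : ℝ) * N := by
    rw [lintegral_enorm_pow_eq v four_ne_zero] at hint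
    have := ENNReal.rpow_le_rpow hint (by norm_num : (0 : ℝ) ≤ 1 / 4)
    rw [ENNReal.mul_rpow_of_nonneg _ _ (by norm_num), ← ENNReal.rpow_natCast,
      ← ENNReal.rpow_natCast, ← ENNReal.rpow_mul, ← ENNReal.rpow_mul] at this
    norm_num at this
    exact this
  refine ⟨⟨Lp.aestronglyMeasurable v, hle.trans_lt (by finiteness)⟩, ?_⟩
  refine (ENNReal.toReal_mono (by finiteness) hle).trans_eq ?_
  rw [ENNReal.toReal_mul, ENNReal.toReal_ofReal (add_nonneg (norm_nonneg _) (gradSum_nonneg v))]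

theorem gradSum_pd_le (hΩ : IsOpen Ω) {v : L2 Ω} (hv : MemH 2 v) (i : Fin d) :
    gradSum (pd i v) ≤ d * normH 2 v := by
  refine (Finset.sum_le_sum (g := fun _ => normH 2 v) fun j _ => ?_).trans (by simp)
  rw [pd_pd hΩ hv]
  exact norm_weakDeriv_le_normH le_rfl _ _

theorem gradSum_le_normH (v : L2 Ω) {ℓ : ℕ} (hℓ : 1 ≤ ℓ) : gradSum v ≤ d * normH ℓ v :=
  (Finset.sum_le_sum (g := fun _ => normH ℓ v) fun j _ => norm_pd_le_normH j hℓ v).trans (by simp)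

/-- The embedding `H²(Ω) ⊂ L^∞(Ω)`. -/
theorem IsPolyhedral.exists_lpn_top_le (hd : d ≤ 3) (h : IsPolyhedral Ω) :
    ∃ C : ℝ, 0 ≤ C ∧ ∀ v : L2 Ω, MemH 2 v →
      MemLp v ⊤ (volume.restrict Ω) ∧ lpn ⊤ v ≤ C * normH 2 v := by
  obtain ⟨𝒮, hfin, hcell, hcov⟩ := h.exists_cells
  have hΩ := h.isOpen
  have hK : ∀ S ∈ 𝒮, ∃ K : ENNReal, K ≠ ⊤ ∧ ∀ v : L2 Ω, MemH 1 v →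
      ∀ᵐ x ∂(volume.restrict (interior S)), ‖v x‖ₑ ^ 4 ≤
        K * ((∫⁻ y in Ω, ‖v y‖ₑ ^ 4) + ∑ i, ∫⁻ y in Ω, ‖pd i v y‖ₑ ^ 4) := fun S hS => by
    obtain ⟨K, h1, h2⟩ := exists_cell_bound hd h.isOpen h.isBounded (hcell S hS).1
      (hcell S hS).2.1 (hcell S hS).2.2.1 (hcell S hS).2.2.2
    exact ⟨K, h1, fun v hv => (h2 v hv).2⟩
  choose! K hKtop hKv using hK
  set L : ENNReal := ∑ S ∈ hfin.toFinset, K S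
  have hL : L ≠ ⊤ := ENNReal.sum_ne_top.2 fun S hS => hKtop S (hfin.mem_toFinset.1 hS)
  obtain ⟨C4, hC40, hC4⟩ := h.exists_lpn_four_le hd
  set A : ENNReal := L * (1 + d)
  have hA4 : A ^ (1 / 4 : ℝ) ≠ ⊤ :=
    ENNReal.rpow_ne_top_of_nonneg (by norm_num) (by finiteness)
  refine ⟨(A ^ (1 / 4 : ℝ)).toReal * (C4 * (1 + d)), by positivity, fun v hv => ?_⟩
  set N := normH 2 v
  have hN : 0 ≤ N := normH_nonneg _ _
  have hfour : ∀ w : L2 Ω, MemH 1 w → ‖w‖ ≤ N → gradSum w ≤ d * N →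
      ∫⁻ y in Ω, ‖w y‖ₑ ^ 4 ≤ ENNReal.ofReal (C4 * (1 + d) * N) ^ 4 := by
    intro w hw h1 h2
    obtain ⟨hm, hle⟩ := hC4 w hw
    rw [lintegral_enorm_pow_eq w four_ne_zero]
    gcongr
    change eLpNorm w 4 _ ≤ _
    rw [← ENNReal.ofReal_toReal hm.2.ne]
    refine ENNReal.ofReal_le_ofReal (hle.trans ?_)
    rw [mul_assoc]
    refine mul_le_mul_of_nonneg_left ?_ hC40
    linarith
  have hsum : (∫⁻ y in Ω, ‖v y‖ₑ ^ 4) + ∑ i, ∫⁻ y in Ω, ‖pd i v y‖ₑ ^ 4 ≤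
      (1 + d) * ENNReal.ofReal (C4 * (1 + d) * N) ^ 4 := by
    rw [add_mul, one_mul]
    refine add_le_add (hfour v (hv.mono one_le_two) (norm_le_normH hΩ 2 v)
      (gradSum_le_normH v one_le_two)) ?_
    refine (Finset.sum_le_sum (g := fun _ => ENNReal.ofReal (C4 * (1 + d) * N) ^ 4)
      fun i _ => ?_).trans (by simp)
    exact hfour _ (hv.pd i) (norm_pd_le_normH i one_le_two v) (gradSum_pd_le hΩ hv i)
  have hae : ∀ᵐ x ∂(volume.restrict Ω), ‖v x‖ₑ ≤
      A ^ (1 / 4 : ℝ) * ENNReal.ofReal (C4 * (1 + d) * N) := by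
    have hall : ∀ᵐ x ∂volume, ∀ S ∈ 𝒮, x ∈ interior S → ‖v x‖ₑ ^ 4 ≤
        K S * ((∫⁻ y in Ω, ‖v y‖ₑ ^ 4) + ∑ i, ∫⁻ y in Ω, ‖pd i v y‖ₑ ^ 4) := by
      rw [ae_ball_iff hfin.countable]
      intro S hS
      rw [← ae_restrict_iff' isOpen_interior.measurableSet]
      exact hKv S hS v (hv.mono one_le_two)
    filter_upwards [hcov, ae_restrict_of_ae hall] with x hx hxa
    simp only [mem_iUnion, exists_prop] at hx
    obtain ⟨S, hS, hxS⟩ := hx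
    have h1 : ‖v x‖ₑ ^ 4 ≤ A * ENNReal.ofReal (C4 * (1 + d) * N) ^ 4 := by
      refine (hxa S hS hxS).trans ?_
      rw [mul_assoc]
      refine mul_le_mul' ?_ hsum
      exact Finset.single_le_sum (f := K) (fun _ _ => zero_le) (hfin.mem_toFinset.2 hS)
    have := ENNReal.rpow_le_rpow h1 (by norm_num : (0 : ℝ) ≤ 1 / 4)
    rw [ENNReal.mul_rpow_of_nonneg _ _ (by norm_num), ← ENNReal.rpow_natCast,
      ← ENNReal.rpow_natCast, ← ENNReal.rpow_mul, ← ENNReal.rpow_mul] at this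
    norm_num at this
    simpa using this
  have hle : eLpNorm v ⊤ (volume.restrict Ω) ≤
      A ^ (1 / 4 : ℝ) * ENNReal.ofReal (C4 * (1 + d) * N) := by
    rw [eLpNorm_exponent_top]
    exact eLpNormEssSup_le_of_ae_enorm_bound hae
  refine ⟨⟨Lp.aestronglyMeasurable v, hle.trans_lt (by finiteness)⟩, ?_⟩
  refine (ENNReal.toReal_mono (by finiteness) hle).trans_eq ?_
  rw [ENNReal.toReal_mul, ENNReal.toReal_ofReal (by positivity)]
  ring

end Polyhedral

/-! ### The velocity space and the trilinear form -/

section Velocity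

variable {d : ℕ} {Ω : Set (Pt d)}

/-- The velocity space `X` as a subspace of `L²(Ω)^d`. -/
def XSpace (hΩ : IsOpen Ω) : Submodule ℝ (L2V Ω) where
  carrier := {v | MemX v}
  add_mem' hv hw := fun i => (hv i).add hΩ (hw i)
  zero_mem' := fun _ => memH10_zero hΩ
  smul_mem' c _ hv := fun i => (hv i).smul hΩ c

/-- The Hilbert space of matrix fields in `L²(Ω)`. -/
abbrev L2M {d : ℕ} (Ω : Set (Pt d)) := PiLp 2 (fun _ : Fin d × Fin d => L2 Ω)

/-- The gradient; the entry `(k, i)` is `∂_i v_k`. -/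
noncomputable def gradV (v : L2V Ω) : L2M Ω := WithLp.toLp 2 fun ki => pd ki.2 (v ki.1)

theorem inner_gradV (v w : L2V Ω) : inner ℝ (gradV v) (gradV w) = gradInner v w := by
  rw [PiLp.inner_apply, Fintype.sum_prod_type]
  rfl

theorem norm_gradV (v : L2V Ω) : ‖gradV v‖ = gradNorm v := by
  rw [gradNorm, ← inner_gradV, real_inner_self_eq_norm_sq, Real.sqrt_sq (norm_nonneg _)]

/-- The gradient as a linear map on `X`. -/
noncomputable def gradX (hΩ : IsOpen Ω) : XSpace hΩ →ₗ[ℝ] L2M Ω where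
  toFun v := gradV v
  map_add' v w := by
    ext1 ki
    exact pd_add hΩ ki.2 (v.2 ki.1).1 (w.2 ki.1).1
  map_smul' c v := by
    ext1 ki
    exact pd_smul hΩ ki.2 c (v.2 ki.1).1

theorem gradX_apply (hΩ : IsOpen Ω) (v : XSpace hΩ) : gradX hΩ v = gradV (v : L2V Ω) := rfl

theorem norm_pd_le (v : L2V Ω) (k i : Fin d) : ‖pd i (v k)‖ ≤ ‖gradV v‖ :=
  PiLp.norm_apply_le (gradV v) (k, i)

theorem gradSum_le (v : L2V Ω) (k : Fin d) : gradSum (v k) ≤ d * ‖gradV v‖ :=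
  (Finset.sum_le_sum (g := fun _ => ‖gradV v‖) fun i _ => norm_pd_le v k i).trans (by simp)

theorem norm_comp_le (v : L2V Ω) (k : Fin d) : ‖v k‖ ≤ ‖v‖ := PiLp.norm_apply_le v k

theorem semiSqH_one (v : L2 Ω) : semiSqH 1 v = ∑ i, ‖pd i v‖ ^ 2 := by
  refine Fintype.sum_equiv (Equiv.funUnique (Fin 1) (Fin d)) _ _ fun a => ?_
  have : a = ![a 0] := by
    funext j
    fin_cases j
    rfl
  rw [pd]
  conv_lhs => rw [this]
  rfl

theorem norm_gradV_sq (v : L2V Ω) : ‖gradV v‖ ^ 2 = ∑ k, ∑ i, ‖pd i (v k)‖ ^ 2 := by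
  rw [PiLp.norm_sq_eq_of_L2, Fintype.sum_prod_type]
  rfl

theorem semiHV_one (v : L2V Ω) : semiHV 1 v = ‖gradV v‖ := by
  rw [semiHV, ← Real.sqrt_sq (norm_nonneg (gradV v)), norm_gradV_sq]
  simp only [semiSqH_one]

theorem normHV_sq (ℓ : ℕ) (v : L2V Ω) : normHV ℓ v ^ 2 = ∑ i, normH ℓ (v i) ^ 2 :=
  Real.sq_sqrt (Finset.sum_nonneg fun _ _ => sq_nonneg _)

theorem normHV_nonneg (ℓ : ℕ) (v : L2V Ω) : 0 ≤ normHV ℓ v := Real.sqrt_nonneg _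

theorem normHV_one_sq (hΩ : IsOpen Ω) (v : L2V Ω) :
    normHV 1 v ^ 2 = ‖v‖ ^ 2 + ‖gradV v‖ ^ 2 := by
  rw [normHV_sq, norm_gradV_sq, PiLp.norm_sq_eq_of_L2, ← Finset.sum_add_distrib]
  refine Finset.sum_congr rfl fun i _ => ?_
  rw [normH_sq, Finset.sum_range_succ, Finset.sum_range_one, semiSqH_one, semiSqH]
  simp [weakDeriv_nil hΩ]

theorem norm_gradV_le_normHV (hΩ : IsOpen Ω) (v : L2V Ω) : ‖gradV v‖ ≤ normHV 1 v := by
  refine le_of_sq_le_sq ?_ (normHV_nonneg _ _)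
  rw [normHV_one_sq hΩ]
  nlinarith [norm_nonneg v]

theorem normHV_one_le (hΩ : IsOpen Ω) (v : L2V Ω) : normHV 1 v ≤ ‖v‖ + ‖gradV v‖ := by
  refine le_of_sq_le_sq ?_ (by positivity)
  rw [normHV_one_sq hΩ]
  nlinarith [norm_nonneg v, norm_nonneg (gradV v)]

theorem normH_le_normHV (ℓ : ℕ) (v : L2V Ω) (k : Fin d) : normH ℓ (v k) ≤ normHV ℓ v := by
  refine le_of_sq_le_sq ?_ (normHV_nonneg _ _)
  rw [normHV_sq]
  exact Finset.single_le_sum (f := fun k => normH ℓ (v k) ^ 2) (fun _ _ => sq_nonneg _)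
    (Finset.mem_univ k)

theorem normHV_le_of_forall {ℓ : ℕ} {v : L2V Ω} {B : ℝ} (hB : 0 ≤ B)
    (h : ∀ k, normH ℓ (v k) ≤ B) : normHV ℓ v ≤ d * B := by
  refine le_of_sq_le_sq ?_ (by positivity)
  rw [normHV_sq]
  calc ∑ i, normH ℓ (v i) ^ 2 ≤ ∑ _i : Fin d, B ^ 2 :=
        Finset.sum_le_sum fun i _ => pow_le_pow_left₀ (normH_nonneg _ _) (h i) 2
    _ = d * B ^ 2 := by simp
    _ ≤ (d : ℝ) ^ 2 * B ^ 2 := by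
        gcongr
        exact_mod_cast Nat.le_self_pow two_ne_zero d
    _ = _ := by ring

theorem semiHV_le_normHV (ℓ : ℕ) (v : L2V Ω) : semiHV ℓ v ≤ normHV ℓ v :=
  Real.sqrt_le_sqrt (Finset.sum_le_sum fun _ _ => semiSqH_le_normH_sq le_rfl _)

/-- The trilinear form `((u · ∇) v, w)` as a sum of integrals of products. -/
noncomputable def triSum (u v w : L2V Ω) : ℝ := ∑ k, ∑ i, tri (pd i (v k)) (u i) (w k)

theorem memLp_six (hd : d = 2 ∨ d = 3) (hP : IsPolyhedral Ω) {v : L2 Ω} (hv : MemH10 v) :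
    MemLp v 6 (volume.restrict Ω) := by
  obtain ⟨C, -, hC⟩ := exists_lpn_six_le hd hP.isOpen hP.isBounded
  exact (hC v hv).1

theorem memLp_three (hd : d = 2 ∨ d = 3) (hP : IsPolyhedral Ω) {v : L2 Ω} (hv : MemH10 v) :
    MemLp v 3 (volume.restrict Ω) :=
  (lpn_three_sq_le (memLp_six hd hP hv)).1

/-- The integrals of the single products exist, since `H^1_0(Ω)` embeds into `L⁶` and `L³`. -/
theorem convec_eq (hd : d = 2 ∨ d = 3) (hP : IsPolyhedral Ω) {u v w : L2V Ω} (hu : MemX u)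
    (hw : MemX w) : convec u v w = triSum u v w := by
  rw [convec, triSum]
  have e : ∀ x, ∑ k, ∑ i, u i x * pd i (v k) x * w k x =
      ∑ k, ∑ i, pd i (v k) x * (u i x * w k x) := fun x =>
    Finset.sum_congr rfl fun k _ => Finset.sum_congr rfl fun i _ => by ring
  simp only [e]
  have hint : ∀ k i, Integrable (fun x => pd i (v k) x * (u i x * w k x)) (volume.restrict Ω) :=
    fun k i => tri_integrable (p := 6) (q := 3) _ (memLp_six hd hP (hu i))
      (memLp_three hd hP (hw k))
  rw [integral_finsetSum _ fun k _ => integrable_finsetSum _ fun i _ => hint k i]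
  refine Finset.sum_congr rfl fun k _ => ?_
  rw [integral_finsetSum _ fun i _ => hint k i]
  rfl

theorem trib_eq (hd : d = 2 ∨ d = 3) (hP : IsPolyhedral Ω) {u v w : L2V Ω} (hu : MemX u)
    (hv : MemX v) (hw : MemX w) :
    trib u v w = 1 / 2 * triSum u v w - 1 / 2 * triSum u w v := by
  rw [trib, convec_eq hd hP hu hw, convec_eq hd hP hu hv]

section Bundled

variable (hd : d = 2 ∨ d = 3) (hP : IsPolyhedral Ω)

include hd hP

theorem triSum_add_left {u u' v w : L2V Ω} (hu : MemX u) (hu' : MemX u') (hw : MemX w) :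
    triSum (u + u') v w = triSum u v w + triSum u' v w := by
  simp only [triSum, ← Finset.sum_add_distrib]
  exact Finset.sum_congr rfl fun k _ => Finset.sum_congr rfl fun i _ =>
    tri_add_middle (p := 6) (q := 3) _ (memLp_six hd hP (hu i)) (memLp_six hd hP (hu' i))
      (memLp_three hd hP (hw k))

theorem triSum_add_right {u v w w' : L2V Ω} (hu : MemX u) (hw : MemX w) (hw' : MemX w') :
    triSum u v (w + w') = triSum u v w + triSum u v w' := by
  simp only [triSum, ← Finset.sum_add_distrib]
  exact Finset.sum_congr rfl fun k _ => Finset.sum_congr rfl fun i _ =>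
    tri_add_right (p := 6) (q := 3) _ (memLp_six hd hP (hu i)) (memLp_three hd hP (hw k))
      (memLp_three hd hP (hw' k))

theorem triSum_add_middle {u v v' w : L2V Ω} (hu : MemX u) (hv : MemX v) (hv' : MemX v')
    (hw : MemX w) : triSum u (v + v') w = triSum u v w + triSum u v' w := by
  simp only [triSum, ← Finset.sum_add_distrib]
  refine Finset.sum_congr rfl fun k _ => Finset.sum_congr rfl fun i _ => ?_
  rw [show pd i ((v + v') k) = pd i (v k) + pd i (v' k) from
    pd_add hP.isOpen i (hv k).1 (hv' k).1]
  exact tri_add_left (p := 6) (q := 3) _ _ (memLp_six hd hP (hu i)) (memLp_three hd hP (hw k))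

omit hd hP in
theorem triSum_smul_left (c : ℝ) (u v w : L2V Ω) : triSum (c • u) v w = c * triSum u v w := by
  simp only [triSum, Finset.mul_sum]
  exact Finset.sum_congr rfl fun k _ => Finset.sum_congr rfl fun i _ => tri_smul_middle c _ _ _

omit hd hP in
theorem triSum_smul_right (c : ℝ) (u v w : L2V Ω) : triSum u v (c • w) = c * triSum u v w := by
  simp only [triSum, Finset.mul_sum]
  exact Finset.sum_congr rfl fun k _ => Finset.sum_congr rfl fun i _ => tri_smul_right c _ _ _

omit hd in
theorem triSum_smul_middle (c : ℝ) {u v w : L2V Ω} (hv : MemX v) :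
    triSum u (c • v) w = c * triSum u v w := by
  simp only [triSum, Finset.mul_sum]
  refine Finset.sum_congr rfl fun k _ => Finset.sum_congr rfl fun i _ => ?_
  rw [show pd i ((c • v) k) = c • pd i (v k) from pd_smul hP.isOpen i c (hv k).1]
  exact tri_smul_left c _ _ _

/-- The skew-symmetric form `b` as a trilinear map on `X`. -/
noncomputable def tribX :
    XSpace hP.isOpen →ₗ[ℝ] XSpace hP.isOpen →ₗ[ℝ] XSpace hP.isOpen →ₗ[ℝ] ℝ :=
  LinearMap.mk₂ ℝ (fun u v =>
    { toFun := fun w => trib (u : L2V Ω) v w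
      map_add' := fun w w' => by
        simp only [Submodule.coe_add]
        rw [trib_eq hd hP u.2 v.2 w.2, trib_eq hd hP u.2 v.2 w'.2,
          trib_eq hd hP u.2 v.2 ((XSpace hP.isOpen).add_mem w.2 w'.2),
          triSum_add_right hd hP u.2 w.2 w'.2, triSum_add_middle hd hP u.2 w.2 w'.2 v.2]
        ring
      map_smul' := fun c w => by
        simp only [Submodule.coe_smul, RingHom.id_apply, smul_eq_mul]
        rw [trib_eq hd hP u.2 v.2 w.2, trib_eq hd hP u.2 v.2 ((XSpace hP.isOpen).smul_mem c w.2),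
          triSum_smul_right, triSum_smul_middle hP c w.2]
        ring })
    (fun u u' v => by
      ext w
      simp only [LinearMap.coe_mk, AddHom.coe_mk, LinearMap.add_apply, Submodule.coe_add]
      rw [trib_eq hd hP u.2 v.2 w.2, trib_eq hd hP u'.2 v.2 w.2,
        trib_eq hd hP ((XSpace hP.isOpen).add_mem u.2 u'.2) v.2 w.2,
        triSum_add_left hd hP u.2 u'.2 w.2, triSum_add_left hd hP u.2 u'.2 v.2]
      ring)
    (fun c u v => by
      ext w
      simp only [LinearMap.coe_mk, AddHom.coe_mk, LinearMap.smul_apply, Submodule.coe_smul,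
        smul_eq_mul]
      rw [trib_eq hd hP u.2 v.2 w.2, trib_eq hd hP ((XSpace hP.isOpen).smul_mem c u.2) v.2 w.2,
        triSum_smul_left, triSum_smul_left]
      ring)
    (fun u v v' => by
      ext w
      simp only [LinearMap.coe_mk, AddHom.coe_mk, LinearMap.add_apply, Submodule.coe_add]
      rw [trib_eq hd hP u.2 v.2 w.2, trib_eq hd hP u.2 v'.2 w.2,
        trib_eq hd hP u.2 ((XSpace hP.isOpen).add_mem v.2 v'.2) w.2,
        triSum_add_middle hd hP u.2 v.2 v'.2 w.2, triSum_add_right hd hP u.2 v.2 v'.2]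
      ring)
    (fun c u v => by
      ext w
      simp only [LinearMap.coe_mk, AddHom.coe_mk, LinearMap.smul_apply, Submodule.coe_smul,
        smul_eq_mul]
      rw [trib_eq hd hP u.2 v.2 w.2, trib_eq hd hP u.2 ((XSpace hP.isOpen).smul_mem c v.2) w.2,
        triSum_smul_middle hP c v.2, triSum_smul_right]
      ring)

omit hd hP in
theorem trib_antisymm (u v w : L2V Ω) : trib u v w = - trib u w v := by
  rw [trib, trib]
  ring

/-- Integration by parts in the convective term. -/
theorem triSum_add_swap {u v w : L2V Ω} (hu : MemX u) (hv : MemX v) (hw : MemX w) :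
    triSum u v w + triSum u w v = - ∑ k, ∑ i, tri (pd i (u i)) (v k) (w k) := by
  simp only [triSum, ← Finset.sum_add_distrib, ← Finset.sum_neg_distrib]
  refine Finset.sum_congr rfl fun k _ => Finset.sum_congr rfl fun i _ => ?_
  linarith [tri_pd_add hd hP.isOpen hP.isBounded i (hu i) (hv k) (hw k)]

/-- The form `b` without derivatives of its last argument. -/
theorem trib_eq_sum {u v w : L2V Ω} (hu : MemX u) (hv : MemX v) (hw : MemX w) :
    trib u v w = ∑ k, ∑ i,
      (tri (pd i (v k)) (u i) (w k) + 1 / 2 * tri (pd i (u i)) (v k) (w k)) := by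
  have h := triSum_add_swap hd hP hu hv hw
  rw [trib_eq hd hP hu hv hw]
  simp only [Finset.sum_add_distrib, ← Finset.mul_sum]
  change _ = triSum u v w + _
  linarith

/-- For a solenoidal first argument the form `b` is the convective term. -/
theorem convec_eq_trib {u v w : L2V Ω} (hu : MemX u) (hv : MemX v) (hw : MemX w)
    (hdiv : divg u = 0) : convec u v w = trib u v w := by
  have h := triSum_add_swap hd hP hu hv hw
  have hz : ∀ k, ∑ i, tri (pd i (u i)) (v k) (w k) = 0 := by
    intro k
    have e : ∀ s : Finset (Fin d), tri (∑ i ∈ s, pd i (u i)) (v k) (w k) =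
        ∑ i ∈ s, tri (pd i (u i)) (v k) (w k) := by
      intro s
      induction s using Finset.induction_on with
      | empty => simpa using tri_smul_left 0 (0 : L2 Ω) (v k) (w k)
      | insert a s ha ih =>
        rw [Finset.sum_insert ha, Finset.sum_insert ha, ← ih]
        exact tri_add_left (p := 6) (q := 3) _ _ (memLp_six hd hP (hv k))
          (memLp_three hd hP (hw k))
    rw [← e]
    have : (∑ i, pd i (u i)) = 0 := hdiv
    rw [this]
    simpa using tri_smul_left 0 (0 : L2 Ω) (v k) (w k)
  simp only [hz, Finset.sum_const_zero, neg_zero] at h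
  rw [convec_eq hd hP hu hw, trib_eq hd hP hu hv hw]
  linarith

end Bundled

theorem abs_double_sum_le {F : Fin d → Fin d → ℝ} {B : ℝ} (h : ∀ k i, |F k i| ≤ B) :
    |∑ k, ∑ i, F k i| ≤ (d : ℝ) ^ 2 * B := by
  calc |∑ k, ∑ i, F k i| ≤ ∑ k, ∑ i, |F k i| :=
        (Finset.abs_sum_le_sum_abs _ _).trans
          (Finset.sum_le_sum fun k _ => Finset.abs_sum_le_sum_abs _ _)
    _ ≤ ∑ _k : Fin d, ∑ _i : Fin d, B :=
        Finset.sum_le_sum fun k _ => Finset.sum_le_sum fun i _ => h k i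
    _ = _ := by
        simp
        ring

/-- The form `b` is bounded on `X`, with a bound that is sharp in the last argument. -/
theorem exists_trib_bound (hd : d = 2 ∨ d = 3) (hP : IsPolyhedral Ω) :
    ∃ C : ℝ, 0 < C ∧ ∀ u v w : L2V Ω, MemX u → MemX v → MemX w →
      ‖w‖ ≤ C * ‖gradV w‖ ∧
      |trib u v w| ≤ C * (‖gradV u‖ * ‖gradV v‖ * Real.sqrt (‖w‖ * ‖gradV w‖)) ∧
      |trib u v w| ≤ C * (‖gradV u‖ * ‖gradV v‖ * ‖gradV w‖) := by
  obtain ⟨A, hA0, hA⟩ := exists_lpn_six_le hd hP.isOpen hP.isBounded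
  obtain ⟨P, hP0, hPo⟩ := exists_poincare hd hP.isOpen hP.isBounded
  set a : ℝ := A * d
  have ha : 0 ≤ a := by positivity
  have h6 : ∀ v : L2V Ω, MemX v → ∀ k, lpn 6 (v k) ≤ a * ‖gradV v‖ := fun v hv k => by
    refine (hA _ (hv k)).2.trans ?_
    rw [mul_assoc]
    exact mul_le_mul_of_nonneg_left (gradSum_le v k) hA0
  have hnorm : ∀ v : L2V Ω, MemX v → ‖v‖ ≤ d * (P * (d * ‖gradV v‖)) := fun v hv => by
    have h1 : ∀ k, ‖v k‖ ≤ P * (d * ‖gradV v‖) := fun k =>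
      (hPo _ (hv k)).trans (mul_le_mul_of_nonneg_left (gradSum_le v k) hP0)
    refine le_of_sq_le_sq ?_ (by positivity)
    rw [PiLp.norm_sq_eq_of_L2]
    calc ∑ i, ‖v i‖ ^ 2 ≤ ∑ _i : Fin d, (P * (d * ‖gradV v‖)) ^ 2 :=
          Finset.sum_le_sum fun i _ => pow_le_pow_left₀ (norm_nonneg _) (h1 i) 2
      _ = d * (P * (d * ‖gradV v‖)) ^ 2 := by simp
      _ ≤ (d : ℝ) ^ 2 * (P * (d * ‖gradV v‖)) ^ 2 := by
          gcongr
          exact_mod_cast Nat.le_self_pow two_ne_zero d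
      _ = _ := by ring
  set p : ℝ := d * (P * d)
  have hp : 0 ≤ p := by positivity
  have hnorm' : ∀ v : L2V Ω, MemX v → ‖v‖ ≤ p * ‖gradV v‖ := fun v hv =>
    (hnorm v hv).trans_eq (by simp only [p]; ring)
  have h3 : ∀ v : L2V Ω, MemX v → ∀ k, lpn 3 (v k) ≤ √a * √(‖v‖ * ‖gradV v‖) := fun v hv k => by
    rw [← Real.sqrt_mul ha]
    refine Real.le_sqrt_of_sq_le ?_
    refine (lpn_three_sq_le (memLp_six hd hP (hv k))).2.trans ?_
    calc ‖v k‖ * lpn 6 (v k) ≤ ‖v‖ * (a * ‖gradV v‖) :=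
          mul_le_mul (norm_comp_le v k) (h6 v hv k) (lpn_nonneg _ _) (norm_nonneg _)
      _ = _ := by ring
  set q : ℝ := (d : ℝ) ^ 2 * (2 * (a * √a))
  have hq : 0 ≤ q := by positivity
  have main : ∀ u v w : L2V Ω, MemX u → MemX v → MemX w →
      |trib u v w| ≤ q * (‖gradV u‖ * ‖gradV v‖ * √(‖w‖ * ‖gradV w‖)) := by
    intro u v w hu hv hw
    rw [trib_eq_sum hd hP hu hv hw]
    set s := √(‖w‖ * ‖gradV w‖)
    refine (abs_double_sum_le (B := 2 * (a * √a) * (‖gradV u‖ * ‖gradV v‖ * s))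
      fun k i => ?_).trans_eq (by simp only [q]; ring)
    have t1 : |tri (pd i (v k)) (u i) (w k)| ≤ ‖gradV v‖ * ((a * ‖gradV u‖) * (√a * s)) :=
      (abs_tri_le (p := 6) (q := 3) _ (memLp_six hd hP (hu i)) (memLp_three hd hP (hw k))).trans
        (mul_le_mul (norm_pd_le v k i) (mul_le_mul (h6 u hu i) (h3 w hw k) (lpn_nonneg _ _)
          (by positivity)) (mul_nonneg (lpn_nonneg _ _) (lpn_nonneg _ _)) (by positivity))
    have t2 : |tri (pd i (u i)) (v k) (w k)| ≤ ‖gradV u‖ * ((a * ‖gradV v‖) * (√a * s)) :=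
      (abs_tri_le (p := 6) (q := 3) _ (memLp_six hd hP (hv k)) (memLp_three hd hP (hw k))).trans
        (mul_le_mul (norm_pd_le u i i) (mul_le_mul (h6 v hv k) (h3 w hw k) (lpn_nonneg _ _)
          (by positivity)) (mul_nonneg (lpn_nonneg _ _) (lpn_nonneg _ _)) (by positivity))
    refine (abs_add_le _ _).trans ?_
    rw [abs_mul, abs_of_pos (by norm_num : (0 : ℝ) < 1 / 2)]
    have := abs_nonneg (tri (pd i (u i)) (v k) (w k))
    nlinarith
  refine ⟨p + q + q * √p + 1, by positivity, fun u v w hu hv hw => ⟨?_, ?_, ?_⟩⟩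
  · refine (hnorm' w hw).trans (mul_le_mul_of_nonneg_right ?_ (norm_nonneg _))
    have : 0 ≤ q * √p := by positivity
    linarith
  · refine (main u v w hu hv hw).trans (mul_le_mul_of_nonneg_right ?_ (by positivity))
    have : 0 ≤ q * √p := by positivity
    linarith
  · have hs : √(‖w‖ * ‖gradV w‖) ≤ √p * ‖gradV w‖ := by
      refine Real.sqrt_le_iff.2 ⟨by positivity, ?_⟩
      rw [mul_pow, Real.sq_sqrt hp]
      nlinarith [hnorm' w hw, norm_nonneg (gradV w)]
    refine (main u v w hu hv hw).trans ?_
    calc q * (‖gradV u‖ * ‖gradV v‖ * √(‖w‖ * ‖gradV w‖))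
        ≤ q * (‖gradV u‖ * ‖gradV v‖ * (√p * ‖gradV w‖)) := by gcongr
      _ = (q * √p) * (‖gradV u‖ * ‖gradV v‖ * ‖gradV w‖) := by ring
      _ ≤ _ := by
          refine mul_le_mul_of_nonneg_right ?_ (by positivity)
          linarith

/-- Bounds of the form `b` when one argument belongs to `H²(Ω)`. -/
theorem exists_trib_bound_two (hd : d = 2 ∨ d = 3) (hP : IsPolyhedral Ω) :
    ∃ C : ℝ, 0 < C ∧ ∀ z u v : L2V Ω, MemX z → MemHV 2 z → MemX u → MemX v →
      |trib u z v| ≤ C * normHV 2 z * (‖gradV u‖ * ‖v‖) ∧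
      |trib z u v| ≤ C * normHV 2 z * (‖gradV u‖ * ‖v‖) ∧
      |trib u z v| ≤ C * normHV 2 z * (‖u‖ * ‖gradV v‖) := by
  have hd3 : d ≤ 3 := by omega
  obtain ⟨A, hA0, hA⟩ := hP.exists_lpn_four_le hd3
  obtain ⟨L, hL0, hL⟩ := hP.exists_lpn_top_le hd3
  obtain ⟨P, hP0, hPo⟩ := exists_poincare hd hP.isOpen hP.isBounded
  set a : ℝ := A * (P * d + d)
  have ha : 0 ≤ a := by positivity
  have h4 : ∀ u : L2V Ω, MemX u → ∀ k, MemLp (u k) 4 (volume.restrict Ω) ∧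
      lpn 4 (u k) ≤ a * ‖gradV u‖ := fun u hu k => by
    obtain ⟨h1, h2⟩ := hA _ (hu k).1
    refine ⟨h1, h2.trans ?_⟩
    have h3 := hPo _ (hu k)
    have h4 := gradSum_le u k
    calc A * (‖u k‖ + gradSum (u k)) ≤ A * (P * (d * ‖gradV u‖) + d * ‖gradV u‖) := by
          gcongr
          exact h3.trans (mul_le_mul_of_nonneg_left h4 hP0)
      _ = _ := by simp only [a]; ring
  set c : ℝ := A * (1 + d)
  have hc : 0 ≤ c := by positivity
  have hder : ∀ z : L2V Ω, MemHV 2 z → ∀ k i, MemLp (pd i (z k)) 4 (volume.restrict Ω) ∧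
      lpn 4 (pd i (z k)) ≤ c * normHV 2 z := fun z hz k i => by
    obtain ⟨h1, h2⟩ := hA _ ((hz k).pd i)
    refine ⟨h1, h2.trans ?_⟩
    have h3 := norm_pd_le_normH i one_le_two (z k)
    have h4 := gradSum_pd_le hP.isOpen (hz k) i
    have h5 := normH_le_normHV 2 z k
    calc A * (‖pd i (z k)‖ + gradSum (pd i (z k)))
        ≤ A * (normHV 2 z + d * normHV 2 z) := by
          gcongr
          · exact h3.trans h5
          · exact h4.trans (by gcongr)
      _ = _ := by simp only [c]; ring
  have htop : ∀ z : L2V Ω, MemHV 2 z → ∀ k, MemLp (z k) ⊤ (volume.restrict Ω) ∧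
      lpn ⊤ (z k) ≤ L * normHV 2 z := fun z hz k =>
    ⟨(hL _ (hz k)).1, (hL _ (hz k)).2.trans
      (mul_le_mul_of_nonneg_left (normH_le_normHV 2 z k) hL0)⟩
  -- products containing a factor in `L^∞` or two factors in `L⁴`
  have pinf : ∀ z : L2V Ω, MemHV 2 z → ∀ (k : Fin d) (x y : L2 Ω) (X Y : ℝ), ‖x‖ ≤ X → ‖y‖ ≤ Y →
      |tri x (z k) y| ≤ L * normHV 2 z * (X * Y) := by
    intro z hz k x y X Y hx hy
    have hX : 0 ≤ X := (norm_nonneg _).trans hx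
    have hY : 0 ≤ Y := (norm_nonneg _).trans hy
    refine (abs_tri_le (p := ⊤) (q := 2) x (htop z hz k).1 (Lp.memLp y)).trans ?_
    rw [lpn_two]
    have hN := normHV_nonneg 2 z
    calc ‖x‖ * (lpn ⊤ (z k) * ‖y‖) ≤ X * (L * normHV 2 z * Y) :=
          mul_le_mul hx (mul_le_mul (htop z hz k).2 hy (norm_nonneg _) (by positivity))
            (mul_nonneg (lpn_nonneg _ _) (norm_nonneg _)) hX
      _ = _ := by ring
  have pfour : ∀ z : L2V Ω, MemHV 2 z → ∀ u : L2V Ω, MemX u → ∀ (k i j : Fin d) (x : L2 Ω) (X : ℝ),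
      ‖x‖ ≤ X → |tri x (u j) (pd i (z k))| ≤ a * c * normHV 2 z * (‖gradV u‖ * X) := by
    intro z hz u hu k i j x X hx
    have hX : 0 ≤ X := (norm_nonneg _).trans hx
    refine (abs_tri_le (p := 4) (q := 4) x (h4 u hu j).1 (hder z hz k i).1).trans ?_
    have hN := normHV_nonneg 2 z
    calc ‖x‖ * (lpn 4 (u j) * lpn 4 (pd i (z k)))
        ≤ X * ((a * ‖gradV u‖) * (c * normHV 2 z)) :=
          mul_le_mul hx (mul_le_mul (h4 u hu j).2 (hder z hz k i).2 (lpn_nonneg _ _)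
            (by positivity)) (mul_nonneg (lpn_nonneg _ _) (lpn_nonneg _ _)) hX
      _ = _ := by ring
  refine ⟨(d : ℝ) ^ 2 * (L + a * c) + 1, by positivity, fun z u v hz hz2 hu hv => ?_⟩
  have hN := normHV_nonneg 2 z
  have fin : ∀ {F : Fin d → Fin d → ℝ} {Y : ℝ}, 0 ≤ Y →
      (∀ k i, |F k i| ≤ (L + a * c) * (normHV 2 z * Y)) →
      |∑ k, ∑ i, F k i| ≤ ((d : ℝ) ^ 2 * (L + a * c) + 1) * normHV 2 z * Y := by
    intro F Y hY hF
    refine (abs_double_sum_le hF).trans ?_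
    have : 0 ≤ normHV 2 z * Y := by positivity
    nlinarith
  refine ⟨?_, ?_, ?_⟩
  · rw [trib_eq_sum hd hP hu hz hv]
    refine fin (by positivity) fun k i => ?_
    have t1 : |tri (pd i (z k)) (u i) (v k)| ≤ a * c * normHV 2 z * (‖gradV u‖ * ‖v‖) := by
      rw [tri_comm, tri_left_comm, tri_comm]
      exact pfour z hz2 u hu k i i _ _ (norm_comp_le v k)
    have t2 : |tri (pd i (u i)) (z k) (v k)| ≤ L * normHV 2 z * (‖gradV u‖ * ‖v‖) :=
      pinf z hz2 k _ _ _ _ (norm_pd_le u i i) (norm_comp_le v k)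
    refine (abs_add_le _ _).trans ?_
    rw [abs_mul, abs_of_pos (by norm_num : (0 : ℝ) < 1 / 2)]
    have := abs_nonneg (tri (pd i (u i)) (z k) (v k))
    linarith
  · rw [trib_eq_sum hd hP hz hu hv]
    refine fin (by positivity) fun k i => ?_
    have t1 : |tri (pd i (u k)) (z i) (v k)| ≤ L * normHV 2 z * (‖gradV u‖ * ‖v‖) :=
      pinf z hz2 i _ _ _ _ (norm_pd_le u k i) (norm_comp_le v k)
    have t2 : |tri (pd i (z i)) (u k) (v k)| ≤ a * c * normHV 2 z * (‖gradV u‖ * ‖v‖) := by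
      rw [tri_comm, tri_left_comm, tri_comm]
      exact pfour z hz2 u hu i i k _ _ (norm_comp_le v k)
    refine (abs_add_le _ _).trans ?_
    rw [abs_mul, abs_of_pos (by norm_num : (0 : ℝ) < 1 / 2)]
    have := abs_nonneg (tri (pd i (z i)) (u k) (v k))
    linarith
  · have e : trib u z v = ∑ k, ∑ i, (1 / 2 * tri (pd i (z k)) (u i) (v k)
        - 1 / 2 * tri (pd i (v k)) (u i) (z k)) := by
      rw [trib_eq hd hP hu hz hv]
      simp only [Finset.sum_sub_distrib, ← Finset.mul_sum]
      rfl
    rw [e]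
    refine fin (by positivity) fun k i => ?_
    have t1 : |tri (pd i (z k)) (u i) (v k)| ≤ a * c * normHV 2 z * (‖u‖ * ‖gradV v‖) := by
      rw [tri_left_comm, tri_comm, mul_comm ‖u‖]
      exact pfour z hz2 v hv k i k _ _ (norm_comp_le u i)
    have t2 : |tri (pd i (v k)) (u i) (z k)| ≤ L * normHV 2 z * (‖u‖ * ‖gradV v‖) := by
      rw [tri_comm, mul_comm ‖u‖]
      exact pinf z hz2 k _ _ _ _ (norm_pd_le v k i) (norm_comp_le u i)
    refine (abs_sub _ _).trans ?_
    rw [abs_mul, abs_mul, abs_of_pos (by norm_num : (0 : ℝ) < 1 / 2)]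
    have h1 := abs_nonneg (tri (pd i (z k)) (u i) (v k))
    have h2 := abs_nonneg (tri (pd i (v k)) (u i) (z k))
    linarith

end Velocity

/-! ### Taylor remainders of time-dependent functions -/

section Time

variable {d : ℕ} {Ω : Set (Pt d)}

/-- `z` is dominated by `c ∫_a^b |w|` in the weak sense, i.e. after the application of any continuous
linear functional. This is inherited by all Sobolev norms. -/
def WeakDom (c : ℝ) (w : ℝ → L2 Ω) (a b : ℝ) (z : L2 Ω) : Prop :=
  ∀ Λ : L2 Ω →L[ℝ] ℝ, |Λ z| ≤ c * ∫ s in a..b, |Λ (w s)|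

theorem WeakDom.add {c c' a b : ℝ} {w : ℝ → L2 Ω} {z z' : L2 Ω} (h : WeakDom c w a b z)
    (h' : WeakDom c' w a b z') : WeakDom (c + c') w a b (z + z') := fun Λ => by
  rw [map_add, add_mul]
  exact (abs_add_le _ _).trans (add_le_add (h Λ) (h' Λ))

theorem WeakDom.smul {c a b : ℝ} {w : ℝ → L2 Ω} {z : L2 Ω} (k : ℝ) (h : WeakDom c w a b z) :
    WeakDom (|k| * c) w a b (k • z) := fun Λ => by
  rw [map_smul, smul_eq_mul, abs_mul, mul_assoc]
  exact mul_le_mul_of_nonneg_left (h Λ) (abs_nonneg k)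

theorem WeakDom.mono {c c' a b : ℝ} {w : ℝ → L2 Ω} {z : L2 Ω} (hab : a ≤ b) (hc : c ≤ c')
    (h : WeakDom c w a b z) : WeakDom c' w a b z := fun Λ =>
  (h Λ).trans (mul_le_mul_of_nonneg_right hc
    (intervalIntegral.integral_nonneg hab fun _ _ => abs_nonneg _))

theorem WeakDom.sum {ι : Type*} (S : Finset ι) {c : ι → ℝ} {a b : ℝ} {w : ℝ → L2 Ω}
    {z : ι → L2 Ω} (h : ∀ i ∈ S, WeakDom (c i) w a b (z i)) :
    WeakDom (∑ i ∈ S, c i) w a b (∑ i ∈ S, z i) := fun Λ => by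
  rw [map_sum, Finset.sum_mul]
  exact (Finset.abs_sum_le_sum_abs _ _).trans (Finset.sum_le_sum fun i hi => h i hi Λ)

theorem HasTimeDeriv.intervalIntegrable {T : ℝ} {w w' : ℝ → L2 Ω} (h : HasTimeDeriv T w w')
    {a x : ℝ} (ha : 0 ≤ a) (hax : a ≤ x) (hx : x ≤ T) : IntervalIntegrable w' volume a x :=
  h.1.mono_set (by
    rw [uIcc_of_le hax, uIcc_of_le (ha.trans (hax.trans hx))]
    exact Icc_subset_Icc ha hx)

theorem HasTimeDeriv.sub_eq {T : ℝ} {w w' : ℝ → L2 Ω} (h : HasTimeDeriv T w w') {a x : ℝ}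
    (ha : 0 ≤ a) (hax : a ≤ x) (hx : x ≤ T) : w x - w a = ∫ s in a..x, w' s := by
  rw [h.2 x ⟨ha.trans hax, hx⟩, h.2 a ⟨ha, hax.trans hx⟩, add_sub_add_left_eq_sub,
    intervalIntegral.integral_interval_sub_left]
  · exact h.intervalIntegrable le_rfl (ha.trans hax) hx
  · exact h.intervalIntegrable le_rfl ha (hax.trans hx)

/-- Integration in time adds one power of the length of the interval to the constant. -/
theorem weakDom_integral {a x b c : ℝ} {w v : ℝ → L2 Ω} (hax : a ≤ x) (hxb : x ≤ b) (hc : 0 ≤ c)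
    (hv : IntervalIntegrable v volume a x) (h : ∀ s ∈ Icc a x, WeakDom c w a b (v s)) :
    WeakDom (c * (b - a)) w a b (∫ s in a..x, v s) := fun Λ => by
  rw [← ContinuousLinearMap.intervalIntegral_comp_comm Λ hv]
  have hI : 0 ≤ ∫ s in a..b, |Λ (w s)| :=
    intervalIntegral.integral_nonneg (hax.trans hxb) fun _ _ => abs_nonneg _
  have h1 := intervalIntegral.norm_integral_le_of_norm_le_const (a := a) (b := x)
    (f := fun s => Λ (v s)) (C := c * ∫ s in a..b, |Λ (w s)|) (fun s hs => by
      rw [uIoc_of_le hax] at hs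
      exact h s ⟨hs.1.le, hs.2⟩ Λ)
  rw [abs_of_nonneg (sub_nonneg.2 hax)] at h1
  refine h1.trans ?_
  have : 0 ≤ c * ∫ s in a..b, |Λ (w s)| := mul_nonneg hc hI
  nlinarith

theorem HasTimeDeriv.weakDom_one {T : ℝ} {w w' : ℝ → L2 Ω} (h : HasTimeDeriv T w w') {a x b : ℝ}
    (ha : 0 ≤ a) (hax : a ≤ x) (hxb : x ≤ b) (hb : b ≤ T) :
    WeakDom 1 w' a b (w x - w a) := fun Λ => by
  rw [h.sub_eq ha hax (hxb.trans hb), ← ContinuousLinearMap.intervalIntegral_comp_comm Λ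
    (h.intervalIntegrable ha hax (hxb.trans hb)), one_mul]
  have hi : IntervalIntegrable (fun s => |Λ (w' s)|) volume a b := by
    have := h.intervalIntegrable ha (hax.trans hxb) hb
    exact IntervalIntegrable.abs ⟨Λ.integrable_comp this.1, Λ.integrable_comp this.2⟩
  refine (intervalIntegral.abs_integral_le_integral_abs hax).trans ?_
  exact intervalIntegral.integral_mono_interval le_rfl hax hxb
    (Filter.Eventually.of_forall fun _ => abs_nonneg _) hi

theorem HasTimeDeriv.weakDom_two {T : ℝ} {w w' w'' : ℝ → L2 Ω} (h : HasTimeDeriv T w w')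
    (h' : HasTimeDeriv T w' w'') {a x b : ℝ} (ha : 0 ≤ a) (hax : a ≤ x) (hxb : x ≤ b)
    (hb : b ≤ T) : WeakDom (b - a) w'' a b (w x - w a - (x - a) • w' a) := by
  have hv := h.intervalIntegrable ha hax (hxb.trans hb)
  have e : w x - w a - (x - a) • w' a = ∫ s in a..x, (w' s - w' a) := by
    rw [intervalIntegral.integral_sub hv intervalIntegrable_const,
      intervalIntegral.integral_const, h.sub_eq ha hax (hxb.trans hb)]
  rw [e, ← one_mul (b - a)]
  exact weakDom_integral hax hxb zero_le_one (hv.sub intervalIntegrable_const)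
    fun s hs => h'.weakDom_one ha hs.1 (hs.2.trans hxb) hb

theorem HasTimeDeriv.weakDom_three {T : ℝ} {w w' w'' w''' : ℝ → L2 Ω} (h : HasTimeDeriv T w w')
    (h' : HasTimeDeriv T w' w'') (h'' : HasTimeDeriv T w'' w''') {a x b : ℝ} (ha : 0 ≤ a)
    (hax : a ≤ x) (hxb : x ≤ b) (hb : b ≤ T) :
    WeakDom ((b - a) * (b - a)) w''' a b
      (w x - w a - (x - a) • w' a - ((x - a) ^ 2 / 2) • w'' a) := by
  have hv := h.intervalIntegrable ha hax (hxb.trans hb)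
  have hl : IntervalIntegrable (fun s : ℝ => (s - a) • w'' a) volume a x :=
    (Continuous.intervalIntegrable (by fun_prop) _ _)
  have e : w x - w a - (x - a) • w' a - ((x - a) ^ 2 / 2) • w'' a
      = ∫ s in a..x, (w' s - w' a - (s - a) • w'' a) := by
    rw [intervalIntegral.integral_sub (hv.sub intervalIntegrable_const) hl,
      intervalIntegral.integral_sub hv intervalIntegrable_const,
      intervalIntegral.integral_const, h.sub_eq ha hax (hxb.trans hb),
      intervalIntegral.integral_smul_const]
    congr 2
    rw [intervalIntegral.integral_comp_sub_right (fun s => s), integral_id]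
    ring
  rw [e]
  exact weakDom_integral hax hxb (sub_nonneg.2 (hax.trans hxb))
    ((hv.sub intervalIntegrable_const).sub hl)
    fun s hs => h'.weakDom_two h'' ha hs.1 (hs.2.trans hxb) hb

/-- A combination of point values which annihilates constants is controlled by the first time
derivative. -/
theorem HasTimeDeriv.weakDom_comb_one {T : ℝ} {w w' : ℝ → L2 Ω} (h : HasTimeDeriv T w w')
    {a b : ℝ} (ha : 0 ≤ a) (hab : a ≤ b) (hb : b ≤ T) {ι : Type*} [Fintype ι] (c τ : ι → ℝ)
    (hτ : ∀ i, τ i ∈ Icc a b) (h0 : ∑ i, c i = 0) {K : ℝ} (hK : ∑ i, |c i| ≤ K) :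
    WeakDom K w' a b (∑ i, c i • w (τ i)) := by
  have e : ∑ i, c i • w (τ i) = ∑ i, c i • (w (τ i) - w a) := by
    simp only [smul_sub, Finset.sum_sub_distrib, ← Finset.sum_smul, h0, zero_smul, sub_zero]
  rw [e]
  refine WeakDom.mono hab ?_ (WeakDom.sum Finset.univ fun i _ =>
    (h.weakDom_one ha (hτ i).1 (hτ i).2 hb).smul (c i))
  simpa using hK

/-- A combination of point values which annihilates affine functions is controlled by the second
time derivative. -/
theorem HasTimeDeriv.weakDom_comb_two {T : ℝ} {w w' w'' : ℝ → L2 Ω} (h : HasTimeDeriv T w w')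
    (h' : HasTimeDeriv T w' w'')
    {a b : ℝ} (ha : 0 ≤ a) (hab : a ≤ b) (hb : b ≤ T) {ι : Type*} [Fintype ι] (c τ : ι → ℝ)
    (hτ : ∀ i, τ i ∈ Icc a b) (h0 : ∑ i, c i = 0) (h1 : ∑ i, c i * τ i = 0) {K : ℝ}
    (hK : ∑ i, |c i| ≤ K) :
    WeakDom (K * (b - a)) w'' a b (∑ i, c i • w (τ i)) := by
  have e : ∑ i, c i • w (τ i) = ∑ i, c i • (w (τ i) - w a - (τ i - a) • w' a) := by
    simp only [smul_sub, Finset.sum_sub_distrib, ← Finset.sum_smul, h0, zero_smul, sub_zero,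
      smul_smul, mul_sub, ← Finset.sum_mul, h1, zero_mul]
  rw [e]
  refine WeakDom.mono hab ?_ (WeakDom.sum Finset.univ fun i _ =>
    (h.weakDom_two h' ha (hτ i).1 (hτ i).2 hb).smul (c i))
  rw [← Finset.sum_mul]
  exact mul_le_mul_of_nonneg_right hK (sub_nonneg.2 hab)

/-- The consistency error of a difference formula that is exact on quadratic functions is controlled
by the third time derivative. -/
theorem HasTimeDeriv.weakDom_comb_three {T : ℝ} {w w' w'' w''' : ℝ → L2 Ω}
    (h : HasTimeDeriv T w w') (h' : HasTimeDeriv T w' w'') (h'' : HasTimeDeriv T w'' w''')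
    {a b : ℝ} (ha : 0 ≤ a) (hab : a ≤ b) (hb : b ≤ T) {ι : Type*} [Fintype ι] (c τ : ι → ℝ)
    (hτ : ∀ i, τ i ∈ Icc a b) {σ κ : ℝ} (hσ : σ ∈ Icc a b) (h0 : ∑ i, c i = 0)
    (h1 : ∑ i, c i * (τ i - σ) = κ) (h2 : ∑ i, c i * (τ i - σ) ^ 2 = 0) {K : ℝ}
    (hK : ∑ i, |c i| ≤ K) (hκ : |κ| ≤ K * (b - a)) :
    WeakDom (2 * K * (b - a) ^ 2) w''' a b (∑ i, c i • w (τ i) - κ • w' σ) := by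
  have e1 : ∑ i, c i * (τ i - a) = κ := by
    have : ∑ i, c i * (τ i - a) = ∑ i, (c i * (τ i - σ) + c i * (σ - a)) :=
      Finset.sum_congr rfl fun i _ => by ring
    rw [this, Finset.sum_add_distrib, h1, ← Finset.sum_mul, h0]
    ring
  have e2 : ∑ i, c i * ((τ i - a) ^ 2 / 2) = κ * (σ - a) := by
    have : ∑ i, c i * ((τ i - a) ^ 2 / 2) = ∑ i, (c i * (τ i - σ) ^ 2 * (1 / 2)
        + c i * (τ i - σ) * (σ - a) + c i * ((σ - a) ^ 2 / 2)) :=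
      Finset.sum_congr rfl fun i _ => by ring
    rw [this, Finset.sum_add_distrib, Finset.sum_add_distrib, ← Finset.sum_mul, ← Finset.sum_mul,
      ← Finset.sum_mul, h1, h0, h2]
    ring
  have e : ∑ i, c i • w (τ i) - κ • w' σ
      = ∑ i, c i • (w (τ i) - w a - (τ i - a) • w' a - ((τ i - a) ^ 2 / 2) • w'' a)
        + (-κ) • (w' σ - w' a - (σ - a) • w'' a) := by
    simp only [smul_sub, Finset.sum_sub_distrib, ← Finset.sum_smul, h0, zero_smul, sub_zero,
      smul_smul, e1, e2]
    module
  rw [e]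
  refine WeakDom.mono hab ?_ ((WeakDom.sum Finset.univ fun i _ =>
    (h.weakDom_three h' h'' ha (hτ i).1 (hτ i).2 hb).smul (c i)).add
      ((h'.weakDom_two h'' ha hσ.1 hσ.2 hb).smul (-κ)))
  rw [← Finset.sum_mul, abs_neg]
  have hba := sub_nonneg.2 hab
  nlinarith [mul_le_mul_of_nonneg_right hK (mul_nonneg hba hba),
    mul_le_mul_of_nonneg_right hκ hba]

/-- Weak domination by a function in `L²(0,T;H^ℓ)` gives a bound in `H^ℓ`. -/
theorem WeakDom.memH {T : ℝ} {ℓ : ℕ} {w : ℝ → L2 Ω} (hw : MemL2H T ℓ w) {a b c : ℝ} {z : L2 Ω}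
    (h : WeakDom c w a b z) (ha : 0 ≤ a) (hab : a ≤ b) (hb : b ≤ T) (hc : 0 ≤ c)
    (hΩ : IsOpen Ω) :
    MemH ℓ z ∧ normH ℓ z ≤
      multiCard d ℓ * (c * Real.sqrt ((b - a) * ∫ s in a..b, normH ℓ (w s) ^ 2)) := by
  have hsub : Ioo a b ⊆ Ioo 0 T := Ioo_subset_Ioo ha hb
  have hsq : IntegrableOn (fun s => normH ℓ (w s) ^ 2) (Ioo a b) := hw.2.2.mono_measure
    (Measure.restrict_mono hsub le_rfl)
  have hmem : ∀ᵐ s ∂(volume.restrict (Ioo a b)), MemH ℓ (w s) :=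
    ae_mono (Measure.restrict_mono hsub le_rfl) hw.2.1
  have hmeas : AEStronglyMeasurable w (volume.restrict (Ioo a b)) :=
    hw.1.mono_measure (Measure.restrict_mono hsub le_rfl)
  have hnm : AEStronglyMeasurable (fun s => normH ℓ (w s)) (volume.restrict (Ioo a b)) := by
    have := Real.continuous_sqrt.comp_aestronglyMeasurable hsq.1
    refine this.congr (Filter.Eventually.of_forall fun s => ?_)
    simp [Real.sqrt_sq (normH_nonneg ℓ (w s))]
  have hL2 : MemLp (fun s => normH ℓ (w s)) 2 (volume.restrict (Ioo a b)) :=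
    (memLp_two_iff_integrable_sq hnm).2 hsq
  have hint : IntegrableOn (fun s => normH ℓ (w s)) (Ioo a b) := hL2.integrable (by norm_num)
  set I : ℝ := ∫ s in Ioo a b, normH ℓ (w s)
  have hI0 : 0 ≤ I := integral_nonneg fun s => normH_nonneg _ _
  have hI : I ≤ Real.sqrt ((b - a) * ∫ s in a..b, normH ℓ (w s) ^ 2) := by
    refine Real.le_sqrt_of_sq_le ?_
    rw [intervalIntegral.integral_of_le hab, integral_Ioc_eq_integral_Ioo]
    have h1 := integral_mul_le_Lp_mul_Lq_of_nonneg (μ := volume.restrict (Ioo a b))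
      (p := 2) (q := 2) (f := fun _ => (1 : ℝ)) (g := fun s => normH ℓ (w s))
      Real.HolderConjugate.two_two (Filter.Eventually.of_forall fun _ => zero_le_one)
      (Filter.Eventually.of_forall fun s => normH_nonneg _ _) (by
        simpa using memLp_const (1 : ℝ)) (by simpa using hL2)
    simp only [one_mul, one_pow, integral_const, smul_eq_mul, mul_one, Real.rpow_two] at h1
    have hvol : (volume.restrict (Ioo a b)).real univ = b - a := by
      simp [Measure.real, hab]
    rw [hvol] at h1
    have hJ0 : 0 ≤ ∫ s in Ioo a b, normH ℓ (w s) ^ 2 := integral_nonneg fun s => sq_nonneg _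
    have h2 := pow_le_pow_left₀ hI0 h1 2
    rw [mul_pow, ← Real.rpow_mul_natCast (sub_nonneg.2 hab), ← Real.rpow_mul_natCast hJ0] at h2
    norm_num at h2
    exact h2
  have hkey : ∀ k ≤ ℓ, ∀ α : Fin k → Fin d, ∃ g : L2 Ω, IsWeakDeriv α z g ∧ ‖g‖ ≤ c * I := by
    intro k hk α
    refine exists_isWeakDeriv_of_bound (mul_nonneg hc hI0) fun φ => ?_
    have h1 := h (innerSL ℝ (derivLp α φ))
    simp only [innerSL_apply_apply] at h1
    rw [real_inner_comm] at h1
    refine h1.trans ?_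
    rw [mul_assoc]
    refine mul_le_mul_of_nonneg_left ?_ hc
    rw [intervalIntegral.integral_of_le hab, integral_Ioc_eq_integral_Ioo, ← integral_mul_const]
    refine integral_mono_of_nonneg (Filter.Eventually.of_forall fun _ => abs_nonneg _)
      (hint.mul_const _) ?_
    filter_upwards [hmem] with s hs
    have h2 := (isWeakDeriv_iff).1 (hs.isWeakDeriv hk α) φ
    rw [real_inner_comm, h2]
    rw [abs_mul, abs_pow, abs_neg, abs_one, one_pow, one_mul]
    refine (abs_real_inner_le_norm _ _).trans ?_
    exact mul_le_mul_of_nonneg_right (norm_weakDeriv_le_normH hk α _) (norm_nonneg _)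
  refine ⟨fun k hk α => (hkey k hk α).imp fun _ h => h.1, ?_⟩
  refine (normH_le_of_forall (B := c * I) (mul_nonneg hc hI0) fun k hk α => ?_).trans
    (mul_le_mul_of_nonneg_left (mul_le_mul_of_nonneg_left hI hc) (by simp [multiCard]; positivity))
  obtain ⟨g, hg, hgn⟩ := hkey k hk α
  rwa [weakDeriv_eq hΩ hg]

theorem MemL2H.intervalIntegrable {T : ℝ} (hT : 0 ≤ T) {ℓ : ℕ} {w : ℝ → L2 Ω} (hw : MemL2H T ℓ w) :
    IntervalIntegrable (fun s => normH ℓ (w s) ^ 2) volume 0 T := by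
  rw [intervalIntegrable_iff_integrableOn_Ioo_of_le hT]
  exact hw.2.2

theorem intervalIntegrable_normHV {T : ℝ} (hT : 0 ≤ T) {ℓ : ℕ} {w : ℝ → L2V Ω}
    (hw : ∀ k, MemL2H T ℓ (fun s => w s k)) :
    IntervalIntegrable (fun s => normHV ℓ (w s) ^ 2) volume 0 T := by
  simp only [normHV_sq]
  have := IntervalIntegrable.sum Finset.univ fun k _ => (hw k).intervalIntegrable hT
  simpa only [Finset.sum_fn] using this

/-- The vector-valued form of `WeakDom.memH`. -/
theorem memHV_of_weakDom {T : ℝ} (hT : 0 ≤ T) {ℓ : ℕ} {w : ℝ → L2V Ω}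
    (hw : ∀ k, MemL2H T ℓ (fun s => w s k)) {a b c : ℝ} {z : L2V Ω}
    (h : ∀ k, WeakDom c (fun s => w s k) a b (z k)) (ha : 0 ≤ a) (hab : a ≤ b) (hb : b ≤ T)
    (hc : 0 ≤ c) (hΩ : IsOpen Ω) :
    MemHV ℓ z ∧ normHV ℓ z ≤
      d * multiCard d ℓ * (c * Real.sqrt ((b - a) * ∫ s in a..b, normHV ℓ (w s) ^ 2)) := by
  refine ⟨fun k => ((h k).memH (hw k) ha hab hb hc hΩ).1, ?_⟩
  rw [mul_assoc]
  refine normHV_le_of_forall (by positivity) fun k => ?_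
  refine ((h k).memH (hw k) ha hab hb hc hΩ).2.trans ?_
  have hsub : uIcc a b ⊆ uIcc 0 T := by
    rw [uIcc_of_le hab, uIcc_of_le hT]
    exact Icc_subset_Icc ha hb
  have : ∫ s in a..b, normH ℓ (w s k) ^ 2 ≤ ∫ s in a..b, normHV ℓ (w s) ^ 2 :=
    intervalIntegral.integral_mono_on hab (((hw k).intervalIntegrable hT).mono_set hsub)
      ((intervalIntegrable_normHV hT hw).mono_set hsub)
      fun s _ => pow_le_pow_left₀ (normH_nonneg _ _) (normH_le_normHV ℓ (w s) k) 2
  gcongr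

theorem IsGrid.mono {T : ℝ} {N : ℕ} {t : ℕ → ℝ} (h : IsGrid T N t) {m n : ℕ} (hmn : m ≤ n)
    (hn : n ≤ N) : t m ≤ t n := by
  induction n, hmn using Nat.le_induction with
  | base => exact le_rfl
  | succ n _ ih => exact (ih (by omega)).trans (h.lt n (by omega)).le

theorem IsGrid.mem_Icc {T : ℝ} {N : ℕ} {t : ℕ → ℝ} (h : IsGrid T N t) {n : ℕ} (hn : n ≤ N) :
    t n ∈ Icc 0 T := ⟨by
      rw [← h.first]
      exact h.mono (Nat.zero_le n) hn, by
      rw [← h.last]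
      exact h.mono hn le_rfl⟩

/-- The intervals `[t_{n-1}, t_{n+1}]` cover each point at most twice. -/
theorem IsGrid.sum_integral_le {T : ℝ} {N : ℕ} {t : ℕ → ℝ} (h : IsGrid T N t) {g : ℝ → ℝ}
    (hg : IntervalIntegrable g volume 0 T) (hg0 : ∀ s, 0 ≤ g s) :
    ∑ n ∈ Finset.Ico 1 N, ∫ s in t (n - 1)..t (n + 1), g s ≤ 2 * ∫ s in (0 : ℝ)..T, g s := by
  have hT : 0 ≤ T := (h.mem_Icc (Nat.zero_le N)).1.trans (h.mem_Icc (Nat.zero_le N)).2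
  have hii : ∀ m n, m ≤ n → n ≤ N → IntervalIntegrable g volume (t m) (t n) := fun m n hmn hn =>
    hg.mono_set (by
      rw [uIcc_of_le hT, uIcc_of_le (h.mono hmn hn)]
      exact Icc_subset_Icc (h.mem_Icc (hmn.trans hn)).1 (h.mem_Icc hn).2)
  set F : ℕ → ℝ := fun n => ∫ s in t n..t (n + 1), g s
  have hF : ∀ n < N, 0 ≤ F n := fun n hn =>
    intervalIntegral.integral_nonneg (h.lt n hn).le fun s _ => hg0 s
  have hsum : ∑ n ∈ Finset.range N, F n = ∫ s in (0 : ℝ)..T, g s := by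
    rw [← h.first, ← h.last]
    exact intervalIntegral.sum_integral_adjacent_intervals fun k hk => hii k (k + 1) (by omega) hk
  have h1 : ∑ n ∈ Finset.Ico 1 N, ∫ s in t (n - 1)..t (n + 1), g s
      = ∑ n ∈ Finset.Ico 1 N, F (n - 1) + ∑ n ∈ Finset.Ico 1 N, F n := by
    rw [← Finset.sum_add_distrib]
    refine Finset.sum_congr rfl fun n hn => ?_
    obtain ⟨h1, h2⟩ := Finset.mem_Ico.1 hn
    have := intervalIntegral.integral_add_adjacent_intervals (hii (n - 1) n (by omega) (by omega))
      (hii n (n + 1) (by omega) (by omega))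
    rw [← this]
    simp only [F]
    rw [Nat.sub_add_cancel h1]
  have h2 : ∑ n ∈ Finset.Ico 1 N, F n ≤ ∑ n ∈ Finset.range N, F n :=
    Finset.sum_le_sum_of_subset_of_nonneg (fun n hn => by
      simp only [Finset.mem_Ico, Finset.mem_range] at *
      omega) fun n hn _ => hF n (Finset.mem_range.1 hn)
  have h3 : ∑ n ∈ Finset.Ico 1 N, F (n - 1) ≤ ∑ n ∈ Finset.range N, F n := by
    rw [Finset.sum_Ico_eq_sum_range]
    simp only [Nat.add_sub_cancel_left]
    exact Finset.sum_le_sum_of_subset_of_nonneg (Finset.range_mono (Nat.sub_le N 1))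
      fun n hn _ => hF n (Finset.mem_range.1 hn)
  rw [h1]
  linarith

end Time

/-! ### The DLN coefficients -/

section Coefficients

variable {θ : ℝ} {t : ℕ → ℝ} {n : ℕ}

theorem vari_mem (h1 : 0 < stp t n) (h0 : 0 < stp t (n - 1)) : -1 < vari t n ∧ vari t n < 1 := by
  unfold vari
  constructor
  · rw [lt_div_iff₀ (by linarith)]
    linarith
  · rw [div_lt_one (by linarith)]
    linarith

theorem stp_eq (h1 : 0 < stp t n) (h0 : 0 < stp t (n - 1)) :
    stp t n = (1 + vari t n) / 2 * (stp t n + stp t (n - 1)) ∧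
      stp t (n - 1) = (1 - vari t n) / 2 * (stp t n + stp t (n - 1)) := by
  have : stp t n + stp t (n - 1) ≠ 0 := by linarith
  constructor <;>
  · unfold vari
    field_simp
    ring

theorem ratio_eq (h1 : 0 < stp t n) (h0 : 0 < stp t (n - 1)) :
    stp t n / stp t (n - 1) = (1 + vari t n) / (1 - vari t n) := by
  have : stp t n + stp t (n - 1) ≠ 0 := by linarith
  have h2 : 1 - vari t n ≠ 0 := by linarith [(vari_mem h1 h0).2]
  rw [div_eq_div_iff h0.ne' h2]
  unfold vari
  field_simp
  ring

theorem one_add_mul_ge {ε : ℝ} (hθ0 : 0 < θ) (hε : -1 < ε ∧ ε < 1) :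
    1 - θ ≤ 1 + ε * θ ∧ 1 + ε * θ ≤ 2 + (θ - 1) := by
  constructor <;> nlinarith [hε.1, hε.2]

theorem beta_sum (θ ε : ℝ) : beta θ ε 0 + beta θ ε 1 + beta θ ε 2 = 1 := by
  simp only [beta, Matrix.cons_val]
  ring

/-- A bound for the coefficients `β_ℓ`. -/
noncomputable def betaBound (θ : ℝ) : ℝ := ((1 - θ) ^ 2)⁻¹

theorem one_le_betaBound (hθ0 : 0 < θ) (hθ1 : θ < 1) : 1 ≤ betaBound θ := by
  refine (one_le_inv₀ (by nlinarith)).2 (by nlinarith)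

theorem quot_bounds {ε : ℝ} (hθ0 : 0 < θ) (hθ1 : θ < 1) (hε : -1 < ε ∧ ε < 1) :
    0 ≤ (1 - θ ^ 2) / (1 + ε * θ) ^ 2 ∧ (1 - θ ^ 2) / (1 + ε * θ) ^ 2 ≤ betaBound θ := by
  have hD := (one_add_mul_ge hθ0 hε).1
  constructor
  · exact div_nonneg (by nlinarith) (sq_nonneg _)
  · rw [betaBound, ← one_div]
    exact div_le_div₀ zero_le_one (by nlinarith) (by nlinarith) (by nlinarith)

theorem abs_beta_le {ε : ℝ} (hθ0 : 0 < θ) (hθ1 : θ < 1) (hε : -1 < ε ∧ ε < 1) (i : Fin 3) :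
    |beta θ ε i| ≤ betaBound θ := by
  obtain ⟨h0, h1⟩ := quot_bounds hθ0 hθ1 hε
  have hK := one_le_betaBound hθ0 hθ1
  have hε2 : ε ^ 2 ≤ 1 := by nlinarith [hε.1, hε.2]
  have e : ε ^ 2 * (θ * (1 - θ ^ 2) / (1 + ε * θ) ^ 2)
      = ε ^ 2 * θ * ((1 - θ ^ 2) / (1 + ε * θ) ^ 2) := by ring
  set q := (1 - θ ^ 2) / (1 + ε * θ) ^ 2
  have hp : 0 ≤ ε ^ 2 * θ * q := by positivity
  have hp1 : ε ^ 2 * θ * q ≤ q := mul_le_of_le_one_left h0 (by nlinarith [sq_nonneg ε])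
  fin_cases i <;> simp only [beta, Matrix.cons_val, Fin.zero_eta, Fin.mk_one, Fin.reduceFinMk, e] <;>
    rw [abs_le] <;> constructor <;> linarith

theorem beta_two_pos {ε : ℝ} (hθ0 : 0 < θ) (hθ1 : θ < 1) (hε : -1 < ε ∧ ε < 1) :
    0 < beta θ ε 2 := by
  obtain ⟨h0, -⟩ := quot_bounds hθ0 hθ1 hε
  have e : ε ^ 2 * (θ * (1 - θ ^ 2) / (1 + ε * θ) ^ 2)
      = ε ^ 2 * θ * ((1 - θ ^ 2) / (1 + ε * θ) ^ 2) := by ring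
  simp only [beta, Matrix.cons_val, e]
  positivity

theorem khat_eq (h1 : 0 < stp t n) (h0 : 0 < stp t (n - 1)) :
    khat θ t n = (1 + vari t n * θ) / 2 * (stp t n + stp t (n - 1)) := by
  have : stp t n + stp t (n - 1) ≠ 0 := by linarith
  simp only [khat, alpha, Matrix.cons_val]
  unfold vari
  field_simp
  ring

theorem khat_bounds (hθ0 : 0 < θ) (hθ1 : θ < 1) (h1 : 0 < stp t n) (h0 : 0 < stp t (n - 1)) :
    (1 - θ) / 2 * (stp t n + stp t (n - 1)) ≤ khat θ t n ∧
      khat θ t n ≤ stp t n + stp t (n - 1) := by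
  have hD := one_add_mul_ge hθ0 (vari_mem h1 h0)
  rw [khat_eq h1 h0]
  constructor <;> nlinarith

theorem khat_pos (hθ0 : 0 < θ) (hθ1 : θ < 1) (h1 : 0 < stp t n) (h0 : 0 < stp t (n - 1)) :
    0 < khat θ t n :=
  lt_of_lt_of_le (by nlinarith) (khat_bounds hθ0 hθ1 h1 h0).1

theorem succ_eq_add_stp : t (n + 1) = t n + stp t n := by simp [stp]

theorem pred_eq_sub_stp (hn : 1 ≤ n) : t (n - 1) = t n - stp t (n - 1) := by
  simp [stp, Nat.sub_add_cancel hn]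

theorem tBeta_sub (hn : 1 ≤ n) : tBeta θ t n - t n =
    beta θ (vari t n) 2 * stp t n - beta θ (vari t n) 0 * stp t (n - 1) := by
  have h := beta_sum θ (vari t n)
  simp only [tBeta, zBeta, smul_eq_mul]
  rw [succ_eq_add_stp (t := t), pred_eq_sub_stp (t := t) hn]
  linear_combination t n * h

theorem tBeta_sub_eq (hθ0 : 0 < θ) (hθ1 : θ < 1) (hn : 1 ≤ n) (h1 : 0 < stp t n)
    (h0 : 0 < stp t (n - 1)) :
    tBeta θ t n - t n = (stp t n + stp t (n - 1)) / 4 *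
      (vari t n + (θ + vari t n) / (1 + vari t n * θ)) := by
  have hε := vari_mem h1 h0
  have hD : 1 + vari t n * θ ≠ 0 := by linarith [(one_add_mul_ge hθ0 hε).1]
  have hD' : 1 + θ * vari t n ≠ 0 := by rwa [mul_comm θ]
  obtain ⟨e1, e0⟩ := stp_eq h1 h0
  rw [tBeta_sub hn]
  set c := stp t n + stp t (n - 1)
  rw [e1, e0]
  simp only [beta, Matrix.cons_val]
  field_simp
  ring

theorem tBeta_mem (hθ0 : 0 < θ) (hθ1 : θ < 1) (hn : 1 ≤ n) (h1 : 0 < stp t n)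
    (h0 : 0 < stp t (n - 1)) : tBeta θ t n ∈ Ioo (t (n - 1)) (t (n + 1)) := by
  have hε := vari_mem h1 h0
  have hD : 0 < 1 + vari t n * θ := by linarith [(one_add_mul_ge hθ0 hε).1]
  have h := tBeta_sub_eq hθ0 hθ1 hn h1 h0
  obtain ⟨e1, e0⟩ := stp_eq h1 h0
  have hτ1 : (θ + vari t n) / (1 + vari t n * θ) < 1 := by
    rw [div_lt_one hD]
    nlinarith [mul_pos (sub_pos.2 hθ1) (sub_pos.2 hε.2)]
  have hτ0 : -1 < (θ + vari t n) / (1 + vari t n * θ) := by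
    rw [lt_div_iff₀ hD]
    nlinarith [mul_pos (show 0 < 1 + θ by linarith) (show 0 < 1 + vari t n by linarith [hε.1])]
  have hc : 0 < stp t n + stp t (n - 1) := by linarith
  rw [mem_Ioo, succ_eq_add_stp (t := t), pred_eq_sub_stp (t := t) hn]
  constructor
  · nlinarith [hε.1, hε.2]
  · nlinarith [hε.1, hε.2]

/-- The difference formula `z_{n,α}` is exact on quadratic functions at `t_{n,β}`. -/
theorem alpha_quadratic (hθ0 : 0 < θ) (hθ1 : θ < 1) (hn : 1 ≤ n) (h1 : 0 < stp t n)
    (h0 : 0 < stp t (n - 1)) :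
    alpha θ 2 * (t (n + 1) - tBeta θ t n) ^ 2 + alpha θ 1 * (t n - tBeta θ t n) ^ 2
      + alpha θ 0 * (t (n - 1) - tBeta θ t n) ^ 2 = 0 := by
  have hε := vari_mem h1 h0
  have hD : 1 + vari t n * θ ≠ 0 := by linarith [(one_add_mul_ge hθ0 hε).1]
  have hD' : 1 + θ * vari t n ≠ 0 := by rwa [mul_comm θ]
  have h := tBeta_sub_eq hθ0 hθ1 hn h1 h0
  obtain ⟨e1, e0⟩ := stp_eq h1 h0
  set c := stp t n + stp t (n - 1)
  have a1 : t (n + 1) - tBeta θ t n = (1 + vari t n) / 2 * c - c / 4 *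
      (vari t n + (θ + vari t n) / (1 + vari t n * θ)) := by
    rw [← h, ← e1, succ_eq_add_stp (t := t)]; ring
  have a0 : t (n - 1) - tBeta θ t n = - ((1 - vari t n) / 2 * c) - c / 4 *
      (vari t n + (θ + vari t n) / (1 + vari t n * θ)) := by
    rw [← h, ← e0, pred_eq_sub_stp (t := t) hn]; ring
  have a2 : t n - tBeta θ t n = - (c / 4 *
      (vari t n + (θ + vari t n) / (1 + vari t n * θ))) := by rw [← h]; ring
  rw [a1, a0, a2]
  simp only [alpha, Matrix.cons_val]
  field_simp
  ring

theorem alpha_linear (hn : 1 ≤ n) (σ : ℝ) :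
    alpha θ 2 * (t (n + 1) - σ) + alpha θ 1 * (t n - σ) + alpha θ 0 * (t (n - 1) - σ)
      = khat θ t n := by
  rw [succ_eq_add_stp (t := t), pred_eq_sub_stp (t := t) hn]
  simp only [khat, alpha, Matrix.cons_val]
  ring

theorem alpha_sum (θ : ℝ) : alpha θ 2 + alpha θ 1 + alpha θ 0 = 0 := by
  simp only [alpha, Matrix.cons_val]
  ring

theorem abs_alpha_le (hθ0 : 0 < θ) (hθ1 : θ < 1) (i : Fin 3) : |alpha θ i| ≤ 1 := by
  fin_cases i <;> simp only [alpha, Matrix.cons_val, Fin.zero_eta, Fin.mk_one, Fin.reduceFinMk] <;>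
    rw [abs_le] <;> constructor <;> linarith

/-- The coefficients of `z_{n,*}` at `z_n` and `z_{n-1}`. -/
noncomputable def starCoeff (θ : ℝ) (t : ℕ → ℝ) (n : ℕ) : Fin 2 → ℝ :=
  ![beta θ (vari t n) 0 - beta θ (vari t n) 2 * (stp t n / stp t (n - 1)),
    beta θ (vari t n) 2 * (1 + stp t n / stp t (n - 1)) + beta θ (vari t n) 1]

theorem zStar_eq {V : Type*} [AddCommGroup V] [Module ℝ V] (z : ℕ → V) :
    zStar θ t z n = starCoeff θ t n 1 • z n + starCoeff θ t n 0 • z (n - 1) := rfl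

theorem starCoeff_sum : starCoeff θ t n 0 + starCoeff θ t n 1 = 1 := by
  rw [← beta_sum θ (vari t n)]
  simp only [starCoeff, Matrix.cons_val]
  ring

theorem starCoeff_linear (hn : 1 ≤ n) (h0 : 0 < stp t (n - 1)) :
    starCoeff θ t n 1 * t n + starCoeff θ t n 0 * t (n - 1) = tBeta θ t n := by
  have h := tBeta_sub (θ := θ) (t := t) hn
  have hs := starCoeff_sum (θ := θ) (t := t) (n := n)
  have e : starCoeff θ t n 0 * stp t (n - 1)
      = beta θ (vari t n) 0 * stp t (n - 1) - beta θ (vari t n) 2 * stp t n := by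
    simp only [starCoeff, Matrix.cons_val]
    field_simp
  rw [pred_eq_sub_stp (t := t) hn]
  linear_combination t n * hs - h - e

theorem abs_starCoeff_le (hθ0 : 0 < θ) (hθ1 : θ < 1) (h1 : 0 < stp t n) (h0 : 0 < stp t (n - 1))
    {R : ℝ} (hR : stp t n / stp t (n - 1) ≤ R) (i : Fin 2) :
    |starCoeff θ t n i| ≤ betaBound θ * (2 + R) := by
  have hb := fun i => abs_beta_le hθ0 hθ1 (vari_mem h1 h0) i
  have hr : 0 ≤ stp t n / stp t (n - 1) := by positivity
  have hK := one_le_betaBound hθ0 hθ1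
  have hp : ∀ x : ℝ, 0 ≤ x → |beta θ (vari t n) 2 * x| ≤ betaBound θ * x := fun x hx => by
    rw [abs_mul, abs_of_nonneg hx]
    exact mul_le_mul_of_nonneg_right (hb 2) hx
  have hm := mul_le_mul_of_nonneg_left hR (zero_le_one.trans hK)
  fin_cases i <;> simp only [starCoeff, Matrix.cons_val, Fin.zero_eta, Fin.mk_one]
  · refine (abs_sub _ _).trans ?_
    linarith [hb 0, hp _ hr]
  · refine (abs_add_le _ _).trans ?_
    linarith [hb 1, hp (1 + stp t n / stp t (n - 1)) (by linarith)]

section Vector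

variable {V W : Type*} [AddCommGroup V] [Module ℝ V] [AddCommGroup W] [Module ℝ W]

theorem map_zAlpha (L : V →ₗ[ℝ] W) (z : ℕ → V) :
    L (zAlpha θ z n) = zAlpha θ (fun i => L (z i)) n := by simp [zAlpha]

theorem map_zBeta (L : V →ₗ[ℝ] W) (z : ℕ → V) :
    L (zBeta θ t z n) = zBeta θ t (fun i => L (z i)) n := by simp [zBeta]

theorem map_zStar (L : V →ₗ[ℝ] W) (z : ℕ → V) :
    L (zStar θ t z n) = zStar θ t (fun i => L (z i)) n := by simp [zStar]

theorem zAlpha_sub (z z' : ℕ → V) :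
    zAlpha θ (fun i => z i - z' i) n = zAlpha θ z n - zAlpha θ z' n := by
  simp only [zAlpha, smul_sub]; abel

theorem zBeta_sub (z z' : ℕ → V) :
    zBeta θ t (fun i => z i - z' i) n = zBeta θ t z n - zBeta θ t z' n := by
  simp only [zBeta, smul_sub]; abel

theorem zStar_sub (z z' : ℕ → V) :
    zStar θ t (fun i => z i - z' i) n = zStar θ t z n - zStar θ t z' n := by
  simp only [zStar, smul_sub]; abel

/-- The second difference which carries the numerical dissipation of the DLN method. -/
noncomputable def secondDiff (t : ℕ → ℝ) (z : ℕ → V) (n : ℕ) : V :=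
  ((1 - vari t n) / 2) • z (n + 1) - z n + ((1 + vari t n) / 2) • z (n - 1)

/-- The implicit and the extrapolated value differ by a multiple of the second difference in the
numerical dissipation. -/
theorem zBeta_sub_zStar (h1 : 0 < stp t n) (h0 : 0 < stp t (n - 1)) (z : ℕ → V) :
    zBeta θ t z n - zStar θ t z n
      = (beta θ (vari t n) 2 * (2 / (1 - vari t n))) • secondDiff t z n := by
  have h2 : 1 - vari t n ≠ 0 := by linarith [(vari_mem h1 h0).2]
  simp only [zBeta, zStar, secondDiff, ratio_eq h1 h0]
  match_scalars <;> field_simp <;> ring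

end Vector

variable {H : Type*} [NormedAddCommGroup H] [InnerProductSpace ℝ H]

/-- The squared `G`-norm of the pair `(z_{n+1}, z_n)`. -/
noncomputable def gNormSq (θ : ℝ) (z : ℕ → H) (n : ℕ) : ℝ :=
  (1 + θ) / 4 * ‖z (n + 1)‖ ^ 2 + (1 - θ) / 4 * ‖z n‖ ^ 2

/-- The numerical dissipation of the DLN method. -/
noncomputable def dissip (θ : ℝ) (t : ℕ → ℝ) (z : ℕ → H) (n : ℕ) : ℝ :=
  θ * (1 - θ ^ 2) / (2 * (1 + vari t n * θ) ^ 2) * ‖secondDiff t z n‖ ^ 2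

theorem dissip_nonneg (hθ0 : 0 < θ) (hθ1 : θ < 1) (z : ℕ → H) : 0 ≤ dissip θ t z n :=
  mul_nonneg (div_nonneg (mul_nonneg hθ0.le (by nlinarith)) (by positivity)) (sq_nonneg _)

/-- `G`-stability of the DLN method. -/
theorem inner_zAlpha_zBeta (hθ0 : 0 < θ) (hθ1 : θ < 1) (hn : 1 ≤ n) (h1 : 0 < stp t n)
    (h0 : 0 < stp t (n - 1)) (z : ℕ → H) :
    inner ℝ (zAlpha θ z n) (zBeta θ t z n)
      = gNormSq θ z n - gNormSq θ z (n - 1) + dissip θ t z n := by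
  have hD : 1 + vari t n * θ ≠ 0 := by
    linarith [(one_add_mul_ge hθ0 (vari_mem h1 h0)).1]
  have hD' : 1 + θ * vari t n ≠ 0 := by rwa [mul_comm θ]
  simp only [gNormSq, dissip, secondDiff, zAlpha, zBeta, ← real_inner_self_eq_norm_sq,
    inner_add_left, inner_add_right, inner_sub_left, inner_sub_right, inner_smul_left,
    inner_smul_right, Nat.sub_add_cancel hn, real_inner_comm (z (n + 1)) (z n),
    real_inner_comm (z (n + 1)) (z (n - 1)), real_inner_comm (z n) (z (n - 1)), alpha, beta,
    Matrix.cons_val, conj_trivial]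
  field_simp
  ring

/-- The constant in the estimate of `z_{n,β} - z_{n,*}` by the numerical dissipation. -/
noncomputable def dissipConst (θ : ℝ) : ℝ := 8 * betaBound θ ^ 2 / (θ * (1 - θ ^ 2))

theorem dissipConst_pos (hθ0 : 0 < θ) (hθ1 : θ < 1) : 0 < dissipConst θ := by
  have := one_le_betaBound hθ0 hθ1
  exact div_pos (by positivity) (mul_pos hθ0 (by nlinarith))

/-- The origin of the weight `((1 + ε_n θ) / (1 - ε_n)) ^ 2` in the CFL-like condition. -/
theorem norm_zBeta_sub_zStar_sq_le (hθ0 : 0 < θ) (hθ1 : θ < 1) (h1 : 0 < stp t n)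
    (h0 : 0 < stp t (n - 1)) (z : ℕ → H) :
    ‖zBeta θ t z n - zStar θ t z n‖ ^ 2 ≤
      dissipConst θ * ((1 + vari t n * θ) / (1 - vari t n)) ^ 2 * dissip θ t z n := by
  have hε := vari_mem h1 h0
  have hD : 1 + vari t n * θ ≠ 0 := by
    linarith [(one_add_mul_ge hθ0 hε).1]
  have hD' : 1 + θ * vari t n ≠ 0 := by rwa [mul_comm θ]
  have h2 : 1 - vari t n ≠ 0 := by linarith [hε.2]
  have hq : 1 - θ ^ 2 ≠ 0 := by nlinarith
  rw [zBeta_sub_zStar h1 h0, norm_smul, mul_pow, Real.norm_eq_abs, sq_abs]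
  have e : dissipConst θ * ((1 + vari t n * θ) / (1 - vari t n)) ^ 2 * dissip θ t z n
      = (betaBound θ ^ 2 * (2 / (1 - vari t n)) ^ 2) * ‖secondDiff t z n‖ ^ 2 := by
    simp only [dissipConst, dissip]
    field_simp
    ring
  rw [e, mul_pow]
  have hb : beta θ (vari t n) 2 ^ 2 ≤ betaBound θ ^ 2 := by
    rw [← sq_abs]
    exact pow_le_pow_left₀ (abs_nonneg _) (abs_beta_le hθ0 hθ1 hε 2) 2
  gcongr

end Coefficients

/-! ### Mixed approximation of saddle point problems -/

section Saddle

variable {V E F : Type*} [AddCommGroup V] [Module ℝ V] [NormedAddCommGroup E]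
  [InnerProductSpace ℝ E] [NormedAddCommGroup F] [InnerProductSpace ℝ F]
  (D : V →ₗ[ℝ] E) (dv : V →ₗ[ℝ] F)

/-- The elements of `S` whose image under the abstract divergence `dv` is orthogonal to `R`. -/
def discKer (S : Submodule ℝ V) (R : Submodule ℝ F) : Submodule ℝ V where
  carrier := {v | v ∈ S ∧ ∀ q ∈ R, inner ℝ q (dv v) = 0}
  add_mem' := fun {v w} hv hw => ⟨S.add_mem hv.1 hw.1, fun q hq => by
    rw [map_add, inner_add_right, hv.2 q hq, hw.2 q hq, add_zero]⟩
  zero_mem' := ⟨S.zero_mem, fun q _ => by simp⟩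
  smul_mem' := fun c v hv => ⟨S.smul_mem c hv.1, fun q hq => by
    rw [map_smul, inner_smul_right, hv.2 q hq, mul_zero]⟩

theorem finiteDimensional_discKer (S : Submodule ℝ V) [FiniteDimensional ℝ S]
    (R : Submodule ℝ F) : FiniteDimensional ℝ (discKer dv S R) :=
  Submodule.finiteDimensional_of_le (S₂ := S) fun _ h => h.1

/-- Solvability of the variational problem for `⟪D ·, D ·⟫` on a finite-dimensional space. -/
theorem exists_variational (K : Submodule ℝ V) [FiniteDimensional ℝ K] (l : V →ₗ[ℝ] ℝ) {B : ℝ}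
    (hB : 0 ≤ B) (hl : ∀ v ∈ K, |l v| ≤ B * ‖D v‖) :
    ∃ s ∈ K, ∀ v ∈ K, inner ℝ (D s) (D v) = l v := by
  have : CompleteSpace (K.map D) := FiniteDimensional.complete ℝ _
  obtain ⟨⟨_, s, hs, rfl⟩, -, hg⟩ := exists_inner_eq_of_bound (D.submoduleMap K)
    (l.comp K.subtype) B hB fun v => by
      simpa using hl v v.2
  refine ⟨s, hs, fun v hv => ?_⟩
  have := hg ⟨v, hv⟩
  simpa using this.symm

/-- Under the inf-sup condition, elements of `S` are as close to the discrete kernel as they are to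
the continuous kernel. -/
theorem exists_discKer_near (hD : ∀ v, D v = 0 → v = 0) (S : Submodule ℝ V)
    [FiniteDimensional ℝ S] (R : Submodule ℝ F) [FiniteDimensional ℝ R] {κ c : ℝ}
    (hκ : ∀ v, ‖dv v‖ ≤ κ * ‖D v‖) (hc : 0 < c)
    (hinf : ∀ q ∈ R, q ≠ 0 → ∃ v ∈ S, v ≠ 0 ∧ c * (‖D v‖ * ‖q‖) ≤ inner ℝ (dv v) q)
    {u v : V} (hu : dv u = 0) (hv : v ∈ S) :
    ∃ w ∈ discKer dv S R, ‖D (v - w)‖ ≤ κ / c * ‖D (u - v)‖ := by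
  have := finiteDimensional_discKer dv S R
  obtain ⟨w, hw, hwK⟩ := exists_variational D (discKer dv S R)
    ((innerₛₗ ℝ (D v)).comp D) (norm_nonneg (D v)) fun x _ => by
      simpa using abs_real_inner_le_norm (D v) (D x)
  refine ⟨w, hw, ?_⟩
  set z := v - w
  have hzS : z ∈ S := S.sub_mem hv hw.1
  have hzK : ∀ x ∈ discKer dv S R, inner ℝ (D z) (D x) = 0 := fun x hx => by
    simp [z, map_sub, inner_sub_left, hwK x hx]
  -- the functional `⟪D z, D ·⟫` on `S` is represented by an element of `R`
  obtain ⟨q, hq, hqz⟩ : ∃ q ∈ R, ∀ x ∈ S, inner ℝ (D z) (D x) = inner ℝ q (dv x) := by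
    let e := Module.finBasis ℝ R
    have hspan := mem_span_of_iInf_ker_le_ker
      (L := fun i => (innerₛₗ ℝ (e i : F)).comp (dv.comp S.subtype))
      (K := (innerₛₗ ℝ (D z)).comp (D.comp S.subtype)) (by
        intro x hx
        have hx' : ∀ i, inner ℝ (e i : F) (dv x) = 0 := fun i => by
          have := (Submodule.mem_iInf _).1 hx i
          simpa using this
        have : (x : V) ∈ discKer dv S R := ⟨x.2, fun q hq => by
          have h1 := e.sum_repr ⟨q, hq⟩
          have h2 : q = ∑ i, e.repr ⟨q, hq⟩ i • (e i : F) := by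
            have := congrArg Subtype.val h1
            rw [AddSubmonoidClass.coe_finsetSum] at this
            exact this.symm
          rw [h2, sum_inner]
          exact Finset.sum_eq_zero fun i _ => by rw [inner_smul_left, hx' i, mul_zero]⟩
        simpa using hzK x this)
    obtain ⟨a, ha⟩ := (Submodule.mem_span_range_iff_exists_fun ℝ).1 hspan
    refine ⟨∑ i, a i • (e i : F), R.sum_mem fun i _ => R.smul_mem _ (e i).2, fun x hx => ?_⟩
    have := LinearMap.congr_fun ha ⟨x, hx⟩
    rw [sum_inner]
    simp only [inner_smul_left]
    simpa using this.symm
  have hqn : ‖q‖ ≤ ‖D z‖ / c := by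
    rcases eq_or_ne q 0 with rfl | hq0
    · simp only [norm_zero]
      positivity
    · obtain ⟨x, hx, hx0, hxq⟩ := hinf q hq hq0
      have hDx : 0 < ‖D x‖ := norm_pos_iff.2 fun h => hx0 (hD x h)
      rw [real_inner_comm, ← hqz x hx] at hxq
      have h1 := hxq.trans (real_inner_le_norm (D z) (D x))
      rw [le_div_iff₀ hc]
      have : (‖q‖ * c) * ‖D x‖ ≤ ‖D z‖ * ‖D x‖ := by linarith
      exact le_of_mul_le_mul_right this hDx
  have h1 : ‖D z‖ * ‖D z‖ ≤ ‖D z‖ * (κ / c * ‖D (u - v)‖) := by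
    calc ‖D z‖ * ‖D z‖ = inner ℝ q (dv z) := by
          rw [← hqz z hzS, real_inner_self_eq_norm_mul_norm]
      _ = inner ℝ q (dv (v - u)) := by
          simp only [z, map_sub, inner_sub_right, hw.2 q hq, hu, inner_zero_right]
      _ ≤ ‖q‖ * ‖dv (v - u)‖ := real_inner_le_norm _ _
      _ ≤ ‖D z‖ / c * (κ * ‖D (u - v)‖) := by
          have h3 := hκ (v - u)
          have h4 : ‖D (v - u)‖ = ‖D (u - v)‖ := by rw [← neg_sub, map_neg, norm_neg]
          rw [h4] at h3
          exact mul_le_mul hqn h3 (norm_nonneg _) (by positivity)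
      _ = _ := by ring
  rcases (norm_nonneg (D z)).eq_or_lt with h | h
  · rw [← h]
    have h3 : 0 ≤ κ * ‖D (u - v)‖ := (norm_nonneg _).trans (hκ _)
    have : κ / c * ‖D (u - v)‖ = κ * ‖D (u - v)‖ / c := by ring
    rw [this]
    positivity
  · exact le_of_mul_le_mul_left h1 h

/-- The error of the Galerkin solution in the discrete kernel. -/
theorem norm_stokes_error_le {ν : ℝ} (hν : 0 < ν) {S : Submodule ℝ V} {R : Submodule ℝ F} {κ : ℝ}
    (hκ0 : 0 ≤ κ) (hκ : ∀ v, ‖dv v‖ ≤ κ * ‖D v‖) {u s w : V} {p q : F} (hs : s ∈ discKer dv S R)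
    (hw : w ∈ discKer dv S R) (hq : q ∈ R)
    (h : ∀ v ∈ discKer dv S R, ν * inner ℝ (D s) (D v) = ν * inner ℝ (D u) (D v) - inner ℝ p (dv v)) :
    ‖D (u - s)‖ ≤ 2 * ‖D (u - w)‖ + κ / ν * ‖p - q‖ := by
  have hws := (discKer dv S R).sub_mem hw hs
  set z := w - s
  have h1 := h z hws
  have h2 : ν * inner ℝ (D (u - s)) (D z) = inner ℝ (p - q) (dv z) := by
    rw [map_sub, inner_sub_left, inner_sub_left, hws.2 q hq]
    linarith
  have h3 : ‖D z‖ * ‖D z‖ ≤ ‖D z‖ * (‖D (u - w)‖ + κ / ν * ‖p - q‖) := by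
    have e : ‖D z‖ * ‖D z‖ = inner ℝ (D (u - s)) (D z) - inner ℝ (D (u - w)) (D z) := by
      rw [← inner_sub_left, ← map_sub, sub_sub_sub_cancel_left, real_inner_self_eq_norm_mul_norm]
    have h4 : inner ℝ (D (u - s)) (D z) ≤ ν⁻¹ * (‖p - q‖ * (κ * ‖D z‖)) := by
      have h5 : inner ℝ (D (u - s)) (D z) = ν⁻¹ * inner ℝ (p - q) (dv z) := by
        rw [← h2]
        field_simp
      rw [h5]
      exact mul_le_mul_of_nonneg_left ((real_inner_le_norm _ _).trans
        (mul_le_mul_of_nonneg_left (hκ z) (norm_nonneg _))) (by positivity)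
    have h6 := neg_le_of_abs_le (abs_real_inner_le_norm (D (u - w)) (D z))
    rw [e]
    have : κ / ν = ν⁻¹ * κ := by ring
    rw [this]
    linarith
  have h7 : ‖D z‖ ≤ ‖D (u - w)‖ + κ / ν * ‖p - q‖ := by
    rcases (norm_nonneg (D z)).eq_or_lt with h | h
    · rw [← h]
      positivity
    · exact le_of_mul_le_mul_left h3 h
  have e : u - s = (u - w) + z := by simp [z]
  rw [e, map_add]
  linarith [norm_add_le (D (u - w)) (D z)]

end Saddle

/-! ### The divergence and the weak form of the equations -/

section WeakForm

variable {d : ℕ} {Ω : Set (Pt d)}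

/-- The divergence as a linear map on `X`. -/
noncomputable def divX (hΩ : IsOpen Ω) : XSpace hΩ →ₗ[ℝ] L2 Ω where
  toFun v := divg (v : L2V Ω)
  map_add' v w := by
    simp only [divg, ← Finset.sum_add_distrib]
    exact Finset.sum_congr rfl fun i _ => pd_add hΩ i (v.2 i).1 (w.2 i).1
  map_smul' c v := by
    simp only [divg, Finset.smul_sum, RingHom.id_apply]
    exact Finset.sum_congr rfl fun i _ => pd_smul hΩ i c (v.2 i).1

theorem divX_apply (hΩ : IsOpen Ω) (v : XSpace hΩ) : divX hΩ v = divg (v : L2V Ω) := rfl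

theorem norm_divg_le (v : L2V Ω) : ‖divg v‖ ≤ d * ‖gradV v‖ :=
  (norm_sum_le _ _).trans ((Finset.sum_le_sum (g := fun _ => ‖gradV v‖)
    fun i _ => norm_pd_le v i i).trans (by simp))

/-- Integration by parts for the pressure term. -/
theorem inner_divg (hΩ : IsOpen Ω) {q : L2 Ω} (hq : MemH 1 q) {v : L2V Ω} (hv : MemX v) :
    inner ℝ q (divg v) = - ∑ i, inner ℝ (pd i q) (v i) := by
  rw [divg, inner_sum, ← Finset.sum_neg_distrib]
  exact Finset.sum_congr rfl fun i _ => (hq.isWeakDeriv le_rfl _).inner_eq_neg hΩ (hv i)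

theorem abs_inner_divg_le (hΩ : IsOpen Ω) {q : L2 Ω} (hq : MemH 1 q) {v : L2V Ω} (hv : MemX v) :
    |inner ℝ q (divg v)| ≤ d * normH 1 q * ‖v‖ := by
  rw [inner_divg hΩ hq hv, abs_neg]
  calc |∑ i, inner ℝ (pd i q) (v i)| ≤ ∑ _i : Fin d, normH 1 q * ‖v‖ :=
        (Finset.abs_sum_le_sum_abs _ _).trans (Finset.sum_le_sum fun i _ =>
          (abs_real_inner_le_norm _ _).trans (mul_le_mul (norm_pd_le_normH i le_rfl q)
            (norm_comp_le v i) (norm_nonneg _) (normH_nonneg _ _)))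
    _ = _ := by
        simp
        ring

/-- Integration by parts for the viscous term. -/
theorem inner_gradV_eq_neg (hΩ : IsOpen Ω) {w v : L2V Ω} (hw : MemHV 2 w) (hv : MemX v) :
    inner ℝ (gradV w) (gradV v) = - ∑ k, ∑ i, inner ℝ (weakDeriv ![i, i] (w k)) (v k) := by
  rw [inner_gradV, gradInner, ← Finset.sum_neg_distrib]
  refine Finset.sum_congr rfl fun k _ => ?_
  rw [← Finset.sum_neg_distrib]
  exact Finset.sum_congr rfl fun i _ => ((hw k).isWeakDeriv_pd i i).inner_eq_neg hΩ (hv k)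

theorem abs_inner_gradV_le (hΩ : IsOpen Ω) {w v : L2V Ω} (hw : MemHV 2 w) (hv : MemX v) :
    |inner ℝ (gradV w) (gradV v)| ≤ (d : ℝ) ^ 2 * (normHV 2 w * ‖v‖) := by
  rw [inner_gradV_eq_neg hΩ hw hv, abs_neg]
  exact abs_double_sum_le fun k i => (abs_real_inner_le_norm _ _).trans
    (mul_le_mul ((norm_weakDeriv_le_normH le_rfl _ _).trans (normH_le_normHV 2 w k))
      (norm_comp_le v k) (norm_nonneg _) (normHV_nonneg _ _))

/-- The weak form of the momentum equation. -/
theorem IsNSESolution.weak {ν T : ℝ} (hd : d = 2 ∨ d = 3) (hP : IsPolyhedral Ω)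
    {u ut : ℝ → L2V Ω} {p : ℝ → L2 Ω} {f : ℝ → L2V Ω} (hs : IsNSESolution ν T u ut p f) {t : ℝ}
    (ht : t ∈ Ioo 0 T) {v : L2V Ω} (hv : MemX v) :
    inner ℝ (ut t) v + trib (u t) (u t) v + ν * inner ℝ (gradV (u t)) (gradV v)
      - inner ℝ (p t) (divg v) = inner ℝ (f t) v := by
  have hΩ := hP.isOpen
  have htc : t ∈ Icc 0 T := ⟨ht.1.le, ht.2.le⟩
  have hu := hs.memX t htc
  rw [← convec_eq_trib hd hP hu hu hv (hs.divFree t htc), inner_gradV_eq_neg hΩ (hs.memH2 t ht) hv,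
    inner_divg hΩ (hs.memH1 t ht) hv, convec_eq hd hP hu hv, triSum]
  simp only [PiLp.inner_apply]
  -- the equation is tested componentwise
  have key : ∀ k, inner ℝ (ut t k) (v k) + ∑ i, tri (pd i (u t k)) (u t i) (v k)
      - ν * ∑ i, inner ℝ (weakDeriv ![i, i] (u t k)) (v k) + inner ℝ (pd k (p t)) (v k)
      = inner ℝ (f t k) (v k) := by
    intro k
    have hi : ∀ g : L2 Ω, Integrable (fun x => g x * v k x) (volume.restrict Ω) := fun g =>
      (Lp.memLp g).integrable_mul (Lp.memLp (v k))
    have ht3 : ∀ i, Integrable (fun x => pd i (u t k) x * (u t i x * v k x))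
        (volume.restrict Ω) := fun i =>
      tri_integrable (p := 6) (q := 3) _ (memLp_six hd hP (hu i)) (memLp_three hd hP (hv k))
    simp only [inner_eq_integral, tri]
    have i1 : Integrable (fun x => ∑ i, pd i (u t k) x * (u t i x * v k x))
        (volume.restrict Ω) := integrable_finsetSum _ fun i _ => ht3 i
    have i2 : Integrable (fun x => ν * ∑ i, weakDeriv ![i, i] (u t k) x * v k x)
        (volume.restrict Ω) := (integrable_finsetSum _ fun i _ => hi _).const_mul ν
    have i3 : Integrable (fun x => ut t k x * v k x
        + ∑ i, pd i (u t k) x * (u t i x * v k x)) (volume.restrict Ω) := (hi _).add i1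
    have i4 : Integrable (fun x => ut t k x * v k x
        + ∑ i, pd i (u t k) x * (u t i x * v k x)
        - ν * ∑ i, weakDeriv ![i, i] (u t k) x * v k x) (volume.restrict Ω) := i3.sub i2
    rw [← integral_finsetSum _ fun i _ => ht3 i, ← integral_finsetSum _ fun i _ => hi _,
      ← integral_const_mul, ← integral_add (hi _) i1, ← integral_sub i3 i2,
      ← integral_add i4 (hi _)]
    refine integral_congr_ae ?_
    filter_upwards [hs.momentum t ht] with x hx
    rw [← hx k]
    simp only [← Finset.sum_mul]
    have : ∑ i, pd i (u t k) x * (u t i x * v k x) = (∑ i, u t i x * pd i (u t k) x) * v k x := by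
      rw [Finset.sum_mul]
      exact Finset.sum_congr rfl fun i _ => by ring
    rw [this]
    ring
  rw [← Finset.sum_congr rfl fun k _ => key k]
  simp only [Finset.sum_add_distrib, Finset.sum_sub_distrib, ← Finset.mul_sum]
  ring

end WeakForm

/-! ### The convective terms of the error equation -/

section Convective

variable {V E : Type*} [NormedAddCommGroup V] [InnerProductSpace ℝ V] [NormedAddCommGroup E]
  [InnerProductSpace ℝ E] (D : V →ₗ[ℝ] E) (b : V →ₗ[ℝ] V →ₗ[ℝ] V →ₗ[ℝ] ℝ)

/-- The bounds for the trilinear form which hold if one of the arguments has two derivatives, with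
norm `B` in `H²`. -/
structure SmoothBound (B : ℝ) (z : V) : Prop where
  middle : ∀ x v, |b x z v| ≤ B * (‖D x‖ * ‖v‖)
  left : ∀ x v, |b z x v| ≤ B * (‖D x‖ * ‖v‖)
  middle' : ∀ x v, |b x z v| ≤ B * (‖x‖ * ‖D v‖)

variable {D b}

theorem trilinear_self (hanti : ∀ u v w, b u v w = - b u w v) (u v : V) : b u v v = 0 := by
  linarith [hanti u v v]

variable {u ds db es eb fs fb U' : V} {Cb Ci B δ ζ ζ' τ h : ℝ}

/-- The convective error terms tested with the error itself. -/
theorem convective_error_le (hanti : ∀ u v w, b u v w = - b u w v)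
    (hb : ∀ x y z, |b x y z| ≤ Cb * (‖D x‖ * ‖D y‖ * ‖D z‖))
    (hτ : ∀ x y, |b x y (fb - fs)| ≤ τ * (‖D x‖ * ‖D y‖ * ‖fb - fs‖))
    (hCb : 0 ≤ Cb) (hCi : 0 ≤ Ci) (h0 : 0 < h) (h1 : h ≤ 1)
    (hu : SmoothBound D b B u) (hdb : SmoothBound D b δ db) (hDu : ‖D u‖ ≤ B) (hds : ‖D ds‖ ≤ δ)
    (hdb' : ‖D db‖ ≤ δ) (hes : ‖D es‖ ≤ ζ) (heb : ‖D eb‖ ≤ ζ) (hee : ‖D (eb - es)‖ ≤ ζ')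
    (hδ : δ ≤ B) (hζ : ζ ≤ B * h) (hfs : ‖D fs‖ ≤ Ci * h⁻¹ * ‖fs‖) :
    |b (u + ds - es - fs) (u + db - eb - fb) fb - b u u fb
        - b U' ((u + db - eb - fb) - (u + ds - es - fs)) fb| ≤
      ‖D fb‖ * (B * (2 + 4 * Cb + Cb * Ci) * (‖fs‖ + δ + ζ) + τ * (‖D U'‖ * ‖fb - fs‖)
        + Cb * (‖D U'‖ * (2 * δ + ζ'))) := by
  have hz := trilinear_self hanti
  have hδ0 : 0 ≤ δ := (norm_nonneg _).trans hds
  have hζ0 : 0 ≤ ζ := (norm_nonneg _).trans hes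
  have hB : 0 ≤ B := hδ0.trans hδ
  have hζB : ζ ≤ B := hζ.trans (mul_le_of_le_one_right hB h1)
  set X := ‖D fb‖
  have hX : 0 ≤ X := norm_nonneg _
  have hD' := norm_nonneg (D U')
  have hF := norm_nonneg fs
  have n1 : ‖D (ds - es)‖ ≤ δ + ζ := by
    rw [map_sub]; exact (norm_sub_le _ _).trans (add_le_add hds hes)
  have n2 : ‖D (db - eb)‖ ≤ δ + ζ := by
    rw [map_sub]; exact (norm_sub_le _ _).trans (add_le_add hdb' heb)
  have n3 : ‖D (db - ds)‖ ≤ 2 * δ := by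
    rw [map_sub]; exact (norm_sub_le _ _).trans (by linarith)
  have t1 : |b (ds - es) u fb| ≤ Cb * ((δ + ζ) * B * X) := (hb _ _ _).trans (by gcongr)
  have t2 : |b fs u fb| ≤ B * (‖fs‖ * X) := hu.middle' _ _
  have t3 : |b u (db - eb) fb| ≤ Cb * (B * (δ + ζ) * X) := (hb _ _ _).trans (by gcongr)
  have t4 : |b (ds - es) (db - eb) fb| ≤ Cb * ((δ + ζ) * (2 * B) * X) :=
    (hb _ _ _).trans (by
      have := n2.trans (show δ + ζ ≤ 2 * B by linarith)
      gcongr)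
  have t5 : |b fs db fb| ≤ B * (‖fs‖ * X) := (hdb.middle' _ _).trans (by gcongr)
  have t6 : |b fs eb fb| ≤ Cb * (Ci * B * ‖fs‖ * X) := by
    refine (hb _ _ _).trans ?_
    have : ‖D fs‖ * ‖D eb‖ ≤ Ci * h⁻¹ * ‖fs‖ * (B * h) :=
      mul_le_mul hfs (heb.trans hζ) (norm_nonneg _) (by positivity)
    have e : Ci * h⁻¹ * ‖fs‖ * (B * h) = Ci * B * ‖fs‖ := by field_simp
    rw [e] at this
    gcongr
  have t7 : |b U' (db - ds) fb| ≤ Cb * (‖D U'‖ * (2 * δ) * X) := (hb _ _ _).trans (by gcongr)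
  have t8 : |b U' (eb - es) fb| ≤ Cb * (‖D U'‖ * ζ' * X) := (hb _ _ _).trans (by gcongr)
  have t9 : |b U' (fb - fs) fb| ≤ τ * (‖D U'‖ * X * ‖fb - fs‖) := by
    rw [hanti, abs_neg]
    exact hτ _ _
  have e : b (u + ds - es - fs) (u + db - eb - fb) fb - b u u fb
        - b U' ((u + db - eb - fb) - (u + ds - es - fs)) fb
      = b (ds - es) u fb - b fs u fb + b u (db - eb) fb + b (ds - es) (db - eb) fb
        - b fs db fb + b fs eb fb - b U' (db - ds) fb + b U' (eb - es) fb
        + b U' (fb - fs) fb := by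
    simp only [map_sub, map_add, LinearMap.add_apply, LinearMap.sub_apply, hz]
    ring
  have p1 : 0 ≤ Cb * B * ‖fs‖ * X := by positivity
  have p2 : 0 ≤ B * δ * X := by positivity
  have p3 : 0 ≤ B * ζ * X := by positivity
  have p4 : 0 ≤ Cb * Ci * B * δ * X := by positivity
  have p5 : 0 ≤ Cb * Ci * B * ζ * X := by positivity
  rw [e]
  rw [abs_le] at *
  constructor <;> linarith

/-- The convective error terms tested with a discrete function, bounded by its `L²` norm. -/
theorem convective_error_le' {B₁ : ℝ} {w : V}
    (hτ : ∀ x y, |b x y w| ≤ τ * (‖D x‖ * ‖D y‖ * ‖w‖)) (hτ0 : 0 ≤ τ)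
    (hu : SmoothBound D b B u) (hdb : SmoothBound D b δ db) (hds : SmoothBound D b δ ds)
    (hds' : ‖D ds‖ ≤ δ)
    (hdb' : ‖D db‖ ≤ δ) (hes : ‖D es‖ ≤ ζ) (heb : ‖D eb‖ ≤ ζ) (hee : ‖D (eb - es)‖ ≤ ζ')
    (hδ : δ ≤ B) (hζ : τ * ζ ≤ B₁) :
    |b (u + ds - es - fs) (u + db - eb - fb) w - b u u w
        - b U' ((u + db - eb - fb) - (u + ds - es - fs)) w| ≤
      ‖w‖ * (τ * (‖D U'‖ * ‖D (fb - fs)‖) + ((4 * B + B₁) * (‖D fs‖ + ‖D fb‖ + δ + ζ)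
        + τ * (‖D fs‖ * ‖D fb‖) + ‖D U'‖ * (2 * δ + τ * ζ'))) := by
  have hδ0 : 0 ≤ δ := (norm_nonneg _).trans hds'
  have hζ0 : 0 ≤ ζ := (norm_nonneg _).trans hes
  have hB : 0 ≤ B := hδ0.trans hδ
  have hB₁ : 0 ≤ B₁ := (mul_nonneg hτ0 hζ0).trans hζ
  set X := ‖w‖
  have hX : 0 ≤ X := norm_nonneg _
  have hD' := norm_nonneg (D U')
  have hF := norm_nonneg (D fs)
  have hG := norm_nonneg (D fb)
  have n1 : ‖D (ds - es - fs)‖ ≤ δ + ζ + ‖D fs‖ := by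
    rw [map_sub, map_sub]
    exact (norm_sub_le _ _).trans (by linarith [norm_sub_le (D ds) (D es)])
  have n2 : ‖D (db - eb - fb)‖ ≤ δ + ζ + ‖D fb‖ := by
    rw [map_sub, map_sub]
    exact (norm_sub_le _ _).trans (by linarith [norm_sub_le (D db) (D eb)])
  have n3 : ‖D (es + fs)‖ ≤ ζ + ‖D fs‖ := by
    rw [map_add]; exact (norm_add_le _ _).trans (by linarith)
  have n4 : ‖D (eb + fb)‖ ≤ ζ + ‖D fb‖ := by
    rw [map_add]; exact (norm_add_le _ _).trans (by linarith)
  have t1 : |b (ds - es - fs) u w| ≤ B * ((δ + ζ + ‖D fs‖) * X) :=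
    (hu.middle _ _).trans (by gcongr)
  have t2 : |b u (db - eb - fb) w| ≤ B * ((δ + ζ + ‖D fb‖) * X) :=
    (hu.left _ _).trans (by gcongr)
  have t3 : |b ds (db - eb - fb) w| ≤ B * ((δ + ζ + ‖D fb‖) * X) :=
    (hds.left _ _).trans (by gcongr)
  have t4 : |b (es + fs) db w| ≤ B * ((ζ + ‖D fs‖) * X) :=
    (hdb.middle _ _).trans (by gcongr)
  have t5 : |b (es + fs) (eb + fb) w| ≤
      (B₁ * (ζ + ‖D fs‖ + ‖D fb‖) + τ * (‖D fs‖ * ‖D fb‖)) * X := by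
    refine (hτ _ _).trans ?_
    calc τ * (‖D (es + fs)‖ * ‖D (eb + fb)‖ * X)
        ≤ τ * ((ζ + ‖D fs‖) * (ζ + ‖D fb‖) * X) := by gcongr
      _ = ((τ * ζ) * (ζ + ‖D fs‖ + ‖D fb‖) + τ * (‖D fs‖ * ‖D fb‖)) * X := by ring
      _ ≤ _ := by gcongr
  have t6 : |b U' (db - ds) w| ≤ 2 * δ * (‖D U'‖ * X) := by
    rw [map_sub, LinearMap.sub_apply]
    refine (abs_sub _ _).trans ?_
    linarith [hdb.middle U' w, hds.middle U' w]
  have t7 : |b U' (eb - es) w| ≤ τ * (‖D U'‖ * ζ' * X) := (hτ _ _).trans (by gcongr)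
  have t8 := hτ U' (fb - fs)
  have e : b (u + ds - es - fs) (u + db - eb - fb) w - b u u w
        - b U' ((u + db - eb - fb) - (u + ds - es - fs)) w
      = b (ds - es - fs) u w + b u (db - eb - fb) w + b ds (db - eb - fb) w - b (es + fs) db w
        + b (es + fs) (eb + fb) w - b U' (db - ds) w + b U' (eb - es) w
        + b U' (fb - fs) w := by
    simp only [map_sub, map_add, LinearMap.add_apply, LinearMap.sub_apply]
    ring
  have p1 : 0 ≤ B * δ * X := by positivity
  have p2 : 0 ≤ B₁ * δ * X := by positivity
  have p3 : 0 ≤ B * ‖D fs‖ * X := by positivity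
  have p4 : 0 ≤ B * ‖D fb‖ * X := by positivity
  rw [e]
  rw [abs_le] at *
  constructor <;> linarith

end Convective

/-! ### Discrete Gronwall inequality -/

/-- The explicit discrete Gronwall inequality: the right-hand side contains `y (n - 1)` only, so no
smallness of the weights `a n` is needed. The nonnegative increments `c n` are summed on the left.
-/
theorem discrete_gronwall {N : ℕ} {y c a r : ℕ → ℝ} (hy : ∀ n, 0 ≤ y n)
    (ha : ∀ n ∈ Finset.Ico 1 N, 0 ≤ a n) (hr : ∀ n ∈ Finset.Ico 1 N, 0 ≤ r n)
    (hc : ∀ n ∈ Finset.Ico 1 N, 0 ≤ c n)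
    (h : ∀ n ∈ Finset.Ico 1 N, y n + c n ≤ (1 + a n) * y (n - 1) + r n) {A R : ℝ}
    (hA : ∑ n ∈ Finset.Ico 1 N, a n ≤ A) (hR : ∑ n ∈ Finset.Ico 1 N, r n ≤ R) :
    (∀ m < N, y m ≤ Real.exp A * (y 0 + R)) ∧
      ∑ n ∈ Finset.Ico 1 N, c n ≤ Real.exp A * (y 0 + R) := by
  have key : ∀ m < N, y m + ∑ n ∈ Finset.Ico 1 (m + 1), c n ≤
      Real.exp (∑ n ∈ Finset.Ico 1 (m + 1), a n) * (y 0 + ∑ n ∈ Finset.Ico 1 (m + 1), r n) := by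
    intro m
    induction m with
    | zero => simp
    | succ m ih =>
      intro hm
      have hm1 : m + 1 ∈ Finset.Ico 1 N := Finset.mem_Ico.2 ⟨by omega, hm⟩
      have h1 := h (m + 1) hm1
      have h2 := ih (by omega)
      simp only [Nat.add_sub_cancel] at h1
      have e0 := fun g : ℕ → ℝ => Finset.sum_Ico_succ_top (show 1 ≤ m + 1 by omega) g
      rw [e0 c, e0 a, e0 r]
      have hsub : ∀ n ∈ Finset.Ico 1 (m + 1), n ∈ Finset.Ico 1 N := fun n hn => by
        simp only [Finset.mem_Ico] at *
        omega
      set sc := ∑ n ∈ Finset.Ico 1 (m + 1), c n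
      set sa := ∑ n ∈ Finset.Ico 1 (m + 1), a n
      set sr := ∑ n ∈ Finset.Ico 1 (m + 1), r n
      have hsc : 0 ≤ sc := Finset.sum_nonneg fun n hn => hc n (hsub n hn)
      have hsa : 0 ≤ sa := Finset.sum_nonneg fun n hn => ha n (hsub n hn)
      have hsr : 0 ≤ sr := Finset.sum_nonneg fun n hn => hr n (hsub n hn)
      have ha1 := ha _ hm1
      have hr1 := hr _ hm1
      have e1 : 1 + a (m + 1) ≤ Real.exp (a (m + 1)) := by
        linarith [Real.add_one_le_exp (a (m + 1))]
      have e2 : 1 ≤ Real.exp (sa + a (m + 1)) := Real.one_le_exp (by linarith)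
      have e3 : (1 + a (m + 1)) * (y m + sc) ≤
          Real.exp (a (m + 1)) * (Real.exp sa * (y 0 + sr)) :=
        mul_le_mul e1 h2 (add_nonneg (hy m) hsc) (Real.exp_nonneg _)
      have e4 : Real.exp (a (m + 1)) * (Real.exp sa * (y 0 + sr))
          = Real.exp (sa + a (m + 1)) * (y 0 + sr) := by
        rw [Real.exp_add]
        ring
      rw [e4] at e3
      nlinarith [mul_le_mul_of_nonneg_right e2 hr1, mul_nonneg ha1 hsc]
  have hR0 : 0 ≤ ∑ n ∈ Finset.Ico 1 N, r n := Finset.sum_nonneg hr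
  have mono : ∀ m < N, Real.exp (∑ n ∈ Finset.Ico 1 (m + 1), a n)
      * (y 0 + ∑ n ∈ Finset.Ico 1 (m + 1), r n) ≤ Real.exp A * (y 0 + R) := by
    intro m hm
    have hss : Finset.Ico 1 (m + 1) ⊆ Finset.Ico 1 N := Finset.Ico_subset_Ico_right (by omega)
    have h1 := Finset.sum_le_sum_of_subset_of_nonneg hss fun n hn _ => ha n hn
    have h2 := Finset.sum_le_sum_of_subset_of_nonneg hss fun n hn _ => hr n hn
    have h3 : 0 ≤ ∑ n ∈ Finset.Ico 1 (m + 1), r n := Finset.sum_nonneg fun n hn => hr n (hss hn)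
    exact mul_le_mul (Real.exp_le_exp.2 (h1.trans hA)) (by linarith) (add_nonneg (hy 0) h3)
      (Real.exp_nonneg _)
  constructor
  · intro m hm
    have h1 := (key m hm).trans (mono m hm)
    have h2 : 0 ≤ ∑ n ∈ Finset.Ico 1 (m + 1), c n := Finset.sum_nonneg fun n hn => hc n (by
      simp only [Finset.mem_Ico] at *
      omega)
    linarith
  · rcases Nat.lt_or_ge 1 N with hN | hN
    · have h1 := (key (N - 1) (by omega)).trans (mono (N - 1) (by omega))
      rw [Nat.sub_add_cancel (by omega)] at h1
      linarith [hy (N - 1)]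
    · rw [Finset.Ico_eq_empty (by omega), Finset.sum_empty]
      exact mul_nonneg (Real.exp_nonneg _) (add_nonneg (hy 0) (hR0.trans hR))

/-! ### The energy argument -/

section Energy

theorem mul_le_quarter_sq {ν : ℝ} (hν : 0 < ν) (x g : ℝ) : x * g ≤ ν / 4 * x ^ 2 + g ^ 2 / ν := by
  have h : 0 ≤ (ν * x / 2 - g) ^ 2 / ν := by positivity
  have e : (ν * x / 2 - g) ^ 2 / ν = ν / 4 * x ^ 2 + g ^ 2 / ν - x * g := by
    field_simp
    ring
  linarith

theorem add_sq_le_four (a b c e : ℝ) :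
    (a + (b + c + e)) ^ 2 ≤ 4 * (a ^ 2 + b ^ 2 + c ^ 2 + e ^ 2) := by
  linarith [sq_nonneg (a - b), sq_nonneg (a - c), sq_nonneg (a - e), sq_nonneg (b - c),
    sq_nonneg (b - e), sq_nonneg (c - e)]

/-- Young's inequality for the `L²` energy balance; the part `p` of the right-hand side is absorbed
by the dissipation `dis`. -/
theorem energy_absorb {k ν x Y' Y dis L g₁ p g₂ : ℝ} (hk : 0 < k) (hν : 0 < ν)
    (h : Y' - Y + dis + k * ν * x ^ 2 ≤ k * L) (hL : L ≤ x * (g₁ + p + g₂))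
    (hp : k * p ^ 2 ≤ ν * dis) :
    Y' + k * ν / 4 * x ^ 2 ≤ Y + k / ν * (g₁ ^ 2 + g₂ ^ 2) := by
  have h1 := mul_le_quarter_sq hν x g₁
  have h2 := mul_le_quarter_sq hν x p
  have h3 := mul_le_quarter_sq hν x g₂
  have h4 : k * L ≤ k * (3 * (ν / 4 * x ^ 2) + (g₁ ^ 2 + p ^ 2 + g₂ ^ 2) / ν) := by
    refine mul_le_mul_of_nonneg_left (hL.trans ?_) hk.le
    have : (g₁ ^ 2 + p ^ 2 + g₂ ^ 2) / ν = g₁ ^ 2 / ν + p ^ 2 / ν + g₂ ^ 2 / ν := by ring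
    rw [this]
    linarith
  have h5 : k * p ^ 2 / ν ≤ dis := by
    rw [div_le_iff₀ hν]
    linarith
  have e : k * (3 * (ν / 4 * x ^ 2) + (g₁ ^ 2 + p ^ 2 + g₂ ^ 2) / ν)
      = 3 * (k * ν / 4 * x ^ 2) + k / ν * (g₁ ^ 2 + g₂ ^ 2) + k * p ^ 2 / ν := by ring
  rw [e] at h4
  linarith

/-- Young's inequality for the `H¹` energy balance; the part `p` of the right-hand side is absorbed
by the dissipation `dis`. -/
theorem energy_absorb' {k ν w Y' Y dis L p g : ℝ} (hk : 0 < k)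
    (h : k * w ^ 2 + ν * (Y' - Y + dis) ≤ k * L) (hL : L ≤ w * (p + g))
    (hp : k * p ^ 2 ≤ ν * dis) :
    ν * Y' + k / 2 * w ^ 2 ≤ ν * Y + k * g ^ 2 := by
  have h1 : k * L ≤ k * (w ^ 2 / 2 + p ^ 2 + g ^ 2) := by
    refine mul_le_mul_of_nonneg_left (hL.trans ?_) hk.le
    nlinarith [sq_nonneg (w / 2 - p), sq_nonneg (w / 2 - g)]
  linarith

variable {θ : ℝ} {t : ℕ → ℝ} {n : ℕ}

/-- The constant in the estimate of the extrapolation `z_{n,*}` by the `G`-norm. -/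
noncomputable def starConst (θ R : ℝ) : ℝ := 8 * (betaBound θ * (2 + R)) ^ 2 / (1 - θ)

theorem starConst_nonneg (hθ1 : θ < 1) (R : ℝ) : 0 ≤ starConst θ R :=
  div_nonneg (by positivity) (by linarith)

theorem gNormSq_nonneg {H : Type*} [NormedAddCommGroup H] (hθ0 : 0 < θ) (hθ1 : θ < 1)
    (z : ℕ → H) : 0 ≤ (1 + θ) / 4 * ‖z (n + 1)‖ ^ 2 + (1 - θ) / 4 * ‖z n‖ ^ 2 :=
  add_nonneg (mul_nonneg (by linarith) (sq_nonneg _)) (mul_nonneg (by linarith) (sq_nonneg _))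

/-- The extrapolation `z_{n,*}` is bounded by the `G`-norm of the previous pair, which makes the
Gronwall argument explicit. -/
theorem norm_zStar_sq_le {H : Type*} [NormedAddCommGroup H] [InnerProductSpace ℝ H]
    (hθ0 : 0 < θ) (hθ1 : θ < 1) (hn : 1 ≤ n) (h1 : 0 < stp t n) (h0 : 0 < stp t (n - 1)) {R : ℝ}
    (hR : stp t n / stp t (n - 1) ≤ R) (z : ℕ → H) :
    ‖zStar θ t z n‖ ^ 2 ≤ starConst θ R * gNormSq θ z (n - 1) := by
  have hc := abs_starCoeff_le hθ0 hθ1 h1 h0 hR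
  set c := betaBound θ * (2 + R)
  have hc0 : 0 ≤ c := (abs_nonneg _).trans (hc 0)
  have h2 : ‖zStar θ t z n‖ ≤ c * ‖z n‖ + c * ‖z (n - 1)‖ := by
    rw [zStar_eq]
    refine (norm_add_le _ _).trans (add_le_add ?_ ?_)
    · rw [norm_smul]
      exact mul_le_mul_of_nonneg_right (hc 1) (norm_nonneg _)
    · rw [norm_smul]
      exact mul_le_mul_of_nonneg_right (hc 0) (norm_nonneg _)
  have h3 := pow_le_pow_left₀ (norm_nonneg _) h2 2
  refine h3.trans ?_
  have hθ : (0 : ℝ) < 1 - θ := by linarith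
  have e : starConst θ R * gNormSq θ z (n - 1)
      = 2 * c ^ 2 * ((1 + θ) / (1 - θ) * ‖z n‖ ^ 2 + ‖z (n - 1)‖ ^ 2) := by
    simp only [starConst, gNormSq, Nat.sub_add_cancel hn]
    field_simp
    ring
  rw [e]
  have h4 : 1 ≤ (1 + θ) / (1 - θ) := by
    rw [le_div_iff₀ hθ]
    linarith
  have h5 : c ^ 2 * (‖z n‖ ^ 2) ≤ c ^ 2 * ((1 + θ) / (1 - θ) * ‖z n‖ ^ 2) :=
    mul_le_mul_of_nonneg_left (le_mul_of_one_le_left (sq_nonneg _) h4) (sq_nonneg _)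
  nlinarith [sq_nonneg (c * ‖z n‖ - c * ‖z (n - 1)‖)]

variable {V E : Type*} [NormedAddCommGroup V] [InnerProductSpace ℝ V] [NormedAddCommGroup E]
  [InnerProductSpace ℝ E] (D : V →ₗ[ℝ] E) (b : V →ₗ[ℝ] V →ₗ[ℝ] V →ₗ[ℝ] ℝ)

/-- The data of one time step of the error equation. Here `φ` is the discrete part of the error, `u`
the exact solution at `t_{n,β}`, `ds` and `db` are the consistency errors of `z_{n,*}` and
`z_{n,β}`, `es` and `eb` the corresponding projection errors, and `U'` the fluctuation of the
ensemble. -/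
structure ErrorStep (S : Submodule ℝ V) (θ ν B κ c h : ℝ) (t : ℕ → ℝ) (φ : ℕ → V) (n : ℕ)
    (u ds db es eb U' : V) (δ ζ ζ' γ : ℝ) (l : V → ℝ) : Prop where
  smooth_u : SmoothBound D b B u
  smooth_ds : SmoothBound D b δ ds
  smooth_db : SmoothBound D b δ db
  norm_u : ‖D u‖ ≤ B
  norm_ds : ‖D ds‖ ≤ δ
  norm_db : ‖D db‖ ≤ δ
  norm_es : ‖D es‖ ≤ ζ
  norm_eb : ‖D eb‖ ≤ ζ
  norm_sub : ‖D (eb - es)‖ ≤ ζ'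
  le_B : δ ≤ B
  le_Bh : ζ ≤ B * h
  cfl : c * ((1 + vari t n * θ) / (1 - vari t n)) ^ 2 * (khat θ t n * ‖D U'‖ ^ 2) ≤ h * ν
  cfl' : khat θ t n * ‖D U'‖ ^ 2 ≤ κ * h
  eq : ∀ v ∈ S, inner ℝ ((khat θ t n)⁻¹ • zAlpha θ φ n) v
      + ν * inner ℝ (D (zBeta θ t φ n)) (D v)
    = l v + (b (u + ds - es - zStar θ t φ n) (u + db - eb - zBeta θ t φ n) v - b u u v
        - b U' ((u + db - eb - zBeta θ t φ n) - (u + ds - es - zStar θ t φ n)) v)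
  l_le : ∀ v ∈ S, |l v| ≤ γ * ‖v‖

/-- The contribution of one time step to the square of the consistency error. -/
noncomputable def residual (k h δ ζ ζ' γ : ℝ) : ℝ :=
  k * (γ ^ 2 + δ ^ 2 + ζ ^ 2) + h * δ ^ 2 + ζ' ^ 2

variable {D b} {S : Submodule ℝ V} {ν B κ h Cb Ci CP R : ℝ} {φ : ℕ → V}
  {u ds db es eb U' : V} {δ ζ ζ' γ : ℝ} {l : V → ℝ}

theorem residual_nonneg {k : ℝ} (hk : 0 ≤ k) (h0 : 0 ≤ h) : 0 ≤ residual k h δ ζ ζ' γ := by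
  unfold residual
  positivity

/-- The inverse inequality trades half a derivative of a discrete last argument for a factor `h ^
(-1/2)`. -/
theorem abs_trilinear_le_of_inverse (hCb : 0 ≤ Cb) (hCi : 0 ≤ Ci) (h0 : 0 < h)
    (hT : ∀ x y z, |b x y z| ≤ Cb * (‖D x‖ * ‖D y‖ * Real.sqrt (‖z‖ * ‖D z‖)))
    (hinv : ∀ v ∈ S, ‖D v‖ ≤ Ci * h⁻¹ * ‖v‖) {w : V} (hw : w ∈ S) (x y : V) :
    |b x y w| ≤ Cb * Real.sqrt (Ci * h⁻¹) * (‖D x‖ * ‖D y‖ * ‖w‖) := by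
  refine (hT x y w).trans ?_
  have h1 : Real.sqrt (‖w‖ * ‖D w‖) ≤ Real.sqrt (Ci * h⁻¹) * ‖w‖ := by
    rw [← Real.sqrt_sq (norm_nonneg w), ← Real.sqrt_mul (by positivity), Real.sqrt_sq (norm_nonneg w)]
    refine Real.sqrt_le_sqrt ?_
    nlinarith [hinv w hw, norm_nonneg w]
  have e : Cb * Real.sqrt (Ci * h⁻¹) * (‖D x‖ * ‖D y‖ * ‖w‖)
      = Cb * (‖D x‖ * ‖D y‖ * (Real.sqrt (Ci * h⁻¹) * ‖w‖)) := by ring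
  rw [e]
  gcongr

/-- The CFL-like condition lets the numerical dissipation absorb the difference of `z_{n,β}` and
`z_{n,*}` in the fluctuation term. -/
theorem cfl_absorb {H : Type*} [NormedAddCommGroup H] [InnerProductSpace ℝ H] {m : ℝ}
    (hCi : 0 ≤ Ci) (h0 : 0 < h) (hθ0 : 0 < θ) (hθ1 : θ < 1)
    (hk1 : 0 < stp t n) (hk0 : 0 < stp t (n - 1))
    (hcfl : Cb ^ 2 * Ci * dissipConst θ * ((1 + vari t n * θ) / (1 - vari t n)) ^ 2
      * (khat θ t n * m ^ 2) ≤ h * ν) (z : ℕ → H) :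
    khat θ t n * (Cb * Real.sqrt (Ci * h⁻¹) * (m * ‖zBeta θ t z n - zStar θ t z n‖)) ^ 2
      ≤ ν * dissip θ t z n := by
  have hk : 0 < khat θ t n := khat_pos hθ0 hθ1 hk1 hk0
  have h2 := norm_zBeta_sub_zStar_sq_le hθ0 hθ1 hk1 hk0 z
  set k := khat θ t n
  set τ := Cb * Real.sqrt (Ci * h⁻¹)
  have hτ2 : τ ^ 2 * h = Cb ^ 2 * Ci := by
    rw [mul_pow, Real.sq_sqrt (by positivity)]
    field_simp
  set q := ((1 + vari t n * θ) / (1 - vari t n)) ^ 2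
  have hdis := dissip_nonneg (t := t) (n := n) hθ0 hθ1 z
  have h4 : τ ^ 2 * (dissipConst θ * q) * (k * m ^ 2) ≤ ν := by
    have : h * (τ ^ 2 * (dissipConst θ * q) * (k * m ^ 2)) ≤ h * ν := by
      calc _ = τ ^ 2 * h * dissipConst θ * q * (k * m ^ 2) := by ring
        _ ≤ _ := by rw [hτ2]; exact hcfl
    exact le_of_mul_le_mul_left this h0
  set e := zBeta θ t z n - zStar θ t z n
  calc k * (τ * (m * ‖e‖)) ^ 2
      = τ ^ 2 * (k * m ^ 2) * ‖e‖ ^ 2 := by ring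
    _ ≤ τ ^ 2 * (k * m ^ 2) * (dissipConst θ * q * dissip θ t z n) := by gcongr
    _ = τ ^ 2 * (dissipConst θ * q) * (k * m ^ 2) * dissip θ t z n := by ring
    _ ≤ _ := by gcongr

/-- The `L²` energy inequality. The dissipation of the DLN method absorbs the ensemble fluctuation by
the CFL-like condition. -/
theorem ErrorStep.energy_L2 (hanti : ∀ u v w, b u v w = - b u w v)
    (hb : ∀ x y z, |b x y z| ≤ Cb * (‖D x‖ * ‖D y‖ * ‖D z‖))
    (hT : ∀ x y z, |b x y z| ≤ Cb * (‖D x‖ * ‖D y‖ * Real.sqrt (‖z‖ * ‖D z‖)))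
    (hP : ∀ v, ‖v‖ ≤ CP * ‖D v‖)
    (hCb : 0 ≤ Cb) (hCi : 0 ≤ Ci) (h0 : 0 < h) (h1 : h ≤ 1)
    (hν : 0 < ν) (hinv : ∀ v ∈ S, ‖D v‖ ≤ Ci * h⁻¹ * ‖v‖) (hθ0 : 0 < θ) (hθ1 : θ < 1)
    (hn : 1 ≤ n) (hk1 : 0 < stp t n) (hk0 : 0 < stp t (n - 1))
    (hR : stp t n / stp t (n - 1) ≤ R)
    (hβ : zBeta θ t φ n ∈ S) (hs : zStar θ t φ n ∈ S)
    (hst : ErrorStep D b S θ ν B κ (Cb ^ 2 * Ci * dissipConst θ) h t φ n u ds db es eb U' δ ζ ζ' γ l) :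
    gNormSq θ φ n + khat θ t n * ν / 4 * ‖D (zBeta θ t φ n)‖ ^ 2 ≤
      (1 + 4 / ν * (B * (2 + 4 * Cb + Cb * Ci)) ^ 2 * starConst θ R * khat θ t n)
          * gNormSq θ φ (n - 1)
        + (4 / ν * (CP ^ 2 + (B * (2 + 4 * Cb + Cb * Ci)) ^ 2) + 8 * Cb ^ 2 * κ / ν)
          * residual (khat θ t n) h δ ζ ζ' γ := by
  set K := B * (2 + 4 * Cb + Cb * Ci)
  set k := khat θ t n
  have hk : 0 < k := khat_pos hθ0 hθ1 hk1 hk0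
  set τ := Cb * Real.sqrt (Ci * h⁻¹)
  have hτ0 : 0 ≤ τ := by positivity
  have hτ2 : τ ^ 2 * h = Cb ^ 2 * Ci := by
    rw [mul_pow, Real.sq_sqrt (by positivity)]
    field_simp
  set fs := zStar θ t φ n
  set fb := zBeta θ t φ n
  have hbs : fb - fs ∈ S := S.sub_mem hβ hs
  have hconv := convective_error_le (U' := U') hanti hb
    (abs_trilinear_le_of_inverse hCb hCi h0 hT hinv hbs) hCb hCi h0 h1
    hst.smooth_u hst.smooth_db hst.norm_u hst.norm_ds hst.norm_db hst.norm_es hst.norm_eb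
    hst.norm_sub hst.le_B hst.le_Bh (hinv fs hs)
  have hl := hst.l_le fb hβ
  have heq := hst.eq fb hβ
  have hG := inner_zAlpha_zBeta hθ0 hθ1 hn hk1 hk0 φ
  have hl2 : |l fb| ≤ ‖D fb‖ * (CP * |γ|) := by
    refine hl.trans ((mul_le_mul_of_nonneg_right (le_abs_self γ) (norm_nonneg _)).trans ?_)
    linarith [mul_le_mul_of_nonneg_left (hP fb) (abs_nonneg γ)]
  rw [inner_smul_left, hG, real_inner_self_eq_norm_sq] at heq
  simp only [conj_trivial] at heq
  set L := l fb + (b (u + ds - es - fs) (u + db - eb - fb) fb - b u u fb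
    - b U' ((u + db - eb - fb) - (u + ds - es - fs)) fb)
  have hmain : gNormSq θ φ n - gNormSq θ φ (n - 1) + dissip θ t φ n + k * ν * ‖D fb‖ ^ 2
      ≤ k * L := by
    rw [← heq]
    have : k * (k⁻¹ * (gNormSq θ φ n - gNormSq θ φ (n - 1) + dissip θ t φ n)
        + ν * ‖D fb‖ ^ 2)
        = gNormSq θ φ n - gNormSq θ φ (n - 1) + dissip θ t φ n + k * ν * ‖D fb‖ ^ 2 := by
      field_simp
    rw [this]
  have hL : L ≤ ‖D fb‖ * ((CP * |γ| + K * (‖fs‖ + δ + ζ)) + τ * (‖D U'‖ * ‖fb - fs‖)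
      + Cb * (‖D U'‖ * (2 * δ + ζ'))) := by
    have h2 := le_of_abs_le hl2
    have h3 := le_of_abs_le hconv
    simp only [L]
    linarith
  have hp : k * (τ * (‖D U'‖ * ‖fb - fs‖)) ^ 2 ≤ ν * dissip θ t φ n :=
    cfl_absorb hCi h0 hθ0 hθ1 hk1 hk0 hst.cfl φ
  have habs := energy_absorb hk hν hmain hL hp
  refine habs.trans ?_
  have hfs := norm_zStar_sq_le hθ0 hθ1 hn hk1 hk0 hR φ
  have g1 : (CP * |γ| + K * (‖fs‖ + δ + ζ)) ^ 2 ≤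
      4 * (CP ^ 2 + K ^ 2) * (γ ^ 2 + δ ^ 2 + ζ ^ 2)
        + 4 * K ^ 2 * (starConst θ R * gNormSq θ φ (n - 1)) := by
    have i1 := add_sq_le_four (CP * |γ|) (K * ‖fs‖) (K * δ) (K * ζ)
    rw [← mul_add, ← mul_add] at i1
    have i2 : K ^ 2 * ‖fs‖ ^ 2 ≤ K ^ 2 * (starConst θ R * gNormSq θ φ (n - 1)) := by gcongr
    rw [mul_pow, mul_pow, mul_pow, mul_pow, sq_abs] at i1
    have p1 : 0 ≤ CP ^ 2 * (δ ^ 2 + ζ ^ 2) := by positivity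
    have p2 : 0 ≤ K ^ 2 * γ ^ 2 := by positivity
    linarith
  have g2 : k * (Cb * (‖D U'‖ * (2 * δ + ζ'))) ^ 2 ≤ 8 * Cb ^ 2 * κ * (h * δ ^ 2 + ζ' ^ 2) := by
    have i1 : (2 * δ + ζ') ^ 2 ≤ 8 * δ ^ 2 + 2 * ζ' ^ 2 := by
      linarith [sq_nonneg (2 * δ - ζ')]
    have hκ : 0 ≤ κ * h := le_trans (by positivity) hst.cfl'
    have hκ0 : 0 ≤ κ := nonneg_of_mul_nonneg_left hκ h0
    calc k * (Cb * (‖D U'‖ * (2 * δ + ζ'))) ^ 2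
        = Cb ^ 2 * ((k * ‖D U'‖ ^ 2) * (2 * δ + ζ') ^ 2) := by ring
      _ ≤ Cb ^ 2 * ((κ * h) * (8 * δ ^ 2 + 2 * ζ' ^ 2)) := by
          have := hst.cfl'
          gcongr
      _ = 8 * Cb ^ 2 * κ * (h * δ ^ 2) + 2 * Cb ^ 2 * κ * ζ' ^ 2 * h := by ring
      _ ≤ 8 * Cb ^ 2 * κ * (h * δ ^ 2) + 8 * Cb ^ 2 * κ * ζ' ^ 2 * 1 := by
          gcongr
          norm_num
      _ = _ := by ring
  have hκ0 : 0 ≤ κ := nonneg_of_mul_nonneg_left (le_trans (by positivity) hst.cfl') h0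
  have g3 : k / ν * (CP * |γ| + K * (‖fs‖ + δ + ζ)) ^ 2 ≤ k / ν *
      (4 * (CP ^ 2 + K ^ 2) * (γ ^ 2 + δ ^ 2 + ζ ^ 2)
        + 4 * K ^ 2 * (starConst θ R * gNormSq θ φ (n - 1))) := by gcongr
  have g4 : k / ν * (Cb * (‖D U'‖ * (2 * δ + ζ'))) ^ 2 ≤
      8 * Cb ^ 2 * κ / ν * (h * δ ^ 2 + ζ' ^ 2) := by
    have e1 : k / ν * (Cb * (‖D U'‖ * (2 * δ + ζ'))) ^ 2
        = (k * (Cb * (‖D U'‖ * (2 * δ + ζ'))) ^ 2) / ν := by ring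
    have e2 : 8 * Cb ^ 2 * κ / ν * (h * δ ^ 2 + ζ' ^ 2)
        = (8 * Cb ^ 2 * κ * (h * δ ^ 2 + ζ' ^ 2)) / ν := by ring
    rw [e1, e2]
    gcongr
  have p1 : 0 ≤ 4 / ν * (CP ^ 2 + K ^ 2) * (h * δ ^ 2 + ζ' ^ 2) := by positivity
  have p2 : 0 ≤ 8 * Cb ^ 2 * κ / ν * (k * (γ ^ 2 + δ ^ 2 + ζ ^ 2)) := by positivity
  have e3 : k / ν * (4 * (CP ^ 2 + K ^ 2) * (γ ^ 2 + δ ^ 2 + ζ ^ 2)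
        + 4 * K ^ 2 * (starConst θ R * gNormSq θ φ (n - 1)))
      = 4 / ν * (CP ^ 2 + K ^ 2) * (k * (γ ^ 2 + δ ^ 2 + ζ ^ 2))
        + 4 / ν * K ^ 2 * starConst θ R * k * gNormSq θ φ (n - 1) := by ring
  rw [e3] at g3
  unfold residual
  linarith

end Energy

/-! ### The estimate in `H¹` -/

section EnergyH1

variable {θ : ℝ} {t : ℕ → ℝ} {n : ℕ}
variable {V E : Type*} [NormedAddCommGroup V] [InnerProductSpace ℝ V] [NormedAddCommGroup E]
  [InnerProductSpace ℝ E] {D : V →ₗ[ℝ] E} {b : V →ₗ[ℝ] V →ₗ[ℝ] V →ₗ[ℝ] ℝ}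
variable {S : Submodule ℝ V} {ν B κ h Cb Ci CP R : ℝ} {φ : ℕ → V}
  {u ds db es eb U' : V} {δ ζ ζ' γ : ℝ} {l : V → ℝ}

/-- The square of the right-hand side of the `H¹` estimate. The product `f * x` of two discrete
errors contributes to the factor of `Y`, everything else to the residual and to the viscous term
`k * x ^ 2`, which is summable by the `L²` estimate. -/
theorem energy_H1_rhs {k g f x d m F Y K c τ : ℝ} (hk : 0 ≤ k) (h0 : 0 < h) (hF : f ^ 2 ≤ F * Y)
    (hm : k * m ^ 2 ≤ κ * h) (hτ : τ ^ 2 * h = c) (hc : 0 ≤ c)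
    (hg : g = γ + K * (f + x + δ + ζ) + τ * (f * x) + m * (2 * d + τ * ζ')) (hd : d = δ) :
    k * g ^ 2 ≤ 16 * F * (K ^ 2 * k + c * (k * x ^ 2 / h)) * Y
      + (16 * (1 + K ^ 2) + 32 * κ + 8 * κ * c) * (residual k h δ ζ ζ' γ + k * x ^ 2) := by
  subst hd
  have i1 := add_sq_le_four γ (K * (f + x + d + ζ)) (τ * (f * x)) (m * (2 * d + τ * ζ'))
  have i2 := add_sq_le_four f x d ζ
  have i3 : (2 * d + τ * ζ') ^ 2 ≤ 8 * d ^ 2 + 2 * (τ ^ 2 * ζ' ^ 2) := by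
    linarith [sq_nonneg (2 * d - τ * ζ')]
  have hκ : 0 ≤ κ := nonneg_of_mul_nonneg_left (le_trans (by positivity) hm) h0
  have eg : g = γ + (K * (f + x + d + ζ) + τ * (f * x) + m * (2 * d + τ * ζ')) := by
    rw [hg]; ring
  have ef : f + x + d + ζ = f + (x + d + ζ) := by ring
  rw [← eg] at i1
  have hτe : τ ^ 2 = c / h := by
    rw [← hτ]
    field_simp
  have j1 : k * (K * (f + x + d + ζ)) ^ 2 ≤
      4 * K ^ 2 * (k * (x ^ 2 + d ^ 2 + ζ ^ 2)) + 4 * K ^ 2 * k * (F * Y) := by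
    rw [ef]
    calc k * (K * (f + (x + d + ζ))) ^ 2 = k * K ^ 2 * (f + (x + d + ζ)) ^ 2 := by ring
      _ ≤ k * K ^ 2 * (4 * (F * Y + x ^ 2 + d ^ 2 + ζ ^ 2)) := by
          refine mul_le_mul_of_nonneg_left (i2.trans ?_) (by positivity)
          linarith
      _ = _ := by ring
  have j2 : k * (τ * (f * x)) ^ 2 ≤ c * (k * x ^ 2 / h) * (F * Y) := by
    calc k * (τ * (f * x)) ^ 2 = τ ^ 2 * (k * x ^ 2) * f ^ 2 := by ring
      _ ≤ τ ^ 2 * (k * x ^ 2) * (F * Y) := by gcongr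
      _ = _ := by
          rw [hτe]
          ring
  have j3 : k * (m * (2 * d + τ * ζ')) ^ 2 ≤ 8 * κ * (h * d ^ 2) + 2 * κ * c * ζ' ^ 2 := by
    calc k * (m * (2 * d + τ * ζ')) ^ 2 = (k * m ^ 2) * (2 * d + τ * ζ') ^ 2 := by ring
      _ ≤ (κ * h) * (8 * d ^ 2 + 2 * (τ ^ 2 * ζ' ^ 2)) := by gcongr
      _ = 8 * κ * (h * d ^ 2) + 2 * κ * (τ ^ 2 * h) * ζ' ^ 2 := by ring
      _ = _ := by rw [hτ]
  have i4 := mul_le_mul_of_nonneg_left i1 hk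
  have hFY : 0 ≤ F * Y := (sq_nonneg f).trans hF
  have p1 : 0 ≤ k * (c * (x ^ 2 / h)) * (F * Y) := by positivity
  have p2 : 0 ≤ k * γ ^ 2 := by positivity
  have p3 : 0 ≤ K ^ 2 * (k * γ ^ 2) := by positivity
  have p4 : 0 ≤ k * (x ^ 2 + d ^ 2 + ζ ^ 2) := by positivity
  have p5 : 0 ≤ (1 + K ^ 2) * (h * d ^ 2) := by positivity
  have p6 : 0 ≤ (1 + K ^ 2) * ζ' ^ 2 := by positivity
  have p7 : 0 ≤ κ * (k * (γ ^ 2 + d ^ 2 + ζ ^ 2) + k * x ^ 2) := by positivity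
  have p8 : 0 ≤ κ * c * (k * (γ ^ 2 + d ^ 2 + ζ ^ 2) + k * x ^ 2 + h * d ^ 2) := by positivity
  have p9 : 0 ≤ κ * ζ' ^ 2 := by positivity
  have p10 : 0 ≤ κ * (h * d ^ 2) := by positivity
  have p11 : 0 ≤ c * (k * x ^ 2 / h) * (F * Y) := by positivity
  unfold residual
  linarith

/-- The `H¹` energy inequality. The product of the discrete errors enters with the factor
`h⁻¹ ‖D z_{n,β}‖²`, which is summable by the `L²` energy estimate. -/
theorem ErrorStep.energy_H1
    (hT : ∀ x y z, |b x y z| ≤ Cb * (‖D x‖ * ‖D y‖ * Real.sqrt (‖z‖ * ‖D z‖)))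
    (hCb : 0 ≤ Cb) (hCi : 0 ≤ Ci) (h0 : 0 < h) (h1 : h ≤ 1)
    (hinv : ∀ v ∈ S, ‖D v‖ ≤ Ci * h⁻¹ * ‖v‖) (hθ0 : 0 < θ) (hθ1 : θ < 1)
    (hn : 1 ≤ n) (hk1 : 0 < stp t n) (hk0 : 0 < stp t (n - 1))
    (hR : stp t n / stp t (n - 1) ≤ R) (hα : zAlpha θ φ n ∈ S)
    (hst : ErrorStep D b S θ ν B κ (Cb ^ 2 * Ci * dissipConst θ) h t φ n u ds db es eb U' δ ζ ζ' γ l) :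
    ν * gNormSq θ (fun i => D (φ i)) n
        + khat θ t n / 2 * ‖(khat θ t n)⁻¹ • zAlpha θ φ n‖ ^ 2 ≤
      ν * gNormSq θ (fun i => D (φ i)) (n - 1)
        + (16 * starConst θ R * ((4 * B + Cb * Real.sqrt Ci * B) ^ 2 * khat θ t n
          + Cb ^ 2 * Ci * (khat θ t n * ‖D (zBeta θ t φ n)‖ ^ 2 / h))
            * gNormSq θ (fun i => D (φ i)) (n - 1)
        + (16 * (1 + (4 * B + Cb * Real.sqrt Ci * B) ^ 2) + 32 * κ + 8 * κ * (Cb ^ 2 * Ci)) *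
          (residual (khat θ t n) h δ ζ ζ' γ + khat θ t n * ‖D (zBeta θ t φ n)‖ ^ 2)) := by
  have hk : 0 < khat θ t n := khat_pos hθ0 hθ1 hk1 hk0
  have hp := cfl_absorb hCi h0 hθ0 hθ1 hk1 hk0 hst.cfl fun i => D (φ i)
  rw [← map_zBeta, ← map_zStar, ← map_sub] at hp
  set k := khat θ t n
  set τ := Cb * Real.sqrt (Ci * h⁻¹)
  have hτ0 : 0 ≤ τ := by positivity
  have hτ2 : τ ^ 2 * h = Cb ^ 2 * Ci := by
    rw [mul_pow, Real.sq_sqrt (by positivity)]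
    field_simp
  set w := k⁻¹ • zAlpha θ φ n
  have hw : w ∈ S := S.smul_mem _ hα
  have hζ0 : 0 ≤ ζ := (norm_nonneg _).trans hst.norm_es
  have hB : 0 ≤ B := (norm_nonneg _).trans hst.norm_u
  have hζ : τ * ζ ≤ Cb * Real.sqrt Ci * B := by
    have e : τ * (B * h) = Cb * Real.sqrt Ci * B * (Real.sqrt h⁻¹ * h) := by
      simp only [τ]
      rw [Real.sqrt_mul hCi]
      ring
    have h2 : Real.sqrt h⁻¹ * h ≤ 1 := by
      rw [Real.sqrt_inv]
      calc (Real.sqrt h)⁻¹ * h = Real.sqrt h := by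
            nth_rewrite 2 [← Real.mul_self_sqrt h0.le]
            field_simp
        _ ≤ 1 := Real.sqrt_le_one.2 h1
    calc τ * ζ ≤ τ * (B * h) := mul_le_mul_of_nonneg_left hst.le_Bh hτ0
      _ ≤ Cb * Real.sqrt Ci * B * 1 := by
          rw [e]
          gcongr
      _ = _ := mul_one _
  have hconv := convective_error_le' (U' := U') (fs := zStar θ t φ n) (fb := zBeta θ t φ n)
    (abs_trilinear_le_of_inverse hCb hCi h0 hT hinv hw) hτ0 hst.smooth_u hst.smooth_db
    hst.smooth_ds hst.norm_ds hst.norm_db hst.norm_es hst.norm_eb hst.norm_sub hst.le_B hζ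
  have hl := hst.l_le w hw
  have heq := hst.eq w hw
  have hG := inner_zAlpha_zBeta hθ0 hθ1 hn hk1 hk0 fun i => D (φ i)
  have hfs := norm_zStar_sq_le hθ0 hθ1 hn hk1 hk0 hR fun i => D (φ i)
  rw [← map_zBeta, ← map_zAlpha] at hG
  rw [← map_zStar] at hfs
  rw [real_inner_self_eq_norm_sq] at heq
  have e1 : inner ℝ (D (zBeta θ t φ n)) (D w) =
      k⁻¹ * inner ℝ (D (zAlpha θ φ n)) (D (zBeta θ t φ n)) := by
    simp only [w, map_smul, inner_smul_right]
    rw [real_inner_comm]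
  rw [e1, hG] at heq
  have hL := (add_le_add (le_of_abs_le hl) (le_of_abs_le hconv)).trans (le_of_eq
    (show γ * ‖w‖ + _ = ‖w‖ * (τ * (‖D U'‖ * ‖D (zBeta θ t φ n - zStar θ t φ n)‖)
      + (γ + (4 * B + Cb * Real.sqrt Ci * B)
        * (‖D (zStar θ t φ n)‖ + ‖D (zBeta θ t φ n)‖ + δ + ζ)
        + τ * (‖D (zStar θ t φ n)‖ * ‖D (zBeta θ t φ n)‖)
        + ‖D U'‖ * (2 * δ + τ * ζ'))) by ring))
  refine (energy_absorb' (Y := gNormSq θ (fun i => D (φ i)) (n - 1))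
    (dis := dissip θ t (fun i => D (φ i)) n) (w := ‖w‖) hk (le_of_eq ?_) hL hp).trans ?_
  · have aux : ∀ x y : ℝ, k * x + ν * y = k * (x + ν * (k⁻¹ * y)) := fun x y => by field_simp
    rw [← heq]
    exact aux _ _
  gcongr
  exact energy_H1_rhs hk.le h0 hfs hst.cfl' hτ2 (by positivity) rfl rfl

/-- **Error estimate in energy form.** If the sum of the squared consistency errors and the squared
initial errors are at most `ϱ`, the squared `H¹` error is at most a constant times `ϱ`. The bound
`ϱ ≤ R₀ * h` makes the term that is quadratic in the error harmless. -/
theorem energy_estimate (hanti : ∀ u v w, b u v w = - b u w v)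
    (hb : ∀ x y z, |b x y z| ≤ Cb * (‖D x‖ * ‖D y‖ * ‖D z‖))
    (hT : ∀ x y z, |b x y z| ≤ Cb * (‖D x‖ * ‖D y‖ * Real.sqrt (‖z‖ * ‖D z‖)))
    (hP : ∀ v, ‖v‖ ≤ CP * ‖D v‖) (hCb : 0 ≤ Cb) (hCi : 0 ≤ Ci) (hν : 0 < ν)
    (hθ0 : 0 < θ) (hθ1 : θ < 1) (B κ R T R₀ : ℝ) (hκ : 0 ≤ κ) :
    ∃ C : ℝ, 0 ≤ C ∧ ∀ (S : Submodule ℝ V) (h : ℝ), 0 < h → h ≤ 1 →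
      (∀ v ∈ S, ‖D v‖ ≤ Ci * h⁻¹ * ‖v‖) →
      ∀ (N : ℕ) (t : ℕ → ℝ), IsGrid T N t →
      (∀ n ∈ Finset.Ico 1 N, stp t n / stp t (n - 1) ≤ R) →
      ∀ φ : ℕ → V, (∀ n ≤ N, φ n ∈ S) →
      ∀ (u ds db es eb U' : ℕ → V) (δ ζ' γ : ℕ → ℝ) (ζ ϱ : ℝ) (l : ℕ → V → ℝ),
      (∀ n ∈ Finset.Ico 1 N, ErrorStep D b S θ ν B κ (Cb ^ 2 * Ci * dissipConst θ) h t φ n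
        (u n) (ds n) (db n) (es n) (eb n) (U' n) (δ n) ζ (ζ' n) (γ n) (l n)) →
      ∑ n ∈ Finset.Ico 1 N, residual (khat θ t n) h (δ n) ζ (ζ' n) (γ n) ≤ ϱ →
      (∀ n ≤ 1, ‖φ n‖ ^ 2 ≤ ϱ ∧ ‖D (φ n)‖ ^ 2 ≤ ϱ) → ϱ ≤ R₀ * h →
      (∀ n ≤ N, ‖φ n‖ ^ 2 ≤ C * ϱ ∧ ‖D (φ n)‖ ^ 2 ≤ C * ϱ) ∧
        ∑ n ∈ Finset.Ico 1 N, khat θ t n * ‖(khat θ t n)⁻¹ • zAlpha θ φ n‖ ^ 2 ≤ C * ϱ := by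
  set K := B * (2 + 4 * Cb + Cb * Ci)
  set F := starConst θ R
  have hF : 0 ≤ F := starConst_nonneg hθ1 R
  set a₀ := 4 / ν * K ^ 2 * F
  have ha₀ : 0 ≤ a₀ := by positivity
  set c₀ := 4 / ν * (CP ^ 2 + K ^ 2) + 8 * Cb ^ 2 * κ / ν
  have hc₀ : 0 ≤ c₀ := by positivity
  set C₁ := Real.exp (a₀ * (2 * T)) * (1 + c₀)
  have hC₁ : 0 ≤ C₁ := by positivity
  set K' := 4 * B + Cb * Real.sqrt Ci * B
  set C₂ := 4 / ν * C₁
  have hC₂ : 0 ≤ C₂ := by positivity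
  set c₁ := 16 * (1 + K' ^ 2) + 32 * κ + 8 * κ * (Cb ^ 2 * Ci)
  have hc₁ : 0 ≤ c₁ := by positivity
  set a₁ := 16 * F / ν
  have ha₁ : 0 ≤ a₁ := by positivity
  set A₁ := a₁ * (K' ^ 2 * (2 * T) + Cb ^ 2 * Ci * (C₂ * R₀))
  set C₃ := Real.exp A₁ * (ν + c₁ * (1 + C₂))
  have hC₃ : 0 ≤ C₃ := by positivity
  have hθ' : 0 < 1 + θ := by linarith
  refine ⟨1 + 4 / (1 + θ) * C₁ + 4 / (1 + θ) * (C₃ / ν) + 2 * C₃, by positivity, ?_⟩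
  intro S h h0 h1 hinv N t hgrid hR φ hφ u ds db es eb U' δ ζ' γ ζ ϱ l hstep hres hinit hϱ
  have hpos : ∀ n ∈ Finset.Ico 1 N, 1 ≤ n ∧ 0 < stp t n ∧ 0 < stp t (n - 1) := fun n hn => by
    obtain ⟨h1, h2⟩ := Finset.mem_Ico.1 hn
    refine ⟨h1, sub_pos.2 (hgrid.lt n h2), ?_⟩
    have := hgrid.lt (n - 1) (by omega)
    exact sub_pos.2 this
  have hkpos : ∀ n ∈ Finset.Ico 1 N, 0 < khat θ t n := fun n hn =>
    khat_pos hθ0 hθ1 (hpos n hn).2.1 (hpos n hn).2.2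
  have hϱ0 : 0 ≤ ϱ := (sq_nonneg _).trans (hinit 0 zero_le_one).1
  have hmem : ∀ n ∈ Finset.Ico 1 N, φ (n + 1) ∈ S ∧ φ n ∈ S ∧ φ (n - 1) ∈ S := fun n hn => by
    obtain ⟨h1, h2⟩ := Finset.mem_Ico.1 hn
    exact ⟨hφ _ (by omega), hφ _ (by omega), hφ _ (by omega)⟩
  have hα : ∀ n ∈ Finset.Ico 1 N, zAlpha θ φ n ∈ S := fun n hn =>
    S.add_mem (S.add_mem (S.smul_mem _ (hmem n hn).1) (S.smul_mem _ (hmem n hn).2.1))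
      (S.smul_mem _ (hmem n hn).2.2)
  have hβ : ∀ n ∈ Finset.Ico 1 N, zBeta θ t φ n ∈ S := fun n hn =>
    S.add_mem (S.add_mem (S.smul_mem _ (hmem n hn).1) (S.smul_mem _ (hmem n hn).2.1))
      (S.smul_mem _ (hmem n hn).2.2)
  have hs : ∀ n ∈ Finset.Ico 1 N, zStar θ t φ n ∈ S := fun n hn =>
    S.add_mem (S.smul_mem _ (hmem n hn).2.1) (S.smul_mem _ (hmem n hn).2.2)
  have hksum : ∑ n ∈ Finset.Ico 1 N, khat θ t n ≤ 2 * T := by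
    have h2 := hgrid.sum_integral_le (g := fun _ => (1 : ℝ)) intervalIntegrable_const
      fun _ => zero_le_one
    simp only [intervalIntegral.integral_const, smul_eq_mul, mul_one, sub_zero] at h2
    refine (Finset.sum_le_sum fun n hn => ?_).trans h2
    obtain ⟨hn1, hk1, hk0⟩ := hpos n hn
    have h3 := (khat_bounds hθ0 hθ1 hk1 hk0).2
    refine h3.trans (le_of_eq ?_)
    simp only [stp, Nat.sub_add_cancel hn1]
    ring
  have hres0 : ∀ n ∈ Finset.Ico 1 N, 0 ≤ residual (khat θ t n) h (δ n) ζ (ζ' n) (γ n) :=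
    fun n hn => residual_nonneg (hkpos n hn).le h0.le
  have ginit : gNormSq θ φ 0 ≤ ϱ ∧ gNormSq θ (fun i => D (φ i)) 0 ≤ ϱ := by
    obtain ⟨i0, j0⟩ := hinit 0 zero_le_one
    obtain ⟨i1, j1⟩ := hinit 1 le_rfl
    have w1 : 0 ≤ (1 + θ) / 4 := by linarith
    have w0 : 0 ≤ (1 - θ) / 4 := by linarith
    constructor
    · simp only [gNormSq, zero_add]
      linarith [mul_le_mul_of_nonneg_left i1 w1, mul_le_mul_of_nonneg_left i0 w0]
    · simp only [gNormSq, zero_add]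
      linarith [mul_le_mul_of_nonneg_left j1 w1, mul_le_mul_of_nonneg_left j0 w0]
  -- the `L²` estimate
  obtain ⟨gA, gA'⟩ := discrete_gronwall (N := N) (y := gNormSq θ φ)
    (c := fun n => khat θ t n * ν / 4 * ‖D (zBeta θ t φ n)‖ ^ 2)
    (a := fun n => a₀ * khat θ t n)
    (r := fun n => c₀ * residual (khat θ t n) h (δ n) ζ (ζ' n) (γ n))
    (A := a₀ * (2 * T)) (R := c₀ * ϱ) (fun n => gNormSq_nonneg hθ0 hθ1 φ)
    (fun n hn => mul_nonneg ha₀ (hkpos n hn).le) (fun n hn => mul_nonneg hc₀ (hres0 n hn))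
    (fun n hn => by
      have := hkpos n hn
      positivity)
    (fun n hn => by
      obtain ⟨hn1, hk1, hk0⟩ := hpos n hn
      exact (hstep n hn).energy_L2 hanti hb hT hP hCb hCi h0 h1 hν hinv hθ0 hθ1 hn1 hk1 hk0
        (hR n hn) (hβ n hn) (hs n hn))
    (by
      rw [← Finset.mul_sum]
      exact mul_le_mul_of_nonneg_left hksum ha₀)
    (by
      rw [← Finset.mul_sum]
      exact mul_le_mul_of_nonneg_left hres hc₀)
  have hA : Real.exp (a₀ * (2 * T)) * (gNormSq θ φ 0 + c₀ * ϱ) ≤ C₁ * ϱ := by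
    have : C₁ * ϱ = Real.exp (a₀ * (2 * T)) * (ϱ + c₀ * ϱ) := by
      simp only [C₁]
      ring
    rw [this]
    exact mul_le_mul_of_nonneg_left (by linarith [ginit.1]) (Real.exp_nonneg _)
  have hx : ∑ n ∈ Finset.Ico 1 N, khat θ t n * ‖D (zBeta θ t φ n)‖ ^ 2 ≤ C₂ * ϱ := by
    have h2 := gA'.trans hA
    have e : ∑ n ∈ Finset.Ico 1 N, khat θ t n * ν / 4 * ‖D (zBeta θ t φ n)‖ ^ 2
        = ν / 4 * ∑ n ∈ Finset.Ico 1 N, khat θ t n * ‖D (zBeta θ t φ n)‖ ^ 2 := by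
      rw [Finset.mul_sum]
      exact Finset.sum_congr rfl fun n _ => by ring
    rw [e] at h2
    have h3 := mul_le_mul_of_nonneg_left h2 (show 0 ≤ 4 / ν by positivity)
    calc _ = 4 / ν * (ν / 4 * ∑ n ∈ Finset.Ico 1 N, khat θ t n * ‖D (zBeta θ t φ n)‖ ^ 2) := by
          field_simp
      _ ≤ _ := h3
      _ = _ := by
          simp only [C₂]
          ring
  -- the `H¹` estimate; the Gronwall weights are summable by the `L²` estimate
  obtain ⟨gB, gB'⟩ := discrete_gronwall (N := N) (y := fun n => ν * gNormSq θ (fun i => D (φ i)) n)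
    (c := fun n => khat θ t n / 2 * ‖(khat θ t n)⁻¹ • zAlpha θ φ n‖ ^ 2)
    (a := fun n => a₁ * (K' ^ 2 * khat θ t n
      + Cb ^ 2 * Ci * (khat θ t n * ‖D (zBeta θ t φ n)‖ ^ 2 / h)))
    (r := fun n => c₁ * (residual (khat θ t n) h (δ n) ζ (ζ' n) (γ n)
      + khat θ t n * ‖D (zBeta θ t φ n)‖ ^ 2))
    (A := A₁) (R := c₁ * (ϱ + C₂ * ϱ))
    (fun n => mul_nonneg hν.le (gNormSq_nonneg hθ0 hθ1 fun i => D (φ i)))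
    (fun n hn => by
      have := hkpos n hn
      positivity)
    (fun n hn => by
      have := hkpos n hn
      have := hres0 n hn
      positivity)
    (fun n hn => by
      have := hkpos n hn
      positivity)
    (fun n hn => by
      obtain ⟨hn1, hk1, hk0⟩ := hpos n hn
      refine ((hstep n hn).energy_H1 hT hCb hCi h0 h1 hinv hθ0 hθ1 hn1 hk1 hk0
        (hR n hn) (hα n hn)).trans (le_of_eq ?_)
      simp only [a₁]
      field_simp
      ring)
    (by
      rw [← Finset.mul_sum, Finset.sum_add_distrib, ← Finset.mul_sum, ← Finset.mul_sum,
        ← Finset.sum_div]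
      refine mul_le_mul_of_nonneg_left (add_le_add
        (mul_le_mul_of_nonneg_left hksum (sq_nonneg _)) (mul_le_mul_of_nonneg_left ?_
          (by positivity))) ha₁
      rw [div_le_iff₀ h0]
      calc _ ≤ C₂ * ϱ := hx
        _ ≤ C₂ * (R₀ * h) := mul_le_mul_of_nonneg_left hϱ hC₂
        _ = _ := by ring)
    (by
      rw [← Finset.mul_sum, Finset.sum_add_distrib]
      exact mul_le_mul_of_nonneg_left (add_le_add hres hx) hc₁)
  have hB' : Real.exp A₁ * (ν * gNormSq θ (fun i => D (φ i)) 0 + c₁ * (ϱ + C₂ * ϱ)) ≤ C₃ * ϱ := by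
    have : C₃ * ϱ = Real.exp A₁ * (ν * ϱ + c₁ * (ϱ + C₂ * ϱ)) := by
      simp only [C₃]
      ring
    rw [this]
    refine mul_le_mul_of_nonneg_left ?_ (Real.exp_nonneg _)
    have := mul_le_mul_of_nonneg_left ginit.2 hν.le
    linarith
  have hθθ : (0 : ℝ) < 1 - θ := by linarith
  have q1 : 0 ≤ 4 / (1 + θ) * C₁ * ϱ := by positivity
  have q2 : 0 ≤ 4 / (1 + θ) * (C₃ / ν) * ϱ := by positivity
  have q3 : 0 ≤ 2 * C₃ * ϱ := by positivity
  refine ⟨fun n hn => ?_, ?_⟩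
  · rcases Nat.eq_zero_or_pos n with rfl | hn0
    · obtain ⟨i0, j0⟩ := hinit 0 zero_le_one
      constructor <;> linarith
    · have i1 := (gA (n - 1) (by omega)).trans hA
      have i2 := (gB (n - 1) (by omega)).trans hB'
      simp only [gNormSq, Nat.sub_add_cancel hn0] at i1 i2
      constructor
      · have : ‖φ n‖ ^ 2 ≤ 4 / (1 + θ) * (C₁ * ϱ) := by
          rw [← div_le_iff₀' (by positivity)]
          have p := mul_nonneg hθθ.le (sq_nonneg ‖φ (n - 1)‖)
          have e : ‖φ n‖ ^ 2 / (4 / (1 + θ)) = (1 + θ) / 4 * ‖φ n‖ ^ 2 := by field_simp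
          rw [e]
          linarith
        linarith
      · have : ‖D (φ n)‖ ^ 2 ≤ 4 / (1 + θ) * (C₃ / ν * ϱ) := by
          rw [← div_le_iff₀' (by positivity)]
          have p := mul_nonneg hν.le (mul_nonneg hθθ.le (sq_nonneg ‖D (φ (n - 1))‖))
          have e : ‖D (φ n)‖ ^ 2 / (4 / (1 + θ)) = (1 + θ) / 4 * ‖D (φ n)‖ ^ 2 := by field_simp
          have e2 : C₃ / ν * ϱ = C₃ * ϱ / ν := by ring
          rw [e, e2, le_div_iff₀ hν]
          linarith
        linarith
  · have i2 := gB'.trans hB'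
    have e : ∑ n ∈ Finset.Ico 1 N, khat θ t n * ‖(khat θ t n)⁻¹ • zAlpha θ φ n‖ ^ 2
        = 2 * ∑ n ∈ Finset.Ico 1 N, khat θ t n / 2 * ‖(khat θ t n)⁻¹ • zAlpha θ φ n‖ ^ 2 := by
      rw [Finset.mul_sum]
      exact Finset.sum_congr rfl fun n _ => by ring
    rw [e]
    linarith

end EnergyH1

/-! ### Consistency of the DLN formulas -/

section Consistency

variable {d : ℕ} {Ω : Set (Pt d)} {θ T R : ℝ} {t : ℕ → ℝ} {n N : ℕ}

theorem IsGrid.stp_pos (h : IsGrid T N t) (hn : n ∈ Finset.Ico 1 N) :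
    1 ≤ n ∧ 0 < stp t n ∧ 0 < stp t (n - 1) := by
  obtain ⟨h1, h2⟩ := Finset.mem_Ico.1 hn
  exact ⟨h1, sub_pos.2 (h.lt n h2), sub_pos.2 (h.lt (n - 1) (by omega))⟩

theorem stp_add_stp (hn : 1 ≤ n) : stp t n + stp t (n - 1) = t (n + 1) - t (n - 1) := by
  simp only [stp, Nat.sub_add_cancel hn]
  ring

/-- A bound for the sum of the absolute values of the coefficients of all difference formulas. -/
noncomputable def coeffBound (θ R : ℝ) : ℝ := 3 * betaBound θ + 2 * (betaBound θ * (2 + R)) + 3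

theorem coeffBound_ge (hθ0 : 0 < θ) (hθ1 : θ < 1) (hR : 0 ≤ R) : 3 ≤ coeffBound θ R := by
  have := one_le_betaBound hθ0 hθ1
  unfold coeffBound
  have : 0 ≤ betaBound θ * (2 + R) := by positivity
  linarith

/-- The data of a time step that is used in the consistency estimates. -/
structure IsStep (θ T R : ℝ) (t : ℕ → ℝ) (n : ℕ) : Prop where
  theta_pos : 0 < θ
  theta_lt : θ < 1
  one_le : 1 ≤ n
  pos : 0 < stp t n
  pos' : 0 < stp t (n - 1)
  ratio : stp t n / stp t (n - 1) ≤ R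
  nonneg : 0 ≤ t (n - 1)
  le : t (n + 1) ≤ T

theorem IsGrid.isStep (h : IsGrid T N t) (hθ0 : 0 < θ) (hθ1 : θ < 1) (hn : n ∈ Finset.Ico 1 N)
    (hR : stp t n / stp t (n - 1) ≤ R) : IsStep θ T R t n where
  theta_pos := hθ0
  theta_lt := hθ1
  one_le := (h.stp_pos hn).1
  pos := (h.stp_pos hn).2.1
  pos' := (h.stp_pos hn).2.2
  ratio := hR
  nonneg := (h.mem_Icc (by
    have := Finset.mem_Ico.1 hn
    omega)).1
  le := (h.mem_Icc (by
    have := Finset.mem_Ico.1 hn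
    omega)).2

theorem IsStep.lt (h : IsStep θ T R t n) : t (n - 1) < t n ∧ t n < t (n + 1) := by
  have h1 := h.pos
  have h2 := h.pos'
  simp only [stp, Nat.sub_add_cancel h.one_le] at h1 h2
  constructor <;> linarith

theorem IsStep.le_succ (h : IsStep θ T R t n) : t (n - 1) ≤ t (n + 1) := (h.lt.1.trans h.lt.2).le

theorem IsStep.ratio_nonneg (h : IsStep θ T R t n) : 0 ≤ R :=
  (div_nonneg h.pos.le h.pos'.le).trans h.ratio

theorem IsStep.tBeta_mem (h : IsStep θ T R t n) : tBeta θ t n ∈ Icc (t (n - 1)) (t (n + 1)) :=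
  Ioo_subset_Icc_self (DLN.tBeta_mem h.theta_pos h.theta_lt h.one_le h.pos h.pos')

theorem IsStep.nodes_mem (h : IsStep θ T R t n) (i : Fin 4) :
    ![t (n + 1), t n, t (n - 1), tBeta θ t n] i ∈ Icc (t (n - 1)) (t (n + 1)) := by
  have h1 := h.lt
  fin_cases i
  · exact ⟨h.le_succ, le_rfl⟩
  · exact ⟨h1.1.le, h1.2.le⟩
  · exact ⟨le_rfl, h.le_succ⟩
  · exact h.tBeta_mem

theorem beta_linear : beta θ (vari t n) 2 * t (n + 1) + beta θ (vari t n) 1 * t n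
    + beta θ (vari t n) 0 * t (n - 1) = tBeta θ t n := rfl

theorem IsStep.abs_le (h : IsStep θ T R t n) :
    (∀ i, |beta θ (vari t n) i| ≤ betaBound θ) ∧
      (∀ i, |starCoeff θ t n i| ≤ betaBound θ * (2 + R)) ∧ 1 ≤ betaBound θ ∧
      0 ≤ betaBound θ * (2 + R) := by
  have h1 := one_le_betaBound h.theta_pos h.theta_lt
  have h2 := h.ratio_nonneg
  exact ⟨abs_beta_le h.theta_pos h.theta_lt (vari_mem h.pos h.pos'),
    abs_starCoeff_le h.theta_pos h.theta_lt h.pos h.pos' h.ratio, h1, by positivity⟩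

variable {w w' w'' w''' : ℝ → L2 Ω}

theorem IsStep.weakDom_beta (h : IsStep θ T R t n) (hw : HasTimeDeriv T w w')
    (hw' : HasTimeDeriv T w' w'') :
    WeakDom (coeffBound θ R * (t (n + 1) - t (n - 1))) w'' (t (n - 1)) (t (n + 1))
      (zBeta θ t (fun i => w (t i)) n - w (tBeta θ t n)) := by
  obtain ⟨hb, -, hK, hK'⟩ := h.abs_le
  have hs := beta_sum θ (vari t n)
  have e := hw.weakDom_comb_two hw' h.nonneg h.le_succ h.le
    ![beta θ (vari t n) 2, beta θ (vari t n) 1, beta θ (vari t n) 0, -1] _ h.nodes_mem (by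
      simp only [Fin.sum_univ_four, Matrix.cons_val]
      linarith) (by
      simp only [Fin.sum_univ_four, Matrix.cons_val]
      linarith [beta_linear (θ := θ) (t := t) (n := n)]) (K := coeffBound θ R) (by
      simp only [Fin.sum_univ_four, Matrix.cons_val, abs_neg, abs_one]
      unfold coeffBound
      linarith [hb 0, hb 1, hb 2])
  simp only [Fin.sum_univ_four, Matrix.cons_val, neg_one_smul, ← sub_eq_add_neg] at e
  exact e

theorem IsStep.weakDom_star (h : IsStep θ T R t n) (hw : HasTimeDeriv T w w')
    (hw' : HasTimeDeriv T w' w'') :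
    WeakDom (coeffBound θ R * (t (n + 1) - t (n - 1))) w'' (t (n - 1)) (t (n + 1))
      (zStar θ t (fun i => w (t i)) n - w (tBeta θ t n)) := by
  obtain ⟨-, hb, hK, hK'⟩ := h.abs_le
  have hs := starCoeff_sum (θ := θ) (t := t) (n := n)
  have e := hw.weakDom_comb_two hw' h.nonneg h.le_succ h.le
    ![0, starCoeff θ t n 1, starCoeff θ t n 0, -1] _ h.nodes_mem (by
      simp only [Fin.sum_univ_four, Matrix.cons_val]
      linarith) (by
      simp only [Fin.sum_univ_four, Matrix.cons_val]
      linarith [starCoeff_linear (θ := θ) h.one_le h.pos']) (K := coeffBound θ R) (by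
      simp only [Fin.sum_univ_four, Matrix.cons_val, abs_neg, abs_one, abs_zero]
      unfold coeffBound
      linarith [hb 0, hb 1])
  simp only [Fin.sum_univ_four, Matrix.cons_val, neg_one_smul, ← sub_eq_add_neg, zero_smul,
    zero_add] at e
  exact e

theorem IsStep.weakDom_alpha (h : IsStep θ T R t n) (hw : HasTimeDeriv T w w') :
    WeakDom (coeffBound θ R) w' (t (n - 1)) (t (n + 1)) (zAlpha θ (fun i => w (t i)) n) := by
  obtain ⟨-, -, hK, hK'⟩ := h.abs_le
  have ha := abs_alpha_le h.theta_pos h.theta_lt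
  have e := hw.weakDom_comb_one h.nonneg h.le_succ h.le
    ![alpha θ 2, alpha θ 1, alpha θ 0, 0] _ h.nodes_mem (by
      simp only [Fin.sum_univ_four, Matrix.cons_val]
      linarith [alpha_sum θ]) (K := coeffBound θ R) (by
      simp only [Fin.sum_univ_four, Matrix.cons_val, abs_zero]
      unfold coeffBound
      linarith [ha 0, ha 1, ha 2])
  simp only [Fin.sum_univ_four, Matrix.cons_val, zero_smul, add_zero] at e
  exact e

theorem IsStep.weakDom_beta_star (h : IsStep θ T R t n) (hw : HasTimeDeriv T w w') :
    WeakDom (coeffBound θ R) w' (t (n - 1)) (t (n + 1))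
      (zBeta θ t (fun i => w (t i)) n - zStar θ t (fun i => w (t i)) n) := by
  obtain ⟨hb, hc, hK, hK'⟩ := h.abs_le
  have e := hw.weakDom_comb_one h.nonneg h.le_succ h.le
    ![beta θ (vari t n) 2, beta θ (vari t n) 1 - starCoeff θ t n 1,
      beta θ (vari t n) 0 - starCoeff θ t n 0, 0] _ h.nodes_mem (by
      simp only [Fin.sum_univ_four, Matrix.cons_val]
      linarith [beta_sum θ (vari t n), starCoeff_sum (θ := θ) (t := t) (n := n)])
      (K := coeffBound θ R) (by
      simp only [Fin.sum_univ_four, Matrix.cons_val, abs_zero]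
      unfold coeffBound
      linarith [hb 0, hb 1, hb 2, hc 0, hc 1, abs_sub (beta θ (vari t n) 1) (starCoeff θ t n 1),
        abs_sub (beta θ (vari t n) 0) (starCoeff θ t n 0)])
  simp only [Fin.sum_univ_four, Matrix.cons_val, zero_smul, add_zero] at e
  have e2 : zBeta θ t (fun i => w (t i)) n - zStar θ t (fun i => w (t i)) n
      = beta θ (vari t n) 2 • w (t (n + 1)) + (beta θ (vari t n) 1 - starCoeff θ t n 1) • w (t n)
        + (beta θ (vari t n) 0 - starCoeff θ t n 0) • w (t (n - 1)) := by
    rw [zStar_eq, zBeta]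
    module
  rw [e2]
  exact e

/-- The DLN formula `z_{n,α} / k̂_n` approximates the derivative at `t_{n,β}` to second order. -/
theorem IsStep.weakDom_alpha_deriv (h : IsStep θ T R t n) (hw : HasTimeDeriv T w w')
    (hw' : HasTimeDeriv T w' w'') (hw'' : HasTimeDeriv T w'' w''') :
    WeakDom (2 * coeffBound θ R * (t (n + 1) - t (n - 1)) ^ 2) w''' (t (n - 1)) (t (n + 1))
      (zAlpha θ (fun i => w (t i)) n - khat θ t n • w' (tBeta θ t n)) := by
  obtain ⟨-, -, hK, hK'⟩ := h.abs_le
  have ha := abs_alpha_le h.theta_pos h.theta_lt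
  have hkb := (khat_bounds h.theta_pos h.theta_lt h.pos h.pos').2
  have hkp := khat_pos h.theta_pos h.theta_lt h.pos h.pos'
  rw [stp_add_stp h.one_le] at hkb
  have e := hw.weakDom_comb_three hw' hw'' h.nonneg h.le_succ h.le
    ![alpha θ 2, alpha θ 1, alpha θ 0, 0] _ h.nodes_mem (σ := tBeta θ t n) (κ := khat θ t n)
    h.tBeta_mem (by
      simp only [Fin.sum_univ_four, Matrix.cons_val]
      linarith [alpha_sum θ]) (by
      simp only [Fin.sum_univ_four, Matrix.cons_val]
      linarith [alpha_linear (θ := θ) (t := t) h.one_le (tBeta θ t n)]) (by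
      simp only [Fin.sum_univ_four, Matrix.cons_val]
      linarith [alpha_quadratic h.theta_pos h.theta_lt h.one_le h.pos h.pos'])
    (K := coeffBound θ R) (by
      simp only [Fin.sum_univ_four, Matrix.cons_val, abs_zero]
      unfold coeffBound
      linarith [ha 0, ha 1, ha 2]) (by
      rw [abs_of_pos hkp]
      refine hkb.trans (le_mul_of_one_le_left (sub_nonneg.2 h.le_succ) ?_)
      unfold coeffBound
      linarith)
  simp only [Fin.sum_univ_four, Matrix.cons_val, zero_smul, add_zero] at e
  exact e

/-- The integrand of the squared norms of the time derivatives. -/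
noncomputable def derivSq (r s : ℕ) (ut utt uttt : ℝ → L2V Ω) (pt ptt : ℝ → L2 Ω) (τ : ℝ) : ℝ :=
  normHV (r + 1) (ut τ) ^ 2 + normHV (r + 1) (utt τ) ^ 2 + normHV 0 (uttt τ) ^ 2
    + normH (s + 1) (pt τ) ^ 2 + normH (s + 1) (ptt τ) ^ 2

theorem derivSq_nonneg (r s : ℕ) (ut utt uttt : ℝ → L2V Ω) (pt ptt : ℝ → L2 Ω) (τ : ℝ) :
    0 ≤ derivSq r s ut utt uttt pt ptt τ := by
  unfold derivSq
  positivity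

theorem le_derivSq (r s : ℕ) (ut utt uttt : ℝ → L2V Ω) (pt ptt : ℝ → L2 Ω) (τ : ℝ) :
    normHV (r + 1) (ut τ) ^ 2 ≤ derivSq r s ut utt uttt pt ptt τ ∧
      normHV (r + 1) (utt τ) ^ 2 ≤ derivSq r s ut utt uttt pt ptt τ ∧
      normHV 0 (uttt τ) ^ 2 ≤ derivSq r s ut utt uttt pt ptt τ ∧
      normH (s + 1) (pt τ) ^ 2 ≤ derivSq r s ut utt uttt pt ptt τ ∧
      normH (s + 1) (ptt τ) ^ 2 ≤ derivSq r s ut utt uttt pt ptt τ := by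
  have h1 := sq_nonneg (normHV (r + 1) (ut τ))
  have h2 := sq_nonneg (normHV (r + 1) (utt τ))
  have h3 := sq_nonneg (normHV 0 (uttt τ))
  have h4 := sq_nonneg (normH (s + 1) (pt τ))
  have h5 := sq_nonneg (normH (s + 1) (ptt τ))
  unfold derivSq
  refine ⟨?_, ?_, ?_, ?_, ?_⟩ <;> linarith

/-- The consistency estimates for one time step of length `c`, where `J` is the integral of the
squared time derivatives. -/
structure StepConsistency (θ : ℝ) (r s : ℕ) (Λ c J : ℝ) (t : ℕ → ℝ) (n : ℕ) (u ut : ℝ → L2V Ω)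
    (p : ℝ → L2 Ω) : Prop where
  u_beta : MemHV (r + 1) (zBeta θ t (fun i => u (t i)) n - u (tBeta θ t n)) ∧
    normHV (r + 1) (zBeta θ t (fun i => u (t i)) n - u (tBeta θ t n)) ≤ Λ * (c * Real.sqrt (c * J))
  u_star : MemHV (r + 1) (zStar θ t (fun i => u (t i)) n - u (tBeta θ t n)) ∧
    normHV (r + 1) (zStar θ t (fun i => u (t i)) n - u (tBeta θ t n)) ≤ Λ * (c * Real.sqrt (c * J))
  u_alpha : MemHV (r + 1) (zAlpha θ (fun i => u (t i)) n) ∧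
    normHV (r + 1) (zAlpha θ (fun i => u (t i)) n) ≤ Λ * Real.sqrt (c * J)
  u_diff : MemHV (r + 1) (zBeta θ t (fun i => u (t i)) n - zStar θ t (fun i => u (t i)) n) ∧
    normHV (r + 1) (zBeta θ t (fun i => u (t i)) n - zStar θ t (fun i => u (t i)) n)
      ≤ Λ * Real.sqrt (c * J)
  u_deriv : ‖zAlpha θ (fun i => u (t i)) n - khat θ t n • ut (tBeta θ t n)‖
    ≤ Λ * (c ^ 2 * Real.sqrt (c * J))
  p_beta : MemH (s + 1) (zBeta θ t (fun i => p (t i)) n - p (tBeta θ t n)) ∧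
    normH (s + 1) (zBeta θ t (fun i => p (t i)) n - p (tBeta θ t n)) ≤ Λ * (c * Real.sqrt (c * J))
  p_alpha : MemH (s + 1) (zAlpha θ (fun i => p (t i)) n) ∧
    normH (s + 1) (zAlpha θ (fun i => p (t i)) n) ≤ Λ * Real.sqrt (c * J)
  p_diff : MemH (s + 1) (zBeta θ t (fun i => p (t i)) n - zStar θ t (fun i => p (t i)) n) ∧
    normH (s + 1) (zBeta θ t (fun i => p (t i)) n - zStar θ t (fun i => p (t i)) n)
      ≤ Λ * Real.sqrt (c * J)

theorem zAlpha_apply (u : ℕ → L2V Ω) (k : Fin d) :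
    (zAlpha θ u n) k = zAlpha θ (fun i => u i k) n := rfl

theorem zBeta_apply (u : ℕ → L2V Ω) (k : Fin d) :
    (zBeta θ t u n) k = zBeta θ t (fun i => u i k) n := rfl

theorem zStar_apply (u : ℕ → L2V Ω) (k : Fin d) :
    (zStar θ t u n) k = zStar θ t (fun i => u i k) n := rfl

theorem norm_le_normHV (hΩ : IsOpen Ω) (ℓ : ℕ) (v : L2V Ω) : ‖v‖ ≤ normHV ℓ v := by
  refine le_of_sq_le_sq ?_ (normHV_nonneg _ _)
  rw [normHV_sq, PiLp.norm_sq_eq_of_L2]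
  exact Finset.sum_le_sum fun i _ => pow_le_pow_left₀ (norm_nonneg _) (norm_le_normH hΩ ℓ _) 2

theorem normHV_mono {ℓ m : ℕ} (h : m ≤ ℓ) (v : L2V Ω) : normHV m v ≤ normHV ℓ v :=
  Real.sqrt_le_sqrt (Finset.sum_le_sum fun _ _ =>
    pow_le_pow_left₀ (normH_nonneg _ _) (normH_mono h _) 2)

theorem IsStep.consistency (hΩ : IsOpen Ω) {r s : ℕ} {u ut utt uttt : ℝ → L2V Ω}
    {p pt ptt : ℝ → L2 Ω} (hreg : IsRegular T r s u ut utt uttt p pt ptt) (h : IsStep θ T R t n) :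
    StepConsistency θ r s (2 * (d + 1) * (multiCard d (r + 1) + multiCard d (s + 1)
        + multiCard d 0) * coeffBound θ R)
      (t (n + 1) - t (n - 1))
      (∫ τ in t (n - 1)..t (n + 1), derivSq r s ut utt uttt pt ptt τ) t n u ut p := by
  have ha := h.nonneg
  have hab := h.le_succ
  have hb := h.le
  have hT : 0 ≤ T := ha.trans (hab.trans hb)
  have hK : 0 ≤ coeffBound θ R :=
    le_trans (by norm_num) (coeffBound_ge h.theta_pos h.theta_lt h.ratio_nonneg)
  have hc : 0 ≤ t (n + 1) - t (n - 1) := sub_nonneg.2 hab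
  set Λ := 2 * ((d : ℝ) + 1) * (multiCard d (r + 1) + multiCard d (s + 1) + multiCard d 0)
    * coeffBound θ R
  set c := t (n + 1) - t (n - 1)
  set J := ∫ τ in t (n - 1)..t (n + 1), derivSq r s ut utt uttt pt ptt τ
  have hsub : uIcc (t (n - 1)) (t (n + 1)) ⊆ uIcc 0 T := by
    rw [uIcc_of_le hab, uIcc_of_le hT]
    exact Icc_subset_Icc ha hb
  have i1 := (intervalIntegrable_normHV hT hreg.mem_ut).mono_set hsub
  have i2 := (intervalIntegrable_normHV hT hreg.mem_utt).mono_set hsub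
  have i3 := (intervalIntegrable_normHV hT hreg.mem_uttt).mono_set hsub
  have i4 := (hreg.mem_pt.intervalIntegrable hT).mono_set hsub
  have i5 := (hreg.mem_ptt.intervalIntegrable hT).mono_set hsub
  have iJ : IntervalIntegrable (derivSq r s ut utt uttt pt ptt) volume (t (n - 1)) (t (n + 1)) :=
    (((i1.add i2).add i3).add i4).add i5
  have hJ : ∀ g : ℝ → ℝ, IntervalIntegrable g volume (t (n - 1)) (t (n + 1)) →
      (∀ τ, g τ ≤ derivSq r s ut utt uttt pt ptt τ) →
      Real.sqrt (c * ∫ τ in t (n - 1)..t (n + 1), g τ) ≤ Real.sqrt (c * J) := fun g hg hle =>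
    Real.sqrt_le_sqrt (mul_le_mul_of_nonneg_left
      (intervalIntegral.integral_mono_on hab hg iJ fun τ _ => hle τ) hc)
  have j1 := hJ _ i1 fun τ => (le_derivSq r s ut utt uttt pt ptt τ).1
  have j2 := hJ _ i2 fun τ => (le_derivSq r s ut utt uttt pt ptt τ).2.1
  have j3 := hJ _ i3 fun τ => (le_derivSq r s ut utt uttt pt ptt τ).2.2.1
  have j4 := hJ _ i4 fun τ => (le_derivSq r s ut utt uttt pt ptt τ).2.2.2.1
  have j5 := hJ _ i5 fun τ => (le_derivSq r s ut utt uttt pt ptt τ).2.2.2.2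
  -- all constants are absorbed in `Λ`
  have hΛ : ∀ {m : ℕ} {x y z : ℝ}, (m = multiCard d (r + 1) ∨ m = multiCard d (s + 1) ∨
      m = multiCard d 0) → 0 ≤ x → 0 ≤ y → 0 ≤ z → z ≤ Real.sqrt (c * J) → x ≤ d + 1 →
      x * m * (2 * coeffBound θ R * y * z) ≤ Λ * (y * Real.sqrt (c * J)) := by
    intro m x y z hm hx hy hz hzJ hxd
    have hm' : (m : ℝ) ≤ multiCard d (r + 1) + multiCard d (s + 1) + multiCard d 0 := by
      rcases hm with rfl | rfl | rfl <;> norm_cast <;> omega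
    calc x * m * (2 * coeffBound θ R * y * z)
        ≤ (d + 1) * (multiCard d (r + 1) + multiCard d (s + 1) + multiCard d 0)
          * (2 * coeffBound θ R * y * Real.sqrt (c * J)) := by gcongr
      _ = _ := by
        simp only [Λ]
        ring
  have hd1 : (d : ℝ) ≤ d + 1 := by linarith
  have h11 : (1 : ℝ) ≤ d + 1 := by linarith [(Nat.cast_nonneg d : (0 : ℝ) ≤ d)]
  have hd0 : (0 : ℝ) ≤ d := Nat.cast_nonneg d
  have mono2 : ∀ y z : ℝ, 0 ≤ y → 0 ≤ z → coeffBound θ R * y * z ≤ 2 * coeffBound θ R * y * z :=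
    fun y z hy hz => by linarith [mul_nonneg (mul_nonneg hK hy) hz]
  refine ⟨?_, ?_, ?_, ?_, ?_, ?_, ?_, ?_⟩
  · obtain ⟨m, e⟩ := memHV_of_weakDom hT hreg.mem_utt (z := zBeta θ t (fun i => u (t i)) n
      - u (tBeta θ t n)) (fun k => by
      have e := h.weakDom_beta (w := fun τ => u τ k) (hreg.hasDeriv_u k) (hreg.hasDeriv_ut k)
      rw [PiLp.sub_apply, zBeta_apply]
      exact e)
      ha hab hb (mul_nonneg hK hc) hΩ
    exact ⟨m, e.trans ((mul_le_mul_of_nonneg_left (mono2 _ _ hc (Real.sqrt_nonneg _))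
      (by positivity)).trans (hΛ (Or.inl rfl) hd0 hc (Real.sqrt_nonneg _) j2 hd1))⟩
  · obtain ⟨m, e⟩ := memHV_of_weakDom hT hreg.mem_utt (z := zStar θ t (fun i => u (t i)) n
      - u (tBeta θ t n)) (fun k => by
      have e := h.weakDom_star (w := fun τ => u τ k) (hreg.hasDeriv_u k) (hreg.hasDeriv_ut k)
      rw [PiLp.sub_apply, zStar_apply]
      exact e)
      ha hab hb (mul_nonneg hK hc) hΩ
    exact ⟨m, e.trans ((mul_le_mul_of_nonneg_left (mono2 _ _ hc (Real.sqrt_nonneg _))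
      (by positivity)).trans (hΛ (Or.inl rfl) hd0 hc (Real.sqrt_nonneg _) j2 hd1))⟩
  · obtain ⟨m, e⟩ := memHV_of_weakDom hT hreg.mem_ut (z := zAlpha θ (fun i => u (t i)) n)
      (fun k => by
      have e := h.weakDom_alpha (w := fun τ => u τ k) (hreg.hasDeriv_u k)
      rw [zAlpha_apply]
      exact e) ha hab hb hK hΩ
    have := hΛ (Or.inl rfl) hd0 zero_le_one (Real.sqrt_nonneg _) j1 hd1
    rw [one_mul] at this
    refine ⟨m, e.trans ((mul_le_mul_of_nonneg_left ?_ (by positivity)).trans this)⟩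
    simpa using mono2 1 _ zero_le_one (Real.sqrt_nonneg _)
  · obtain ⟨m, e⟩ := memHV_of_weakDom hT hreg.mem_ut (z := zBeta θ t (fun i => u (t i)) n
      - zStar θ t (fun i => u (t i)) n)
      (fun k => by
      have e := h.weakDom_beta_star (w := fun τ => u τ k) (hreg.hasDeriv_u k)
      rw [PiLp.sub_apply, zBeta_apply, zStar_apply]
      exact e) ha hab hb hK hΩ
    have := hΛ (Or.inl rfl) hd0 zero_le_one (Real.sqrt_nonneg _) j1 hd1
    rw [one_mul] at this
    refine ⟨m, e.trans ((mul_le_mul_of_nonneg_left ?_ (by positivity)).trans this)⟩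
    simpa using mono2 1 _ zero_le_one (Real.sqrt_nonneg _)
  · obtain ⟨m, e⟩ := memHV_of_weakDom hT hreg.mem_uttt (z := zAlpha θ (fun i => u (t i)) n
      - khat θ t n • ut (tBeta θ t n)) (fun k => by
      have e := h.weakDom_alpha_deriv (w := fun τ => u τ k) (hreg.hasDeriv_u k)
        (hreg.hasDeriv_ut k) (hreg.hasDeriv_utt k)
      rw [PiLp.sub_apply, zAlpha_apply, PiLp.smul_apply]
      exact e) ha hab hb (by positivity) hΩ
    exact (norm_le_normHV hΩ 0 _).trans (e.trans
      (hΛ (Or.inr (Or.inr rfl)) hd0 (sq_nonneg _) (Real.sqrt_nonneg _) j3 hd1))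
  · obtain ⟨m, e⟩ := (h.weakDom_beta hreg.hasDeriv_p hreg.hasDeriv_pt).memH hreg.mem_ptt
      ha hab hb (mul_nonneg hK hc) hΩ
    have := hΛ (Or.inr (Or.inl rfl)) zero_le_one hc (Real.sqrt_nonneg _) j5 h11
    rw [one_mul] at this
    exact ⟨m, e.trans ((mul_le_mul_of_nonneg_left (mono2 _ _ hc (Real.sqrt_nonneg _))
      (by positivity)).trans this)⟩
  · obtain ⟨m, e⟩ := (h.weakDom_alpha hreg.hasDeriv_p).memH hreg.mem_pt ha hab hb hK hΩ
    have := hΛ (Or.inr (Or.inl rfl)) zero_le_one zero_le_one (Real.sqrt_nonneg _) j4 h11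
    rw [one_mul, one_mul] at this
    refine ⟨m, e.trans ((mul_le_mul_of_nonneg_left ?_ (by positivity)).trans this)⟩
    simpa using mono2 1 _ zero_le_one (Real.sqrt_nonneg _)
  · obtain ⟨m, e⟩ := (h.weakDom_beta_star hreg.hasDeriv_p).memH hreg.mem_pt ha hab hb hK hΩ
    have := hΛ (Or.inr (Or.inl rfl)) zero_le_one zero_le_one (Real.sqrt_nonneg _) j4 h11
    rw [one_mul, one_mul] at this
    refine ⟨m, e.trans ((mul_le_mul_of_nonneg_left ?_ (by positivity)).trans this)⟩
    simpa using mono2 1 _ zero_le_one (Real.sqrt_nonneg _)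

end Consistency

/-! ### The discrete Stokes projection -/

section Stokes

variable {V E F : Type*} [AddCommGroup V] [Module ℝ V] [NormedAddCommGroup E]
  [InnerProductSpace ℝ E] [NormedAddCommGroup F] [InnerProductSpace ℝ F]
  (D : V →ₗ[ℝ] E) (dv : V →ₗ[ℝ] F)

/-- `s` is the velocity component of the discrete Stokes projection of `(u, p)` with viscosity `ν`. -/
structure IsStokes (ν : ℝ) (S : Submodule ℝ V) (Q : Submodule ℝ F) (u : V) (p : F) (s : V) :
    Prop where
  mem : s ∈ discKer dv S Q
  eq : ∀ v ∈ discKer dv S Q,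
    ν * inner ℝ (D s) (D v) = ν * inner ℝ (D u) (D v) - inner ℝ p (dv v)

variable {D dv} {ν : ℝ} {S : Submodule ℝ V} {Q : Submodule ℝ F}

/-- The discrete Stokes projection exists without an inf-sup condition, as it is formulated in the
discrete kernel. -/
theorem exists_isStokes [FiniteDimensional ℝ S] (hν : 0 < ν) {κ : ℝ} (hκ0 : 0 ≤ κ)
    (hκ : ∀ v, ‖dv v‖ ≤ κ * ‖D v‖) (u : V) (p : F) : ∃ s, IsStokes D dv ν S Q u p s := by
  have := finiteDimensional_discKer dv S Q
  obtain ⟨s, hs, h⟩ := exists_variational D (discKer dv S Q)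
    ((innerₛₗ ℝ (D u)).comp D - ν⁻¹ • (innerₛₗ ℝ p).comp dv) (B := ‖D u‖ + ν⁻¹ * (‖p‖ * κ))
    (by positivity) fun v _ => by
      simp only [LinearMap.sub_apply, LinearMap.comp_apply, LinearMap.smul_apply, smul_eq_mul,
        innerₛₗ_apply_apply]
      refine (abs_sub _ _).trans ?_
      rw [abs_mul, abs_of_pos (inv_pos.2 hν), add_mul]
      refine add_le_add (abs_real_inner_le_norm _ _) ?_
      rw [mul_assoc, mul_assoc]
      exact mul_le_mul_of_nonneg_left ((abs_real_inner_le_norm _ _).trans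
        (mul_le_mul_of_nonneg_left (hκ v) (norm_nonneg _))) (inv_nonneg.2 hν.le)
  refine ⟨s, hs, fun v hv => ?_⟩
  rw [h v hv]
  simp only [LinearMap.sub_apply, LinearMap.comp_apply, LinearMap.smul_apply, smul_eq_mul,
    innerₛₗ_apply_apply]
  field_simp

theorem IsStokes.add {u u' s s' : V} {p p' : F} (h : IsStokes D dv ν S Q u p s)
    (h' : IsStokes D dv ν S Q u' p' s') : IsStokes D dv ν S Q (u + u') (p + p') (s + s') :=
  ⟨(discKer dv S Q).add_mem h.mem h'.mem, fun v hv => by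
    simp only [map_add, inner_add_left]
    linarith [h.eq v hv, h'.eq v hv]⟩

theorem IsStokes.smul (c : ℝ) {u s : V} {p : F} (h : IsStokes D dv ν S Q u p s) :
    IsStokes D dv ν S Q (c • u) (c • p) (c • s) :=
  ⟨(discKer dv S Q).smul_mem c h.mem, fun v hv => by
    simp only [map_smul, inner_smul_left, conj_trivial]
    linear_combination c * h.eq v hv⟩

variable {θ : ℝ} {t : ℕ → ℝ} {n : ℕ} {u s : ℕ → V} {p : ℕ → F}

theorem IsStokes.zAlpha (h : ∀ i ∈ Icc (n - 1) (n + 1), IsStokes D dv ν S Q (u i) (p i) (s i)) :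
    IsStokes D dv ν S Q (zAlpha θ u n) (zAlpha θ p n) (zAlpha θ s n) :=
  (((h _ ⟨by omega, le_rfl⟩).smul _).add ((h _ ⟨by omega, by omega⟩).smul _)).add
    ((h _ ⟨by omega, by omega⟩).smul _)

theorem IsStokes.zBeta (h : ∀ i ∈ Icc (n - 1) (n + 1), IsStokes D dv ν S Q (u i) (p i) (s i)) :
    IsStokes D dv ν S Q (zBeta θ t u n) (zBeta θ t p n) (zBeta θ t s n) :=
  (((h _ ⟨by omega, le_rfl⟩).smul _).add ((h _ ⟨by omega, by omega⟩).smul _)).add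
    ((h _ ⟨by omega, by omega⟩).smul _)

theorem IsStokes.zStar (h : ∀ i ∈ Icc (n - 1) (n + 1), IsStokes D dv ν S Q (u i) (p i) (s i)) :
    IsStokes D dv ν S Q (zStar θ t u n) (zStar θ t p n) (zStar θ t s n) :=
  ((h _ ⟨by omega, by omega⟩).smul _).add ((h _ ⟨by omega, by omega⟩).smul _)

theorem IsStokes.sub {u u' s s' : V} {p p' : F} (h : IsStokes D dv ν S Q u p s)
    (h' : IsStokes D dv ν S Q u' p' s') : IsStokes D dv ν S Q (u - u') (p - p') (s - s') := by
  simpa [sub_eq_add_neg] using h.add (h'.smul (-1))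

end Stokes

section StokesError

variable {d : ℕ} {Ω : Set (Pt d)}

/-- The finite element space as a subspace of `X`. -/
noncomputable def femSpace (hΩ : IsOpen Ω) (Xh : Submodule ℝ (L2V Ω)) : Submodule ℝ (XSpace hΩ) :=
  Xh.comap (XSpace hΩ).subtype

/-- The discretely divergence-free functions as a subspace of `X`. -/
noncomputable def kerSpace (hΩ : IsOpen Ω) (Xh : Submodule ℝ (L2V Ω)) (Qh : Submodule ℝ (L2 Ω)) :
    Submodule ℝ (XSpace hΩ) :=
  discKer (divX hΩ) (femSpace hΩ Xh) Qh

theorem mem_kerSpace {hΩ : IsOpen Ω} {Xh : Submodule ℝ (L2V Ω)} {Qh : Submodule ℝ (L2 Ω)}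
    {v : XSpace hΩ} : v ∈ kerSpace hΩ Xh Qh ↔ MemVh Xh Qh v := Iff.rfl

theorem finiteDimensional_femSpace (hΩ : IsOpen Ω) (Xh : Submodule ℝ (L2V Ω))
    [FiniteDimensional ℝ Xh] : FiniteDimensional ℝ (femSpace hΩ Xh) := by
  refine FiniteDimensional.of_injective
    (((XSpace hΩ).subtype.comp (femSpace hΩ Xh).subtype).codRestrict Xh fun v => v.2) ?_
  intro v w h
  have := congrArg Subtype.val h
  exact Subtype.ext (Subtype.ext this)

/-- The constant in the error estimate of the Stokes projection. -/
noncomputable def stokesConst (d : ℕ) (ν Capp Cis : ℝ) : ℝ :=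
  2 * (1 + d / Cis) * Capp + d / ν * Capp

theorem IsStokes.norm_sub_le {r s m : ℕ} {ν Capp Cinv Cis h : ℝ}
    {K : Geometry.SimplicialComplex ℝ (Pt d)} {Xh : Submodule ℝ (L2V Ω)}
    {Qh : Submodule ℝ (L2 Ω)} (hΩ : IsOpen Ω) (hFE : IsFEPair r s m Capp Cinv Cis h K Xh Qh)
    (hX : ∀ v : XSpace hΩ, gradX hΩ v = 0 → v = 0) (hν : 0 < ν) (hCapp : 0 < Capp)
    (hCis : 0 < Cis) (h0 : 0 < h) {u z : XSpace hΩ} {p : L2 Ω}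
    (hu : MemHV (r + 1) (u : L2V Ω)) (hdiv : divX hΩ u = 0) (hp : MemH (s + 1) p) (hpQ : MemQ p)
    (hz : IsStokes (gradX hΩ) (divX hΩ) ν (femSpace hΩ Xh) Qh u p z) :
    ‖gradX hΩ (u - z)‖ ≤ stokesConst d ν Capp Cis *
      (h ^ r * normHV (r + 1) (u : L2V Ω) + h ^ (s + 1) * normH (s + 1) p) := by
  have := hFE.finX
  have := hFE.finQ
  have := finiteDimensional_femSpace hΩ Xh
  have hκ : ∀ v : XSpace hΩ, ‖divX hΩ v‖ ≤ d * ‖gradX hΩ v‖ := fun v => norm_divg_le _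
  obtain ⟨v, hv, -, hvn⟩ := hFE.approxX u u.2 hu 1 (by omega)
  obtain ⟨q, hq, -, hqn⟩ := hFE.approxQ p hpQ hp 0 (by omega)
  simp only [Nat.add_sub_cancel, Nat.sub_zero] at hvn hqn
  let v' : XSpace hΩ := ⟨v, hFE.memX v hv⟩
  obtain ⟨w, hw, hwn⟩ := exists_discKer_near (gradX hΩ) (divX hΩ) hX (femSpace hΩ Xh) Qh hκ hCis
    (fun q hq hq0 => by
      obtain ⟨x, hx, hx0, hxq⟩ := hFE.infSup q hq hq0
      refine ⟨⟨x, hFE.memX x hx⟩, hx, fun h => hx0 (congrArg Subtype.val h), ?_⟩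
      rw [gradX_apply, norm_gradV]
      exact hxq) hdiv (show v' ∈ femSpace hΩ Xh from hv)
  have e1 := norm_stokes_error_le (gradX hΩ) (divX hΩ) hν (Nat.cast_nonneg d) hκ hz.mem hw hq hz.eq
  have e2 : ‖gradX hΩ (u - v')‖ ≤ Capp * h ^ r * normHV (r + 1) (u : L2V Ω) := by
    refine (norm_gradV_le_normHV hΩ _).trans (hvn.trans ?_)
    exact mul_le_mul_of_nonneg_left (semiHV_le_normHV _ _) (by positivity)
  have e3 : ‖p - q‖ ≤ Capp * h ^ (s + 1) * normH (s + 1) p := by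
    refine (norm_le_normH hΩ 0 _).trans (hqn.trans ?_)
    exact mul_le_mul_of_nonneg_left (semiH_le_normH _ _) (by positivity)
  have e4 : ‖gradX hΩ (u - w)‖ ≤ (1 + d / Cis) * ‖gradX hΩ (u - v')‖ := by
    have : u - w = (u - v') + (v' - w) := by abel
    rw [this, map_add]
    refine (norm_add_le _ _).trans ?_
    linarith
  have hn1 := normHV_nonneg (r + 1) (u : L2V Ω)
  have hn2 := normH_nonneg (s + 1) p
  calc ‖gradX hΩ (u - z)‖ ≤ 2 * ‖gradX hΩ (u - w)‖ + d / ν * ‖p - q‖ := e1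
    _ ≤ 2 * ((1 + d / Cis) * (Capp * h ^ r * normHV (r + 1) (u : L2V Ω)))
        + d / ν * (Capp * h ^ (s + 1) * normH (s + 1) p) := by
        have := e4.trans (mul_le_mul_of_nonneg_left e2 (by positivity))
        gcongr
    _ ≤ _ := by
        have p1 : 0 ≤ 2 * (1 + d / Cis) * Capp * (h ^ (s + 1) * normH (s + 1) p) := by positivity
        have p2 : 0 ≤ d / ν * Capp * (h ^ r * normHV (r + 1) (u : L2V Ω)) := by positivity
        unfold stokesConst
        linarith

end StokesError

/-! ### The error equation -/

section ErrorEquation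

variable {d : ℕ} {Ω : Set (Pt d)} {hd : d = 2 ∨ d = 3} {hP : IsPolyhedral Ω}

theorem SmoothBound.mono {V E : Type*} [NormedAddCommGroup V] [InnerProductSpace ℝ V]
    [NormedAddCommGroup E] [InnerProductSpace ℝ E] {D : V →ₗ[ℝ] E}
    {b : V →ₗ[ℝ] V →ₗ[ℝ] V →ₗ[ℝ] ℝ} {B B' : ℝ} {z : V} (h : SmoothBound D b B z) (hB : B ≤ B') :
    SmoothBound D b B' z :=
  ⟨fun x v => (h.middle x v).trans (mul_le_mul_of_nonneg_right hB (by positivity)),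
    fun x v => (h.left x v).trans (mul_le_mul_of_nonneg_right hB (by positivity)),
    fun x v => (h.middle' x v).trans (mul_le_mul_of_nonneg_right hB (by positivity))⟩

theorem memQ_add (hP : IsPolyhedral Ω) {p q : L2 Ω} (hp : MemQ p) (hq : MemQ q) : MemQ (p + q) := by
  have : IsFiniteMeasure (volume.restrict Ω) :=
    ⟨by simpa using (volume_ne_top_of_isBounded hP.isBounded).lt_top⟩
  have hi : ∀ f : L2 Ω, Integrable f (volume.restrict Ω) := fun f =>
    (Lp.memLp f).integrable (by norm_num)
  rw [MemQ, integral_congr_ae (Lp.coeFn_add p q)]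
  simp only [Pi.add_apply]
  rw [integral_add (hi p) (hi q), hp, hq, add_zero]

theorem memQ_smul (c : ℝ) {p : L2 Ω} (hp : MemQ p) : MemQ (c • p) := by
  rw [MemQ, integral_congr_ae (Lp.coeFn_smul c p)]
  simp only [Pi.smul_apply]
  rw [integral_smul, hp, smul_zero]

variable (hP) in
/-- The pressure space as a subspace of `L²(Ω)`. -/
def QSpace : Submodule ℝ (L2 Ω) where
  carrier := {q | MemQ q}
  add_mem' hp hq := memQ_add hP hp hq
  zero_mem' := (integral_congr_ae (Lp.coeFn_zero ℝ 2 (volume.restrict Ω))).trans (by simp)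
  smul_mem' c _ hp := memQ_smul c hp

section Combinations

variable {V : Type*} [AddCommGroup V] [Module ℝ V] {θ : ℝ} {t : ℕ → ℝ} {n : ℕ} {W : Submodule ℝ V}
  {z z' : ℕ → V}

theorem zAlpha_mem (h : ∀ i ∈ Icc (n - 1) (n + 1), z i ∈ W) : zAlpha θ z n ∈ W :=
  W.add_mem (W.add_mem (W.smul_mem _ (h _ ⟨by omega, le_rfl⟩))
    (W.smul_mem _ (h _ ⟨by omega, by omega⟩))) (W.smul_mem _ (h _ ⟨by omega, by omega⟩))

theorem zBeta_mem (h : ∀ i ∈ Icc (n - 1) (n + 1), z i ∈ W) : zBeta θ t z n ∈ W :=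
  W.add_mem (W.add_mem (W.smul_mem _ (h _ ⟨by omega, le_rfl⟩))
    (W.smul_mem _ (h _ ⟨by omega, by omega⟩))) (W.smul_mem _ (h _ ⟨by omega, by omega⟩))

theorem zStar_mem (h : ∀ i ∈ Icc (n - 1) (n + 1), z i ∈ W) : zStar θ t z n ∈ W :=
  W.add_mem (W.smul_mem _ (h _ ⟨by omega, by omega⟩)) (W.smul_mem _ (h _ ⟨by omega, by omega⟩))

theorem zAlpha_congr (h : ∀ i ∈ Icc (n - 1) (n + 1), z i = z' i) :
    zAlpha θ z n = zAlpha θ z' n := by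
  rw [zAlpha, zAlpha, h _ ⟨by omega, le_rfl⟩, h n ⟨by omega, by omega⟩,
    h (n - 1) ⟨by omega, by omega⟩]

theorem zBeta_congr (h : ∀ i ∈ Icc (n - 1) (n + 1), z i = z' i) :
    zBeta θ t z n = zBeta θ t z' n := by
  rw [zBeta, zBeta, h _ ⟨by omega, le_rfl⟩, h n ⟨by omega, by omega⟩,
    h (n - 1) ⟨by omega, by omega⟩]

theorem zStar_congr (h : ∀ i ∈ Icc (n - 1) (n + 1), z i = z' i) :
    zStar θ t z n = zStar θ t z' n := by
  rw [zStar, zStar, h n ⟨by omega, by omega⟩, h (n - 1) ⟨by omega, by omega⟩]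

theorem zBeta_sub_zStar_comm (z z' : ℕ → V) :
    zBeta θ t (fun i => z i - z' i) n - zStar θ t (fun i => z i - z' i) n
      = (zBeta θ t z n - zStar θ t z n) - (zBeta θ t z' n - zStar θ t z' n) := by
  rw [zBeta_sub, zStar_sub]
  abel

theorem IsStep.norm_zBeta_le {V E : Type*} [AddCommGroup V] [Module ℝ V] [NormedAddCommGroup E]
    [InnerProductSpace ℝ E] (D : V →ₗ[ℝ] E) {T R ζ : ℝ} (hst : IsStep θ T R t n) {z : ℕ → V}
    (h : ∀ i ∈ Icc (n - 1) (n + 1), ‖D (z i)‖ ≤ ζ) :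
    ‖D (zBeta θ t z n)‖ ≤ coeffBound θ R * ζ ∧ ‖D (zStar θ t z n)‖ ≤ coeffBound θ R * ζ := by
  obtain ⟨hb, hc, h1, h0⟩ := hst.abs_le
  have e1 := h (n + 1) ⟨by omega, le_rfl⟩
  have e2 := h n ⟨by omega, by omega⟩
  have e3 := h (n - 1) ⟨by omega, by omega⟩
  have hζ : 0 ≤ ζ := (norm_nonneg _).trans e1
  have hs : ∀ {c K x : ℝ}, |c| ≤ K → 0 ≤ x → x ≤ ζ → ‖c‖ * x ≤ K * ζ := fun hc hx hxζ =>
    mul_le_mul hc hxζ hx ((abs_nonneg _).trans hc)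
  have p1 : 0 ≤ betaBound θ * ζ := mul_nonneg (by linarith) hζ
  have p2 : 0 ≤ betaBound θ * (2 + R) * ζ := mul_nonneg h0 hζ
  have e : coeffBound θ R * ζ
      = 3 * (betaBound θ * ζ) + 2 * (betaBound θ * (2 + R) * ζ) + 3 * ζ := by
    unfold coeffBound
    ring
  constructor
  · simp only [zBeta, map_add, map_smul]
    refine (norm_add₃_le).trans ?_
    rw [norm_smul, norm_smul, norm_smul]
    linarith [hs (hb 2) (norm_nonneg _) e1, hs (hb 1) (norm_nonneg _) e2,
      hs (hb 0) (norm_nonneg _) e3]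
  · rw [zStar_eq, map_add, map_smul, map_smul]
    refine (norm_add_le _ _).trans ?_
    rw [norm_smul, norm_smul]
    linarith [hs (hc 1) (norm_nonneg _) e2, hs (hc 0) (norm_nonneg _) e3]

end Combinations

variable {θ T R ν h B κ Cb C₂ Cinv Cs ζ₀ Λ J ρ : ℝ} {t : ℕ → ℝ} {n r s : ℕ}
  {S : Submodule ℝ (XSpace hP.isOpen)} {Q : Submodule ℝ (L2 Ω)}

/-- The equation for the discrete part of the error: the difference of the discrete Stokes problem
(`e3`), the weak form of the equations (`e4`) and the numerical method (`e5`). -/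
theorem error_equation {V E : Type*} [NormedAddCommGroup V] [InnerProductSpace ℝ V]
    [NormedAddCommGroup E] [InnerProductSpace ℝ E] (D : V →ₗ[ℝ] E)
    (b : V →ₗ[ℝ] V →ₗ[ℝ] V →ₗ[ℝ] ℝ) {u uβ sα sβ Uα Uβ Us m v : V} {k ν a x y f : ℝ}
    (e3 : ν * inner ℝ (D sβ) (D v) = ν * inner ℝ (D uβ) (D v) - x)
    (e4 : a + b u u v + ν * inner ℝ (D u) (D v) - y = f)
    (e5 : inner ℝ (k • Uα) v + b m Uβ v + ν * inner ℝ (D Uβ) (D v) = f - b (Us - m) Us v) :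
    inner ℝ (k • (sα - Uα)) v + ν * inner ℝ (D (sβ - Uβ)) (D v)
      = inner ℝ (k • sα) v - a + ν * inner ℝ (D (uβ - u)) (D v) - (x - y)
        + (b Us Uβ v - b u u v - b (Us - m) (Uβ - Us) v) := by
  simp only [map_sub, LinearMap.sub_apply, smul_sub, inner_sub_left] at e5 ⊢
  linarith

/-- The linear part of the error equation. -/
theorem error_equation_zBeta {V E F : Type*} [NormedAddCommGroup V] [InnerProductSpace ℝ V]
    [NormedAddCommGroup E] [InnerProductSpace ℝ E]
    [NormedAddCommGroup F] [InnerProductSpace ℝ F] (D : V →ₗ[ℝ] E)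
    (b : V →ₗ[ℝ] V →ₗ[ℝ] V →ₗ[ℝ] ℝ) {θ : ℝ} {t : ℕ → ℝ} {n : ℕ} {uX sX UX : ℕ → V} {u m v : V}
    {k ν a f : ℝ} {x y w : F}
    (e3 : ν * inner ℝ (D (zBeta θ t sX n)) (D v)
      = ν * inner ℝ (D (zBeta θ t uX n)) (D v) - inner ℝ x w)
    (e4 : a + b u u v + ν * inner ℝ (D u) (D v) - inner ℝ y w = f)
    (e5 : inner ℝ (k • zAlpha θ UX n) v + b m (zBeta θ t UX n) v
      + ν * inner ℝ (D (zBeta θ t UX n)) (D v) = f - b (zStar θ t UX n - m) (zStar θ t UX n) v) :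
    inner ℝ (k • zAlpha θ (fun i => sX i - UX i) n) v
        + ν * inner ℝ (D (zBeta θ t (fun i => sX i - UX i) n)) (D v)
      = inner ℝ (k • zAlpha θ sX n) v - a + ν * inner ℝ (D (zBeta θ t uX n - u)) (D v)
        - inner ℝ (x - y) w
        + (b (u + (zStar θ t uX n - u) - zStar θ t (fun i => uX i - sX i) n
              - zStar θ t (fun i => sX i - UX i) n)
            (u + (zBeta θ t uX n - u) - zBeta θ t (fun i => uX i - sX i) n
              - zBeta θ t (fun i => sX i - UX i) n) v - b u u v
          - b (zStar θ t UX n - m)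
            ((u + (zBeta θ t uX n - u) - zBeta θ t (fun i => uX i - sX i) n
              - zBeta θ t (fun i => sX i - UX i) n)
            - (u + (zStar θ t uX n - u) - zStar θ t (fun i => uX i - sX i) n
              - zStar θ t (fun i => sX i - UX i) n)) v) := by
  have e1 : u + (zStar θ t uX n - u) - zStar θ t (fun i => uX i - sX i) n
      - zStar θ t (fun i => sX i - UX i) n = zStar θ t UX n := by
    rw [zStar_sub, zStar_sub]
    abel
  have e2 : u + (zBeta θ t uX n - u) - zBeta θ t (fun i => uX i - sX i) n
      - zBeta θ t (fun i => sX i - UX i) n = zBeta θ t UX n := by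
    rw [zBeta_sub, zBeta_sub]
    abel
  rw [e1, e2, zAlpha_sub, zBeta_sub, inner_sub_left x]
  exact error_equation D b e3 e4 e5

/-- The discrete time derivative of the projection `s` against the exact one: a Taylor remainder of
`a` and the projection error `a - s`. -/
theorem inner_alpha_identity {V : Type*} [NormedAddCommGroup V] [InnerProductSpace ℝ V]
    {k : ℝ} (hk : k ≠ 0) (a s w v : V) :
    inner ℝ (k⁻¹ • s) v - inner ℝ w v
      = k⁻¹ * (inner ℝ (a - k • w) v - inner ℝ (a - s) v) := by
  rw [inner_sub_left, inner_sub_left, inner_smul_left, inner_smul_left]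
  simp only [conj_trivial]
  field_simp
  ring

theorem abs_add_add_sub_le {x y z X Y Z g : ℝ} (h1 : |x| ≤ X * g) (h2 : |y| ≤ Y * g)
    (h3 : |z| ≤ Z * g) : |x + y - z| ≤ (X + (Y + Z)) * g := by
  have := (abs_sub (x + y) z).trans (add_le_add_left (abs_add_le x y) _)
  linarith

set_option maxHeartbeats 800000 in
/-- One step of the method satisfies the hypotheses of the abstract energy estimate; the projection
error of `z_{n,α}` is estimated as well. -/
theorem IsStep.errorStep (hst : IsStep θ T R t n) (hν : 0 < ν) (hC₂ : 0 ≤ C₂) (hCs : 0 ≤ Cs)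
    (hC : ∀ v : XSpace hP.isOpen, ‖v‖ ≤ Cb * ‖gradX hP.isOpen v‖)
    (hCb : 0 ≤ Cb)
    (hsm : ∀ z : XSpace hP.isOpen, MemHV 2 (z : L2V Ω) →
      SmoothBound (gradX hP.isOpen) (tribX hd hP) (C₂ * normHV 2 (z : L2V Ω)) z)
    (hr : 1 ≤ r)
    {u ut : ℝ → L2V Ω} {p : ℝ → L2 Ω}
    (hcons : StepConsistency θ r s Λ (t (n + 1) - t (n - 1)) J t n u ut p) (hΛ : 0 ≤ Λ)
    {uX sX UX : ℕ → XSpace hP.isOpen} {ub m : XSpace hP.isOpen}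
    (huX : ∀ i ∈ Icc (n - 1) (n + 1), (uX i : L2V Ω) = u (t i))
    (hub : (ub : L2V Ω) = u (tBeta θ t n)) (hub2 : MemHV 2 (ub : L2V Ω))
    (hubB : C₂ * normHV 2 (ub : L2V Ω) ≤ B) (hubB' : normHV 2 (ub : L2V Ω) ≤ B)
    (hS : ∀ i ∈ Icc (n - 1) (n + 1),
      IsStokes (gradX hP.isOpen) (divX hP.isOpen) ν S Q (uX i) (p (t i)) (sX i))
    (hdiv : ∀ i ∈ Icc (n - 1) (n + 1), divX hP.isOpen (uX i) = 0)
    (hQ : ∀ i ∈ Icc (n - 1) (n + 1), MemQ (p (t i)))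
    (hζ₀ : ∀ i ∈ Icc (n - 1) (n + 1), ‖gradX hP.isOpen (uX i - sX i)‖ ≤ ζ₀)
    (herr : ∀ (v z : XSpace hP.isOpen) (q : L2 Ω), divX hP.isOpen v = 0 → MemQ q →
      MemHV (r + 1) (v : L2V Ω) → MemH (s + 1) q →
      IsStokes (gradX hP.isOpen) (divX hP.isOpen) ν S Q v q z → ‖gradX hP.isOpen (v - z)‖ ≤
        Cs * (h ^ r * normHV (r + 1) (v : L2V Ω) + h ^ (s + 1) * normH (s + 1) q))
    (hρ : h ^ r + h ^ (s + 1) ≤ ρ) (h0 : 0 < h)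
    {fv : XSpace hP.isOpen → ℝ}
    (hex : ∀ v : XSpace hP.isOpen, inner ℝ (ut (tBeta θ t n)) (v : L2V Ω)
      + tribX hd hP ub ub v + ν * inner ℝ (gradX hP.isOpen ub) (gradX hP.isOpen v)
      - inner ℝ (p (tBeta θ t n)) (divX hP.isOpen v) = fv v)
    (hnum : ∀ v ∈ discKer (divX hP.isOpen) S Q, inner ℝ ((khat θ t n)⁻¹ • zAlpha θ UX n) v
      + tribX hd hP m (zBeta θ t UX n) v
      + ν * inner ℝ (gradX hP.isOpen (zBeta θ t UX n)) (gradX hP.isOpen v)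
      = fv v - tribX hd hP (zStar θ t UX n - m) (zStar θ t UX n) v)
    (hcfl : Cb ^ 2 * Cinv * dissipConst θ * ((1 + vari t n * θ) / (1 - vari t n)) ^ 2 *
      (khat θ t n * ‖gradX hP.isOpen (zStar θ t UX n - m)‖ ^ 2) ≤ h * ν)
    (hcfl' : khat θ t n * ‖gradX hP.isOpen (zStar θ t UX n - m)‖ ^ 2 ≤ κ * h)
    (hδB : (1 + C₂) * (Λ * ((t (n + 1) - t (n - 1)) *
      Real.sqrt ((t (n + 1) - t (n - 1)) * J))) ≤ B)
    (hζB : coeffBound θ R * ζ₀ ≤ B * h) :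
    ‖gradX hP.isOpen (zAlpha θ (fun i => uX i - sX i) n)‖
      ≤ Cs * Λ * ρ * Real.sqrt ((t (n + 1) - t (n - 1)) * J) ∧
    ErrorStep (gradX hP.isOpen) (tribX hd hP) (discKer (divX hP.isOpen) S Q) θ ν B κ
      (Cb ^ 2 * Cinv * dissipConst θ) h t (fun i => sX i - UX i) n ub
      (zStar θ t uX n - ub) (zBeta θ t uX n - ub)
      (zStar θ t (fun i => uX i - sX i) n) (zBeta θ t (fun i => uX i - sX i) n)
      (zStar θ t UX n - m)
      ((1 + C₂) * (Λ * ((t (n + 1) - t (n - 1)) * Real.sqrt ((t (n + 1) - t (n - 1)) * J))))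
      (coeffBound θ R * ζ₀)
      (Cs * Λ * ρ * Real.sqrt ((t (n + 1) - t (n - 1)) * J))
      ((khat θ t n)⁻¹ * (Cb * (Cs * Λ * ρ * Real.sqrt ((t (n + 1) - t (n - 1)) * J))
          + Λ * ((t (n + 1) - t (n - 1)) ^ 2 * Real.sqrt ((t (n + 1) - t (n - 1)) * J)))
        + (ν * d ^ 2 + d) * (Λ * ((t (n + 1) - t (n - 1)) *
          Real.sqrt ((t (n + 1) - t (n - 1)) * J))))
      (fun v => inner ℝ ((khat θ t n)⁻¹ • zAlpha θ sX n) v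
        - inner ℝ (ut (tBeta θ t n)) (v : L2V Ω)
        + ν * inner ℝ (gradX hP.isOpen (zBeta θ t uX n - ub)) (gradX hP.isOpen v)
        - inner ℝ (zBeta θ t (fun i => p (t i)) n - p (tBeta θ t n)) (divX hP.isOpen v)) := by
  obtain ⟨c, hc⟩ : ∃ c, c = t (n + 1) - t (n - 1) := ⟨_, rfl⟩
  rw [← hc] at hcons hδB ⊢
  have hc0 : 0 ≤ c := hc ▸ sub_nonneg.2 hst.le_succ
  have hkp := khat_pos hst.theta_pos hst.theta_lt hst.pos hst.pos'
  have hσ : 0 ≤ Real.sqrt (c * J) := Real.sqrt_nonneg _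
  have cβ : ((zBeta θ t uX n : XSpace hP.isOpen) : L2V Ω) = zBeta θ t (fun i => u (t i)) n :=
    (map_zBeta (XSpace hP.isOpen).subtype uX).trans (zBeta_congr huX)
  have cs : ((zStar θ t uX n : XSpace hP.isOpen) : L2V Ω) = zStar θ t (fun i => u (t i)) n :=
    (map_zStar (XSpace hP.isOpen).subtype uX).trans (zStar_congr huX)
  have cα : ((zAlpha θ uX n : XSpace hP.isOpen) : L2V Ω) = zAlpha θ (fun i => u (t i)) n :=
    (map_zAlpha (XSpace hP.isOpen).subtype uX).trans (zAlpha_congr huX)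
  have hker : ∀ i ∈ Icc (n - 1) (n + 1), uX i ∈ LinearMap.ker (divX hP.isOpen) := hdiv
  have hQ' : ∀ i ∈ Icc (n - 1) (n + 1), p (t i) ∈ QSpace hP := hQ
  have hρle : ∀ x y : ℝ, 0 ≤ x → x ≤ Λ * Real.sqrt (c * J) → 0 ≤ y → y ≤ Λ * Real.sqrt (c * J) →
      Cs * (h ^ r * x + h ^ (s + 1) * y) ≤ Cs * Λ * ρ * Real.sqrt (c * J) := by
    intro x y hx hx' hy hy'
    have : h ^ r * x + h ^ (s + 1) * y ≤ ρ * (Λ * Real.sqrt (c * J)) := by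
      calc h ^ r * x + h ^ (s + 1) * y
          ≤ h ^ r * (Λ * Real.sqrt (c * J)) + h ^ (s + 1) * (Λ * Real.sqrt (c * J)) := by gcongr
        _ = (h ^ r + h ^ (s + 1)) * (Λ * Real.sqrt (c * J)) := by ring
        _ ≤ _ := by gcongr
    calc _ ≤ Cs * (ρ * (Λ * Real.sqrt (c * J))) := by gcongr
      _ = _ := by ring
  have herr' : ∀ (v z : XSpace hP.isOpen) (w : L2V Ω) (q : L2 Ω), (v : L2V Ω) = w →
      divX hP.isOpen v = 0 → MemQ q → MemHV (r + 1) w ∧ normHV (r + 1) w ≤ Λ * Real.sqrt (c * J) →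
      MemH (s + 1) q ∧ normH (s + 1) q ≤ Λ * Real.sqrt (c * J) →
      IsStokes (gradX hP.isOpen) (divX hP.isOpen) ν S Q v q z →
      ‖gradX hP.isOpen (v - z)‖ ≤ Cs * Λ * ρ * Real.sqrt (c * J) := by
    rintro v z w q rfl hv hq hw hqn hz
    exact (herr v z q hv hq hw.1 hqn.1 hz).trans
      (hρle _ _ (normHV_nonneg _ _) hw.2 (normH_nonneg _ _) hqn.2)
  have hα : ‖gradX hP.isOpen (zAlpha θ (fun i => uX i - sX i) n)‖
      ≤ Cs * Λ * ρ * Real.sqrt (c * J) :=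
    (congrArg (fun x => ‖gradX hP.isOpen x‖) (zAlpha_sub uX sX)).trans_le
      (herr' _ _ _ _ cα (zAlpha_mem hker) (zAlpha_mem hQ') hcons.u_alpha hcons.p_alpha
        (IsStokes.zAlpha hS))
  have hsub : ‖gradX hP.isOpen (zBeta θ t (fun i => uX i - sX i) n
      - zStar θ t (fun i => uX i - sX i) n)‖ ≤ Cs * Λ * ρ * Real.sqrt (c * J) :=
    (congrArg (fun x => ‖gradX hP.isOpen x‖) (zBeta_sub_zStar_comm uX sX)).trans_le
      (herr' _ _ _ _ (congrArg₂ (· - ·) cβ cs)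
        (Submodule.sub_mem _ (zBeta_mem hker) (zStar_mem hker))
        ((QSpace hP).sub_mem (zBeta_mem hQ') (zStar_mem hQ')) hcons.u_diff hcons.p_diff
        ((IsStokes.zBeta hS).sub (IsStokes.zStar hS)))
  have hdβ : ((zBeta θ t uX n - ub : XSpace hP.isOpen) : L2V Ω)
      = zBeta θ t (fun i => u (t i)) n - u (tBeta θ t n) := by
    rw [Submodule.coe_sub, cβ, hub]
  have hds : ((zStar θ t uX n - ub : XSpace hP.isOpen) : L2V Ω)
      = zStar θ t (fun i => u (t i)) n - u (tBeta θ t n) := by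
    rw [Submodule.coe_sub, cs, hub]
  have hr2 : 2 ≤ r + 1 := by omega
  have hδ : 0 ≤ Λ * (c * Real.sqrt (c * J)) := by positivity
  have hδ1 : Λ * (c * Real.sqrt (c * J)) ≤ (1 + C₂) * (Λ * (c * Real.sqrt (c * J))) :=
    le_mul_of_one_le_left hδ (by linarith)
  have hδ2 : C₂ * (Λ * (c * Real.sqrt (c * J))) ≤ (1 + C₂) * (Λ * (c * Real.sqrt (c * J))) :=
    mul_le_mul_of_nonneg_right (by linarith) hδ
  have n2β : normHV 2 ((zBeta θ t uX n - ub : XSpace hP.isOpen) : L2V Ω)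
      ≤ Λ * (c * Real.sqrt (c * J)) := by
    rw [hdβ]
    exact (normHV_mono hr2 _).trans hcons.u_beta.2
  have n2s : normHV 2 ((zStar θ t uX n - ub : XSpace hP.isOpen) : L2V Ω)
      ≤ Λ * (c * Real.sqrt (c * J)) := by
    rw [hds]
    exact (normHV_mono hr2 _).trans hcons.u_star.2
  have m2β : MemHV 2 ((zBeta θ t uX n - ub : XSpace hP.isOpen) : L2V Ω) := by
    rw [hdβ]
    exact fun i => (hcons.u_beta.1 i).mono hr2
  have m2s : MemHV 2 ((zStar θ t uX n - ub : XSpace hP.isOpen) : L2V Ω) := by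
    rw [hds]
    exact fun i => (hcons.u_star.1 i).mono hr2
  have grad2 : ∀ v : XSpace hP.isOpen, ‖gradX hP.isOpen v‖ ≤ normHV 2 (v : L2V Ω) := fun v =>
    (norm_gradV_le_normHV hP.isOpen _).trans (normHV_mono one_le_two _)
  have hηα : zAlpha θ (fun i => uX i - sX i) n = zAlpha θ uX n - zAlpha θ sX n := zAlpha_sub _ _
  have hη := hst.norm_zBeta_le (gradX hP.isOpen) (z := fun i => uX i - sX i) hζ₀
  refine ⟨hα, ?_⟩
  refine
    { smooth_u := (hsm ub hub2).mono hubB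
      smooth_ds := (hsm _ m2s).mono ((mul_le_mul_of_nonneg_left n2s hC₂).trans hδ2)
      smooth_db := (hsm _ m2β).mono ((mul_le_mul_of_nonneg_left n2β hC₂).trans hδ2)
      norm_u := (grad2 ub).trans hubB'
      norm_ds := (grad2 _).trans (n2s.trans hδ1)
      norm_db := (grad2 _).trans (n2β.trans hδ1)
      norm_es := hη.2
      norm_eb := hη.1
      norm_sub := hsub
      le_B := hδB
      le_Bh := hζB
      cfl := hcfl
      cfl' := hcfl'
      eq := ?_
      l_le := ?_ }
  · intro v hv
    have e3 := (IsStokes.zBeta (θ := θ) (t := t) hS).eq v hv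
    exact error_equation_zBeta (gradX hP.isOpen) (tribX hd hP) e3 (hex v) (hnum v hv)
  · intro v hv
    have e1 : |inner ℝ ((khat θ t n)⁻¹ • zAlpha θ sX n) v
        - inner ℝ (ut (tBeta θ t n)) (v : L2V Ω)|
        ≤ (khat θ t n)⁻¹ * (Cb * (Cs * Λ * ρ * Real.sqrt (c * J))
            + Λ * (c ^ 2 * Real.sqrt (c * J))) * ‖v‖ := by
      have e : inner ℝ ((khat θ t n)⁻¹ • zAlpha θ sX n) v - inner ℝ (ut (tBeta θ t n)) (v : L2V Ω)
          = (khat θ t n)⁻¹ * (inner ℝ (zAlpha θ (fun i => u (t i)) n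
              - khat θ t n • ut (tBeta θ t n)) (v : L2V Ω)
              - inner ℝ (zAlpha θ (fun i => uX i - sX i) n) v) := by
        rw [hηα, ← cα]
        exact inner_alpha_identity (V := L2V Ω) hkp.ne' (zAlpha θ uX n : XSpace hP.isOpen)
          (zAlpha θ sX n : XSpace hP.isOpen) (ut (tBeta θ t n)) v
      rw [e, abs_mul, abs_of_pos (inv_pos.2 hkp), mul_assoc]
      refine mul_le_mul_of_nonneg_left ?_ (inv_pos.2 hkp).le
      refine (abs_sub _ _).trans ?_
      have i1 := (abs_real_inner_le_norm (zAlpha θ (fun i => uX i - sX i) n) v).trans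
        (mul_le_mul_of_nonneg_right ((hC _).trans (mul_le_mul_of_nonneg_left hα hCb))
          (norm_nonneg v))
      have i2 := (abs_real_inner_le_norm (zAlpha θ (fun i => u (t i)) n
          - khat θ t n • ut (tBeta θ t n)) (v : L2V Ω)).trans
        (mul_le_mul_of_nonneg_right hcons.u_deriv (norm_nonneg (v : L2V Ω)))
      rw [Submodule.coe_norm] at i1
      rw [Submodule.coe_norm]
      linarith
    have e2 := abs_inner_gradV_le hP.isOpen m2β v.2
    have e3 := abs_inner_divg_le hP.isOpen (hcons.p_beta.1.mono (show 1 ≤ s + 1 by omega)) v.2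
    have e4 : normH 1 (zBeta θ t (fun i => p (t i)) n - p (tBeta θ t n))
        ≤ Λ * (c * Real.sqrt (c * J)) :=
      (normH_mono (show 1 ≤ s + 1 by omega) _).trans hcons.p_beta.2
    have e5 : |ν * inner ℝ (gradX hP.isOpen (zBeta θ t uX n - ub)) (gradX hP.isOpen v)|
        ≤ ν * d ^ 2 * (Λ * (c * Real.sqrt (c * J))) * ‖v‖ := by
      rw [abs_mul, abs_of_pos hν, mul_assoc, mul_assoc]
      refine mul_le_mul_of_nonneg_left (e2.trans ?_) hν.le
      exact mul_le_mul_of_nonneg_left (mul_le_mul_of_nonneg_right n2β (norm_nonneg _))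
        (by positivity)
    have e6 : |inner ℝ (zBeta θ t (fun i => p (t i)) n - p (tBeta θ t n)) (divX hP.isOpen v)|
        ≤ d * (Λ * (c * Real.sqrt (c * J))) * ‖v‖ :=
      e3.trans (mul_le_mul_of_nonneg_right (mul_le_mul_of_nonneg_left e4 (Nat.cast_nonneg d))
        (norm_nonneg _))
    have e9 := abs_add_add_sub_le e1 e5 e6
    rw [add_mul (ν * (d : ℝ) ^ 2)]
    exact e9

end ErrorEquation

/-! ### Convergence rates and uniform bounds -/

section Rate

/-- The rate against its ingredients. The condition `k ≤ h ^ (1/4)` gives `k ^ 2 ≤ h ^ (1/2)` and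
hence `rate ^ 2 ≤ 16 * h`. -/
theorem rate_bounds {r s : ℕ} (hr : 1 ≤ r) {h k : ℝ} (h0 : 0 < h) (h1 : h ≤ 1) (hk : 0 ≤ k)
    (hkh : k ≤ h ^ (1 / 4 : ℝ)) :
    h ^ r + h ^ (s + 1) ≤ 2 * h ∧ h ^ r + h ^ (s + 1) ≤ rate r s h k ∧
      (h ^ r + h ^ (s + 1)) ^ 2 + k ^ 4 + h * k ^ 3 ≤ rate r s h k ^ 2 ∧
      rate r s h k ^ 2 ≤ 16 * h ∧ rate r s h k ≤ 4 ∧ 0 ≤ rate r s h k := by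
  have e1 : h ^ r ≤ h := pow_le_of_le_one h0.le h1 (by omega)
  have e2 : h ^ (s + 1) ≤ h := pow_le_of_le_one h0.le h1 (by omega)
  have p1 : 0 ≤ h ^ r := by positivity
  have p2 : 0 ≤ h ^ (s + 1) := by positivity
  have s0 : h ^ (1 / 2 : ℝ) = Real.sqrt h := (Real.sqrt_eq_rpow h).symm
  have p3 : 0 ≤ k ^ 2 := by positivity
  have p4 : 0 ≤ h ^ (1 / 2 : ℝ) * k ^ (3 / 2 : ℝ) := by positivity
  have q2 : (h ^ (1 / 2 : ℝ) * k ^ (3 / 2 : ℝ)) ^ 2 = h * k ^ 3 := by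
    rw [mul_pow, s0, Real.sq_sqrt h0.le, ← Real.rpow_natCast (k ^ (3 / 2 : ℝ)), ← Real.rpow_mul hk]
    norm_num
  have k1 : k ≤ 1 := hkh.trans (Real.rpow_le_one h0.le h1 (by norm_num))
  have k2 : k ^ 2 ≤ Real.sqrt h := by
    calc k ^ 2 ≤ (h ^ (1 / 4 : ℝ)) ^ 2 := pow_le_pow_left₀ hk hkh 2
      _ = Real.sqrt h := by
        rw [← s0, ← Real.rpow_natCast (h ^ (1 / 4 : ℝ)), ← Real.rpow_mul h0.le]
        norm_num
  have k3 : h ^ (1 / 2 : ℝ) * k ^ (3 / 2 : ℝ) ≤ Real.sqrt h := by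
    rw [s0]
    exact mul_le_of_le_one_right (Real.sqrt_nonneg _) (Real.rpow_le_one hk k1 (by norm_num))
  have hs : h ≤ Real.sqrt h := Real.le_sqrt_of_sq_le (by nlinarith)
  have hs1 : Real.sqrt h ≤ 1 := Real.sqrt_le_one.2 h1
  have hr4 : rate r s h k ≤ 4 * Real.sqrt h := by
    unfold rate
    linarith
  have hr0 : 0 ≤ rate r s h k := by
    unfold rate
    linarith
  refine ⟨by linarith, by unfold rate; linarith, ?_, ?_, by linarith, hr0⟩
  · rw [← q2]
    unfold rate
    nlinarith [mul_nonneg (add_nonneg p1 p2) p3, mul_nonneg (add_nonneg p1 p2) p4,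
      mul_nonneg p3 p4]
  · calc rate r s h k ^ 2 ≤ (4 * Real.sqrt h) ^ 2 := pow_le_pow_left₀ hr0 hr4 2
      _ = 16 * h := by
        rw [mul_pow, Real.sq_sqrt h0.le]
        norm_num

/-- The sum of the squared consistency errors of one time step of length `c`. -/
theorem residual_le {κ c k h T ρ J q D₁ Z F G A Λ : ℝ} (hk : 0 < κ) (hkc : κ ≤ c)
    (hck : c ≤ 2 * k) (hcT : c ≤ T) (hq : κ⁻¹ * c ≤ q) (h0 : 0 ≤ h) (hJ : 0 ≤ J) :
    residual κ h (D₁ * (c * Real.sqrt (c * J))) (Z * ρ) (F * ρ * Real.sqrt (c * J))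
        (κ⁻¹ * (G * ρ * Real.sqrt (c * J) + Λ * (c ^ 2 * Real.sqrt (c * J)))
          + A * (c * Real.sqrt (c * J)))
      ≤ (3 * q * G ^ 2 + 48 * q * Λ ^ 2 + 48 * A ^ 2 + 16 * D₁ ^ 2 + Z ^ 2 + T * F ^ 2)
        * ((ρ ^ 2 + k ^ 4 + h * k ^ 3) * J + c * ρ ^ 2) := by
  have hc : 0 < c := hk.trans_le hkc
  have hσ : Real.sqrt (c * J) ^ 2 = c * J := Real.sq_sqrt (by positivity)
  set σ := Real.sqrt (c * J)
  have hk0 : 0 ≤ k := by linarith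
  have c4 : c ^ 4 ≤ 16 * k ^ 4 := by
    calc c ^ 4 ≤ (2 * k) ^ 4 := pow_le_pow_left₀ hc.le hck 4
      _ = _ := by ring
  have c3 : c ^ 3 ≤ 8 * k ^ 3 := by
    calc c ^ 3 ≤ (2 * k) ^ 3 := pow_le_pow_left₀ hc.le hck 3
      _ = _ := by ring
  have hki : 0 < κ⁻¹ := inv_pos.2 hk
  have hq0 : 0 ≤ q := le_trans (by positivity) hq
  have hT : 0 ≤ T := hc.le.trans hcT
  have g1 : κ * (κ⁻¹ * (G * ρ * σ + Λ * (c ^ 2 * σ)) + A * (c * σ)) ^ 2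
      ≤ 3 * q * G ^ 2 * (ρ ^ 2 * J) + 48 * q * Λ ^ 2 * (k ^ 4 * J) + 48 * A ^ 2 * (k ^ 4 * J) := by
    have e1 : (κ⁻¹ * (G * ρ * σ + Λ * (c ^ 2 * σ)) + A * (c * σ)) ^ 2
        ≤ 3 * ((κ⁻¹ * G * ρ * σ) ^ 2 + (κ⁻¹ * Λ * c ^ 2 * σ) ^ 2 + (A * c * σ) ^ 2) := by
      nlinarith [sq_nonneg (κ⁻¹ * G * ρ * σ - κ⁻¹ * Λ * c ^ 2 * σ),
        sq_nonneg (κ⁻¹ * G * ρ * σ - A * c * σ), sq_nonneg (κ⁻¹ * Λ * c ^ 2 * σ - A * c * σ)]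
    calc _ ≤ κ * (3 * ((κ⁻¹ * G * ρ * σ) ^ 2 + (κ⁻¹ * Λ * c ^ 2 * σ) ^ 2 + (A * c * σ) ^ 2)) := by
          gcongr
      _ = 3 * (κ⁻¹ * c) * G ^ 2 * (ρ ^ 2 * J) + 3 * (κ⁻¹ * c) * Λ ^ 2 * (c ^ 4 * J)
          + 3 * A ^ 2 * (κ * c ^ 3 * J) := by
          simp only [mul_pow, hσ]
          field_simp
      _ ≤ 3 * q * G ^ 2 * (ρ ^ 2 * J) + 3 * q * Λ ^ 2 * (16 * k ^ 4 * J)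
          + 3 * A ^ 2 * (16 * k ^ 4 * J) := by
          have : κ * c ^ 3 ≤ 16 * k ^ 4 := by
            refine le_trans ?_ c4
            calc κ * c ^ 3 ≤ c * c ^ 3 := by gcongr
              _ = c ^ 4 := by ring
          gcongr
      _ = _ := by ring
  have g2 : κ * (D₁ * (c * σ)) ^ 2 ≤ 16 * D₁ ^ 2 * (k ^ 4 * J) := by
    calc _ ≤ c * (D₁ * (c * σ)) ^ 2 := by gcongr
      _ = D₁ ^ 2 * (c ^ 4 * J) := by
        simp only [mul_pow, hσ]
        ring
      _ ≤ D₁ ^ 2 * (16 * k ^ 4 * J) := by gcongr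
      _ = _ := by ring
  have g3 : κ * (Z * ρ) ^ 2 ≤ Z ^ 2 * (c * ρ ^ 2) := by
    calc _ ≤ c * (Z * ρ) ^ 2 := by gcongr
      _ = _ := by ring
  have g4 : h * (D₁ * (c * σ)) ^ 2 ≤ 8 * D₁ ^ 2 * (h * k ^ 3 * J) := by
    calc h * (D₁ * (c * σ)) ^ 2 = D₁ ^ 2 * (h * c ^ 3 * J) := by
          simp only [mul_pow, hσ]
          ring
      _ ≤ D₁ ^ 2 * (h * (8 * k ^ 3) * J) := by gcongr
      _ = _ := by ring
  have g5 : (F * ρ * σ) ^ 2 ≤ T * F ^ 2 * (ρ ^ 2 * J) := by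
    calc (F * ρ * σ) ^ 2 = c * (F ^ 2 * (ρ ^ 2 * J)) := by
          simp only [mul_pow, hσ]
          ring
      _ ≤ T * (F ^ 2 * (ρ ^ 2 * J)) := by gcongr
      _ = _ := by ring
  set Γ := 3 * q * G ^ 2 + 48 * q * Λ ^ 2 + 48 * A ^ 2 + 16 * D₁ ^ 2 + Z ^ 2 + T * F ^ 2
  have n1 : 0 ≤ 3 * q * G ^ 2 := by positivity
  have n2 : 0 ≤ 48 * q * Λ ^ 2 := by positivity
  have n3 : 0 ≤ 48 * A ^ 2 := by positivity
  have n4 : 0 ≤ 16 * D₁ ^ 2 := by positivity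
  have n5 : 0 ≤ Z ^ 2 := by positivity
  have n6 : 0 ≤ T * F ^ 2 := by positivity
  have f1 : (3 * q * G ^ 2 + T * F ^ 2) * (ρ ^ 2 * J) ≤ Γ * (ρ ^ 2 * J) :=
    mul_le_mul_of_nonneg_right (by linarith) (by positivity)
  have f2 : (48 * q * Λ ^ 2 + 48 * A ^ 2 + 16 * D₁ ^ 2) * (k ^ 4 * J) ≤ Γ * (k ^ 4 * J) :=
    mul_le_mul_of_nonneg_right (by linarith) (by positivity)
  have f3 : 8 * D₁ ^ 2 * (h * k ^ 3 * J) ≤ Γ * (h * k ^ 3 * J) :=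
    mul_le_mul_of_nonneg_right (by linarith) (by positivity)
  have f4 : Z ^ 2 * (c * ρ ^ 2) ≤ Γ * (c * ρ ^ 2) :=
    mul_le_mul_of_nonneg_right (by linarith) (by positivity)
  unfold residual
  linarith

theorem stp_le_kmax {N n : ℕ} {t : ℕ → ℝ} (hn : n < N) :
    stp t n ≤ kmax N t :=
  le_ciSup (f := fun n : Fin N => stp t n) (Set.finite_range _).bddAbove ⟨n, hn⟩

theorem IsGrid.kmax_nonneg {T : ℝ} {N : ℕ} {t : ℕ → ℝ} (h : IsGrid T N t) : 0 ≤ kmax N t :=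
  Real.iSup_nonneg fun n => (sub_pos.2 (h.lt n n.2)).le

theorem IsGrid.sum_length_le {T : ℝ} {N : ℕ} {t : ℕ → ℝ} (h : IsGrid T N t) :
    ∑ n ∈ Finset.Ico 1 N, (t (n + 1) - t (n - 1)) ≤ 2 * T := by
  have e := h.sum_integral_le (g := fun _ => 1) intervalIntegrable_const fun _ => zero_le_one
  simpa using e

end Rate

section UniformBound

variable {d : ℕ} {Ω : Set (Pt d)}

/-- The triangle inequality up to a constant. -/
theorem normH_add_le (hΩ : IsOpen Ω) {ℓ : ℕ} {v w : L2 Ω} (hv : MemH ℓ v) (hw : MemH ℓ w) :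
    normH ℓ (v + w) ≤ multiCard d ℓ * (normH ℓ v + normH ℓ w) := by
  refine normH_le_of_forall (add_nonneg (normH_nonneg _ _) (normH_nonneg _ _)) fun k hk a => ?_
  rw [weakDeriv_add hΩ hv hw hk]
  exact (norm_add_le _ _).trans
    (add_le_add (norm_weakDeriv_le_normH hk _ _) (norm_weakDeriv_le_normH hk _ _))

/-- A function whose time derivative is square integrable with values in `H^ℓ` is bounded in `H^ℓ`
as soon as one of its values belongs to `H^ℓ`. -/
theorem HasTimeDeriv.exists_normH_le {T : ℝ} (hT : 0 ≤ T) (hΩ : IsOpen Ω) {ℓ : ℕ}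
    {w w' : ℝ → L2 Ω} (h : HasTimeDeriv T w w') (hw : MemL2H T ℓ w') {a : ℝ} (ha : a ∈ Icc 0 T)
    (hm : MemH ℓ (w a)) : ∃ M, 0 ≤ M ∧ ∀ x ∈ Icc 0 T, MemH ℓ (w x) ∧ normH ℓ (w x) ≤ M := by
  refine ⟨multiCard d ℓ * (multiCard d ℓ * ((1 + |(-1 : ℝ)| * 1) * Real.sqrt ((T - 0) *
    ∫ s in (0 : ℝ)..T, normH ℓ (w' s) ^ 2)) + normH ℓ (w a)), ?_, fun x hx => ?_⟩
  · have := normH_nonneg ℓ (w a)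
    positivity
  have e := ((h.weakDom_one le_rfl hx.1 hx.2 le_rfl).add
    ((h.weakDom_one le_rfl ha.1 ha.2 le_rfl).smul (-1))).memH hw le_rfl hT le_rfl (by positivity) hΩ
  have e2 : w x = (w x - w 0 + (-1 : ℝ) • (w a - w 0)) + w a := by
    rw [neg_one_smul]
    abel
  rw [e2]
  exact ⟨e.1.add hm, (normH_add_le hΩ e.1 hm).trans
    (mul_le_mul_of_nonneg_left (add_le_add_left e.2 _) (by positivity))⟩

theorem exists_normHV_le {T : ℝ} (hT : 0 ≤ T) (hΩ : IsOpen Ω) {ℓ : ℕ} {w w' : ℝ → L2V Ω}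
    (h : ∀ k, HasTimeDeriv T (fun t => w t k) (fun t => w' t k))
    (hw : ∀ k, MemL2H T ℓ (fun t => w' t k)) {a : ℝ} (ha : a ∈ Icc 0 T) (hm : MemHV ℓ (w a)) :
    ∃ M, 0 ≤ M ∧ ∀ x ∈ Icc 0 T, MemHV ℓ (w x) ∧ normHV ℓ (w x) ≤ M := by
  choose M hM0 hM using fun k => (h k).exists_normH_le hT hΩ (hw k) ha (hm k)
  refine ⟨d * ∑ k, M k, mul_nonneg (Nat.cast_nonneg d) (Finset.sum_nonneg fun k _ => hM0 k),
    fun x hx => ⟨fun k => (hM k x hx).1, ?_⟩⟩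
  exact normHV_le_of_forall (Finset.sum_nonneg fun k _ => hM0 k) fun k => ((hM k x hx).2).trans
    (Finset.single_le_sum (fun k _ => hM0 k) (Finset.mem_univ k))

end UniformBound

/-! ### Collecting the parts of the error -/

section Final

variable {V E : Type*} [NormedAddCommGroup V] [InnerProductSpace ℝ V] [NormedAddCommGroup E]
  [InnerProductSpace ℝ E] {D : V →ₗ[ℝ] E} {uX sX UX : ℕ → V} {Z ρ e K Ce : ℝ}

/-- The error is at most the projection error plus its discrete part. -/
theorem norm_error_le (hZ : 0 ≤ Z) (hρ : ρ ≤ e) (he : 0 ≤ e) {n : ℕ}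
    (hη : ‖D (uX n - sX n)‖ ≤ Z * ρ) (hφ : ‖D (sX n - UX n)‖ ^ 2 ≤ K * e ^ 2) :
    ‖D (uX n - UX n)‖ ≤ (Z + Real.sqrt K) * e := by
  have h1 : ‖D (sX n - UX n)‖ ≤ Real.sqrt K * e := by
    have := Real.le_sqrt_of_sq_le hφ
    rwa [Real.sqrt_mul' _ (sq_nonneg e), Real.sqrt_sq he] at this
  have h2 : uX n - UX n = (uX n - sX n) + (sX n - UX n) := by abel
  rw [h2, map_add]
  refine (norm_add_le _ _).trans ?_
  have := mul_le_mul_of_nonneg_left hρ hZ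
  linarith

/-- The discrete part of the error of the starting values, in `L²` and in the energy norm. -/
theorem norm_initial_le {Cb C₀ : ℝ} (hP : ∀ v, ‖v‖ ≤ Cb * ‖D v‖) (hZ : 0 ≤ Z)
    (hρ : ρ ≤ e) (he : 0 ≤ e) {n : ℕ} (hη : ‖D (uX n - sX n)‖ ≤ Z * ρ)
    (h0 : ‖D (uX n - UX n)‖ ≤ C₀ * e) :
    ‖sX n - UX n‖ ^ 2 ≤ ((1 + Cb ^ 2) * (Z + |C₀|) ^ 2) * e ^ 2 ∧
      ‖D (sX n - UX n)‖ ^ 2 ≤ ((1 + Cb ^ 2) * (Z + |C₀|) ^ 2) * e ^ 2 := by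
  have h2 : sX n - UX n = (uX n - UX n) - (uX n - sX n) := by abel
  have h1 : ‖D (sX n - UX n)‖ ≤ (Z + |C₀|) * e := by
    rw [h2, map_sub]
    refine (norm_sub_le _ _).trans ?_
    have := mul_le_mul_of_nonneg_left hρ hZ
    have := mul_le_mul_of_nonneg_right (le_abs_self C₀) he
    linarith
  have h3 : ‖D (sX n - UX n)‖ ^ 2 ≤ (Z + |C₀|) ^ 2 * e ^ 2 := by
    rw [← mul_pow]
    exact pow_le_pow_left₀ (norm_nonneg _) h1 2
  have h4 : ‖sX n - UX n‖ ^ 2 ≤ Cb ^ 2 * ‖D (sX n - UX n)‖ ^ 2 := by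
    rw [← mul_pow]
    exact pow_le_pow_left₀ (norm_nonneg _) (hP _) 2
  have p : 0 ≤ (Z + |C₀|) ^ 2 * e ^ 2 := by positivity
  have p2 : 0 ≤ Cb ^ 2 * ((Z + |C₀|) ^ 2 * e ^ 2) := by positivity
  have h5 := mul_le_mul_of_nonneg_left h3 (sq_nonneg Cb)
  constructor <;> linarith

/-- The discrete time derivative of the error. -/
theorem sum_norm_alpha_le {Cb F q ν θ Jt : ℝ} {N : ℕ} {t c J : ℕ → ℝ}
    (hP : ∀ v, ‖v‖ ≤ Cb * ‖D v‖) (hCb : 0 ≤ Cb) (hν : 0 < ν) (hρ0 : 0 ≤ ρ)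
    (hρ : ρ ≤ e) (he4 : e ≤ 4)
    (hk : ∀ n ∈ Finset.Ico 1 N, 0 < khat θ t n ∧ (khat θ t n)⁻¹ * c n ≤ q ∧ 0 ≤ c n ∧ 0 ≤ J n)
    (hJ : ∑ n ∈ Finset.Ico 1 N, J n ≤ Jt) (hq : 0 ≤ q)
    (hα : ∀ n ∈ Finset.Ico 1 N,
      ‖D (zAlpha θ (fun i => uX i - sX i) n)‖ ≤ F * ρ * Real.sqrt (c n * J n))
    (hφ : ∑ n ∈ Finset.Ico 1 N, khat θ t n *
      ‖(khat θ t n)⁻¹ • zAlpha θ (fun i => sX i - UX i) n‖ ^ 2 ≤ K * e ^ 2) :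
    ∑ n ∈ Finset.Ico 1 N, khat θ t n / ν *
      ‖(khat θ t n)⁻¹ • (zAlpha θ uX n - zAlpha θ UX n)‖ ^ 2
      ≤ 8 / ν * (q * (Cb * F) ^ 2 * |Jt| + |K|) * e := by
  have he : 0 ≤ e := hρ0.trans hρ
  have h1 : ∀ n ∈ Finset.Ico 1 N, khat θ t n / ν *
      ‖(khat θ t n)⁻¹ • (zAlpha θ uX n - zAlpha θ UX n)‖ ^ 2 ≤
      2 / ν * (q * (Cb * F) ^ 2 * ρ ^ 2 * J n) + 2 / ν * (khat θ t n *
      ‖(khat θ t n)⁻¹ • zAlpha θ (fun i => sX i - UX i) n‖ ^ 2) := by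
    intro n hn
    obtain ⟨k0, kq, c0, J0⟩ := hk n hn
    have e1 : zAlpha θ uX n - zAlpha θ UX n
        = zAlpha θ (fun i => uX i - sX i) n + zAlpha θ (fun i => sX i - UX i) n := by
      rw [zAlpha_sub, zAlpha_sub]
      abel
    have e2 : ‖(khat θ t n)⁻¹ • (zAlpha θ uX n - zAlpha θ UX n)‖ ^ 2 ≤
        2 * (‖(khat θ t n)⁻¹ • zAlpha θ (fun i => uX i - sX i) n‖ ^ 2
          + ‖(khat θ t n)⁻¹ • zAlpha θ (fun i => sX i - UX i) n‖ ^ 2) := by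
      rw [e1, smul_add]
      exact (pow_le_pow_left₀ (norm_nonneg _) (norm_add_le _ _) 2).trans (add_sq_le)
    have e3 : khat θ t n * ‖(khat θ t n)⁻¹ • zAlpha θ (fun i => uX i - sX i) n‖ ^ 2
        ≤ q * (Cb * F) ^ 2 * ρ ^ 2 * J n := by
      rw [norm_smul, Real.norm_of_nonneg (inv_pos.2 k0).le]
      have i1 := (hP _).trans (mul_le_mul_of_nonneg_left (hα n hn) hCb)
      calc _ ≤ khat θ t n * ((khat θ t n)⁻¹ * (Cb * (F * ρ * Real.sqrt (c n * J n)))) ^ 2 := by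
            gcongr
        _ = (khat θ t n)⁻¹ * c n * ((Cb * F) ^ 2 * ρ ^ 2 * J n) := by
            rw [mul_pow, mul_pow, mul_pow, Real.sq_sqrt (mul_nonneg c0 J0)]
            field_simp
        _ ≤ q * ((Cb * F) ^ 2 * ρ ^ 2 * J n) := by gcongr
        _ = _ := by ring
    calc _ ≤ khat θ t n / ν * (2 * (‖(khat θ t n)⁻¹ • zAlpha θ (fun i => uX i - sX i) n‖ ^ 2
          + ‖(khat θ t n)⁻¹ • zAlpha θ (fun i => sX i - UX i) n‖ ^ 2)) := by gcongr
      _ = 2 / ν * (khat θ t n * ‖(khat θ t n)⁻¹ • zAlpha θ (fun i => uX i - sX i) n‖ ^ 2)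
          + 2 / ν * (khat θ t n *
            ‖(khat θ t n)⁻¹ • zAlpha θ (fun i => sX i - UX i) n‖ ^ 2) := by ring
      _ ≤ _ := by gcongr
  refine (Finset.sum_le_sum h1).trans ?_
  rw [Finset.sum_add_distrib, ← Finset.mul_sum, ← Finset.mul_sum, ← Finset.mul_sum, ← mul_add]
  have h2 : q * (Cb * F) ^ 2 * ρ ^ 2 * ∑ n ∈ Finset.Ico 1 N, J n
      ≤ q * (Cb * F) ^ 2 * e ^ 2 * |Jt| := by
    have h5 : ρ ^ 2 ≤ e ^ 2 := pow_le_pow_left₀ hρ0 hρ 2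
    exact mul_le_mul (mul_le_mul_of_nonneg_left h5 (by positivity))
      (hJ.trans (le_abs_self Jt)) (Finset.sum_nonneg fun n hn => (hk n hn).2.2.2) (by positivity)
  have h3 : K * e ^ 2 ≤ |K| * e ^ 2 := mul_le_mul_of_nonneg_right (le_abs_self K) (sq_nonneg e)
  have h4 : e ^ 2 ≤ 4 * e := by
    rw [sq]
    exact mul_le_mul_of_nonneg_right he4 he
  calc _ ≤ 2 / ν * (q * (Cb * F) ^ 2 * e ^ 2 * |Jt| + |K| * e ^ 2) := by
        refine mul_le_mul_of_nonneg_left ?_ (by positivity)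
        linarith
    _ = 2 / ν * (q * (Cb * F) ^ 2 * |Jt| + |K|) * e ^ 2 := by ring
    _ ≤ 2 / ν * (q * (Cb * F) ^ 2 * |Jt| + |K|) * (4 * e) := by gcongr
    _ = _ := by ring

/-- The sum of the squared consistency errors. -/
theorem sum_residual_le {Γ ρ k h a T Jt : ℝ} {N : ℕ} {c J res : ℕ → ℝ} (hΓ : 0 ≤ Γ)
    (ha : ρ ^ 2 + k ^ 4 + h * k ^ 3 ≤ a) (h0 : 0 ≤ h) (hk : 0 ≤ k)
    (hJ0 : ∀ n ∈ Finset.Ico 1 N, 0 ≤ J n) (hJ : ∑ n ∈ Finset.Ico 1 N, J n ≤ 2 * Jt)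
    (hc : ∑ n ∈ Finset.Ico 1 N, c n ≤ 2 * T) (hT : 0 ≤ T)
    (hres : ∀ n ∈ Finset.Ico 1 N, res n ≤ Γ * ((ρ ^ 2 + k ^ 4 + h * k ^ 3) * J n + c n * ρ ^ 2)) :
    ∑ n ∈ Finset.Ico 1 N, res n ≤ Γ * (2 * Jt + 2 * T) * a := by
  refine (Finset.sum_le_sum hres).trans ?_
  rw [← Finset.mul_sum, Finset.sum_add_distrib, ← Finset.mul_sum, ← Finset.sum_mul, mul_assoc]
  refine mul_le_mul_of_nonneg_left ?_ hΓ
  have p1 : 0 ≤ k ^ 4 := by positivity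
  have p2 : 0 ≤ h * k ^ 3 := by positivity
  have h1 : ρ ^ 2 ≤ a := by linarith
  have hJs := (Finset.sum_nonneg hJ0).trans hJ
  have h2 : (ρ ^ 2 + k ^ 4 + h * k ^ 3) * ∑ n ∈ Finset.Ico 1 N, J n ≤ a * (2 * Jt) :=
    mul_le_mul ha hJ (Finset.sum_nonneg hJ0) ((by positivity : (0 : ℝ) ≤ _).trans ha)
  have h3 : (∑ n ∈ Finset.Ico 1 N, c n) * ρ ^ 2 ≤ 2 * T * a :=
    mul_le_mul hc h1 (sq_nonneg _) (by positivity)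
  linarith

end Final

/-! ### The error estimate for one exact solution -/

section Single

variable {d : ℕ} {Ω : Set (Pt d)}

/-- Sequences with values in `X` at the relevant indices are lifted to sequences in the type
`XSpace`. -/
theorem exists_lift (hΩ : IsOpen Ω) {P : ℕ → Prop} {v : ℕ → L2V Ω} (h : ∀ i, P i → MemX (v i)) :
    ∃ w : ℕ → XSpace hΩ, ∀ i, P i → (w i : L2V Ω) = v i := by
  classical
  refine ⟨fun i => if hi : P i then ⟨v i, h i hi⟩ else 0, fun i hi => ?_⟩
  simp only [dif_pos hi]

theorem stokesConst_nonneg {ν Capp Cis : ℝ} (hν : 0 < ν) (hCapp : 0 < Capp) (hCis : 0 < Cis) :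
    0 ≤ stokesConst d ν Capp Cis := by
  unfold stokesConst
  positivity

theorem integral_derivSq_le {T a b : ℝ} (ha : 0 ≤ a) (hab : a ≤ b) (hb : b ≤ T) {r s : ℕ}
    {u ut utt uttt : ℝ → L2V Ω} {p pt ptt : ℝ → L2 Ω}
    (hreg : IsRegular T r s u ut utt uttt p pt ptt) :
    IntervalIntegrable (derivSq r s ut utt uttt pt ptt) volume 0 T ∧
    0 ≤ ∫ τ in a..b, derivSq r s ut utt uttt pt ptt τ ∧
    ∫ τ in a..b, derivSq r s ut utt uttt pt ptt τ
      ≤ ∫ τ in (0 : ℝ)..T, derivSq r s ut utt uttt pt ptt τ := by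
  have hT : 0 ≤ T := ha.trans (hab.trans hb)
  have i1 := intervalIntegrable_normHV hT hreg.mem_ut
  have i2 := intervalIntegrable_normHV hT hreg.mem_utt
  have i3 := intervalIntegrable_normHV hT hreg.mem_uttt
  have i4 := hreg.mem_pt.intervalIntegrable hT
  have i5 := hreg.mem_ptt.intervalIntegrable hT
  have iJ : IntervalIntegrable (derivSq r s ut utt uttt pt ptt) volume 0 T :=
    (((i1.add i2).add i3).add i4).add i5
  exact ⟨iJ, intervalIntegral.integral_nonneg hab fun τ _ => derivSq_nonneg _ _ _ _ _ _ _ _,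
    intervalIntegral.integral_mono_interval ha hab hb
      (Filter.Eventually.of_forall fun τ => derivSq_nonneg _ _ _ _ _ _ _ _) iJ⟩

/-- If no value of the solution has the spatial regularity of the theorem, then the discrete
regularity only admits the trivial grid with one time step. -/
theorem DiscreteRegular.exists_regular {θ T M : ℝ} {r s N : ℕ} {t : ℕ → ℝ} {u : ℝ → L2V Ω}
    {p : ℝ → L2 Ω} (h : DiscreteRegular θ r s N t M u p) (hg : IsGrid T N t) (hθ0 : 0 < θ)
    (hθ1 : θ < 1) (hN : 2 ≤ N) :
    (∃ a ∈ Icc 0 T, MemHV (r + 1) (u a)) ∧ ∃ a ∈ Icc 0 T, MemH (s + 1) (p a) := by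
  have h1 : 1 ∈ Finset.Ico 1 N := Finset.mem_Ico.2 ⟨le_rfl, by omega⟩
  have hst := hg.isStep hθ0 hθ1 h1 le_rfl
  exact ⟨⟨_, ⟨hst.nonneg.trans hst.tBeta_mem.1, hst.tBeta_mem.2.trans hst.le⟩, h.u_two_beta.1 1 h1⟩,
    ⟨_, hg.mem_Icc (Nat.zero_le N), (h.p_inf 0 (Nat.zero_le N)).1⟩⟩

/-- The weight of the CFL-like condition is at least `((1 - θ) / 2) ^ 2`, so that the condition
bounds the fluctuation itself. -/
theorem cfl_bound {θ c h ν x : ℝ} {t : ℕ → ℝ} {n : ℕ} (hθ0 : 0 < θ) (hθ1 : θ < 1) (hc : 0 < c)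
    (h1 : 0 < stp t n) (h0 : 0 < stp t (n - 1)) (hx : 0 ≤ x)
    (hcfl : c * ((1 + vari t n * θ) / (1 - vari t n)) ^ 2 * x ≤ h * ν) :
    x ≤ ν / (c * ((1 - θ) / 2) ^ 2) * h := by
  have hε := vari_mem h1 h0
  have hq : (1 - θ) / 2 ≤ (1 + vari t n * θ) / (1 - vari t n) := by
    have := (one_add_mul_ge hθ0 hε).1
    exact div_le_div₀ (by linarith) this (by linarith) (by linarith)
  have hp : 0 < (1 - θ) / 2 := by linarith
  have : c * ((1 - θ) / 2) ^ 2 * x ≤ h * ν := by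
    refine le_trans ?_ hcfl
    gcongr
  rw [div_mul_eq_mul_div, le_div_iff₀ (by positivity)]
  linarith

end Single

section Single

variable {d : ℕ} {Ω : Set (Pt d)}

set_option maxHeartbeats 1600000 in
/-- The error estimate for one exact solution that is bounded in `H^{r+1} × H^{s+1}`. The
advecting velocity `a` is arbitrary; the ensemble only enters through the CFL-like condition on
`U_{n,*} - a`. -/
theorem exists_error_bound_of_bounded (hd : d = 2 ∨ d = 3) (hP : IsPolyhedral Ω) {θ : ℝ}
    (hθ0 : 0 < θ) (hθ1 : θ < 1) {Cb C₂ Cinv : ℝ} (hCb : 0 < Cb) (hC₂ : 0 < C₂) (hCinv : 0 < Cinv)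
    (hb : ∀ u v w : L2V Ω, MemX u → MemX v → MemX w → ‖w‖ ≤ Cb * ‖gradV w‖ ∧
      |trib u v w| ≤ Cb * (‖gradV u‖ * ‖gradV v‖ * Real.sqrt (‖w‖ * ‖gradV w‖)) ∧
      |trib u v w| ≤ Cb * (‖gradV u‖ * ‖gradV v‖ * ‖gradV w‖))
    (hb₂ : ∀ z u v : L2V Ω, MemX z → MemHV 2 z → MemX u → MemX v →
      |trib u z v| ≤ C₂ * normHV 2 z * (‖gradV u‖ * ‖v‖) ∧
      |trib z u v| ≤ C₂ * normHV 2 z * (‖gradV u‖ * ‖v‖) ∧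
      |trib u z v| ≤ C₂ * normHV 2 z * (‖u‖ * ‖gradV v‖))
    {r s m : ℕ} (hr : 1 ≤ r) {Capp Cis ν T : ℝ} (hCapp : 0 < Capp) (hCis : 0 < Cis) (hν : 0 < ν)
    (hT : 0 < T) {u ut utt uttt f : ℝ → L2V Ω} {p pt ptt : ℝ → L2 Ω}
    (hsol : IsNSESolution ν T u ut p f) (hreg : IsRegular T r s u ut utt uttt p pt ptt)
    {Mu Mp : ℝ} (hMu0 : 0 ≤ Mu) (hMp0 : 0 ≤ Mp)
    (hMu : ∀ x ∈ Icc 0 T, MemHV (r + 1) (u x) ∧ normHV (r + 1) (u x) ≤ Mu)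
    (hMp : ∀ x ∈ Icc 0 T, MemH (s + 1) (p x) ∧ normH (s + 1) (p x) ≤ Mp) (CU M C0 : ℝ) :
    ∃ C : ℝ, 0 ≤ C ∧ ∀ h : ℝ, 0 < h → h ≤ 1 →
      ∀ (K : Geometry.SimplicialComplex ℝ (Pt d)) (Xh : Submodule ℝ (L2V Ω))
        (Qh : Submodule ℝ (L2 Ω)), IsFEPair r s m Capp Cinv Cis h K Xh Qh →
      ∀ (N : ℕ) (t : ℕ → ℝ), IsGrid T N t → 1 ≤ N → DiscreteRegular θ r s N t M u p →
      (∀ n ∈ Finset.Ico 1 N, stp t n / stp t (n - 1) < CU) → kmax N t ≤ h ^ (1 / 4 : ℝ) →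
      ∀ U a : ℕ → L2V Ω, (∀ n ≤ N, MemVh Xh Qh (U n)) → (∀ n ∈ Finset.Ico 1 N, MemX (a n)) →
      (∀ n ∈ Finset.Ico 1 N, ∀ v, MemVh Xh Qh v →
        inner ℝ ((khat θ t n)⁻¹ • zAlpha θ U n) v + trib (a n) (zBeta θ t U n) v
          + ν * gradInner (zBeta θ t U n) v
        = inner ℝ (f (tBeta θ t n)) v - trib (zStar θ t U n - a n) (zStar θ t U n) v) →
      (∀ n ≤ 1, normHV 1 (u (t n) - U n) ≤ C0 * rate r s h (kmax N t)) →
      (∀ n ∈ Finset.Ico 1 N, Cb ^ 2 * Cinv * dissipConst θ *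
        ((1 + vari t n * θ) / (1 - vari t n)) ^ 2 *
        (khat θ t n * ‖gradV (zStar θ t U n - a n)‖ ^ 2) ≤ h * ν) →
      (∀ n ≤ N, normHV 1 (u (t n) - U n) ≤ C * rate r s h (kmax N t)) ∧
        ∑ n ∈ Finset.Ico 1 N, khat θ t n / ν *
          ‖(khat θ t n)⁻¹ • (zAlpha θ (fun i => u (t i)) n - zAlpha θ U n)‖ ^ 2
        ≤ C * rate r s h (kmax N t) := by
  have hΩ := hP.isOpen
  have hCb' : ∀ v : XSpace hP.isOpen, ‖v‖ ≤ Cb * ‖gradX hP.isOpen v‖ := fun v =>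
    (hb v v v v.2 v.2 v.2).1
  have hX : ∀ v : XSpace hP.isOpen, gradX hP.isOpen v = 0 → v = 0 := fun v hv => by
    have e := hCb' v
    rw [hv, norm_zero, mul_zero] at e
    exact norm_le_zero_iff.1 e
  have hsm : ∀ z : XSpace hP.isOpen, MemHV 2 (z : L2V Ω) →
      SmoothBound (gradX hP.isOpen) (tribX hd hP) (C₂ * normHV 2 (z : L2V Ω)) z := fun z hz =>
    ⟨fun x v => (hb₂ z x v z.2 hz x.2 v.2).1, fun x v => (hb₂ z x v z.2 hz x.2 v.2).2.1,
      fun x v => (hb₂ z x v z.2 hz x.2 v.2).2.2⟩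
  have hCs0 : 0 ≤ stokesConst d ν Capp Cis := stokesConst_nonneg hν hCapp hCis
  obtain ⟨Cs, hCs⟩ : ∃ x, x = stokesConst d ν Capp Cis := ⟨_, rfl⟩
  rw [← hCs] at hCs0
  obtain ⟨R, hR⟩ : ∃ x, x = |CU| := ⟨_, rfl⟩
  have hR0 : 0 ≤ R := hR ▸ abs_nonneg _
  have hKc : 0 ≤ coeffBound θ R := le_trans (by norm_num) (coeffBound_ge hθ0 hθ1 hR0)
  obtain ⟨Λ, hΛ⟩ : ∃ x : ℝ, x = 2 * (d + 1) * (multiCard d (r + 1) + multiCard d (s + 1)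
    + multiCard d 0) * coeffBound θ R := ⟨_, rfl⟩
  have hΛ0 : 0 ≤ Λ := by
    rw [hΛ]
    positivity
  obtain ⟨Jt, hJt⟩ : ∃ x, x = ∫ τ in (0 : ℝ)..T, derivSq r s ut utt uttt pt ptt τ := ⟨_, rfl⟩
  have hJt0 : 0 ≤ Jt := hJt ▸ (integral_derivSq_le le_rfl hT.le le_rfl hreg).2.1
  obtain ⟨Z, hZ⟩ : ∃ x, x = Cs * (Mu + Mp) := ⟨_, rfl⟩
  have hZ0 : 0 ≤ Z := by
    rw [hZ]
    positivity
  obtain ⟨B, hB⟩ : ∃ x, x = (1 + C₂) * |M| + (1 + C₂) * (Λ * (T * Real.sqrt (T * Jt)))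
    + 2 * (coeffBound θ R * Z) := ⟨_, rfl⟩
  have hB1 : 0 ≤ (1 + C₂) * |M| := by positivity
  have hB2 : 0 ≤ (1 + C₂) * (Λ * (T * Real.sqrt (T * Jt))) := by positivity
  have hB3 : 0 ≤ 2 * (coeffBound θ R * Z) := by positivity
  obtain ⟨q, hq⟩ : ∃ x, x = 2 / (1 - θ) := ⟨_, rfl⟩
  have hθ : (0 : ℝ) < 1 - θ := by linarith
  have hq0 : 0 ≤ q := by
    rw [hq]
    positivity
  have hcc : 0 < Cb ^ 2 * Cinv * dissipConst θ :=
    mul_pos (by positivity) (dissipConst_pos hθ0 hθ1)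
  obtain ⟨κ, hκ⟩ : ∃ x, x = ν / (Cb ^ 2 * Cinv * dissipConst θ * ((1 - θ) / 2) ^ 2) := ⟨_, rfl⟩
  have hκ0 : 0 ≤ κ := by
    rw [hκ]
    exact (div_pos hν (mul_pos hcc (by positivity))).le
  -- the sum of the residuals is at most `Γ₀ * (2 * Jt + 2 * T) * rate ^ 2`; the constant `Γ`
  -- covers the errors of the starting values, too
  obtain ⟨Γ₀, hΓ₀⟩ : ∃ x, x = 3 * q * (Cb * (Cs * Λ)) ^ 2 + 48 * q * Λ ^ 2
    + 48 * ((ν * d ^ 2 + d) * Λ) ^ 2 + 16 * ((1 + C₂) * Λ) ^ 2 + (coeffBound θ R * Z) ^ 2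
    + T * (Cs * Λ) ^ 2 := ⟨_, rfl⟩
  have hΓ₀0 : 0 ≤ Γ₀ := by
    rw [hΓ₀]
    positivity
  obtain ⟨Γ, hΓ⟩ : ∃ x, x = Γ₀ * (2 * Jt + 2 * T) + (1 + Cb ^ 2) * (Z + |C0|) ^ 2 := ⟨_, rfl⟩
  have hΓ1 : 0 ≤ Γ₀ * (2 * Jt + 2 * T) := by positivity
  have hΓ2 : 0 ≤ (1 + Cb ^ 2) * (Z + |C0|) ^ 2 := by positivity
  have hΓ0 : 0 ≤ Γ := by linarith
  obtain ⟨Ce, hCe0, hCe⟩ := energy_estimate (D := gradX hP.isOpen) (b := tribX hd hP)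
    (fun u v w => trib_antisymm _ _ _)
    (fun x y z => (hb x y z x.2 y.2 z.2).2.2) (fun x y z => (hb x y z x.2 y.2 z.2).2.1)
    hCb' hCb.le hCinv.le hν hθ0 hθ1 B κ R T (16 * Γ) hκ0
  have hC1 : 0 ≤ (Cb + 1) * (Z + Real.sqrt (Ce * Γ)) := by positivity
  have hC2 : 0 ≤ 8 / ν * (q * (Cb * (Cs * Λ)) ^ 2 * |2 * Jt| + |Ce * Γ|) := by positivity
  refine ⟨(Cb + 1) * (Z + Real.sqrt (Ce * Γ))
    + 8 / ν * (q * (Cb * (Cs * Λ)) ^ 2 * |2 * Jt| + |Ce * Γ|), by linarith, ?_⟩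
  intro h h0 h1 K Xh Qh hFE N t hg hN hdr hratio hkm U a hU ha hmom hini hcfl
  obtain ⟨hρ2, hρe, hρsq, he16, he4, he0⟩ :=
    rate_bounds (s := s) hr h0 h1 hg.kmax_nonneg hkm
  obtain ⟨e, he⟩ : ∃ x, x = rate r s h (kmax N t) := ⟨_, rfl⟩
  rw [← he] at hρe hρsq he16 he4 he0 hini ⊢
  obtain ⟨ρ, hρ⟩ : ∃ x, x = h ^ r + h ^ (s + 1) := ⟨_, rfl⟩
  rw [← hρ] at hρ2 hρe hρsq
  have hρ0 : 0 ≤ ρ := by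
    rw [hρ]
    positivity
  have := hFE.finX
  have := finiteDimensional_femSpace hΩ Xh
  have hnode : ∀ n ∈ Finset.Ico 1 N, ∀ i ∈ Icc (n - 1) (n + 1), i ≤ N := fun n hn i hi => by
    have h1 := Finset.mem_Ico.1 hn
    have h2 := hi.2
    omega
  have hst : ∀ n ∈ Finset.Ico 1 N, IsStep θ T R t n := fun n hn =>
    hg.isStep hθ0 hθ1 hn ((hratio n hn).le.trans (hR ▸ le_abs_self CU))
  have htβ : ∀ n ∈ Finset.Ico 1 N, tBeta θ t n ∈ Ioo 0 T := fun n hn => by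
    have h2 := tBeta_mem hθ0 hθ1 (hst n hn).one_le (hst n hn).pos (hst n hn).pos'
    exact ⟨(hst n hn).nonneg.trans_lt h2.1, h2.2.trans_le (hst n hn).le⟩
  -- lifts to the space `X`
  obtain ⟨uX, huX⟩ := exists_lift hP.isOpen (P := fun i => i ≤ N) (v := fun i => u (t i))
    fun i hi => hsol.memX _ (hg.mem_Icc hi)
  obtain ⟨UX, hUX⟩ := exists_lift hP.isOpen (P := fun i => i ≤ N) (v := U)
    fun i hi => hFE.memX _ (hU i hi).1
  obtain ⟨ub, hub⟩ := exists_lift hP.isOpen (P := fun n => n ∈ Finset.Ico 1 N)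
    (v := fun n => u (tBeta θ t n)) fun n hn => hsol.memX _ (Ioo_subset_Icc_self (htβ n hn))
  obtain ⟨aX, haX⟩ := exists_lift hP.isOpen (P := fun n => n ∈ Finset.Ico 1 N) (v := a) ha
  choose sX hsX using fun i => exists_isStokes (D := gradX hP.isOpen) (dv := divX hP.isOpen)
    (S := femSpace hP.isOpen Xh) (Q := Qh) hν (Nat.cast_nonneg d)
    (fun v => norm_divg_le (v : L2V Ω)) (uX i) (p (t i))
  have hdiv : ∀ i ≤ N, divX hP.isOpen (uX i) = 0 := fun i hi => by
    rw [divX_apply, huX i hi]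
    exact hsol.divFree _ (hg.mem_Icc hi)
  have herr : ∀ (v z : XSpace hP.isOpen) (q : L2 Ω), divX hP.isOpen v = 0 → MemQ q →
      MemHV (r + 1) (v : L2V Ω) → MemH (s + 1) q →
      IsStokes (gradX hP.isOpen) (divX hP.isOpen) ν (femSpace hP.isOpen Xh) Qh v q z →
      ‖gradX hP.isOpen (v - z)‖ ≤
        Cs * (h ^ r * normHV (r + 1) (v : L2V Ω) + h ^ (s + 1) * normH (s + 1) q) := by
    intro v z q' hv hq hvr hqs hz
    rw [hCs]
    exact hz.norm_sub_le hP.isOpen hFE hX hν hCapp hCis h0 hvr hv hqs hq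
  have hη : ∀ i ≤ N, ‖gradX hP.isOpen (uX i - sX i)‖ ≤ Z * ρ := fun i hi => by
    have m1 := hMu _ (hg.mem_Icc hi)
    have m2 := hMp _ (hg.mem_Icc hi)
    have e1 := herr (uX i) (sX i) (p (t i)) (hdiv i hi) (hsol.memQ _ (hg.mem_Icc hi))
      (by rw [huX i hi]; exact m1.1) m2.1 (hsX i)
    rw [huX i hi] at e1
    refine e1.trans ?_
    rw [hZ, hρ, mul_assoc]
    refine mul_le_mul_of_nonneg_left ?_ hCs0
    have p1 : 0 ≤ h ^ r := by positivity
    have p2 : 0 ≤ h ^ (s + 1) := by positivity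
    linarith [mul_le_mul_of_nonneg_left m1.2 p1, mul_le_mul_of_nonneg_left m2.2 p2,
      mul_nonneg p1 hMp0, mul_nonneg p2 hMu0]
  have hJn : ∀ n ∈ Finset.Ico 1 N, 0 ≤ (∫ τ in t (n - 1)..t (n + 1),
      derivSq r s ut utt uttt pt ptt τ) ∧ (∫ τ in t (n - 1)..t (n + 1),
      derivSq r s ut utt uttt pt ptt τ) ≤ Jt := fun n hn => by
    rw [hJt]
    exact (integral_derivSq_le (hst n hn).nonneg (hst n hn).le_succ (hst n hn).le hreg).2
  have hJsum : ∑ n ∈ Finset.Ico 1 N, (∫ τ in t (n - 1)..t (n + 1),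
      derivSq r s ut utt uttt pt ptt τ) ≤ 2 * Jt := by
    rw [hJt]
    exact hg.sum_integral_le (integral_derivSq_le le_rfl hT.le le_rfl hreg).1
      fun τ => derivSq_nonneg _ _ _ _ _ _ _ _
  have hstep : ∀ n ∈ Finset.Ico 1 N, _ := fun n hn =>
    have hub2 : MemHV 2 (ub n : L2V Ω) ∧ normHV 2 (ub n : L2V Ω) ≤ |M| := by
      rw [hub n hn]
      exact ⟨(hdr.u_inf_beta n hn).1, (hdr.u_inf_beta n hn).2.trans (le_abs_self M)⟩
    IsStep.errorStep (hd := hd) (hP := hP) (κ := κ) (B := B) (Cinv := Cinv) (Q := Qh)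
      (S := femSpace hP.isOpen Xh) (h := h) (ρ := ρ) (m := aX n) (UX := UX) (uX := uX) (sX := sX)
      (ub := ub n) (ζ₀ := Z * ρ) (Λ := Λ)
      (fv := fun v => inner ℝ (f (tBeta θ t n)) (v : L2V Ω))
      (hst n hn) hν hC₂.le hCs0 hCb' hCb.le hsm hr
      (by
        have := (hst n hn).consistency hP.isOpen hreg
        rw [← hΛ] at this
        exact this) hΛ0
      (fun i hi => huX i (hnode n hn i hi)) (hub n hn) hub2.1
      (by
        have := mul_le_mul_of_nonneg_left hub2.2 hC₂.le
        linarith [abs_nonneg M])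
      (by
        have := mul_nonneg hC₂.le (abs_nonneg M)
        linarith [hub2.2])
      (fun i _ => hsX i) (fun i hi => hdiv i (hnode n hn i hi))
      (fun i hi => hsol.memQ _ (hg.mem_Icc (hnode n hn i hi)))
      (fun i hi => hη i (hnode n hn i hi)) herr hρ.ge h0
      (fun v => by
        have := hsol.weak hd hP (htβ n hn) v.2
        rw [← hub n hn] at this
        exact this)
      (fun v hv => by
        have e1 := hmom n hn v hv
        have cβ : ((zBeta θ t UX n : XSpace hP.isOpen) : L2V Ω) = zBeta θ t U n :=
          (map_zBeta (XSpace hP.isOpen).subtype UX).trans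
            (zBeta_congr fun i hi => hUX i (hnode n hn i hi))
        have cs : ((zStar θ t UX n : XSpace hP.isOpen) : L2V Ω) = zStar θ t U n :=
          (map_zStar (XSpace hP.isOpen).subtype UX).trans
            (zStar_congr fun i hi => hUX i (hnode n hn i hi))
        have cα : ((zAlpha θ UX n : XSpace hP.isOpen) : L2V Ω) = zAlpha θ U n :=
          (map_zAlpha (XSpace hP.isOpen).subtype UX).trans
            (zAlpha_congr fun i hi => hUX i (hnode n hn i hi))
        rw [← cα, ← cβ, ← cs, ← haX n hn, ← inner_gradV] at e1
        exact e1)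
      (by
        have e1 := hcfl n hn
        have cs : ((zStar θ t UX n : XSpace hP.isOpen) : L2V Ω) = zStar θ t U n :=
          (map_zStar (XSpace hP.isOpen).subtype UX).trans
            (zStar_congr fun i hi => hUX i (hnode n hn i hi))
        rw [← cs, ← haX n hn] at e1
        exact e1)
      (by
        have e1 := cfl_bound hθ0 hθ1 hcc (hst n hn).pos (hst n hn).pos'
          (mul_nonneg (khat_pos hθ0 hθ1 (hst n hn).pos (hst n hn).pos').le (sq_nonneg _))
          (hcfl n hn)
        have cs : ((zStar θ t UX n : XSpace hP.isOpen) : L2V Ω) = zStar θ t U n :=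
          (map_zStar (XSpace hP.isOpen).subtype UX).trans
            (zStar_congr fun i hi => hUX i (hnode n hn i hi))
        rw [← cs, ← haX n hn, ← hκ] at e1
        exact e1)
      (by
        have c0 := sub_nonneg.2 (hst n hn).le_succ
        have cT : t (n + 1) - t (n - 1) ≤ T := by linarith [(hst n hn).nonneg, (hst n hn).le]
        have : (1 + C₂) * (Λ * ((t (n + 1) - t (n - 1)) * Real.sqrt ((t (n + 1) - t (n - 1)) *
            ∫ τ in t (n - 1)..t (n + 1), derivSq r s ut utt uttt pt ptt τ)))
            ≤ (1 + C₂) * (Λ * (T * Real.sqrt (T * Jt))) := by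
          have := hJn n hn
          have i1 := Real.sqrt_le_sqrt (mul_le_mul cT this.2 this.1 hT.le)
          gcongr
        linarith)
      (by
        have e1 : coeffBound θ R * (Z * ρ) ≤ coeffBound θ R * (Z * (2 * h)) := by gcongr
        have e2 : 0 ≤ (1 + C₂) * |M| * h := by positivity
        have e3 : 0 ≤ (1 + C₂) * (Λ * (T * Real.sqrt (T * Jt))) * h := by positivity
        rw [hB, add_mul, add_mul]
        linarith)
  have hini' : ∀ n ≤ 1, ‖gradX hP.isOpen (uX n - UX n)‖ ≤ C0 * e := fun n hn => by
    refine le_trans ?_ (hini n hn)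
    have e1 : ((uX n - UX n : XSpace hP.isOpen) : L2V Ω) = u (t n) - U n := by
      rw [Submodule.coe_sub, huX n (hn.trans hN), hUX n (hn.trans hN)]
    rw [← e1]
    exact norm_gradV_le_normHV hP.isOpen _
  have hkc : ∀ n ∈ Finset.Ico 1 N, 0 < khat θ t n ∧ khat θ t n ≤ t (n + 1) - t (n - 1) ∧
      t (n + 1) - t (n - 1) ≤ 2 * kmax N t ∧ t (n + 1) - t (n - 1) ≤ T ∧
      (khat θ t n)⁻¹ * (t (n + 1) - t (n - 1)) ≤ q := fun n hn => by
    have h2 := hst n hn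
    have h3 := Finset.mem_Ico.1 hn
    have k0 := khat_pos hθ0 hθ1 h2.pos h2.pos'
    have kb := khat_bounds hθ0 hθ1 h2.pos h2.pos'
    have k1 := stp_le_kmax (t := t) h3.2
    have k2 := stp_le_kmax (t := t) (show n - 1 < N by omega)
    rw [stp_add_stp h2.one_le] at kb
    refine ⟨k0, kb.2, ?_, by linarith [h2.nonneg, h2.le], ?_⟩
    · rw [← stp_add_stp h2.one_le]
      linarith
    · rw [hq, inv_mul_le_iff₀ k0, mul_div_assoc', le_div_iff₀ hθ]
      linarith [kb.1]
  have hres := sum_residual_le (N := N) (c := fun n => t (n + 1) - t (n - 1))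
    (J := fun n => ∫ τ in t (n - 1)..t (n + 1), derivSq r s ut utt uttt pt ptt τ) hΓ₀0 hρsq h0.le
    hg.kmax_nonneg (fun n hn => (hJn n hn).1) hJsum hg.sum_length_le hT.le
    (res := fun n => residual (khat θ t n) h
      ((1 + C₂) * (Λ * ((t (n + 1) - t (n - 1)) * Real.sqrt ((t (n + 1) - t (n - 1)) *
        ∫ τ in t (n - 1)..t (n + 1), derivSq r s ut utt uttt pt ptt τ))))
      (coeffBound θ R * (Z * ρ))
      (Cs * Λ * ρ * Real.sqrt ((t (n + 1) - t (n - 1)) *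
        ∫ τ in t (n - 1)..t (n + 1), derivSq r s ut utt uttt pt ptt τ))
      ((khat θ t n)⁻¹ * (Cb * (Cs * Λ * ρ * Real.sqrt ((t (n + 1) - t (n - 1)) *
            ∫ τ in t (n - 1)..t (n + 1), derivSq r s ut utt uttt pt ptt τ))
          + Λ * ((t (n + 1) - t (n - 1)) ^ 2 * Real.sqrt ((t (n + 1) - t (n - 1)) *
            ∫ τ in t (n - 1)..t (n + 1), derivSq r s ut utt uttt pt ptt τ)))
        + (ν * d ^ 2 + d) * (Λ * ((t (n + 1) - t (n - 1)) *
          Real.sqrt ((t (n + 1) - t (n - 1)) *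
            ∫ τ in t (n - 1)..t (n + 1), derivSq r s ut utt uttt pt ptt τ)))))
    (fun n hn => by
      obtain ⟨k0, k1, k2, k3, k4⟩ := hkc n hn
      have e1 := residual_le (ρ := ρ) (D₁ := (1 + C₂) * Λ) (Z := coeffBound θ R * Z)
        (F := Cs * Λ) (G := Cb * (Cs * Λ)) (A := (ν * d ^ 2 + d) * Λ) (Λ := Λ)
        k0 k1 k2 k3 k4 h0.le (hJn n hn).1
      rw [← hΓ₀] at e1
      refine le_trans (le_of_eq ?_) e1
      congr 1 <;> ring)
  have hinit := fun (n : ℕ) (hn : n ≤ 1) =>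
    norm_initial_le hCb' hZ0 hρe he0 (hη n (hn.trans hN)) (hini' n hn)
  have he2 : 0 ≤ e ^ 2 := sq_nonneg e
  have hΓe : Γ * e ^ 2 = Γ₀ * (2 * Jt + 2 * T) * e ^ 2 + (1 + Cb ^ 2) * (Z + |C0|) ^ 2 * e ^ 2 := by
    rw [hΓ, add_mul]
  obtain ⟨hφ, hφs⟩ := hCe (kerSpace hP.isOpen Xh Qh) h h0 h1
    (fun v hv => by
      have e1 := hFE.inverse v hv.1
      rw [semiHV_one] at e1
      exact e1) N t hg
    (fun n hn => (hst n hn).ratio) (fun i => sX i - UX i)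
    (fun n hn => Submodule.sub_mem _ (hsX n).mem (mem_kerSpace.2 (by
      rw [hUX n hn]
      exact hU n hn))) _ _ _ _ _ _ _ _ _ _ (Γ * e ^ 2) _ (fun n hn => (hstep n hn).2)
    (hres.trans (by linarith [mul_nonneg hΓ2 he2]))
    (fun n hn => ⟨(hinit n hn).1.trans (by linarith [mul_nonneg hΓ1 he2]),
      (hinit n hn).2.trans (by linarith [mul_nonneg hΓ1 he2])⟩)
    (by linarith [mul_le_mul_of_nonneg_left he16 hΓ0])
  rw [← mul_assoc] at hφs
  constructor
  · intro n hn
    have e1 := norm_error_le hZ0 hρe he0 (hη n hn) ((hφ n hn).2.trans_eq (mul_assoc _ _ _).symm)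
    have e2 : ((uX n - UX n : XSpace hP.isOpen) : L2V Ω) = u (t n) - U n := by
      rw [Submodule.coe_sub, huX n hn, hUX n hn]
    have e3 := normHV_one_le hP.isOpen ((uX n - UX n : XSpace hP.isOpen) : L2V Ω)
    have e4 := hCb' (uX n - UX n)
    rw [e2] at e3
    have e5 : ‖u (t n) - U n‖ ≤ Cb * ‖gradX hP.isOpen (uX n - UX n)‖ := by
      rw [← e2]
      exact e4
    have e6 : ‖gradV (u (t n) - U n)‖ = ‖gradX hP.isOpen (uX n - UX n)‖ := by
      rw [← e2]
      rfl
    rw [e6] at e3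
    have e7 := mul_le_mul_of_nonneg_left e1 (show 0 ≤ Cb + 1 by linarith)
    have e8 := mul_nonneg hC2 he0
    linarith
  · have e1 := sum_norm_alpha_le (uX := uX) (UX := UX) (N := N) (e := e) (q := q) (F := Cs * Λ)
      (c := fun n => t (n + 1) - t (n - 1))
      (J := fun n => ∫ τ in t (n - 1)..t (n + 1), derivSq r s ut utt uttt pt ptt τ)
      hCb' hCb.le hν hρ0 hρe he4
      (fun n hn => ⟨(hkc n hn).1, (hkc n hn).2.2.2.2, sub_nonneg.2 (hst n hn).le_succ,
        (hJn n hn).1⟩) hJsum hq0 (fun n hn => (hstep n hn).1) hφs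
    have e2 := mul_nonneg hC1 he0
    have e3 : ∑ n ∈ Finset.Ico 1 N, khat θ t n / ν *
          ‖(khat θ t n)⁻¹ • (zAlpha θ (fun i => u (t i)) n - zAlpha θ U n)‖ ^ 2
        = ∑ n ∈ Finset.Ico 1 N, khat θ t n / ν *
          ‖(khat θ t n)⁻¹ • (zAlpha θ uX n - zAlpha θ UX n)‖ ^ 2 := by
      refine Finset.sum_congr rfl fun n hn => ?_
      have c1 : ((zAlpha θ UX n : XSpace hP.isOpen) : L2V Ω) = zAlpha θ U n :=
        (map_zAlpha (XSpace hP.isOpen).subtype UX).trans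
          (zAlpha_congr fun i hi => hUX i (hnode n hn i hi))
      have c2 : ((zAlpha θ uX n : XSpace hP.isOpen) : L2V Ω) = zAlpha θ (fun i => u (t i)) n :=
        (map_zAlpha (XSpace hP.isOpen).subtype uX).trans
          (zAlpha_congr fun i hi => huX i (hnode n hn i hi))
      rw [← c1, ← c2]
      rfl
    rw [e3, add_mul]
    linarith

end Single

/-! ### The ensemble method -/

section Ensemble

variable {d : ℕ} {Ω : Set (Pt d)}

/-- The method only requires `U_{n,β}` to be discretely divergence-free. As `β_2` does not vanish,
this passes to `U_{n+1}` by induction. -/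
theorem IsDLNEnsemble.memVh {J N : ℕ} {θ ν T : ℝ} {t : ℕ → ℝ} {Xh : Submodule ℝ (L2V Ω)}
    {Qh : Submodule ℝ (L2 Ω)} {f : Fin J → ℝ → L2V Ω} {U : Fin J → ℕ → L2V Ω}
    {P : Fin J → ℕ → L2 Ω} (h : IsDLNEnsemble θ ν N t Xh Qh f U P) (hΩ : IsOpen Ω)
    (hX : ∀ v ∈ Xh, MemX v) (hg : IsGrid T N t) (hθ0 : 0 < θ) (hθ1 : θ < 1) {j : Fin J}
    (h01 : ∀ n ≤ 1, MemVh Xh Qh (U j n)) : ∀ n ≤ N, MemVh Xh Qh (U j n) := by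
  intro n
  induction n using Nat.strong_induction_on with
  | _ n ih =>
    intro hn
    rcases Nat.lt_or_ge n 2 with h2 | h2
    · exact h01 n (by omega)
    obtain ⟨k, rfl⟩ : ∃ k, n = k + 2 := ⟨n - 2, by omega⟩
    have hk : k + 1 ∈ Finset.Ico 1 N := Finset.mem_Ico.2 ⟨by omega, by omega⟩
    have hst := hg.isStep hθ0 hθ1 hk le_rfl
    have hβ := beta_two_pos hθ0 hθ1 (vari_mem hst.pos hst.pos')
    refine ⟨h.memX j _ hn, ?_⟩
    have e := h.divFree j (k + 1) hk
    have m2 := hX _ (h.memX j _ hn)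
    -- the divergence-free condition holds for `z_{n,β}`, whose leading coefficient is positive
    have lift : ∀ i ≤ k + 2, ∃ w : XSpace hΩ, (w : L2V Ω) = U j i := fun i hi =>
      ⟨⟨U j i, hX _ (h.memX j _ (hi.trans hn))⟩, rfl⟩
    obtain ⟨w2, e2⟩ := lift (k + 2) le_rfl
    obtain ⟨w1, e1⟩ := lift (k + 1) (by omega)
    obtain ⟨w0, e0⟩ := lift k (by omega)
    intro q hq
    have d1 := (ih (k + 1) (by omega) (by omega)).2 q hq
    have d0 := (ih k (by omega) (by omega)).2 q hq
    have d2 := e q hq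
    rw [← e1] at d1
    rw [← e0] at d0
    rw [← e2]
    have ez : zBeta θ t (U j) (k + 1) = ((beta θ (vari t (k + 1)) 2 • w2
        + beta θ (vari t (k + 1)) 1 • w1 + beta θ (vari t (k + 1)) 0 • w0 : XSpace hΩ) : L2V Ω) := by
      simp only [zBeta, Submodule.coe_add, Submodule.coe_smul, e2, e1, e0, Nat.add_sub_cancel]
    rw [ez, ← divX_apply, map_add, map_add, map_smul, map_smul, map_smul, inner_add_left,
      inner_add_left, inner_smul_left, inner_smul_left, inner_smul_left, real_inner_comm,
      real_inner_comm q, real_inner_comm q, divX_apply, divX_apply, divX_apply] at d2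
    simp only [conj_trivial, d1, d0, mul_zero, add_zero] at d2
    exact (mul_eq_zero.1 d2).resolve_left hβ.ne'

theorem ensMean_mem {J : ℕ} {V : Type*} [AddCommGroup V] [Module ℝ V] {W : Submodule ℝ V}
    {U : Fin J → ℕ → V} {n : ℕ} (h : ∀ j, U j n ∈ W) : ensMean U n ∈ W :=
  W.smul_mem _ (W.sum_mem fun j _ => h j)

/-- The error estimate for one exact solution, without a bound of its values: such a bound follows
from the regularity in time unless the grid is trivial. -/
theorem exists_error_bound (hd : d = 2 ∨ d = 3) (hP : IsPolyhedral Ω) {θ : ℝ}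
    (hθ0 : 0 < θ) (hθ1 : θ < 1) {Cb C₂ Cinv : ℝ} (hCb : 0 < Cb) (hC₂ : 0 < C₂) (hCinv : 0 < Cinv)
    (hb : ∀ u v w : L2V Ω, MemX u → MemX v → MemX w → ‖w‖ ≤ Cb * ‖gradV w‖ ∧
      |trib u v w| ≤ Cb * (‖gradV u‖ * ‖gradV v‖ * Real.sqrt (‖w‖ * ‖gradV w‖)) ∧
      |trib u v w| ≤ Cb * (‖gradV u‖ * ‖gradV v‖ * ‖gradV w‖))
    (hb₂ : ∀ z u v : L2V Ω, MemX z → MemHV 2 z → MemX u → MemX v →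
      |trib u z v| ≤ C₂ * normHV 2 z * (‖gradV u‖ * ‖v‖) ∧
      |trib z u v| ≤ C₂ * normHV 2 z * (‖gradV u‖ * ‖v‖) ∧
      |trib u z v| ≤ C₂ * normHV 2 z * (‖u‖ * ‖gradV v‖))
    {r s m : ℕ} (hr : 1 ≤ r) {Capp Cis ν T : ℝ} (hCapp : 0 < Capp) (hCis : 0 < Cis) (hν : 0 < ν)
    (hT : 0 < T) {u ut utt uttt f : ℝ → L2V Ω} {p pt ptt : ℝ → L2 Ω}
    (hsol : IsNSESolution ν T u ut p f) (hreg : IsRegular T r s u ut utt uttt p pt ptt)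
    (CU M C0 : ℝ) :
    ∃ C : ℝ, 0 ≤ C ∧ ∀ h : ℝ, 0 < h → h ≤ 1 →
      ∀ (K : Geometry.SimplicialComplex ℝ (Pt d)) (Xh : Submodule ℝ (L2V Ω))
        (Qh : Submodule ℝ (L2 Ω)), IsFEPair r s m Capp Cinv Cis h K Xh Qh →
      ∀ (N : ℕ) (t : ℕ → ℝ), IsGrid T N t → 1 ≤ N → DiscreteRegular θ r s N t M u p →
      (∀ n ∈ Finset.Ico 1 N, stp t n / stp t (n - 1) < CU) → kmax N t ≤ h ^ (1 / 4 : ℝ) →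
      ∀ U a : ℕ → L2V Ω, (∀ n ≤ N, MemVh Xh Qh (U n)) → (∀ n ∈ Finset.Ico 1 N, MemX (a n)) →
      (∀ n ∈ Finset.Ico 1 N, ∀ v, MemVh Xh Qh v →
        inner ℝ ((khat θ t n)⁻¹ • zAlpha θ U n) v + trib (a n) (zBeta θ t U n) v
          + ν * gradInner (zBeta θ t U n) v
        = inner ℝ (f (tBeta θ t n)) v - trib (zStar θ t U n - a n) (zStar θ t U n) v) →
      (∀ n ≤ 1, normHV 1 (u (t n) - U n) ≤ C0 * rate r s h (kmax N t)) →
      (∀ n ∈ Finset.Ico 1 N, Cb ^ 2 * Cinv * dissipConst θ *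
        ((1 + vari t n * θ) / (1 - vari t n)) ^ 2 *
        (khat θ t n * ‖gradV (zStar θ t U n - a n)‖ ^ 2) ≤ h * ν) →
      (∀ n ≤ N, normHV 1 (u (t n) - U n) ≤ C * rate r s h (kmax N t)) ∧
        ∑ n ∈ Finset.Ico 1 N, khat θ t n / ν *
          ‖(khat θ t n)⁻¹ • (zAlpha θ (fun i => u (t i)) n - zAlpha θ U n)‖ ^ 2
        ≤ C * rate r s h (kmax N t) := by
  by_cases hgood : (∃ a ∈ Icc 0 T, MemHV (r + 1) (u a)) ∧ ∃ a ∈ Icc 0 T, MemH (s + 1) (p a)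
  · obtain ⟨⟨a, ha, hua⟩, a', ha', hpa⟩ := hgood
    obtain ⟨Mu, hMu0, hMu⟩ := exists_normHV_le hT.le hP.isOpen hreg.hasDeriv_u hreg.mem_ut ha hua
    obtain ⟨Mp, hMp0, hMp⟩ := hreg.hasDeriv_p.exists_normH_le hT.le hP.isOpen hreg.mem_pt ha' hpa
    exact exists_error_bound_of_bounded hd hP hθ0 hθ1 hCb hC₂ hCinv hb hb₂ hr hCapp hCis hν hT
      hsol hreg hMu0 hMp0 hMu hMp CU M C0
  · refine ⟨|C0|, abs_nonneg _, ?_⟩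
    intro h h0 h1 K Xh Qh hFE N t hg hN hdr hratio hkm U a hU ha hmom hini hcfl
    have he0 := (rate_bounds (s := s) hr h0 h1 hg.kmax_nonneg hkm).2.2.2.2.2
    have hN1 : N ≤ 1 := by
      by_contra hc
      exact hgood (hdr.exists_regular hg hθ0 hθ1 (by omega))
    rw [Finset.Ico_eq_empty (by omega), Finset.sum_empty]
    exact ⟨fun n hn => (hini n (hn.trans hN1)).trans
      (mul_le_mul_of_nonneg_right (le_abs_self C0) he0), mul_nonneg (abs_nonneg _) he0⟩

end Ensemble

end DLN

theorem mainTheorem3 (d : ℕ) (hd : d = 2 ∨ d = 3) (Ω : Set (DLN.Pt d)) (hΩ : DLN.IsPolyhedral Ω)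
    (θ : ℝ) (hθ0 : 0 < θ) (hθ1 : θ < 1) (Cinv : ℝ) (hCinv : 0 < Cinv) :
    -- the constant of the CFL-like conditions
    ∃ Ccfl : ℝ, 0 < Ccfl ∧
    ∀ (r s m : ℕ), 1 ≤ r → 1 ≤ s →
    ∀ (Capp Cis : ℝ), 0 < Capp → 0 < Cis →
    ∀ (ν T : ℝ), 0 < ν → 0 < T →
    -- the exact solutions
    ∀ (J : ℕ) (u ut utt uttt f : Fin J → ℝ → DLN.L2V Ω) (p pt ptt : Fin J → ℝ → DLN.L2 Ω),
    (∀ j, DLN.IsNSESolution ν T (u j) (ut j) (p j) (f j)) →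
    (∀ j, DLN.IsRegular T r s (u j) (ut j) (utt j) (uttt j) (p j) (pt j) (ptt j)) →
    -- time ratio bounds, bound of the discrete norms, constant for the starting values
    ∀ (CL CU M C0 : ℝ), 0 < CL → 0 < CU →
    ∃ C : ℝ,
    ∀ (h : ℝ), 0 < h → h ≤ 1 →
    ∀ (K : Geometry.SimplicialComplex ℝ (DLN.Pt d)) (Xh : Submodule ℝ (DLN.L2V Ω))
      (Qh : Submodule ℝ (DLN.L2 Ω)),
    DLN.IsFEPair r s m Capp Cinv Cis h K Xh Qh →
    ∀ (N : ℕ) (t : ℕ → ℝ), DLN.IsGrid T N t →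
    (∀ j, DLN.DiscreteRegular θ r s N t M (u j) (p j)) →
    (∀ n ∈ Finset.Ico 1 N,
      CL < DLN.stp t n / DLN.stp t (n - 1) ∧ DLN.stp t n / DLN.stp t (n - 1) < CU) →
    DLN.kmax N t ≤ h ^ (1 / 4 : ℝ) →
    ∀ (U : Fin J → ℕ → DLN.L2V Ω) (P : Fin J → ℕ → DLN.L2 Ω),
    DLN.IsDLNEnsemble θ ν N t Xh Qh f U P →
    (∀ j, ∀ n ≤ 1, DLN.MemVh Xh Qh (U j n) ∧
      DLN.normHV 1 (u j (t n) - U j n) ≤ C0 * DLN.rate r s h (DLN.kmax N t)) →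
    DLN.CFL Ccfl θ ν h N t U →
    ∀ j,
      (⨆ n : Fin (N + 1), DLN.normHV 1 (u j (t n) - U j n))
        + ∑ n ∈ Finset.Ico 1 N, DLN.khat θ t n / ν *
            ‖(DLN.khat θ t n)⁻¹ •
              (DLN.zAlpha θ (fun i => u j (t i)) n - DLN.zAlpha θ (U j) n)‖ ^ 2
      ≤ C * DLN.rate r s h (DLN.kmax N t) := by
  obtain ⟨Cb, hCb, hb⟩ := DLN.exists_trib_bound hd hΩ
  obtain ⟨C₂, hC₂, hb₂⟩ := DLN.exists_trib_bound_two hd hΩ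
  refine ⟨Cb ^ 2 * Cinv * DLN.dissipConst θ,
    mul_pos (by positivity) (DLN.dissipConst_pos hθ0 hθ1), ?_⟩
  intro r s m hr _ Capp Cis hCapp hCis ν T hν hT J u ut utt uttt f p pt ptt hsol hreg CL CU M C0 _ _
  choose C hC0 hC using fun j => DLN.exists_error_bound (m := m) hd hΩ hθ0 hθ1 hCb hC₂ hCinv hb hb₂
    hr hCapp hCis hν hT (hsol j) (hreg j) CU M C0
  refine ⟨2 * ∑ j, C j, ?_⟩
  intro h h0 h1 K Xh Qh hFE N t hg hdr hratio hkm U P hens hini hcfl j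
  have he0 := (DLN.rate_bounds (s := s) hr h0 h1 hg.kmax_nonneg hkm).2.2.2.2.2
  have hN : 1 ≤ N := by
    by_contra hc
    obtain rfl : N = 0 := by omega
    exact hT.ne (hg.first.symm.trans hg.last)
  have hVh := hens.memVh hΩ.isOpen hFE.memX hg hθ0 hθ1 fun n hn => (hini j n hn).1
  have hmean : ∀ n ∈ Finset.Ico 1 N, DLN.MemX (DLN.zStar θ t (DLN.ensMean U) n) := fun n hn =>
    DLN.zStar_mem (W := DLN.XSpace hΩ.isOpen) fun i hi => DLN.ensMean_mem fun j =>
      hFE.memX _ (hens.memX j i (by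
        have h1 := Finset.mem_Ico.1 hn
        have h2 := hi.2
        omega))
  obtain ⟨e1, e2⟩ := hC j h h0 h1 K Xh Qh hFE N t hg hN (hdr j) (fun n hn => (hratio n hn).2) hkm
    (U j) (DLN.zStar θ t (DLN.ensMean U)) hVh hmean
    (fun n hn v hv => by
      have e1 := hens.momentum j n hn v hv.1
      have e2 : inner ℝ (DLN.zBeta θ t (P j) n) (DLN.divg v) = 0 :=
        hv.2 _ (DLN.zBeta_mem fun i hi => hens.memQ j i (by
          have h1 := Finset.mem_Ico.1 hn
          have h2 := hi.2
          omega))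
      rw [e2, sub_zero] at e1
      exact e1)
    (fun n hn => (hini j n hn).2)
    (fun n hn => by
      have e1 := hcfl j n hn
      have hst := hg.isStep hθ0 hθ1 hn le_rfl
      rw [DLN.norm_gradV]
      have e2 : Cb ^ 2 * Cinv * DLN.dissipConst θ *
          ((1 + DLN.vari t n * θ) / (1 - DLN.vari t n)) ^ 2 * (DLN.khat θ t n / (h * ν)) *
          DLN.gradNorm (DLN.zStar θ t (U j) n - DLN.zStar θ t (DLN.ensMean U) n) ^ 2
          = (Cb ^ 2 * Cinv * DLN.dissipConst θ *
          ((1 + DLN.vari t n * θ) / (1 - DLN.vari t n)) ^ 2 * (DLN.khat θ t n *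
          DLN.gradNorm (DLN.zStar θ t (U j) n - DLN.zStar θ t (DLN.ensMean U) n) ^ 2))
            / (h * ν) := by ring
      rw [e2, sub_nonneg, div_le_one (mul_pos h0 hν)] at e1
      exact e1)
  have e3 : C j * DLN.rate r s h (DLN.kmax N t) ≤ (∑ j, C j) * DLN.rate r s h (DLN.kmax N t) :=
    mul_le_mul_of_nonneg_right
      (Finset.single_le_sum (fun j _ => hC0 j) (Finset.mem_univ j)) he0
  have e4 : (⨆ n : Fin (N + 1), DLN.normHV 1 (u j (t n) - U j n))
      ≤ C j * DLN.rate r s h (DLN.kmax N t) :=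
    ciSup_le fun n => e1 n (by omega)
  linarith
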